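/- Let $d\ge 1$ and $\mathbb T^d=[0,2\pi)^d$. For $0<p<\infty$ let $L_p(\mathbb T^d)$ be the space of measurable real-valued functions on $\mathbb R^d$ that are $2\pi$-periodic in each variable and satisfy $\|f\|_p=\big(\int_{\mathbb T^d}|f(x)|^p\,dx\big)^{1/p}<\infty$; let $L_\infty(\mathbb T^d)$ be the space of continuous real-valued functions on $\mathbb R^d$ that are $2\pi$-periodic in each variable, with the norm $\|f\|_\infty=\max|f|$. For $\beta,\delta>0$ and $n\in\mathbb N$ put $$\mathcal R_n^{\beta,\delta}(x)=\sum_{k\in\mathbb Z^d}\Big(1-\frac{|k|^\beta}{n^\beta}\Big)_+^{\delta}e^{i(k,x)},\qquad t_n^k=\frac{2\pi k}{2n+1},$$ where $|\cdot|$ is the Euclidean norm and $x_+=\max\{x,0\}$, and for $\lambda\in\mathbb T^d$ put $$\mathcal S_{n;\lambda}^{\beta,\delta}(f;x)=(2n+1)^{-d}\sum_{k\in\{0,\dots,2n\}^d}f(t_n^k+\lambda)\,\mathcal R_n^{\beta,\delta}(x-t_n^k-\lambda),\qquad \mathcal S_{n;\lambda}^{\delta}=\mathcal S_{n;\lambda}^{2,\delta}.$$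 The family $\{\mathcal S_{n;\lambda}^{\beta,\delta}\}$ is said to converge in $L_p$ if $\lim_{n\to\infty}\big\|\,\|f-\mathcal S_{n;\lambda}^{\beta,\delta}(f)\|_{p;x}\,\big\|_{p;\lambda}=0$ for every $f\in L_p(\mathbb T^d)$, where $\|\cdot\|_{p;x}$ and $\|\cdot\|_{p;\lambda}$ denote $\|\cdot\|_p$ with respect to $x$ and $\lambda$; otherwise it diverges in $L_p$. With $\mathbb R_+=[0,\infty)$ and $1/\infty=0$ let $$\Sigma(d)=\Big\{\big(\tfrac1p,\delta\big)\in\mathbb R_+^2:\ \delta>\max\big\{\tfrac{d-1}2,\ d\big(\tfrac1p-\tfrac12\big)-\tfrac12\big\}\Big\},$$ $$\Gamma(d)=\Big\{\big(\tfrac1p,\delta\big)\in\mathbb R_+^2:\ 0\le\delta\le d\big|\tfrac1p-\tfrac12\big|-\tfrac12\Big\},$$ $$\mathrm B(d)=\Big\{\big(\tfrac1p,\beta\big)\in\mathbb R_+^2:\ \beta\in2\mathbb N\ \text{ or }\ \beta>d\big(\tfrac1p-1\big)_+\Big\},\qquad \mathbb N=\{1,2,\dots\}.$$ **Theorem.**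 Let $\beta,\delta>0$. 1) Let $1\le p\le\infty$. Then the family $\{\mathcal S_{n;\lambda}^{\beta,\delta}\}$ converges in $L_p$ if and only if the family $\{\mathcal S_{n;\lambda}^{\delta}\}$ converges in $L_p$. In particular, the family $\{\mathcal S_{n;\lambda}^{\beta,\delta}\}$ converges in $L_p$ if $(1/p,\delta)\in\Sigma(d)$, and it diverges in $L_p$ if $(1/p,\delta)\in\Gamma(d)$. 2) Let $0<p<1$. Then the family $\{\mathcal S_{n;\lambda}^{\beta,\delta}\}$ converges in $L_p$ if and only if $(1/p,\delta)\in\Sigma(d)$ and $(1/p,\beta)\in\mathrm B(d)$, that is, if and only if $\delta>d(1/p-1/2)-1/2$ and $\beta$ is an even positive integer or $\beta>d(1/p-1)$. -/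

import Mathlib

open scoped ENNReal

namespace BochnerRiesz

noncomputable section

/-- The fundamental cell `[0, 2π)^d` of the torus. -/
def cell (d : ℕ) : Set (Fin d → ℝ) :=
  Set.univ.pi fun _ => Set.Ico 0 (2 * Real.pi)

/-- `2π`-periodicity in each variable. -/
def IsPeriodic {d : ℕ} (f : (Fin d → ℝ) → ℝ) : Prop :=
  ∀ (x : Fin d → ℝ) (i : Fin d), f (x + Pi.single i (2 * Real.pi)) = f x

/-- The (quasi-)norm of `L_p(𝕋^d)`: `(∫_{[0,2π)^d} |f|^p)^{1/p}` for `0 < p < ∞`, and the supremum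
of `|f|` over the cell for `p = ∞`. Values in `[0, ∞]`. -/
def torusNorm {d : ℕ} {E : Type*} [ENorm E] (p : ℝ≥0∞) (f : (Fin d → ℝ) → E) : ℝ≥0∞ :=
  if p = ∞ then ⨆ x ∈ cell d, ‖f x‖ₑ
  else MeasureTheory.eLpNorm f p (MeasureTheory.volume.restrict (cell d))

/-- Real valued `2π`-periodic functions that are `p`-integrable over the cell if `p < ∞`, and
continuous if `p = ∞`. -/
def MemTorusLp {d : ℕ} (p : ℝ≥0∞) (f : (Fin d → ℝ) → ℝ) : Prop :=
  IsPeriodic f ∧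
    if p = ∞ then Continuous f
    else MeasureTheory.MemLp f p (MeasureTheory.volume.restrict (cell d))

/-- The iterated (quasi-)norm `‖ ‖F(x, l)‖_{p; x} ‖_{p; l}`; the function is written `F l x`. -/
def torusNormBar {d : ℕ} {E : Type*} [ENorm E] (p : ℝ≥0∞)
    (F : (Fin d → ℝ) → (Fin d → ℝ) → E) : ℝ≥0∞ :=
  torusNorm p fun l => torusNorm p (F l)

/-- The Euclidean length of a lattice point. -/
def latticeNorm {d : ℕ} (k : Fin d → ℤ) : ℝ :=
  Real.sqrt (∑ i, (k i : ℝ) ^ 2)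

/-- The generalized Bochner–Riesz kernel
`R_n^{β,δ}(x) = ∑_{k ∈ ℤ^d} (1 - |k|^β / n^β)_+^δ e^{i(k,x)}`. -/
def kernel {d : ℕ} (β δ : ℝ) (n : ℕ) (x : Fin d → ℝ) : ℂ :=
  ∑' k : Fin d → ℤ,
    (((max (1 - latticeNorm k ^ β / (n : ℝ) ^ β) 0) ^ δ : ℝ) : ℂ) *
      Complex.exp (Complex.I * ((∑ i, (k i : ℝ) * x i : ℝ) : ℂ))

/-- The nodes `t_n^k = 2πk / (2n+1)`, `k ∈ {0, …, 2n}^d`. -/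
def node {d : ℕ} (n : ℕ) (k : Fin d → Fin (2 * n + 1)) : Fin d → ℝ :=
  fun i => 2 * Real.pi * ((k i : ℕ) : ℝ) / (2 * (n : ℝ) + 1)

/-- The polynomial operators
`S_{n;l}^{β,δ}(f; x) = (2n+1)^{-d} ∑_{k ∈ {0,…,2n}^d} f(t_n^k + l) R_n^{β,δ}(x - t_n^k - l)`. -/
def polyOp {d : ℕ} (β δ : ℝ) (n : ℕ) (l : Fin d → ℝ) (f : (Fin d → ℝ) → ℝ)
    (x : Fin d → ℝ) : ℂ :=
  ((2 * (n : ℂ) + 1) ^ d)⁻¹ *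
    ∑ k : Fin d → Fin (2 * n + 1),
      (f (node n k + l) : ℂ) * kernel β δ n (x - node n k - l)

/-- The family `{S_{n;l}^{β,δ}}` converges in `L_p(𝕋^d)`:
`‖f - S_{n;l}^{β,δ}(f)‖_{p̄} → 0` for every `f ∈ L_p(𝕋^d)`. -/
def FamilyConverges (d : ℕ) (p : ℝ≥0∞) (β δ : ℝ) : Prop :=
  ∀ f : (Fin d → ℝ) → ℝ, MemTorusLp p f →
    Filter.Tendsto
      (fun n : ℕ => torusNormBar p fun (l x : Fin d → ℝ) => (f x : ℂ) - polyOp β δ n l f x)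
      Filter.atTop (nhds 0)

/-- The set `Σ(d)` of pairs `(1/p, δ)`. -/
def SigmaSet (d : ℕ) : Set (ℝ × ℝ) :=
  {q | 0 ≤ q.1 ∧ 0 ≤ q.2 ∧ max (((d : ℝ) - 1) / 2) (d * (q.1 - 1 / 2) - 1 / 2) < q.2}

/-- The set `Γ(d)` of pairs `(1/p, δ)`. -/
def GammaSet (d : ℕ) : Set (ℝ × ℝ) :=
  {q | 0 ≤ q.1 ∧ 0 ≤ q.2 ∧ q.2 ≤ d * |q.1 - 1 / 2| - 1 / 2}

/-- The set `B(d)` of pairs `(1/p, β)`: `β` is a positive even integer, or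
`β > d (1/p - 1)_+`. -/
def BSet (d : ℕ) : Set (ℝ × ℝ) :=
  {q | 0 ≤ q.1 ∧ 0 ≤ q.2 ∧
    ((∃ m : ℕ, 0 < m ∧ q.2 = 2 * m) ∨ d * max (q.1 - 1) 0 < q.2)}

end

end BochnerRiesz

/-! ### Polynomial decay of functions and of Fourier transforms. -/

namespace BochnerRiesz

open MeasureTheory Real Filter Topology FourierTransform
open scoped ContDiff Interval

set_option linter.unusedSectionVars false

/-! Let φ(ξ) = (1 - |ξ|^β)_+^δ. The kernel is the sum of φ(k/n) e^{i(k,x)}, which by Poisson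
summation (`poisson_summation`) is a periodization of n^d φ̂(n ·). Everything is therefore decided
by the size of φ̂ at infinity, and φ is singular in two places only. At the unit sphere it is a
combination of classical symbols (1 - |ξ|^2)_+^{δ+j} up to a smooth error; the leading one
contributes an oscillating term of exact order |y|^{-(δ+(d+1)/2)} (`exists_fourier_ballProfile`,
`exists_normalized_solution`). At the origin it is a power series in |ξ|^β, whose linear term
contributes κ |y|^{-(d+β)} with κ ≠ 0 unless β is an even integer, and for even β the symbol is
smooth there (`exists_fourier_powerProfile_asymptotics`). Hence φ̂ decays with order a =
min(δ+(d+1)/2, d+β), the second entry being dropped for even β (`hasDecay_fourier_rieszProfile`),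
and |φ̂|^s is not integrable once s a ≤ d (`not_integrable_fourier_rieszProfile`).

Sufficiency. If a > d and, for finite p, also a p > d, the sums of |K_n|^{min(p,1)} over shifted
grids have the right size, so the sampling operators are uniformly bounded in the averaged
quasi-norm (`IsSymbol.exists_qnorm_sampleOp_le`). On a trigonometric polynomial there is no aliasing
for large n, and the operator is the multiplier φ(·/n), which tends to φ(0) = 1. Density of
trigonometric polynomials finishes the argument (`IsSymbol.tendsto_qnorm`).

Necessity. Convergence for every f forces uniform boundedness, by a Baire category argument that
also covers p < 1 (`exists_qnorm_sampleOp_le_of_tendsto`). Testing on the indicator of one mesh cube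
bounds the L_p size of the kernel (`lintegral_kernel_rpow_le`). Testing on extremal step functions,
together with a Nikolskii inequality, bounds the conjugate L_q size
(`sum_enorm_kernel_rpow_le_of_conj`), and an approximate sign function gives L_1 when p = ∞
(`sum_enorm_kernel_le_of_top`). Since K_n(y/n)/n^d tends to φ̂, with its argument rescaled, Fatou's
lemma puts φ̂ in L_p, in L_q or in L_1 (`lintegral_fourier_rpow_ne_top`), which contradicts the
non-integrability. For p < 1 the sufficient and the necessary conditions coincide.

Independence of β for p ≥ 1. Between Σ and Γ neither argument decides, and two exponents are
compared directly. One has φ_β = φ_β' m + c, where m is smooth with compact support and vanishes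
near the origin, and c is the part of φ_β near the origin, whose transform decays with order d + β >
d. The multiplier m is bounded on L_p for p ≥ 1, and the operators of c converge by the sufficiency
argument; so convergence passes from β' to β (`tendsto_qnorm_of_factor`). -/

/-- `f` is bounded by a multiple of `(1 + ‖y‖)^(-s)`. -/
def HasDecay {E F : Type*} [NormedAddCommGroup E] [NormedAddCommGroup F] (s : ℝ) (f : E → F) :
    Prop :=
  ∃ C : ℝ, 0 ≤ C ∧ ∀ y, ‖f y‖ ≤ C * (1 + ‖y‖) ^ (-s)

namespace HasDecay

variable {E F : Type*} [NormedAddCommGroup E] [NormedAddCommGroup F] {s t : ℝ} {f g : E → F}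

theorem mono (h : HasDecay s f) (hts : t ≤ s) : HasDecay t f := by
  obtain ⟨C, hC, h⟩ := h
  refine ⟨C, hC, fun y => (h y).trans ?_⟩
  gcongr
  linarith [norm_nonneg y]

theorem add (hf : HasDecay s f) (hg : HasDecay s g) : HasDecay s (fun y => f y + g y) := by
  obtain ⟨C, hC, hf⟩ := hf
  obtain ⟨D, hD, hg⟩ := hg
  exact ⟨C + D, by positivity, fun y => by
    rw [add_mul]; exact (norm_add_le _ _).trans (add_le_add (hf y) (hg y))⟩

theorem const_mul {f : E → ℂ} (hf : HasDecay s f) (c : ℂ) : HasDecay s (fun y => c * f y) := by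
  obtain ⟨C, hC, hf⟩ := hf
  refine ⟨‖c‖ * C, by positivity, fun y => ?_⟩
  rw [norm_mul, mul_assoc]
  exact mul_le_mul_of_nonneg_left (hf y) (norm_nonneg _)

theorem sum {ι : Type*} {f : ι → E → F} {S : Finset ι} (hf : ∀ i ∈ S, HasDecay s (f i)) :
    HasDecay s (fun y => ∑ i ∈ S, f i y) := by
  classical
  induction S using Finset.induction_on with
  | empty => exact ⟨0, le_rfl, fun y => by simp⟩
  | insert a S ha ih =>
    simp only [Finset.sum_insert ha]
    exact (hf a (by simp)).add (ih fun i hi => hf i (by simp [hi]))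

/-- Decay follows from boundedness and decay at infinity. -/
theorem of_bound {B C : ℝ} (hB : ∀ y, ‖f y‖ ≤ B) (hC : ∀ y, 1 ≤ ‖y‖ → ‖f y‖ ≤ C * ‖y‖ ^ (-s))
    (hs : 0 ≤ s) : HasDecay s f := by
  refine ⟨2 ^ s * (|B| + |C|), by positivity, fun y => ?_⟩
  have h1 : 0 < 1 + ‖y‖ := by positivity
  rcases le_total 1 ‖y‖ with h | h
  · have h2 : ‖y‖ ^ (-s) ≤ 2 ^ s * (1 + ‖y‖) ^ (-s) := by
      have h3 : (1 + ‖y‖) ^ s ≤ 2 ^ s * ‖y‖ ^ s := by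
        rw [← mul_rpow (by norm_num) (by positivity)]
        exact rpow_le_rpow h1.le (by linarith) hs
      rw [rpow_neg (by positivity), rpow_neg h1.le, ← div_eq_mul_inv, le_div_iff₀ (by positivity),
        inv_mul_le_iff₀ (by positivity), mul_comm]
      linarith
    calc ‖f y‖ ≤ C * ‖y‖ ^ (-s) := hC y h
      _ ≤ (|B| + |C|) * (2 ^ s * (1 + ‖y‖) ^ (-s)) := by
        gcongr
        · linarith [le_abs_self C, abs_nonneg B]
      _ = _ := by ring
  · have h2 : 1 ≤ 2 ^ s * (1 + ‖y‖) ^ (-s) := by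
      rw [rpow_neg h1.le, ← div_eq_mul_inv, one_le_div (by positivity)]
      exact rpow_le_rpow h1.le (by linarith) hs
    calc ‖f y‖ ≤ (|B| + |C|) * 1 := by linarith [hB y, le_abs_self B, abs_nonneg C]
      _ ≤ (|B| + |C|) * (2 ^ s * (1 + ‖y‖) ^ (-s)) := by gcongr
      _ = _ := by ring

theorem le_norm_rpow (h : HasDecay s f) (hs : 0 ≤ s) :
    ∃ C : ℝ, 0 ≤ C ∧ ∀ y, 0 < ‖y‖ → ‖f y‖ ≤ C * ‖y‖ ^ (-s) := by
  obtain ⟨C, hC, h⟩ := h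
  refine ⟨C, hC, fun y hy => (h y).trans ?_⟩
  gcongr ?_ * ?_
  exact rpow_le_rpow_of_nonpos hy (by linarith) (by linarith)

end HasDecay

section FourierDecay

variable {E : Type*} [NormedAddCommGroup E] [InnerProductSpace ℝ E] [FiniteDimensional ℝ E]
  [MeasurableSpace E] [BorelSpace E]

theorem norm_fourier_le_integral (f : E → ℂ) (y : E) : ‖𝓕 f y‖ ≤ ∫ x, ‖f x‖ := by
  rw [Real.fourier_eq]
  refine (norm_integral_le_integral_norm _).trans_eq ?_
  simp

/-- The Fourier transform of a compactly supported `C^M` function decays of order `M`. -/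
theorem hasDecay_fourier_of_contDiff {f : E → ℂ} {M : ℕ} (hf : ContDiff ℝ M f)
    (hc : HasCompactSupport f) : HasDecay (M : ℝ) (𝓕 f) := by
  have key := fun w => pow_mul_norm_iteratedFDeriv_fourier_le (K := 0) (N := M) (f := f)
    (by exact_mod_cast hf) (fun k n hk hn => by
      refine Continuous.integrable_of_hasCompactSupport ?_ ?_
      · exact (continuous_norm.pow k).mul
          (hf.continuous_iteratedFDeriv (by exact_mod_cast hn)).norm
      · exact (hc.iteratedFDeriv n).norm.mul_left) (k := 0) (n := M) le_rfl le_rfl w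
  simp only [norm_iteratedFDeriv_zero] at key
  refine HasDecay.of_bound (C := (2 * π) ^ 0 * (2 * (0 : ℕ) + 2) ^ M *
    ∑ p ∈ Finset.range (0 + 1) ×ˢ Finset.range (M + 1),
      ∫ (v : E), ‖v‖ ^ p.1 * ‖iteratedFDeriv ℝ p.2 f v‖)
    (norm_fourier_le_integral f) (fun y hy => ?_) (by positivity)
  · rw [rpow_neg (by positivity), rpow_natCast, ← div_eq_mul_inv, le_div_iff₀ (by positivity),
      mul_comm]
    exact key y

theorem fourier_add_of_integrable {f g : E → ℂ} (hf : Integrable f) (hg : Integrable g) (y : E) :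
    𝓕 (fun x => f x + g x) y = 𝓕 f y + 𝓕 g y := by
  simp only [Real.fourier_eq, smul_add]
  exact integral_add ((Real.fourierIntegral_convergent_iff y).2 hf)
    ((Real.fourierIntegral_convergent_iff y).2 hg)

theorem fourier_const_mul (c : ℂ) (f : E → ℂ) (y : E) :
    𝓕 (fun x => c * f x) y = c * 𝓕 f y := by
  simp only [Real.fourier_eq, Circle.smul_def, smul_eq_mul]
  rw [← integral_const_mul]
  congr 1; ext x; ring

theorem fourier_finset_sum {ι : Type*} {S : Finset ι} {f : ι → E → ℂ}
    (hf : ∀ i ∈ S, Integrable (f i)) (y : E) :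
    𝓕 (fun x => ∑ i ∈ S, f i x) y = ∑ i ∈ S, 𝓕 (f i) y := by
  simp only [Real.fourier_eq, Finset.smul_sum]
  exact integral_finsetSum _ fun i hi => (Real.fourierIntegral_convergent_iff y).2 (hf i hi)

theorem fourier_comp_smul (f : E → ℂ) {c : ℝ} (hc : 0 < c) (y : E) :
    𝓕 (fun x => f (c⁻¹ • x)) y = (c ^ Module.finrank ℝ E : ℝ) * 𝓕 f (c • y) := by
  simp only [Real.fourier_eq]
  have := Measure.integral_comp_inv_smul (volume : Measure E)
    (fun x => 𝐞 (-inner ℝ x (c • y)) • f x) c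
  rw [abs_of_pos (by positivity)] at this
  rw [← Complex.real_smul, ← this]
  congr 1; ext x
  rw [inner_smul_left, inner_smul_right]
  simp [hc.ne']

/-- The reflection in the hyperplane orthogonal to x - y is a linear isometry taking x to y, and it
leaves a radial function unchanged. -/
theorem fourier_radial {f : E → ℂ} (hf : ∀ x y, ‖x‖ = ‖y‖ → f x = f y) {x y : E}
    (hxy : ‖x‖ = ‖y‖) : 𝓕 f x = 𝓕 f y := by
  obtain ⟨R, hR⟩ : ∃ R : E ≃ₗᵢ[ℝ] E, R x = y := by
    exact ⟨Submodule.reflection (ℝ ∙ (x - y))ᗮ, Submodule.reflection_sub hxy⟩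
  have h := Real.fourier_comp_linearIsometry R f x
  rw [hR] at h
  rw [← h]
  have e : f ∘ R = f := funext fun z => hf _ _ (R.norm_map z)
  rw [e]

end FourierDecay

/-- A radial function that is homogeneous of degree `-t` up to rapidly decaying errors is
asymptotic to a multiple of `‖y‖ ^ (-t)`. -/
theorem exists_homogeneous_asymptotics {E : Type*} [NormedAddCommGroup E] [NormedSpace ℝ E]
    [Nontrivial E] {g : E → ℂ} {t : ℝ}
    (hrad : ∀ x y, ‖x‖ = ‖y‖ → g x = g y)
    (h : ∀ c : ℝ, 0 < c → ∀ M : ℕ,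
      HasDecay (M : ℝ) (fun y => ((c ^ t : ℝ) : ℂ) * g (c • y) - g y)) :
    ∃ κ : ℂ, ∀ M : ℕ, ∃ C : ℝ, 0 ≤ C ∧ ∀ y, 1 ≤ ‖y‖ →
      ‖g y - κ * ((‖y‖ ^ (-t) : ℝ) : ℂ)‖ ≤ C * ‖y‖ ^ (-(M : ℝ)) := by
  -- The rescalings 2^{jt} g(2^j y) form a Cauchy sequence with geometric errors. Their limit is
  -- radial and exactly homogeneous of degree -t, hence a multiple of ‖y‖^(-t), and the summed
  -- errors bound the distance from g, the term with j = 0.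
  set k : ℕ → E → ℂ := fun j y => (((2 : ℝ) ^ j) ^ t : ℝ) * g ((2 : ℝ) ^ j • y) with hk
  have herr : ∀ c : ℝ, 0 < c → ∀ M : ℕ, ∃ C : ℝ, 0 ≤ C ∧ ∀ y, 0 < ‖y‖ → ∀ j : ℕ,
      ‖((c ^ t : ℝ) : ℂ) * k j (c • y) - k j y‖
        ≤ C * ‖y‖ ^ (-(M : ℝ)) * ((2 : ℝ) ^ (t - M)) ^ j := by
    intro c hc M
    obtain ⟨C, hC, hb⟩ := (h c hc M).le_norm_rpow (by positivity)
    refine ⟨C, hC, fun y hy j => ?_⟩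
    have h2 : (0 : ℝ) < 2 ^ j := by positivity
    have := hb ((2 : ℝ) ^ j • y) (by rw [norm_smul, Real.norm_of_nonneg h2.le]; positivity)
    have e1 : ((c ^ t : ℝ) : ℂ) * k j (c • y) - k j y = (((2 : ℝ) ^ j) ^ t : ℝ) *
        (((c ^ t : ℝ) : ℂ) * g (c • (2 : ℝ) ^ j • y) - g ((2 : ℝ) ^ j • y)) := by
      simp only [hk]
      rw [smul_comm c]
      ring
    rw [e1, norm_mul, Complex.norm_real, Real.norm_of_nonneg (by positivity)]
    calc ((2 : ℝ) ^ j) ^ t * _ ≤ ((2 : ℝ) ^ j) ^ t * (C * ‖(2 : ℝ) ^ j • y‖ ^ (-(M : ℝ))) := by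
          gcongr
      _ = C * ‖y‖ ^ (-(M : ℝ)) * (((2 : ℝ) ^ j) ^ t * ((2 : ℝ) ^ j) ^ (-(M : ℝ))) := by
          rw [norm_smul, Real.norm_of_nonneg h2.le, mul_rpow h2.le hy.le]; ring
      _ = _ := by
          rw [← rpow_add h2, ← rpow_natCast, ← rpow_natCast, ← rpow_mul (by norm_num),
            ← rpow_mul (by norm_num), mul_comm (j : ℝ), sub_eq_add_neg]
  have hstep : ∀ y j, k (j + 1) y = (((2 : ℝ) ^ t : ℝ) : ℂ) * k j ((2 : ℝ) • y) := by
    intro y j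
    simp only [hk]
    rw [pow_succ, mul_rpow (by positivity) (by positivity), mul_smul]
    push_cast; ring
  have hr : ∀ M : ℕ, t + 1 ≤ M → (2 : ℝ) ^ (t - M) < 1 := fun M hM =>
    rpow_lt_one_of_one_lt_of_neg (by norm_num) (by linarith)
  obtain ⟨M₀, hM₀⟩ := exists_nat_ge (t + 1)
  have hdist : ∀ M : ℕ, ∃ C : ℝ, 0 ≤ C ∧ ∀ y, 0 < ‖y‖ → ∀ j : ℕ,
      dist (k j y) (k (j + 1) y) ≤ C * ‖y‖ ^ (-(M : ℝ)) * ((2 : ℝ) ^ (t - M)) ^ j := by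
    intro M
    obtain ⟨C, hC, hb⟩ := herr 2 (by norm_num) M
    refine ⟨C, hC, fun y hy j => ?_⟩
    rw [dist_comm, dist_eq_norm, hstep]
    exact hb y hy j
  have hlim : ∀ y : E, ∃ l, 0 < ‖y‖ → Tendsto (fun j => k j y) atTop (𝓝 l) := by
    intro y
    by_cases hy : 0 < ‖y‖
    · obtain ⟨C, hC, hb⟩ := hdist M₀
      obtain ⟨l, hl⟩ := cauchySeq_tendsto_of_complete
        (cauchySeq_of_le_geometric _ _ (hr M₀ hM₀) (hb y hy))
      exact ⟨l, fun _ => hl⟩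
    · exact ⟨0, fun h => absurd h hy⟩
  choose L hL using hlim
  have hLrad : ∀ x y, 0 < ‖x‖ → ‖x‖ = ‖y‖ → L x = L y := by
    intro x y hx hxy
    refine tendsto_nhds_unique (hL x hx) ((hL y (hxy ▸ hx)).congr fun j => ?_)
    simp only [hk]
    rw [hrad ((2 : ℝ) ^ j • y) ((2 : ℝ) ^ j • x) (by simp [norm_smul, hxy])]
  have hLhom : ∀ c : ℝ, 0 < c → ∀ y, 0 < ‖y‖ → ((c ^ t : ℝ) : ℂ) * L (c • y) = L y := by
    intro c hc y hy
    obtain ⟨C, hC, hb⟩ := herr c hc M₀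
    have h0 : Tendsto (fun j => ((c ^ t : ℝ) : ℂ) * k j (c • y) - k j y) atTop (𝓝 0) := by
      refine squeeze_zero_norm (hb y hy) ?_
      simpa using (tendsto_pow_atTop_nhds_zero_of_lt_one (by positivity) (hr M₀ hM₀)).const_mul
        (C * ‖y‖ ^ (-(M₀ : ℝ)))
    have h1 := ((hL (c • y) (by rw [norm_smul, Real.norm_of_nonneg hc.le]; positivity)).const_mul
      ((c ^ t : ℝ) : ℂ)).sub (hL y hy)
    exact sub_eq_zero.1 (tendsto_nhds_unique h1 h0)
  obtain ⟨e, he⟩ := exists_norm_eq E (zero_le_one' ℝ)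
  have hLe : ∀ y, 0 < ‖y‖ → L y = L e * ((‖y‖ ^ (-t) : ℝ) : ℂ) := by
    intro y hy
    rw [hLrad y (‖y‖ • e) hy (by simp [norm_smul, he]), ← hLhom ‖y‖ hy e (by simp [he]),
      rpow_neg hy.le]
    have : ((‖y‖ ^ t : ℝ) : ℂ) ≠ 0 := by exact_mod_cast (rpow_pos_of_pos hy t).ne'
    push_cast
    field_simp
  refine ⟨L e, fun M => ?_⟩
  -- An order of at least M₀ is needed for the geometric ratio 2^(t-M) to be below 1. Raising M
  -- costs nothing where ‖y‖ ≥ 1.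
  obtain ⟨C, hC, hb⟩ := hdist (max M M₀)
  have hr' := hr (max M M₀) (by push_cast; exact hM₀.trans (le_max_right _ _))
  refine ⟨C / (1 - 2 ^ (t - (max M M₀ : ℕ))), div_nonneg hC (by linarith), fun y hy => ?_⟩
  have hy0 : 0 < ‖y‖ := by linarith
  have := dist_le_of_le_geometric_of_tendsto₀ _ _ hr' (hb y hy0) (hL y hy0)
  rw [hLe y hy0, dist_eq_norm] at this
  simp only [hk, pow_zero, one_rpow, Complex.ofReal_one, one_mul, one_smul] at this
  refine this.trans ?_
  rw [mul_div_right_comm]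
  refine mul_le_mul_of_nonneg_left (rpow_le_rpow_of_exponent_le hy ?_)
    (div_nonneg hC (by linarith))
  push_cast
  linarith [le_max_left (M : ℝ) M₀]

/-- The first derivative of |t|^s is s |t|^{s-2} t for s > 1, so this formula supplies the second
derivative when s > 2. -/
theorem hasDerivAt_abs_rpow_mul_self {q : ℝ} (hq : 0 < q) (t : ℝ) :
    HasDerivAt (fun t : ℝ => |t| ^ q * t) ((q + 1) * |t| ^ q) t := by
  rcases eq_or_ne t 0 with rfl | ht
  · rw [hasDerivAt_iff_tendsto_slope]
    have h : Tendsto (fun t : ℝ => |t| ^ q) (𝓝[≠] 0) (𝓝 ((q + 1) * |(0 : ℝ)| ^ q)) := by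
      have : Continuous fun t : ℝ => |t| ^ q := continuous_abs.rpow_const fun _ => Or.inr hq.le
      simpa [hq.ne'] using this.continuousAt.tendsto.mono_left (nhdsWithin_le_nhds (a := (0 : ℝ)))
    refine h.congr' ?_
    filter_upwards [self_mem_nhdsWithin] with t ht
    have : t ≠ 0 := ht
    simp [slope_def_field, this]
  · have h := ((hasDerivAt_abs ht).rpow_const (p := q) (Or.inl (abs_ne_zero.2 ht))).mul
      (hasDerivAt_id t)
    refine h.congr_deriv ?_
    have e : |t| ^ q = |t| ^ (q - 1) * |t| := by
      rw [← rpow_add_one (abs_ne_zero.2 ht)]; ring_nf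
    have e2 : (SignType.sign t : ℝ) * t = |t| := by
      rw [mul_comm]; exact self_mul_sign t
    simp only [id, e]
    linear_combination (q * |t| ^ (q - 1)) * e2

theorem ContDiffAt.deriv_of_top {f : ℝ → ℝ} {x : ℝ} (hf : ContDiffAt ℝ ∞ f x) :
    ContDiffAt ℝ ∞ (deriv f) x := by
  have h := (hf.fderiv_right (m := ∞) (by simp)).clm_apply (contDiffAt_const (c := (1 : ℝ)))
  exact h

/-- `|t| ^ s` is smooth at the origin only for even `s`. -/
theorem even_of_contDiffAt_abs_rpow (m : ℕ) : ∀ s : ℝ, 0 < s → s ≤ 2 * m →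
    ContDiffAt ℝ ∞ (fun t : ℝ => |t| ^ s) 0 → ∃ m : ℕ, 0 < m ∧ s = 2 * m := by
  induction m with
  | zero => intro s h1 h2; simp at h2; linarith
  | succ m ih =>
    intro s hs hsm hf
    have hd := ContDiffAt.deriv_of_top hf
    -- Two derivatives turn |t|^s into a nonzero multiple of |t|^{s-2}, which is the induction step
    -- for s > 2. For s < 2 the difference quotient at 0 of the first derivative is s t^{s-2}, which
    -- is unbounded as t decreases to 0.
    rcases lt_trichotomy s 2 with h2 | h2 | h2
    · exfalso
      have h0 : deriv (fun t : ℝ => |t| ^ s) 0 = 0 := by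
        refine IsLocalMin.deriv_eq_zero (Filter.Eventually.of_forall fun t => ?_)
        simp [hs.ne']
        positivity
      have hs' := ((hd.differentiableAt (by simp)).hasDerivAt.tendsto_slope).mono_left
        (nhdsWithin_mono 0 (fun t (ht : t ∈ Set.Ioi (0 : ℝ)) => (ne_of_gt ht : t ≠ 0)))
      have h3 : Tendsto (fun t : ℝ => s * t ^ (s - 2)) (𝓝[>] 0) atTop :=
        (tendsto_rpow_neg_nhdsGT_zero (by linarith)).const_mul_atTop hs
      refine not_tendsto_nhds_of_tendsto_atTop h3 _ (hs'.congr' ?_)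
      filter_upwards [self_mem_nhdsWithin] with t ht
      have ht0 : (0 : ℝ) < t := ht
      have hdt : deriv (fun t : ℝ => |t| ^ s) t = s * t ^ (s - 1) := by
        have h4 : (fun t : ℝ => |t| ^ s) =ᶠ[𝓝 t] fun t => t ^ s := by
          filter_upwards [lt_mem_nhds ht0] with x hx
          rw [abs_of_pos hx]
        rw [h4.deriv_eq]
        simp [ht0.ne']
      rw [slope_def_field, h0, hdt, sub_zero, sub_zero, mul_div_assoc, ← rpow_sub_one ht0.ne']
      ring_nf
    · exact ⟨1, by norm_num, by simpa using h2⟩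
    · have e1 : deriv (deriv fun t : ℝ => |t| ^ s) = fun t => s * ((s - 1) * |t| ^ (s - 2)) := by
        have : (deriv fun t : ℝ => |t| ^ s) = fun t => s * (|t| ^ (s - 2) * t) := by
          ext t
          rw [(hasDerivAt_abs_rpow t (by linarith : 1 < s)).deriv, mul_assoc]
        rw [this]
        ext t
        have := ((hasDerivAt_abs_rpow_mul_self (by linarith : 0 < s - 2) t).const_mul s).deriv
        rw [this]; ring_nf
      have hd2 := ContDiffAt.deriv_of_top hd
      rw [e1] at hd2
      have h5 : ContDiffAt ℝ ∞ (fun t : ℝ => |t| ^ (s - 2)) 0 := by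
        have := (contDiffAt_const (c := (s * (s - 1))⁻¹)).mul hd2
        refine this.congr_of_eventuallyEq (Filter.Eventually.of_forall fun t => ?_)
        have : s - 1 ≠ 0 := by linarith
        have : s ≠ 0 := hs.ne'
        simp only []
        field_simp
      obtain ⟨k, hk, hsk⟩ := ih (s - 2) (by linarith) (by push_cast at hsm; linarith) h5
      exact ⟨k + 1, by omega, by push_cast; linarith⟩

/-- A smooth function equal to `1` on `(-∞, 1/4]` and to `0` on `[1/2, ∞)`. -/
noncomputable def cutoff (u : ℝ) : ℝ := Real.smoothTransition (2 - 4 * u)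

theorem contDiff_cutoff (M : ℕ) : ContDiff ℝ M cutoff :=
  (Real.smoothTransition.contDiff (n := M)).comp
    (contDiff_const.sub (contDiff_const.mul contDiff_id))

theorem cutoff_eq_one {u : ℝ} (h : u ≤ 1 / 4) : cutoff u = 1 :=
  Real.smoothTransition.one_of_one_le (by linarith)

theorem cutoff_eq_zero {u : ℝ} (h : 1 / 2 ≤ u) : cutoff u = 0 :=
  Real.smoothTransition.zero_of_nonpos (by linarith)

/-! ### Radial functions and cut off powers of the norm. -/

section Radial

variable (E : Type*) [NormedAddCommGroup E] [InnerProductSpace ℝ E]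

/-- The radial function with profile `g` in the variable `‖ξ‖ ^ 2`. -/
noncomputable def radial (g : ℝ → ℝ) (ξ : E) : ℂ := ((g (‖ξ‖ ^ 2) : ℝ) : ℂ)

variable {E}

theorem radial_congr (g : ℝ → ℝ) (x y : E) (h : ‖x‖ = ‖y‖) : radial E g x = radial E g y := by
  simp [radial, h]

/-- The variable u = ‖ξ‖^2 is smooth even at ξ = 0, so two-sided smoothness of the profile at u = 0
is all that the origin requires. -/
theorem contDiff_radial {g : ℝ → ℝ} {n : ℕ∞ω}
    (hg : ∀ u, 0 ≤ u → ContDiffAt ℝ n g u) : ContDiff ℝ n (radial E g) := by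
  rw [contDiff_iff_contDiffAt]
  intro ξ
  have h1 : ContDiffAt ℝ n (fun ξ : E => g (‖ξ‖ ^ 2)) ξ :=
    (hg (‖ξ‖ ^ 2) (by positivity)).comp ξ ((contDiff_norm_sq ℝ).contDiffAt)
  exact (Complex.ofRealCLM.contDiff.contDiffAt).comp ξ h1

theorem hasCompactSupport_radial [FiniteDimensional ℝ E] {g : ℝ → ℝ} {R : ℝ}
    (hg : ∀ u, R ≤ u → g u = 0) : HasCompactSupport (radial E g) := by
  refine HasCompactSupport.intro (isCompact_closedBall (0 : E) (|R| + 1)) fun x hx => ?_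
  simp only [Metric.mem_closedBall, dist_zero_right, not_le] at hx
  rw [radial, hg, Complex.ofReal_zero]
  nlinarith [le_abs_self R, abs_nonneg R]

theorem continuous_radial {g : ℝ → ℝ} (hg : ContinuousOn g (Set.Ici 0)) :
    Continuous (radial E g) := by
  refine Complex.continuous_ofReal.comp ?_
  exact hg.comp_continuous (by fun_prop) fun x => by simp

theorem integrable_radial [FiniteDimensional ℝ E] [MeasurableSpace E] [BorelSpace E] {g : ℝ → ℝ}
    {R : ℝ} (hc : ContinuousOn g (Set.Ici 0)) (hg : ∀ u, R ≤ u → g u = 0) :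
    Integrable (radial E g) :=
  (continuous_radial hc).integrable_of_hasCompactSupport (hasCompactSupport_radial hg)

variable [FiniteDimensional ℝ E] [MeasurableSpace E] [BorelSpace E]

/-- The profile `u ^ (s / 2)` near the origin, cut off. -/
noncomputable def powerProfile (s u : ℝ) : ℝ := u ^ (s / 2) * cutoff u

theorem continuous_powerProfile {s : ℝ} (hs : 0 < s) : Continuous (powerProfile s) :=
  (continuous_id.rpow_const fun _ => Or.inr (by positivity)).mul
    (contDiff_cutoff 0).continuous

theorem powerProfile_eq_zero (s : ℝ) {u : ℝ} (h : 1 / 2 ≤ u) : powerProfile s u = 0 := by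
  simp [powerProfile, cutoff_eq_zero h]

theorem integrable_powerProfile {s : ℝ} (hs : 0 < s) : Integrable (radial E (powerProfile s)) :=
  integrable_radial (continuous_powerProfile hs).continuousOn fun _ h => powerProfile_eq_zero s h

/-- Since ‖ξ‖^s is homogeneous, a dilation changes the cut off power only through the cutoff. The
difference is supported away from the origin, where it is smooth, so its transform decays to any
order. This is the hypothesis of `exists_homogeneous_asymptotics` with t = dim E + s. -/
theorem hasDecay_dilation_powerProfile {s : ℝ} (hs : 0 < s) {c : ℝ} (hc : 0 < c) (M : ℕ) :
    HasDecay (M : ℝ) (fun y : E =>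
      ((c ^ (Module.finrank ℝ E + s) : ℝ) : ℂ) * 𝓕 (radial E (powerProfile s)) (c • y)
        - 𝓕 (radial E (powerProfile s)) y) := by
  set g : ℝ → ℝ := fun u => u ^ (s / 2) * (cutoff (u / c ^ 2) - cutoff u) with hg
  have h1 : ContDiff ℝ M (radial E g) := by
    refine contDiff_radial fun u hu => ?_
    rcases hu.eq_or_lt with rfl | hu
    · have : g =ᶠ[𝓝 0] fun _ => 0 := by
        have h2 : (0 : ℝ) < c ^ 2 / 4 := by positivity
        filter_upwards [gt_mem_nhds h2, gt_mem_nhds (show (0 : ℝ) < 1 / 4 by norm_num)]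
          with u h3 h4
        simp only [hg]
        rw [cutoff_eq_one h4.le, cutoff_eq_one, sub_self, mul_zero]
        rw [div_le_iff₀ (by positivity)]; linarith
      exact contDiffAt_const.congr_of_eventuallyEq this
    · refine ContDiffAt.mul (contDiffAt_id.rpow_const_of_ne hu.ne') ?_
      have hcut := contDiff_cutoff M
      exact (hcut.comp (contDiff_id.div_const _)).contDiffAt.sub hcut.contDiffAt
  have h2 : HasCompactSupport (radial E g) := by
    refine hasCompactSupport_radial (R := max (1 / 2) (c ^ 2 / 2)) fun u hu => ?_
    have := le_trans (le_max_left _ _) hu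
    have h3 := le_trans (le_max_right _ _) hu
    simp only [hg]
    rw [cutoff_eq_zero this, cutoff_eq_zero, sub_self, mul_zero]
    rw [le_div_iff₀ (by positivity)]; linarith
  have h3 := hasDecay_fourier_of_contDiff h1 h2
  convert! h3 using 2 with y
  have e1 : radial E g = fun x => (((c ^ s : ℝ) : ℂ) * radial E (powerProfile s) (c⁻¹ • x))
      + (-1) * radial E (powerProfile s) x := by
    ext x
    have : (c ^ s) * (‖c⁻¹ • x‖ ^ 2) ^ (s / 2) = (‖x‖ ^ 2) ^ (s / 2) := by
      rw [norm_smul, norm_inv, Real.norm_of_nonneg hc.le, mul_pow, mul_rpow (by positivity)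
        (by positivity), inv_pow, inv_rpow (by positivity), ← rpow_natCast c, ← rpow_mul hc.le]
      have := (rpow_pos_of_pos hc s).ne'
      rw [show ((2 : ℕ) : ℝ) * (s / 2) = s by push_cast; ring]
      field_simp
    have h4 : ‖c⁻¹ • x‖ ^ 2 = ‖x‖ ^ 2 / c ^ 2 := by
      rw [norm_smul, norm_inv, Real.norm_of_nonneg hc.le]; field_simp
    simp only [radial, hg, powerProfile]
    rw [← this, h4]
    push_cast
    ring
  have hi := integrable_powerProfile (E := E) hs
  rw [e1, fourier_add_of_integrable, fourier_const_mul, fourier_const_mul, fourier_comp_smul _ hc,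
    rpow_add hc, rpow_natCast]
  · push_cast; ring
  · exact (hi.comp_smul (inv_ne_zero hc.ne')).const_mul _
  · exact hi.const_mul _

/-- Asymptotics of the Fourier transform of a cut off power of the norm. -/
theorem exists_fourier_powerProfile_asymptotics [Nontrivial E] {s : ℝ} (hs : 0 < s) :
    ∃ κ : ℂ, ((¬ ∃ m : ℕ, 0 < m ∧ s = 2 * m) → κ ≠ 0) ∧
      ((∃ m : ℕ, 0 < m ∧ s = 2 * m) → κ = 0) ∧ ∀ M : ℕ, ∃ C : ℝ, 0 ≤ C ∧ ∀ y : E, 1 ≤ ‖y‖ →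
      ‖𝓕 (radial E (powerProfile s)) y - κ * ((‖y‖ ^ (-(Module.finrank ℝ E + s)) : ℝ) : ℂ)‖
        ≤ C * ‖y‖ ^ (-(M : ℝ)) := by
  have hrad := fun x y => fourier_radial (radial_congr (E := E) (powerProfile s)) (x := x) (y := y)
  obtain ⟨κ, hκ⟩ := exists_homogeneous_asymptotics hrad
    (fun c hc M => hasDecay_dilation_powerProfile hs hc M)
  have hi := integrable_powerProfile (E := E) hs
  refine ⟨κ, ?_, ?_, hκ⟩
  · rintro hne rfl
    apply hne
    -- With κ = 0 the transform decays faster than every power, so Fourier inversion makes the cut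
    -- off power smooth. Its restriction to a line is |t|^s near 0, which forces s to be even.
    have hdec : ∀ M : ℕ, HasDecay (M : ℝ) (𝓕 (radial E (powerProfile s))) := by
      intro M
      obtain ⟨C, hC, h⟩ := hκ M
      refine HasDecay.of_bound (C := C) (norm_fourier_le_integral _) (fun y hy => ?_)
        (by positivity)
      simpa using h y hy
    have hcontF : Continuous (𝓕 (radial E (powerProfile s))) :=
      VectorFourier.fourierIntegral_continuous continuous_fourierChar
        (by exact continuous_inner) hi
    have hInt : ∀ k : ℕ, Integrable (fun y : E => ‖y‖ ^ k * ‖𝓕 (radial E (powerProfile s)) y‖) := by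
      intro k
      obtain ⟨C, hC, h⟩ := hdec (k + (Module.finrank ℝ E + 1))
      have h1 := (integrable_one_add_norm (E := E) (μ := volume)
        (r := (Module.finrank ℝ E + 1 : ℝ)) (by linarith)).const_mul C
      refine h1.mono' (by fun_prop) (Filter.Eventually.of_forall fun y => ?_)
      rw [Real.norm_of_nonneg (by positivity)]
      have h2 : 0 < 1 + ‖y‖ := by positivity
      calc ‖y‖ ^ k * ‖𝓕 (radial E (powerProfile s)) y‖
          ≤ (1 + ‖y‖) ^ k * (C * (1 + ‖y‖) ^ (-((k + (Module.finrank ℝ E + 1) : ℕ) : ℝ))) := by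
            gcongr
            · linarith
            · exact h y
        _ = C * ((1 + ‖y‖) ^ (k : ℝ) * (1 + ‖y‖) ^ (-((k + (Module.finrank ℝ E + 1) : ℕ) : ℝ))) := by
            rw [rpow_natCast]; ring
        _ = _ := by
            rw [← rpow_add h2]; push_cast; ring_nf
    have hsm : ContDiff ℝ ∞ (𝓕 (𝓕 (radial E (powerProfile s)))) :=
      contDiff_fourier fun n _ => hInt n
    have hinv : ∀ x, radial E (powerProfile s) x = 𝓕 (𝓕 (radial E (powerProfile s))) (-x) := by
      intro x
      have h0 : Integrable (𝓕 (radial E (powerProfile s))) := by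
        have := hInt 0
        simp only [pow_zero, one_mul] at this
        exact (integrable_norm_iff hcontF.aestronglyMeasurable).1 this
      have := (continuous_radial (E := E) (continuous_powerProfile hs).continuousOn).fourierInv_fourier_eq hi h0
      rw [← Real.fourierInv_eq_fourier_neg, this]
    obtain ⟨e, he⟩ := exists_norm_eq E (zero_le_one' ℝ)
    have h3 : ContDiff ℝ ∞ (fun t : ℝ => (radial E (powerProfile s) (t • e)).re) := by
      simp_rw [hinv]
      exact Complex.reCLM.contDiff.comp (hsm.comp (by fun_prop))
    obtain ⟨m, hm⟩ := exists_nat_ge (s / 2)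
    refine even_of_contDiffAt_abs_rpow m s hs (by linarith) ?_
    refine h3.contDiffAt.congr_of_eventuallyEq ?_
    filter_upwards [Metric.ball_mem_nhds (0 : ℝ) (show (0 : ℝ) < 1 / 2 by norm_num)] with t ht
    rw [Metric.mem_ball, dist_zero_right, Real.norm_eq_abs] at ht
    simp only [radial, powerProfile, Complex.ofReal_re, norm_smul, he, mul_one, Real.norm_eq_abs]
    rw [cutoff_eq_one (by nlinarith [abs_nonneg t]), mul_one, ← rpow_natCast, ← rpow_mul (abs_nonneg t)]
    congr 1; push_cast; ring
  · rintro ⟨m, hm, rfl⟩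
    -- For even s the cut off power is smooth with compact support, so its transform decays with an
    -- order M larger than dim E + s. A term of order dim E + s with nonzero coefficient is then
    -- impossible, as seen by letting r tend to infinity.
    obtain ⟨M, hM⟩ := exists_nat_gt ((Module.finrank ℝ E : ℝ) + 2 * m)
    have h1 : HasDecay (M : ℝ) (𝓕 (radial E (powerProfile (2 * m)))) := by
      refine hasDecay_fourier_of_contDiff ?_ (hasCompactSupport_radial (R := 1 / 2)
        fun u hu => powerProfile_eq_zero _ hu)
      refine contDiff_radial fun u _ => ContDiff.contDiffAt ?_
      refine ContDiff.mul ?_ (contDiff_cutoff M)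
      have : (fun u : ℝ => u ^ ((2 * m : ℝ) / 2)) = fun u => u ^ m := by
        ext u
        rw [mul_div_cancel_left₀ _ (by norm_num), rpow_natCast]
      rw [this]
      fun_prop
    obtain ⟨C, hC, h1⟩ := h1.le_norm_rpow (by positivity)
    obtain ⟨D, hD, h2⟩ := hκ M
    obtain ⟨e, he⟩ := exists_norm_eq E (zero_le_one' ℝ)
    set t : ℝ := (Module.finrank ℝ E : ℝ) + 2 * m with ht
    have h4 : ∀ r : ℝ, 1 ≤ r → ‖κ‖ ≤ (C + D) * r ^ (-(M - t)) := by
      intro r hr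
      have hr0 : 0 < r := by linarith
      have hn : ‖r • e‖ = r := by rw [norm_smul, he, Real.norm_of_nonneg hr0.le, mul_one]
      have h5 := h1 (r • e) (by rw [hn]; exact hr0)
      have h6 := h2 (r • e) (by rw [hn]; exact hr)
      rw [hn] at h5 h6
      have h7 : ‖κ * ((r ^ (-t) : ℝ) : ℂ)‖ ≤ (C + D) * r ^ (-(M : ℝ)) := by
        have := norm_sub_le (𝓕 (radial E (powerProfile (2 * m))) (r • e))
          (𝓕 (radial E (powerProfile (2 * m))) (r • e) - κ * ((r ^ (-t) : ℝ) : ℂ))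
        rw [sub_sub_cancel] at this
        linarith
      rw [norm_mul, Complex.norm_real, Real.norm_of_nonneg (by positivity)] at h7
      have h8 : r ^ (-(M - t)) = r ^ (-(M : ℝ)) * r ^ t := by
        rw [← rpow_add hr0]; ring_nf
      have h9 : r ^ (-t) * r ^ t = 1 := by rw [← rpow_add hr0]; simp
      calc ‖κ‖ = (‖κ‖ * r ^ (-t)) * r ^ t := by rw [mul_assoc, h9, mul_one]
        _ ≤ ((C + D) * r ^ (-(M : ℝ))) * r ^ t := by gcongr
        _ = _ := by rw [h8]; ring
    have h5 : Tendsto (fun r : ℝ => (C + D) * r ^ (-(M - t))) atTop (𝓝 0) := by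
      simpa using (tendsto_rpow_neg_atTop (sub_pos.2 hM)).const_mul (C + D)
    have h6 : ‖κ‖ ≤ 0 := by
      refine ge_of_tendsto h5 ?_
      filter_upwards [eventually_ge_atTop 1] with r hr using h4 r hr
    exact norm_le_zero_iff.1 h6

end Radial

/-! ### Poisson's integral and its differential equation. -/

theorem hasDerivAt_integral_cos {k : ℝ → ℝ} (hk : Continuous k) (r : ℝ) :
    HasDerivAt (fun r => ∫ s in (-1 : ℝ)..1, cos (r * s) * k s)
      (∫ s in (-1 : ℝ)..1, -(sin (r * s) * (s * k s))) r := by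
  refine (intervalIntegral.hasDerivAt_integral_of_dominated_loc_of_deriv_le
    (F := fun r s => cos (r * s) * k s) (F' := fun r s => -(sin (r * s) * (s * k s)))
    (bound := fun s => |s * k s|) (s := Set.univ) univ_mem
    (Filter.Eventually.of_forall fun r => ?_) ?_ ?_ ?_ ?_ ?_).2
  · exact (by fun_prop : Continuous fun s => cos (r * s) * k s).aestronglyMeasurable
  · exact (by fun_prop : Continuous fun s => cos (r * s) * k s).intervalIntegrable _ _
  · exact (by fun_prop : Continuous fun s => -(sin (r * s) * (s * k s))).aestronglyMeasurable
  · refine Filter.Eventually.of_forall fun s _ x _ => ?_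
    rw [norm_neg, norm_mul, Real.norm_eq_abs, Real.norm_eq_abs]
    exact mul_le_of_le_one_left (abs_nonneg _) (abs_sin_le_one _)
  · exact (by fun_prop : Continuous fun s => |s * k s|).intervalIntegrable _ _
  · refine Filter.Eventually.of_forall fun s _ x _ => ?_
    have := (((hasDerivAt_id x).mul_const s).cos).mul_const (k s)
    refine this.congr_deriv ?_
    simp; ring

theorem hasDerivAt_integral_sin {k : ℝ → ℝ} (hk : Continuous k) (r : ℝ) :
    HasDerivAt (fun r => ∫ s in (-1 : ℝ)..1, sin (r * s) * k s)
      (∫ s in (-1 : ℝ)..1, cos (r * s) * (s * k s)) r := by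
  refine (intervalIntegral.hasDerivAt_integral_of_dominated_loc_of_deriv_le
    (F := fun r s => sin (r * s) * k s) (F' := fun r s => cos (r * s) * (s * k s))
    (bound := fun s => |s * k s|) (s := Set.univ) univ_mem
    (Filter.Eventually.of_forall fun r => ?_) ?_ ?_ ?_ ?_ ?_).2
  · exact (by fun_prop : Continuous fun s => sin (r * s) * k s).aestronglyMeasurable
  · exact (by fun_prop : Continuous fun s => sin (r * s) * k s).intervalIntegrable _ _
  · exact (by fun_prop : Continuous fun s => cos (r * s) * (s * k s)).aestronglyMeasurable
  · refine Filter.Eventually.of_forall fun s _ x _ => ?_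
    rw [norm_mul, Real.norm_eq_abs, Real.norm_eq_abs]
    exact mul_le_of_le_one_left (abs_nonneg _) (abs_cos_le_one _)
  · exact (by fun_prop : Continuous fun s => |s * k s|).intervalIntegrable _ _
  · refine Filter.Eventually.of_forall fun s _ x _ => ?_
    have := (((hasDerivAt_id x).mul_const s).sin).mul_const (k s)
    refine this.congr_deriv ?_
    simp; ring

/-- Poisson's integral, a multiple of `r ^ (-(ν + 1/2)) J_{ν + 1/2}(r)`. -/
noncomputable def poissonIntegral (ν r : ℝ) : ℝ :=
  ∫ s in (-1 : ℝ)..1, cos (r * s) * (1 - s ^ 2) ^ ν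

theorem continuous_one_sub_sq_rpow {ν : ℝ} (hν : 0 < ν) :
    Continuous fun s : ℝ => (1 - s ^ 2) ^ ν :=
  (by fun_prop : Continuous fun s : ℝ => 1 - s ^ 2).rpow_const fun _ => Or.inr hν.le

theorem poissonIntegral_zero_pos {ν : ℝ} (hν : 0 < ν) : 0 < poissonIntegral ν 0 := by
  have hc := continuous_one_sub_sq_rpow hν
  refine intervalIntegral.intervalIntegral_pos_of_pos_on ?_ ?_ (by norm_num)
  · exact (by fun_prop : Continuous fun s => cos (0 * s) * (1 - s ^ 2) ^ ν).intervalIntegrable _ _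
  · intro s hs
    simp only [zero_mul, cos_zero, one_mul]
    exact rpow_pos_of_pos (by nlinarith [hs.1, hs.2]) _

/-- The differential equation satisfied by `poissonIntegral`. -/
theorem exists_poissonIntegral_ode {ν : ℝ} (hν : 0 < ν) : ∃ F₁ : ℝ → ℝ,
    (∀ r, HasDerivAt (poissonIntegral ν) (F₁ r) r) ∧
    ∀ r, r ≠ 0 → HasDerivAt F₁ (-poissonIntegral ν r - 2 * (ν + 1) * F₁ r / r) r := by
  have hc := continuous_one_sub_sq_rpow hν
  have hc' := continuous_one_sub_sq_rpow (by linarith : 0 < ν + 1)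
  refine ⟨fun r => ∫ s in (-1 : ℝ)..1, -(sin (r * s) * (s * (1 - s ^ 2) ^ ν)),
    fun r => hasDerivAt_integral_cos hc r, fun r hr => ?_⟩
  have h1 : HasDerivAt (fun r => ∫ s in (-1 : ℝ)..1, -(sin (r * s) * (s * (1 - s ^ 2) ^ ν)))
      (-∫ s in (-1 : ℝ)..1, cos (r * s) * (s * (s * (1 - s ^ 2) ^ ν))) r := by
    have := (hasDerivAt_integral_sin (k := fun s => s * (1 - s ^ 2) ^ ν) (by fun_prop) r).neg
    simpa only [intervalIntegral.integral_neg] using! this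
  refine h1.congr_deriv ?_
  -- Integration by parts: the integrand is the derivative of sin(rs) (1 - s^2)^(ν+1), which
  -- vanishes at both endpoints.
  have h2 : ∫ s in (-1 : ℝ)..1, (r * (cos (r * s) * (1 - s ^ 2) ^ (ν + 1)) +
      (2 * (ν + 1)) * -(sin (r * s) * (s * (1 - s ^ 2) ^ ν))) = 0 := by
    have := intervalIntegral.integral_eq_sub_of_hasDerivAt (a := -1) (b := 1)
      (f := fun s => sin (r * s) * (1 - s ^ 2) ^ (ν + 1))
      (f' := fun s => r * (cos (r * s) * (1 - s ^ 2) ^ (ν + 1)) +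
      (2 * (ν + 1)) * -(sin (r * s) * (s * (1 - s ^ 2) ^ ν))) (fun s _ => ?_)
      ((by fun_prop : Continuous fun s => r * (cos (r * s) * (1 - s ^ 2) ^ (ν + 1)) +
      (2 * (ν + 1)) * -(sin (r * s) * (s * (1 - s ^ 2) ^ ν))).intervalIntegrable _ _)
    · rw [this]
      have : ν + 1 ≠ 0 := by linarith
      simp [this]
    · have e1 := ((hasDerivAt_id s).const_mul r).sin
      have e2 := (((hasDerivAt_id s).pow 2).const_sub 1).rpow_const (p := ν + 1)
        (Or.inr (by linarith))
      refine (e1.mul e2).congr_deriv ?_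
      simp only [id, Nat.cast_ofNat, Nat.add_one_sub_one, pow_one, mul_one, Pi.pow_apply,
        add_sub_cancel_right]
      ring
  have i1 : IntervalIntegrable (fun s => cos (r * s) * (1 - s ^ 2) ^ (ν + 1)) volume (-1) 1 :=
    (by fun_prop : Continuous fun s => cos (r * s) * (1 - s ^ 2) ^ (ν + 1)).intervalIntegrable _ _
  have i2 : IntervalIntegrable (fun s => -(sin (r * s) * (s * (1 - s ^ 2) ^ ν))) volume (-1) 1 :=
    (by fun_prop : Continuous fun s =>
      -(sin (r * s) * (s * (1 - s ^ 2) ^ ν))).intervalIntegrable _ _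
  rw [intervalIntegral.integral_add (i1.const_mul _) (i2.const_mul _),
    intervalIntegral.integral_const_mul, intervalIntegral.integral_const_mul] at h2
  have h3 : ∫ s in (-1 : ℝ)..1, cos (r * s) * (1 - s ^ 2) ^ (ν + 1) =
      poissonIntegral ν r - ∫ s in (-1 : ℝ)..1, cos (r * s) * (s * (s * (1 - s ^ 2) ^ ν)) := by
    rw [poissonIntegral, ← intervalIntegral.integral_sub]
    · refine intervalIntegral.integral_congr fun s hs => ?_
      rw [Set.uIcc_of_le (by norm_num)] at hs
      have : (1 - s ^ 2) ^ (ν + 1) = (1 - s ^ 2) ^ ν * (1 - s ^ 2) :=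
        rpow_add_one' (by nlinarith [hs.1, hs.2]) (by linarith)
      simp only [this]
      ring
    · exact (by fun_prop : Continuous fun s => cos (r * s) * (1 - s ^ 2) ^ ν).intervalIntegrable _ _
    · exact (by fun_prop : Continuous fun s =>
        cos (r * s) * (s * (s * (1 - s ^ 2) ^ ν))).intervalIntegrable _ _
  rw [h3] at h2
  have h4 : ∀ A B P : ℝ, r * (P - A) + 2 * (ν + 1) * B = 0 → -A = -P - 2 * (ν + 1) * B / r := by
    intro A B P h
    field_simp
    linear_combination h
  exact h4 _ _ _ h2

/-- The normalized solution `w = r ^ (ν + 1) F` satisfies `w'' + (1 - ν (ν + 1) / r ^ 2) w = 0`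
and its energy `w ^ 2 + w' ^ 2` stays between positive bounds. -/
theorem exists_normalized_solution {ν : ℝ} (hν : 0 < ν) : ∃ w w₁ : ℝ → ℝ, ∃ m M : ℝ, 0 < m ∧
    (∀ r, 0 < r → poissonIntegral ν r = r ^ (-(ν + 1)) * w r) ∧
    (∀ r, 0 < r → HasDerivAt w (w₁ r) r) ∧
    (∀ r, 0 < r → HasDerivAt w₁ (-w r + ν * (ν + 1) * w r / r ^ 2) r) ∧
    ∀ r, 1 ≤ r → m ≤ w r ^ 2 + w₁ r ^ 2 ∧ w r ^ 2 + w₁ r ^ 2 ≤ M := by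
  obtain ⟨F₁, hF, hF₁⟩ := exists_poissonIntegral_ode hν
  set F := poissonIntegral ν
  set w : ℝ → ℝ := fun r => r ^ (ν + 1) * F r with hw
  set w₁ : ℝ → ℝ := fun r => (ν + 1) * r ^ ν * F r + r ^ (ν + 1) * F₁ r with hw₁
  have hdw : ∀ r, 0 < r → HasDerivAt w (w₁ r) r := by
    intro r hr
    have := (hasDerivAt_rpow_const (p := ν + 1) (Or.inl hr.ne')).mul (hF r)
    simpa only [add_sub_cancel_right] using! this
  have hdw₁ : ∀ r, 0 < r → HasDerivAt w₁ (-w r + ν * (ν + 1) * w r / r ^ 2) r := by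
    intro r hr
    have e1 := ((hasDerivAt_rpow_const (x := r) (p := ν) (Or.inl hr.ne')).const_mul (ν + 1)).mul
      (hF r)
    have e2 := (hasDerivAt_rpow_const (x := r) (p := ν + 1) (Or.inl hr.ne')).mul (hF₁ r hr.ne')
    refine (e1.add e2).congr_deriv ?_
    simp only [hw, add_sub_cancel_right]
    have h1 : r ^ (ν + 1) = r ^ ν * r := rpow_add_one hr.ne' _
    have h2 : r ^ (ν - 1) = r ^ ν / r := rpow_sub_one hr.ne' _
    change _ + (_ + r ^ (ν + 1) * (-F r - _)) = _
    rw [h1, h2]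
    field_simp
    ring
  set c := ν * (ν + 1) with hcdef
  have hc : 0 < c := by positivity
  -- The equation gives E' = 2 c w w₁ / r^2, so |E'| ≤ c E / r^2. Hence E e^{-c/r} increases and E
  -- e^{c/r} decreases, and E stays between positive multiples of its value at one point.
  set En : ℝ → ℝ := fun r => w r ^ 2 + w₁ r ^ 2 with hEn
  have hdE : ∀ r, 0 < r → HasDerivAt En (2 * c * w r * w₁ r / r ^ 2) r := by
    intro r hr
    refine (((hdw r hr).pow 2).add ((hdw₁ r hr).pow 2)).congr_deriv ?_
    simp only [Nat.cast_ofNat, Nat.add_one_sub_one, pow_one]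
    ring
  have hdexp : ∀ k r : ℝ, 0 < r → HasDerivAt (fun r => exp (k / r)) (exp (k / r) * (-k / r ^ 2)) r := by
    intro k r hr
    have := ((hasDerivAt_inv hr.ne').const_mul k).exp
    refine (this.congr_deriv ?_)
    simp only [← div_eq_mul_inv]
    ring
  have hcauchy : ∀ r, |2 * w r * w₁ r| ≤ En r := by
    intro r
    rw [abs_le]
    constructor <;> simp only [hEn] <;> nlinarith [sq_nonneg (w r - w₁ r), sq_nonneg (w r + w₁ r)]
  have hmono : MonotoneOn (fun r => En r * exp (-c / r)) (Set.Ioi 0) := by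
    refine monotoneOn_of_deriv_nonneg (convex_Ioi 0) ?_ ?_ ?_
    · exact fun r hr => ((hdE r hr).mul (hdexp (-c) r hr)).continuousAt.continuousWithinAt
    · rw [interior_Ioi]
      exact fun r hr => ((hdE r hr).mul (hdexp (-c) r hr)).differentiableAt.differentiableWithinAt
    · rw [interior_Ioi]
      intro r hr
      rw [show deriv (fun r => En r * exp (-c / r)) r = _ from
        ((hdE r hr).mul (hdexp (-c) r hr)).deriv]
      have h0 : (0 : ℝ) < r := hr
      have h1 := (abs_le.1 (hcauchy r)).1
      have : 2 * c * w r * w₁ r / r ^ 2 * exp (-c / r) + En r * (exp (-c / r) * (- -c / r ^ 2))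
        = exp (-c / r) * (c / r ^ 2) * (2 * w r * w₁ r + En r) := by ring
      rw [this]
      have : 0 ≤ 2 * w r * w₁ r + En r := by linarith
      positivity
  have hanti : AntitoneOn (fun r => En r * exp (c / r)) (Set.Ioi 0) := by
    refine antitoneOn_of_deriv_nonpos (convex_Ioi 0) ?_ ?_ ?_
    · exact fun r hr => ((hdE r hr).mul (hdexp c r hr)).continuousAt.continuousWithinAt
    · rw [interior_Ioi]
      exact fun r hr => ((hdE r hr).mul (hdexp c r hr)).differentiableAt.differentiableWithinAt
    · rw [interior_Ioi]
      intro r hr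
      rw [show deriv (fun r => En r * exp (c / r)) r = _ from
        ((hdE r hr).mul (hdexp c r hr)).deriv]
      have h0 : (0 : ℝ) < r := hr
      have h1 := (abs_le.1 (hcauchy r)).2
      have : 2 * c * w r * w₁ r / r ^ 2 * exp (c / r) + En r * (exp (c / r) * (-c / r ^ 2))
        = -(exp (c / r) * (c / r ^ 2) * (En r - 2 * w r * w₁ r)) := by ring
      rw [this]
      have : 0 ≤ En r - 2 * w r * w₁ r := by linarith
      have : 0 ≤ exp (c / r) * (c / r ^ 2) * (En r - 2 * w r * w₁ r) := by positivity
      linarith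
  -- The solution is nontrivial because F(0) > 0. A point r₀ ≤ 1 with F(r₀) > 0 provides positive
  -- energy from which to start.
  obtain ⟨r₀, hr₀, hr₁, hFr₀⟩ : ∃ r₀ : ℝ, 0 < r₀ ∧ r₀ ≤ 1 ∧ 0 < F r₀ := by
    have h1 : ∀ᶠ r in 𝓝[>] (0 : ℝ), 0 < F r :=
      ((hF 0).continuousAt.eventually (lt_mem_nhds (poissonIntegral_zero_pos hν))).filter_mono
        nhdsWithin_le_nhds
    have h2 : ∀ᶠ r in 𝓝[>] (0 : ℝ), r ≤ 1 :=
      (ge_mem_nhds one_pos).filter_mono nhdsWithin_le_nhds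
    obtain ⟨r, h3, h4, h5⟩ := (h1.and (h2.and self_mem_nhdsWithin)).exists
    exact ⟨r, h5, h4, h3⟩
  have hE0 : 0 < En r₀ := by
    have : 0 < w r₀ := by positivity
    positivity
  refine ⟨w, w₁, En r₀ * exp (-c / r₀), En r₀ * exp (c / r₀), by positivity, ?_, hdw, hdw₁, ?_⟩
  · intro r hr
    rw [hw, ← mul_assoc, ← rpow_add hr]
    simp [F]
  · intro r hr
    have hr0 : 0 < r := by linarith
    have h1 := hmono (Set.mem_Ioi.2 hr₀) (Set.mem_Ioi.2 hr0) (hr₁.trans hr)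
    have h2 := hanti (Set.mem_Ioi.2 hr₀) (Set.mem_Ioi.2 hr0) (hr₁.trans hr)
    have hEr : 0 ≤ En r := by positivity
    refine ⟨h1.trans (mul_le_of_le_one_right hEr (exp_le_one_iff.2 ?_)),
      le_trans (le_mul_of_one_le_right hEr (one_le_exp ?_)) h2⟩
    · exact div_nonpos_of_nonpos_of_nonneg (by linarith) hr0.le
    · positivity

/-! ### The Fourier transform of the classical Bochner–Riesz symbol. -/

/-- The profile `(1 - u)_+ ^ δ` of the classical Bochner–Riesz symbol. -/
noncomputable def ballProfile (δ u : ℝ) : ℝ := (max (1 - u) 0) ^ δ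

theorem continuous_ballProfile {δ : ℝ} (hδ : 0 < δ) : Continuous (ballProfile δ) :=
  (by fun_prop : Continuous fun u : ℝ => max (1 - u) 0).rpow_const fun _ => Or.inr hδ.le

theorem ballProfile_eq_zero {δ : ℝ} (hδ : 0 < δ) {u : ℝ} (hu : 1 ≤ u) : ballProfile δ u = 0 := by
  rw [ballProfile, max_eq_right (by linarith), zero_rpow hδ.ne']

theorem integrable_ballProfile {E : Type*} [NormedAddCommGroup E] [InnerProductSpace ℝ E]
    [FiniteDimensional ℝ E] [MeasurableSpace E] [BorelSpace E] {δ : ℝ} (hδ : 0 < δ) :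
    Integrable (radial E (ballProfile δ)) :=
  integrable_radial (continuous_ballProfile hδ).continuousOn fun _ h => ballProfile_eq_zero hδ h

theorem hasCompactSupport_ballProfile_sum_sq {δ : ℝ} (hδ : 0 < δ) (n : ℕ) :
    HasCompactSupport fun η : Fin n → ℝ => ballProfile δ (∑ i, η i ^ 2) := by
  refine HasCompactSupport.intro (isCompact_closedBall (0 : Fin n → ℝ) 1) fun x hx => ?_
  apply ballProfile_eq_zero hδ
  simp only [Metric.mem_closedBall, dist_zero_right, not_le] at hx
  obtain ⟨i, hi⟩ : ∃ i, 1 < ‖x i‖ := by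
    by_contra! h
    exact absurd ((pi_norm_le_iff_of_nonneg zero_le_one).2 h) (not_le.2 hx)
  calc (1 : ℝ) ≤ x i ^ 2 := by
        rw [← sq_abs]; rw [Real.norm_eq_abs] at hi; nlinarith
    _ ≤ ∑ i, x i ^ 2 := Finset.single_le_sum (f := fun i => x i ^ 2)
        (fun i _ => sq_nonneg _) (Finset.mem_univ i)

theorem integral_ballProfile_pos {δ : ℝ} (hδ : 0 < δ) (n : ℕ) :
    0 < ∫ η : Fin n → ℝ, ballProfile δ (∑ i, η i ^ 2) := by
  have hc : Continuous fun η : Fin n → ℝ => ballProfile δ (∑ i, η i ^ 2) :=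
    (continuous_ballProfile hδ).comp (by fun_prop)
  refine hc.integral_pos_of_hasCompactSupport_nonneg_nonzero
    (hasCompactSupport_ballProfile_sum_sq hδ n) (fun η => ?_) (x := 0) ?_
  · simp only [ballProfile]; positivity
  · simp [ballProfile]

/-- Integration of the Bochner–Riesz symbol over the slices `ξ₀ = s`. -/
theorem integral_slice_ballProfile (δ : ℝ) (n : ℕ) {s : ℝ} (hs : s ^ 2 < 1) :
    ∫ η : Fin n → ℝ, ballProfile δ (s ^ 2 + ∑ i, η i ^ 2) =
      (1 - s ^ 2) ^ (δ + n / 2) * ∫ η : Fin n → ℝ, ballProfile δ (∑ i, η i ^ 2) := by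
  have h0 : 0 < 1 - s ^ 2 := by linarith
  set c := √(1 - s ^ 2) with hc
  have hc0 : 0 < c := sqrt_pos.2 h0
  have hc2 : c ^ 2 = 1 - s ^ 2 := sq_sqrt h0.le
  have h1 := Measure.integral_comp_inv_smul (volume : Measure (Fin n → ℝ))
    (fun η => ballProfile δ (∑ i, η i ^ 2)) c
  have h2 : ∀ η : Fin n → ℝ, ballProfile δ (s ^ 2 + ∑ i, η i ^ 2) =
      (1 - s ^ 2) ^ δ * ballProfile δ (∑ i, (c⁻¹ • η) i ^ 2) := by
    intro η
    simp only [ballProfile, Pi.smul_apply, smul_eq_mul, mul_pow, ← Finset.mul_sum, inv_pow, hc2]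
    rw [← mul_rpow h0.le (by positivity), mul_max_of_nonneg _ _ h0.le]
    congr 2
    · field_simp; ring
    · simp
  simp_rw [h2, integral_const_mul, h1, smul_eq_mul]
  rw [← mul_assoc]
  congr 1
  rw [rpow_add h0, abs_of_pos (by positivity), Module.finrank_fin_fun, hc, sqrt_eq_rpow,
    ← rpow_mul_natCast h0.le]
  congr 2; ring

/-- The Fourier transform of the Bochner–Riesz symbol. -/
theorem exists_fourier_ballProfile {δ : ℝ} (hδ : 0 < δ) (n : ℕ) : ∃ C : ℝ, 0 < C ∧
    ∀ y : EuclideanSpace ℝ (Fin (n + 1)),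
      𝓕 (radial (EuclideanSpace ℝ (Fin (n + 1))) (ballProfile δ)) y =
        ((C * poissonIntegral (δ + n / 2) (2 * π * ‖y‖) : ℝ) : ℂ) := by
  set C := ∫ η : Fin n → ℝ, ballProfile δ (∑ i, η i ^ 2) with hC
  refine ⟨C, integral_ballProfile_pos hδ n, fun y => ?_⟩
  set ν := δ + (n : ℝ) / 2
  have hν : 0 < ν := by positivity
  have hcν := continuous_one_sub_sq_rpow hν
  set r := ‖y‖ with hrdef
  have hr0 : |r| = r := abs_norm y
  have hr : ‖y‖ = ‖(EuclideanSpace.single 0 r : EuclideanSpace ℝ (Fin (n + 1)))‖ := by simp [← hrdef, hr0]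
  -- By radial symmetry the frequency may be placed on the first axis. Fubini over the slices on
  -- which the first coordinate is constant then leaves a one-dimensional integral with weight (1 -
  -- s^2)^ν, since each slice is a lower-dimensional symbol scaled by √(1 - s^2).
  rw [fourier_radial (radial_congr _) hr, Real.fourier_eq]
  set G : (Fin (n + 1) → ℝ) → ℂ := fun x =>
    𝐞 (-(x 0 * r)) • ((ballProfile δ (∑ i, x i ^ 2) : ℝ) : ℂ) with hG
  have e1 : (∫ v : EuclideanSpace ℝ (Fin (n + 1)), 𝐞 (-inner ℝ v (EuclideanSpace.single 0 r)) •
      radial (EuclideanSpace ℝ (Fin (n + 1))) (ballProfile δ) v) = ∫ x, G x := by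
    rw [← (EuclideanSpace.volume_preserving_symm_measurableEquiv_toLp (Fin (n + 1))).integral_comp
      (MeasurableEquiv.measurableEmbedding _)]
    congr 1; ext v
    simp [hG, radial, EuclideanSpace.inner_single_right, EuclideanSpace.norm_sq_eq, mul_comm]
  have hGint : Integrable G := by
    refine Continuous.integrable_of_hasCompactSupport ?_ ?_
    · refine Continuous.smul (by fun_prop) ?_
      exact Complex.continuous_ofReal.comp ((continuous_ballProfile hδ).comp (by fun_prop))
    · refine HasCompactSupport.smul_left ?_
      exact (hasCompactSupport_ballProfile_sum_sq hδ (n + 1)).comp_left Complex.ofReal_zero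
  have hmp := (volume_preserving_piFinSuccAbove (fun _ : Fin (n + 1) => ℝ) 0).symm
  have e2 : ∫ x, G x = ∫ s : ℝ, ∫ η : Fin n → ℝ, G (Fin.cons s η) := by
    rw [← hmp.integral_comp (MeasurableEquiv.measurableEmbedding _)]
    have hi : Integrable (fun z => G ((MeasurableEquiv.piFinSuccAbove (fun _ => ℝ) 0).symm z))
        (volume.prod volume) :=
      (hmp.integrable_comp_emb (MeasurableEquiv.measurableEmbedding _)).2 hGint
    rw [Measure.volume_eq_prod, integral_prod _ hi]
    refine integral_congr_ae (.of_forall fun s => integral_congr_ae (.of_forall fun η => ?_))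
    simp [MeasurableEquiv.piFinSuccAbove, Fin.insertNthEquiv]
  have e3 : ∀ s : ℝ, ∫ η : Fin n → ℝ, G (Fin.cons s η) =
      (Set.Ioc (-1 : ℝ) 1).indicator
        (fun s => 𝐞 (-(s * r)) • ((((1 - s ^ 2) ^ ν * C : ℝ)) : ℂ)) s := by
    intro s
    have e4 : ∀ η : Fin n → ℝ, G (Fin.cons s η) =
        𝐞 (-(s * r)) • ((ballProfile δ (s ^ 2 + ∑ i, η i ^ 2) : ℝ) : ℂ) := by
      intro η
      simp [hG, Fin.sum_univ_succ]
    simp_rw [e4, Circle.smul_def]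
    rw [integral_smul, integral_complex_ofReal]
    by_cases hs : s ^ 2 < 1
    · have hs' := abs_lt.1 ((sq_lt_one_iff_abs_lt_one s).1 hs)
      rw [Set.indicator_of_mem (show s ∈ Set.Ioc (-1 : ℝ) 1 from ⟨hs'.1, hs'.2.le⟩),
        integral_slice_ballProfile δ n hs]
    · have h0 : ∀ η : Fin n → ℝ, ballProfile δ (s ^ 2 + ∑ i, η i ^ 2) = 0 := fun η => by
        refine ballProfile_eq_zero hδ ?_
        have : 0 ≤ ∑ i, η i ^ 2 := Finset.sum_nonneg fun i _ => sq_nonneg _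
        linarith
      simp_rw [h0]
      by_cases hm : s ∈ Set.Ioc (-1 : ℝ) 1
      · rw [Set.indicator_of_mem hm]
        have : s ^ 2 = 1 := le_antisymm (by nlinarith [hm.1, hm.2]) (not_lt.1 hs)
        simp [this, hν.ne']
      · rw [Set.indicator_of_notMem hm]; simp
  rw [e1, e2]
  simp_rw [e3]
  rw [integral_indicator measurableSet_Ioc, ← intervalIntegral.integral_of_le (by norm_num)]
  have e5 : ∀ s : ℝ, 𝐞 (-(s * r)) • ((((1 - s ^ 2) ^ ν * C : ℝ)) : ℂ) =
      ((C * (cos (2 * π * r * s) * (1 - s ^ 2) ^ ν) : ℝ) : ℂ) -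
        ((C * (sin (2 * π * r * s) * (1 - s ^ 2) ^ ν) : ℝ) : ℂ) * Complex.I := by
    intro s
    rw [Circle.smul_def, Real.fourierChar_apply, smul_eq_mul, Complex.exp_mul_I]
    rw [← Complex.ofReal_cos, ← Complex.ofReal_sin]
    rw [show 2 * π * -(s * r) = -(2 * π * r * s) by ring, cos_neg, sin_neg]
    push_cast; ring
  simp_rw [e5]
  have hodd : ∫ s in (-1 : ℝ)..1, C * (sin (2 * π * r * s) * (1 - s ^ 2) ^ ν) = 0 := by
    have := intervalIntegral.integral_comp_neg (a := -1) (b := 1)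
      (fun s => C * (sin (2 * π * r * s) * (1 - s ^ 2) ^ ν))
    simp only [mul_neg, sin_neg, neg_mul, neg_sq, neg_neg, intervalIntegral.integral_neg] at this
    linarith
  rw [intervalIntegral.integral_sub, intervalIntegral.integral_mul_const,
    intervalIntegral.integral_ofReal, intervalIntegral.integral_ofReal, hodd,
    intervalIntegral.integral_const_mul]
  · simp [poissonIntegral]
  · exact (by fun_prop : Continuous fun s : ℝ =>
      ((C * (cos (2 * π * r * s) * (1 - s ^ 2) ^ ν) : ℝ) : ℂ)).intervalIntegrable _ _
  · exact (by fun_prop : Continuous fun s : ℝ =>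
      ((C * (sin (2 * π * r * s) * (1 - s ^ 2) ^ ν) : ℝ) : ℂ) * Complex.I).intervalIntegrable _ _

/-! ### Expansions of the generalized symbol at the origin and at the unit sphere. -/

/-- Taylor expansion of an analytic function, with analytic remainder. -/
theorem exists_taylor_of_analyticAt {f : ℝ → ℝ} {x₀ : ℝ} (hf : AnalyticAt ℝ f x₀) (J : ℕ) :
    ∃ (c : ℕ → ℝ) (g : ℝ → ℝ), AnalyticAt ℝ g x₀ ∧ c 0 = f x₀ ∧ c 1 = deriv f x₀ ∧
      ∀ x, f x = ∑ j ∈ Finset.range J, c j * (x - x₀) ^ j + (x - x₀) ^ J * g x := by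
  induction J generalizing f with
  | zero =>
    -- For J = 0 the sum is empty, and the coefficients are merely given the values prescribed for c
    -- 0 and c 1.
    exact ⟨fun j => if j = 0 then f x₀ else deriv f x₀, f, hf, by simp, by simp, by simp⟩
  | succ J ih =>
    obtain ⟨p, hp⟩ := id hf
    obtain ⟨c, g, hg, hc0, -, hx⟩ := ih ⟨_, hp.has_fpower_series_dslope_fslope⟩
    refine ⟨fun j => if j = 0 then f x₀ else c (j - 1), g, hg, by simp, ?_, fun x => ?_⟩
    · simpa using hc0
    · rw [Finset.sum_range_succ']
      have h1 := sub_smul_dslope f x₀ x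
      have h2 := hx x
      simp only [smul_eq_mul] at h1
      have h3 : ∀ k ∈ Finset.range J, (if k + 1 = 0 then f x₀ else c (k + 1 - 1)) *
          (x - x₀) ^ (k + 1) = (x - x₀) * (c k * (x - x₀) ^ k) := by
        intro k _
        simp only [Nat.add_one_ne_zero, if_false, Nat.add_sub_cancel]
        ring
      rw [Finset.sum_congr rfl h3, ← Finset.mul_sum]
      simp only [if_true, pow_zero, mul_one]
      linear_combination (x - x₀) * h2 - h1

/-- `v_+ ^ s g (v_+ ^ b)` is `C^M` at the origin if `s > M`. -/
theorem contDiffAt_posPart_rpow_mul {b : ℝ} (hb : 0 < b) (M : ℕ) : ∀ (s : ℝ) (g : ℝ → ℝ),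
    (M : ℝ) < s → AnalyticAt ℝ g 0 →
      ContDiffAt ℝ M (fun v : ℝ => (max v 0) ^ s * g ((max v 0) ^ b)) 0 := by
  have hcont : ∀ (s : ℝ) (g : ℝ → ℝ), 0 < s → ContinuousAt g 0 →
      ContinuousAt (fun v : ℝ => (max v 0) ^ s * g ((max v 0) ^ b)) 0 := by
    intro s g hs hg
    have h1 : ∀ s : ℝ, 0 < s → Continuous fun v : ℝ => (max v 0) ^ s := fun s hs =>
      (by fun_prop : Continuous fun v : ℝ => max v 0).rpow_const fun _ => Or.inr hs.le
    refine (h1 s hs).continuousAt.mul (ContinuousAt.comp (g := g) ?_ (h1 b hb).continuousAt)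
    simpa [hb.ne'] using hg
  induction M with
  | zero =>
    intro s g hs hg
    have hev : ∀ᶠ v in 𝓝 (0 : ℝ), ContinuousAt g ((max v 0) ^ b) := by
      have h1 : Continuous fun v : ℝ => (max v 0) ^ b :=
        (by fun_prop : Continuous fun v : ℝ => max v 0).rpow_const fun _ => Or.inr hb.le
      have h2 := h1.tendsto 0
      simp only [max_self, zero_rpow hb.ne'] at h2
      exact h2.eventually (hg.eventually_analyticAt.mono fun x hx => hx.continuousAt)
    have hs' : 0 < s := by exact_mod_cast hs
    simp only [Nat.cast_zero]
    rw [contDiffAt_zero]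
    refine ⟨_, hev, fun v hv => ContinuousAt.continuousWithinAt ?_⟩
    have h1 : ∀ s : ℝ, 0 < s → Continuous fun v : ℝ => (max v 0) ^ s := fun s hs =>
      (by fun_prop : Continuous fun v : ℝ => max v 0).rpow_const fun _ => Or.inr hs.le
    exact (h1 s hs').continuousAt.mul (ContinuousAt.comp (g := g) hv (h1 b hb).continuousAt)
  | succ M ih =>
    intro s g hs hg
    push_cast at hs
    have hM : (0 : ℝ) ≤ M := by positivity
    -- The derivative is a sum of two functions of the same shape, with exponents s - 1 and s - 1 +
    -- b and with g and its derivative as analytic factors. The induction on M therefore runs over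
    -- all s and g at once.
    set f' : ℝ → ℝ := fun v => s * ((max v 0) ^ (s - 1) * g ((max v 0) ^ b)) +
      b * ((max v 0) ^ (s - 1 + b) * deriv g ((max v 0) ^ b)) with hf'
    have hd : ContDiffAt ℝ M f' 0 :=
      (contDiffAt_const.mul (ih (s - 1) g (by linarith) hg)).add
        (contDiffAt_const.mul (ih (s - 1 + b) (deriv g) (by linarith) hg.deriv))
    have hev : ∀ᶠ v in 𝓝 (0 : ℝ), DifferentiableAt ℝ g ((max v 0) ^ b) := by
      have h1 : Continuous fun v : ℝ => (max v 0) ^ b :=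
        (by fun_prop : Continuous fun v : ℝ => max v 0).rpow_const fun _ => Or.inr hb.le
      have h2 := h1.tendsto 0
      simp only [max_self, zero_rpow hb.ne'] at h2
      exact h2.eventually (hg.eventually_analyticAt.mono fun x hx => hx.differentiableAt)
    have key : ∀ᶠ v in 𝓝 (0 : ℝ),
        HasDerivAt (fun v : ℝ => (max v 0) ^ s * g ((max v 0) ^ b)) (f' v) v := by
      filter_upwards [hev] with v hv
      rcases lt_trichotomy v 0 with h | rfl | h
      · have e : (fun v : ℝ => (max v 0) ^ s * g ((max v 0) ^ b)) =ᶠ[𝓝 v] fun _ => 0 := by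
          filter_upwards [gt_mem_nhds h] with x hx
          rw [max_eq_right hx.le, zero_rpow (by linarith), zero_mul]
        have e2 : f' v = 0 := by
          simp only [hf', max_eq_right h.le]
          rw [zero_rpow (by linarith : s - 1 ≠ 0), zero_rpow (by linarith : s - 1 + b ≠ 0)]
          ring
        rw [e2]
        exact (hasDerivAt_const v (0 : ℝ)).congr_of_eventuallyEq e
      · have e2 : f' 0 = 0 := by
          simp only [hf', max_self]
          rw [zero_rpow (by linarith : s - 1 ≠ 0), zero_rpow (by linarith : s - 1 + b ≠ 0)]
          ring
        rw [e2, hasDerivAt_iff_tendsto_slope]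
        have h1 := (hcont (s - 1) g (by linarith) hg.continuousAt).tendsto
        simp only [max_self] at h1
        rw [zero_rpow (by linarith), zero_mul] at h1
        refine (h1.mono_left nhdsWithin_le_nhds).congr' ?_
        filter_upwards [self_mem_nhdsWithin] with x hx
        have hx0 : x ≠ 0 := hx
        rw [slope_def_field]
        rcases lt_or_gt_of_ne hx0 with h | h
        · simp only [max_eq_right h.le, max_self]
          rw [zero_rpow (by linarith), zero_rpow (by linarith)]
          simp
        · simp only [max_eq_left h.le, max_self]
          rw [zero_rpow (by linarith : s ≠ 0), rpow_sub_one hx0]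
          field_simp
          ring
      · have e : (fun v : ℝ => (max v 0) ^ s * g ((max v 0) ^ b)) =ᶠ[𝓝 v]
            fun v => v ^ s * g (v ^ b) := by
          filter_upwards [lt_mem_nhds h] with x hx
          rw [max_eq_left hx.le]
        refine HasDerivAt.congr_of_eventuallyEq ?_ e
        rw [max_eq_left h.le] at hv
        have h1 := (hasDerivAt_rpow_const (x := v) (p := s) (Or.inl h.ne')).mul
          (hv.hasDerivAt.comp v (hasDerivAt_rpow_const (x := v) (p := b) (Or.inl h.ne')))
        refine h1.congr_deriv ?_
        have e1 : v ^ (s - 1 + b) = v ^ s * v ^ (b - 1) := by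
          rw [← rpow_add h]; ring_nf
        simp only [hf', max_eq_left h.le, Function.comp, e1]
        ring
    push_cast
    rw [contDiffAt_succ_iff_hasFDerivAt]
    refine ⟨fun v => ContinuousLinearMap.toSpanSingleton ℝ (f' v),
      ⟨_, key, fun v hv => hv.hasFDerivAt⟩, ?_⟩
    exact (ContinuousLinearMap.toSpanSingletonCLE (𝕜 := ℝ) (E := ℝ)).contDiff.contDiffAt.comp 0 hd

theorem contDiffAt_posPart_rpow (M : ℕ) {s : ℝ} (hs : (M : ℝ) < s) :
    ContDiffAt ℝ M (fun v : ℝ => (max v 0) ^ s) 0 := by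
  simpa using contDiffAt_posPart_rpow_mul one_pos M s (fun _ => 1) hs analyticAt_const

/-- The profile `(1 - u^{β/2})_+^δ` of the generalized Bochner–Riesz symbol. -/
noncomputable def rieszProfile (β δ u : ℝ) : ℝ := (max (1 - (max u 0) ^ (β / 2)) 0) ^ δ

theorem continuous_rieszProfile {β δ : ℝ} (hβ : 0 < β) (hδ : 0 < δ) :
    Continuous (rieszProfile β δ) := by
  have h1 : Continuous fun u : ℝ => (max u 0) ^ (β / 2) :=
    (by fun_prop : Continuous fun v : ℝ => max v 0).rpow_const fun _ => Or.inr (by positivity)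
  exact (by fun_prop : Continuous fun u : ℝ => max (1 - (max u 0) ^ (β / 2)) 0).rpow_const
    fun _ => Or.inr hδ.le

theorem rieszProfile_eq_zero {β δ : ℝ} (hβ : 0 < β) (hδ : 0 < δ) {u : ℝ} (hu : 1 ≤ u) :
    rieszProfile β δ u = 0 := by
  rw [rieszProfile, max_eq_left (by linarith : (0 : ℝ) ≤ u), max_eq_right, zero_rpow hδ.ne']
  linarith [one_le_rpow hu (by positivity : 0 ≤ β / 2)]

theorem contDiffAt_rieszProfile {β δ : ℝ} (hβ : 0 < β) {n : ℕ∞ω} {u : ℝ} (h0 : 0 < u)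
    (h1 : u < 1) : ContDiffAt ℝ n (rieszProfile β δ) u := by
  have e : rieszProfile β δ =ᶠ[𝓝 u] fun u => (1 - u ^ (β / 2)) ^ δ := by
    filter_upwards [lt_mem_nhds h0, gt_mem_nhds h1] with x hx hx1
    rw [rieszProfile, max_eq_left hx.le, max_eq_left]
    linarith [rpow_le_one hx.le hx1.le (by positivity : 0 ≤ β / 2)]
  refine ContDiffAt.congr_of_eventuallyEq ?_ e
  refine ContDiffAt.rpow_const_of_ne
    (contDiffAt_const.sub (contDiffAt_id.rpow_const_of_ne h0.ne')) ?_
  have := rpow_lt_one h0.le h1 (by positivity : 0 < β / 2)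
  linarith

theorem contDiffAt_ballProfile {δ : ℝ} {n : ℕ∞ω} {u : ℝ} (h1 : u < 1) :
    ContDiffAt ℝ n (ballProfile δ) u := by
  have e : ballProfile δ =ᶠ[𝓝 u] fun u => (1 - u) ^ δ := by
    filter_upwards [gt_mem_nhds h1] with x hx1
    rw [ballProfile, max_eq_left (by linarith)]
  refine ContDiffAt.congr_of_eventuallyEq ?_ e
  exact (contDiffAt_const.sub contDiffAt_id).rpow_const_of_ne (by simp only [id]; linarith)

/-- Decomposition of the symbol near the origin. -/
theorem exists_rieszProfile_mul_cutoff_eq {β δ : ℝ} (hβ : 0 < β) (M : ℕ) :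
    ∃ (J : ℕ) (c : ℕ → ℝ) (ρ : ℝ → ℝ), 2 ≤ J ∧ c 1 = -δ ∧
      (∀ u, 0 ≤ u → ContDiffAt ℝ M ρ u) ∧ (∀ u, 1 / 2 ≤ u → ρ u = 0) ∧
      ∀ u, 0 ≤ u → rieszProfile β δ u * cutoff u =
        ∑ j ∈ Finset.Ico 1 J, c j * powerProfile (j * β) u + ρ u := by
  -- The Taylor remainder is u_+^{Jβ/2} times an analytic function of u_+^{β/2}, and it is C^M as
  -- soon as Jβ/2 > M. The bound J ≥ 2 ensures that the linear term, with coefficient -δ, is among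
  -- those listed.
  obtain ⟨J₀, hJ₀⟩ := exists_nat_gt (M / (β / 2))
  set J := max J₀ 2
  have hJ : (M : ℝ) < J * (β / 2) := by
    rw [div_lt_iff₀ (by positivity)] at hJ₀
    refine hJ₀.trans_le ?_
    gcongr
    exact le_max_left _ _
  have han : AnalyticAt ℝ (fun t : ℝ => (1 - t) ^ δ) 0 := by
    refine ContDiffAt.analyticAt (𝕜 := ℝ) ?_
    exact (contDiffAt_const.sub contDiffAt_id).rpow_const_of_ne (by simp)
  obtain ⟨c, g, hg, hc0, hc1, hx⟩ := exists_taylor_of_analyticAt han J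
  simp only [sub_zero] at hx
  have hJ2 : 2 ≤ J := le_max_right _ _
  refine ⟨J, c, fun u => cutoff u * (rieszProfile β δ u -
    ∑ j ∈ Finset.Ico 1 J, c j * (max u 0) ^ (j * (β / 2))), hJ2, ?_, ?_, ?_, ?_⟩
  · rw [hc1]
    have := (((hasDerivAt_id (0 : ℝ)).const_sub 1).rpow_const (p := δ) (Or.inl (by simp))).deriv
    simpa using this
  · intro u hu
    rcases hu.eq_or_lt with rfl | hu
    · refine (contDiff_cutoff M).contDiffAt.mul ?_
      have e : (fun u => rieszProfile β δ u -
          ∑ j ∈ Finset.Ico 1 J, c j * (max u 0) ^ (j * (β / 2))) =ᶠ[𝓝 0]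
          fun u => c 0 + (max u 0) ^ (J * (β / 2)) * g ((max u 0) ^ (β / 2)) := by
        filter_upwards [gt_mem_nhds (zero_lt_one' ℝ)] with u hu
        have hm0 : 0 ≤ max u 0 := le_max_right _ _
        have h1 : (max u 0) ^ (β / 2) ≤ 1 :=
          rpow_le_one hm0 (max_le hu.le zero_le_one) (by positivity)
        rw [rieszProfile, max_eq_left (by linarith), hx, Finset.range_eq_Ico,
          Finset.sum_eq_sum_Ico_succ_bot (by omega)]
        have h2 : ∀ j : ℕ, ((max u 0) ^ (β / 2)) ^ j = (max u 0) ^ (j * (β / 2)) := by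
          intro j
          rw [← rpow_mul_natCast hm0, mul_comm]
        simp only [h2, zero_add]
        simp
        ring
      refine ContDiffAt.congr_of_eventuallyEq ?_ e
      exact contDiffAt_const.add (contDiffAt_posPart_rpow_mul (by positivity) M _ g hJ hg)
    · rcases lt_or_ge u 1 with h1 | h1
      · refine (contDiff_cutoff M).contDiffAt.mul ((contDiffAt_rieszProfile hβ hu h1).sub ?_)
        refine ContDiffAt.sum fun j _ => contDiffAt_const.mul ?_
        have e : (fun u : ℝ => (max u 0) ^ (j * (β / 2))) =ᶠ[𝓝 u] fun u => u ^ (j * (β / 2)) := by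
          filter_upwards [lt_mem_nhds hu] with x hx
          rw [max_eq_left hx.le]
        exact (contDiffAt_id.rpow_const_of_ne hu.ne').congr_of_eventuallyEq e
      · refine (contDiffAt_const (c := (0 : ℝ))).congr_of_eventuallyEq ?_
        filter_upwards [lt_mem_nhds (show (1 / 2 : ℝ) < u by linarith)] with x hx
        rw [cutoff_eq_zero hx.le, zero_mul]
  · intro u hu
    simp only [cutoff_eq_zero hu, zero_mul]
  · intro u hu
    simp only [powerProfile, max_eq_left hu]
    rw [mul_sub, Finset.mul_sum]
    have : ∑ j ∈ Finset.Ico 1 J, c j * (u ^ (↑j * β / 2) * cutoff u) =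
        ∑ j ∈ Finset.Ico 1 J, cutoff u * (c j * u ^ (↑j * (β / 2))) :=
      Finset.sum_congr rfl fun j _ => by rw [mul_div_assoc]; ring
    rw [this]; ring

theorem analyticAt_rpow_const {x p : ℝ} (hx : x ≠ 0) : AnalyticAt ℝ (fun x : ℝ => x ^ p) x :=
  ContDiffAt.analyticAt (𝕜 := ℝ) (contDiffAt_id.rpow_const_of_ne hx)

/-- The difference quotient of `u ^ b` at `1`. -/
noncomputable def powSlope (b : ℝ) : ℝ → ℝ := dslope (fun u => u ^ b) 1

theorem sub_mul_powSlope (b u : ℝ) : (u - 1) * powSlope b u = u ^ b - 1 := by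
  have := sub_smul_dslope (fun u : ℝ => u ^ b) 1 u
  simpa [powSlope] using this

theorem powSlope_one (b : ℝ) : powSlope b 1 = b := by
  rw [powSlope, dslope_same]
  simp

theorem powSlope_pos {b : ℝ} (hb : 0 < b) {u : ℝ} (hu : 0 < u) : 0 < powSlope b u := by
  have h := sub_mul_powSlope b u
  rcases lt_trichotomy u 1 with h1 | rfl | h1
  · have := rpow_lt_one hu.le h1 hb
    by_contra! h2
    nlinarith
  · rw [powSlope_one]; exact hb
  · have := one_lt_rpow h1 hb
    by_contra! h2
    nlinarith

theorem analyticAt_powSlope (b : ℝ) {u : ℝ} (hu : 0 < u) : AnalyticAt ℝ (powSlope b) u := by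
  rcases eq_or_ne u 1 with rfl | h1
  · obtain ⟨p, hp⟩ := analyticAt_rpow_const (x := 1) (p := b) one_ne_zero
    exact ⟨_, hp.has_fpower_series_dslope_fslope⟩
  · have e : powSlope b =ᶠ[𝓝 u] fun u => (u ^ b - 1) / (u - 1) := by
      filter_upwards [isOpen_ne.mem_nhds h1] with x hx
      rw [eq_div_iff (sub_ne_zero.2 hx), mul_comm, sub_mul_powSlope]
    refine AnalyticAt.congr ?_ e.symm
    exact ((analyticAt_rpow_const hu.ne').sub analyticAt_const).div
      (analyticAt_id.sub analyticAt_const) (sub_ne_zero.2 h1)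

/-- The factorization 1 - u^{β/2} = (1 - u) · `powSlope (β / 2) u` has a positive factor that is
analytic on u > 0. At the sphere the general symbol is thus the classical one times an analytic
function. -/
theorem rieszProfile_eq_mul {β δ : ℝ} (hβ : 0 < β) {u : ℝ} (hu : 0 < u) :
    rieszProfile β δ u = ballProfile δ u * powSlope (β / 2) u ^ δ := by
  have h := powSlope_pos (by positivity : 0 < β / 2) hu
  rw [rieszProfile, ballProfile, ← mul_rpow (le_max_right _ _) h.le, max_mul_of_nonneg _ _ h.le,
    max_eq_left hu.le, zero_mul]
  congr 2
  linear_combination sub_mul_powSlope (β / 2) u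

/-- Decomposition of the symbol near the unit sphere. -/
theorem exists_rieszProfile_mul_one_sub_cutoff_eq {β δ : ℝ} (hβ : 0 < β) (hδ : 0 < δ) (M : ℕ) :
    ∃ (J : ℕ) (c : ℕ → ℝ) (ρ : ℝ → ℝ), 0 < c 0 ∧
      (∀ u, 0 ≤ u → ContDiffAt ℝ M ρ u) ∧ (∀ u, 1 ≤ u → ρ u = 0) ∧
      ∀ u, rieszProfile β δ u * (1 - cutoff u) =
        ∑ j ∈ Finset.range (J + 1), c j * ballProfile (δ + j) u + ρ u := by
  -- The remainder after J + 1 terms carries the power δ + M + 1 > M of the distance to the sphere,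
  -- hence is C^M.
  set J := M
  have hβ2 : 0 < β / 2 := by positivity
  have han : AnalyticAt ℝ (fun u => powSlope (β / 2) u ^ δ) 1 := by
    refine ContDiffAt.analyticAt (𝕜 := ℝ) ?_
    exact (analyticAt_powSlope (β / 2) one_pos).contDiffAt.rpow_const_of_ne
      (powSlope_pos hβ2 one_pos).ne'
  obtain ⟨c, g, hg, hc0, -, hx⟩ := exists_taylor_of_analyticAt han (J + 1)
  -- A factor (u - 1)^j raises the index of the classical symbol from δ to δ + j, so the Taylor
  -- series of the analytic factor becomes a series of classical symbols.
  have hball : ∀ (j : ℕ) (u : ℝ), ballProfile δ u * (u - 1) ^ j =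
      (-1) ^ j * ballProfile (δ + j) u := by
    intro j u
    rcases le_or_gt 1 u with h | h
    · rw [ballProfile_eq_zero hδ h, ballProfile_eq_zero (by positivity) h]; ring
    · have h1 : 0 < 1 - u := by linarith
      rw [ballProfile, ballProfile, max_eq_left h1.le, rpow_add h1, rpow_natCast,
        show u - 1 = -1 * (1 - u) by ring, mul_pow]
      ring
  refine ⟨J, fun j => (-1) ^ j * c j, fun u => rieszProfile β δ u * (1 - cutoff u) -
    ∑ j ∈ Finset.range (J + 1), (-1) ^ j * c j * ballProfile (δ + j) u, ?_, ?_, ?_, ?_⟩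
  · simp only [pow_zero, one_mul, hc0, powSlope_one]; positivity
  · intro u hu
    rcases lt_trichotomy u 1 with h1 | rfl | h1
    · refine ContDiffAt.sub ?_ (ContDiffAt.sum fun j _ =>
        contDiffAt_const.mul (contDiffAt_ballProfile h1))
      rcases hu.eq_or_lt with rfl | hu
      · refine (contDiffAt_const (c := (0 : ℝ))).congr_of_eventuallyEq ?_
        filter_upwards [gt_mem_nhds (show (0 : ℝ) < 1 / 4 by norm_num)] with x hx
        rw [cutoff_eq_one hx.le]; ring
      · exact (contDiffAt_rieszProfile hβ hu h1).mul
          (contDiffAt_const.sub (contDiff_cutoff M).contDiffAt)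
    · have e : (fun u => rieszProfile β δ u * (1 - cutoff u) -
          ∑ j ∈ Finset.range (J + 1), (-1) ^ j * c j * ballProfile (δ + j) u) =ᶠ[𝓝 1]
          fun u => (-1) ^ (J + 1) * ballProfile (δ + (J + 1 : ℕ)) u * g u := by
        filter_upwards [lt_mem_nhds (show (1 / 2 : ℝ) < 1 by norm_num)] with u hu
        rw [cutoff_eq_zero hu.le, rieszProfile_eq_mul hβ (by linarith), hx u]
        rw [sub_zero, mul_one, mul_add, Finset.mul_sum, ← mul_assoc, hball]
        have : ∀ j ∈ Finset.range (J + 1), ballProfile δ u * (c j * (u - 1) ^ j) =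
            (-1) ^ j * c j * ballProfile (δ + j) u := by
          intro j _
          linear_combination c j * hball j u
        rw [Finset.sum_congr rfl this]
        ring
      refine ContDiffAt.congr_of_eventuallyEq ?_ e
      refine (contDiffAt_const.mul ?_).mul hg.contDiffAt
      have h2 := contDiffAt_posPart_rpow M (s := δ + (J + 1 : ℕ)) (by push_cast; linarith)
      have h3 : ContDiffAt ℝ M (fun u : ℝ => 1 - u) 1 := by fun_prop
      refine ContDiffAt.comp (g := fun v : ℝ => (max v 0) ^ (δ + (J + 1 : ℕ))) 1 ?_ h3
      simpa using h2
    · refine (contDiffAt_const (c := (0 : ℝ))).congr_of_eventuallyEq ?_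
      filter_upwards [lt_mem_nhds h1] with x hx
      rw [rieszProfile_eq_zero hβ hδ hx.le, zero_mul, zero_sub, neg_eq_zero]
      exact Finset.sum_eq_zero fun j _ => by
        rw [ballProfile_eq_zero (by positivity) hx.le, mul_zero]
  · intro u hu
    simp only [rieszProfile_eq_zero hβ hδ hu, zero_mul, zero_sub, neg_eq_zero]
    exact Finset.sum_eq_zero fun j _ => by
      rw [ballProfile_eq_zero (by positivity) hu, mul_zero]
  · intro u
    ring

/-! ### Decay and asymptotics of the Fourier transform of the symbol. -/

section
variable {E : Type*} [NormedAddCommGroup E] [InnerProductSpace ℝ E] [FiniteDimensional ℝ E]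
  [MeasurableSpace E] [BorelSpace E]

theorem fourier_radial_linear_combination {ι : Type*} {S : Finset ι} {c : ι → ℝ}
    {g : ι → ℝ → ℝ} {ρ f : ℝ → ℝ} (hf : ∀ u, 0 ≤ u → f u = ∑ j ∈ S, c j * g j u + ρ u)
    (hg : ∀ j ∈ S, Integrable (radial E (g j))) (hρ : Integrable (radial E ρ)) (y : E) :
    𝓕 (radial E f) y = ∑ j ∈ S, (c j : ℂ) * 𝓕 (radial E (g j)) y + 𝓕 (radial E ρ) y := by
  have e : radial E f = fun x => (∑ j ∈ S, (c j : ℂ) * radial E (g j) x) + radial E ρ x := by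
    ext x
    simp only [radial]
    rw [hf _ (by positivity)]
    push_cast
    rfl
  rw [e, fourier_add_of_integrable _ hρ, fourier_finset_sum]
  · simp_rw [fourier_const_mul]
  · exact fun j hj => (hg j hj).const_mul _
  · exact integrable_finsetSum _ fun j hj => (hg j hj).const_mul _

theorem integrable_radial_of_contDiffAt {ρ : ℝ → ℝ} {M : ℕ} {R : ℝ}
    (h : ∀ u, 0 ≤ u → ContDiffAt ℝ M ρ u) (h0 : ∀ u, R ≤ u → ρ u = 0) :
    Integrable (radial E ρ) :=
  integrable_radial (fun u hu => (h u hu).continuousAt.continuousWithinAt) h0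

theorem hasDecay_fourier_radial {ρ : ℝ → ℝ} {M : ℕ} {R : ℝ}
    (h : ∀ u, 0 ≤ u → ContDiffAt ℝ M ρ u) (h0 : ∀ u, R ≤ u → ρ u = 0) :
    HasDecay (M : ℝ) (𝓕 (radial E ρ)) :=
  hasDecay_fourier_of_contDiff (contDiff_radial h) (hasCompactSupport_radial h0)

/-- The Fourier transform of the symbol cut off to a neighbourhood of the origin. -/
theorem exists_fourier_rieszProfile_mul_cutoff [Nontrivial E] {β δ : ℝ} (hβ : 0 < β) (hδ : 0 < δ) :
    ∃ κ : ℂ, ((¬ ∃ m : ℕ, 0 < m ∧ β = 2 * m) → κ ≠ 0) ∧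
      ∃ C : ℝ, 0 ≤ C ∧ ∀ y : E, 1 ≤ ‖y‖ →
        ‖𝓕 (radial E (fun u => rieszProfile β δ u * cutoff u)) y -
          κ * ((‖y‖ ^ (-(Module.finrank ℝ E + β)) : ℝ) : ℂ)‖ ≤
            C * ‖y‖ ^ (-(Module.finrank ℝ E + 2 * β)) := by
  -- All errors of order M are absorbed into ‖y‖^{-(dim E + 2β)}. The powers with j ≥ 2 contribute
  -- order dim E + jβ, which is at least as good, and only the linear term survives as the main
  -- term.
  obtain ⟨M, hM⟩ := exists_nat_ge ((Module.finrank ℝ E : ℝ) + 2 * β)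
  obtain ⟨J, c, ρ, hJ, hc1, hρ, hρ0, hdec⟩ := exists_rieszProfile_mul_cutoff_eq (δ := δ) hβ M
  have hpos : ∀ j ∈ Finset.Ico 1 J, 0 < (j : ℝ) * β := fun j hj => by
    have : (0 : ℝ) < j := by exact_mod_cast (Finset.mem_Ico.1 hj).1
    positivity
  choose! κ hκ hκ' hκC using fun s (hs : 0 < s) =>
    exists_fourier_powerProfile_asymptotics (E := E) (s := s) hs
  choose! C hC0 hC using hκC
  obtain ⟨D, hD0, hD⟩ := (hasDecay_fourier_radial (E := E) hρ hρ0).le_norm_rpow (by positivity)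
  have hmono : ∀ {y : E} {s t : ℝ}, 1 ≤ ‖y‖ → t ≤ s → ‖y‖ ^ (-s) ≤ ‖y‖ ^ (-t) :=
    fun h1 h2 => rpow_le_rpow_of_exponent_le h1 (by linarith)
  refine ⟨c 1 * κ β, fun h => mul_ne_zero ?_ (hκ β hβ h), ?_⟩
  · rw [hc1]; exact_mod_cast (neg_ne_zero.2 hδ.ne')
  refine ⟨|c 1| * C β M + (∑ j ∈ Finset.Ico 2 J, |c j| * (‖κ (j * β)‖ + C (j * β) M)) + D, ?_,
    fun y hy => ?_⟩
  · have : ∀ j ∈ Finset.Ico 2 J, 0 ≤ |c j| * (‖κ (j * β)‖ + C (j * β) M) := fun j hj => by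
      have := hC0 (j * β) (hpos j (by rw [Finset.mem_Ico] at *; omega)) M
      positivity
    have h2 := hC0 β hβ M
    have := Finset.sum_nonneg this
    positivity
  have hy0 : 0 < ‖y‖ := by linarith
  rw [fourier_radial_linear_combination hdec
    (fun j hj => integrable_powerProfile (hpos j hj)) (integrable_radial_of_contDiffAt hρ hρ0),
    Finset.sum_eq_sum_Ico_succ_bot (by omega), Nat.cast_one, one_mul]
  set T := ‖y‖ ^ (-(Module.finrank ℝ E + 2 * β)) with hT
  have hMT : ‖y‖ ^ (-(M : ℝ)) ≤ T := hmono hy hM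
  have h1 : ‖(c 1 : ℂ) * (𝓕 (radial E (powerProfile β)) y -
      κ β * ((‖y‖ ^ (-(Module.finrank ℝ E + β)) : ℝ) : ℂ))‖ ≤ |c 1| * C β M * T := by
    rw [norm_mul, Complex.norm_real, Real.norm_eq_abs, mul_assoc]
    gcongr
    exact (hC β hβ M y hy).trans (mul_le_mul_of_nonneg_left hMT (hC0 β hβ M))
  have h2 : ‖∑ j ∈ Finset.Ico 2 J, (c j : ℂ) * 𝓕 (radial E (powerProfile (j * β))) y‖ ≤
      (∑ j ∈ Finset.Ico 2 J, |c j| * (‖κ (j * β)‖ + C (j * β) M)) * T := by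
    rw [Finset.sum_mul]
    refine norm_sum_le_of_le _ fun j hj => ?_
    have hj1 : j ∈ Finset.Ico 1 J := by rw [Finset.mem_Ico] at *; omega
    have hj2 : (2 : ℝ) ≤ j := by exact_mod_cast (Finset.mem_Ico.1 hj).1
    rw [norm_mul, Complex.norm_real, Real.norm_eq_abs, mul_assoc]
    gcongr
    have h3 := hC (j * β) (hpos j hj1) M y hy
    have h4 : ‖κ (j * β) * ((‖y‖ ^ (-(Module.finrank ℝ E + j * β)) : ℝ) : ℂ)‖ ≤
        ‖κ (j * β)‖ * T := by
      rw [norm_mul, Complex.norm_real, Real.norm_of_nonneg (by positivity)]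
      gcongr
      exact hmono hy (by nlinarith)
    have h5 := mul_le_mul_of_nonneg_left hMT (hC0 (j * β) (hpos j hj1) M)
    calc _ = ‖(𝓕 (radial E (powerProfile (j * β))) y -
          κ (j * β) * ((‖y‖ ^ (-(Module.finrank ℝ E + j * β)) : ℝ) : ℂ)) +
          κ (j * β) * ((‖y‖ ^ (-(Module.finrank ℝ E + j * β)) : ℝ) : ℂ)‖ := by rw [sub_add_cancel]
      _ ≤ _ := norm_add_le _ _
      _ ≤ _ := by rw [add_mul]; linarith
  have h3 : ‖𝓕 (radial E ρ) y‖ ≤ D * T :=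
    (hD y hy0).trans (mul_le_mul_of_nonneg_left hMT hD0)
  calc _ = ‖(c 1 : ℂ) * (𝓕 (radial E (powerProfile β)) y -
      κ β * ((‖y‖ ^ (-(Module.finrank ℝ E + β)) : ℝ) : ℂ)) +
      ∑ j ∈ Finset.Ico 2 J, (c j : ℂ) * 𝓕 (radial E (powerProfile (j * β))) y +
      𝓕 (radial E ρ) y‖ := by congr 1; ring
    _ ≤ _ := norm_add₃_le
    _ ≤ _ := by rw [add_mul, add_mul]; linarith

/-- For β = 2m the profile near the origin is (1 - u^m)^δ, which is smooth at u = 0. The origin then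
adds nothing to the transform beyond rapid decay, which is why even exponents are exceptional. -/
theorem hasDecay_fourier_rieszProfile_mul_cutoff_of_even {m : ℕ} (hm : 0 < m) {δ : ℝ} (M : ℕ) :
    HasDecay (M : ℝ) (𝓕 (radial E (fun u => rieszProfile (2 * m) δ u * cutoff u))) := by
  have hβ : (0 : ℝ) < 2 * m := by positivity
  set f : ℝ → ℝ := fun u => (max (1 - u ^ m) 0) ^ δ * cutoff u
  have e : radial E (fun u => rieszProfile (2 * m) δ u * cutoff u) = radial E f := by
    ext x
    simp only [radial, f, rieszProfile]
    rw [max_eq_left (by positivity : (0 : ℝ) ≤ ‖x‖ ^ 2), mul_div_cancel_left₀ _ (by norm_num), rpow_natCast]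
  rw [e]
  refine hasDecay_fourier_radial (R := 1 / 2) (fun u hu => ?_) fun u hu => by
    simp [f, cutoff_eq_zero hu]
  rcases lt_or_ge u 1 with h1 | h1
  · refine ContDiffAt.mul ?_ (contDiff_cutoff M).contDiffAt
    have h2 : u ^ m < 1 := pow_lt_one₀ hu h1 hm.ne'
    have h3 : ∀ᶠ x : ℝ in 𝓝 u, x ^ m < 1 :=
      (continuous_pow m).continuousAt.eventually (gt_mem_nhds h2)
    have e2 : (fun u : ℝ => (max (1 - u ^ m) 0) ^ δ) =ᶠ[𝓝 u] fun u => (1 - u ^ m) ^ δ := by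
      filter_upwards [h3] with x hx
      rw [max_eq_left (by linarith)]
    refine ContDiffAt.congr_of_eventuallyEq ?_ e2
    exact ContDiffAt.rpow_const_of_ne (by fun_prop) (by linarith)
  · refine (contDiffAt_const (c := (0 : ℝ))).congr_of_eventuallyEq ?_
    filter_upwards [lt_mem_nhds (show (1 / 2 : ℝ) < u by linarith)] with x hx
    simp only [f, cutoff_eq_zero hx.le, mul_zero]

theorem hasDecay_fourier_rieszProfile_mul_cutoff [Nontrivial E] {β δ : ℝ} (hβ : 0 < β)
    (hδ : 0 < δ) :
    HasDecay (Module.finrank ℝ E + β)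
      (𝓕 (radial E (fun u => rieszProfile β δ u * cutoff u))) := by
  obtain ⟨κ, -, C, hC, h⟩ := exists_fourier_rieszProfile_mul_cutoff (E := E) hβ hδ
  refine HasDecay.of_bound (C := C + ‖κ‖) (norm_fourier_le_integral _) (fun y hy => ?_)
    (by positivity)
  have h1 := h y hy
  have h2 : ‖y‖ ^ (-(Module.finrank ℝ E + 2 * β)) ≤ ‖y‖ ^ (-(Module.finrank ℝ E + β)) :=
    rpow_le_rpow_of_exponent_le hy (by linarith)
  have h3 : ‖κ * ((‖y‖ ^ (-(Module.finrank ℝ E + β)) : ℝ) : ℂ)‖ =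
      ‖κ‖ * ‖y‖ ^ (-(Module.finrank ℝ E + β)) := by
    rw [norm_mul, Complex.norm_real, Real.norm_of_nonneg (by positivity)]
  have h4 := norm_add_le (𝓕 (radial E (fun u => rieszProfile β δ u * cutoff u)) y -
          κ * ((‖y‖ ^ (-(Module.finrank ℝ E + β)) : ℝ) : ℂ))
          (κ * ((‖y‖ ^ (-(Module.finrank ℝ E + β)) : ℝ) : ℂ))
  rw [sub_add_cancel, h3] at h4
  have h5 := mul_le_mul_of_nonneg_left h2 hC
  rw [add_mul]
  linarith

end

/-- The transform is a multiple of Poisson's integral with ν = δ + n/2, and the energy bound keeps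
r^(ν+1) times that integral bounded for r ≥ 1. -/
theorem hasDecay_fourier_ballProfile {δ : ℝ} (hδ : 0 < δ) (n : ℕ) :
    HasDecay (δ + n / 2 + 1)
      (𝓕 (radial (EuclideanSpace ℝ (Fin (n + 1))) (ballProfile δ))) := by
  obtain ⟨C, hC, h⟩ := exists_fourier_ballProfile hδ n
  have hν : 0 < δ + (n : ℝ) / 2 := by positivity
  obtain ⟨w, w₁, m, M, hm, hF, -, -, hE⟩ := exists_normalized_solution hν
  refine HasDecay.of_bound (C := C * ((2 * π) ^ (-(δ + n / 2 + 1)) * √M))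
    (norm_fourier_le_integral _) (fun y hy => ?_) (by positivity)
  have h1 : 1 ≤ 2 * π * ‖y‖ := by nlinarith [pi_gt_three]
  have h2 : |w (2 * π * ‖y‖)| ≤ √M := by
    refine abs_le_sqrt ?_
    nlinarith [(hE _ h1).2, sq_nonneg (w₁ (2 * π * ‖y‖))]
  rw [h, hF _ (by linarith), Complex.norm_real, Real.norm_eq_abs, abs_mul, abs_mul,
    abs_of_pos hC, abs_of_nonneg (by positivity), mul_rpow (by positivity) (by positivity)]
  calc _ ≤ C * ((2 * π) ^ (-(δ + n / 2 + 1)) * ‖y‖ ^ (-(δ + n / 2 + 1)) * √M) := by gcongr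
    _ = _ := by ring

/-- The Fourier transform of the symbol away from the origin. -/
theorem exists_fourier_rieszProfile_mul_one_sub_cutoff {β δ : ℝ} (hβ : 0 < β) (hδ : 0 < δ)
    (n : ℕ) : ∃ A : ℝ, 0 < A ∧
      HasDecay (δ + n / 2 + 2) (fun y : EuclideanSpace ℝ (Fin (n + 1)) =>
        𝓕 (radial (EuclideanSpace ℝ (Fin (n + 1)))
          (fun u => rieszProfile β δ u * (1 - cutoff u))) y
          - ((A * poissonIntegral (δ + n / 2) (2 * π * ‖y‖) : ℝ) : ℂ)) := by
  obtain ⟨M, hM⟩ := exists_nat_ge (δ + n / 2 + 2)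
  obtain ⟨J, c, ρ, hc0, hρ, hρ0, hdec⟩ := exists_rieszProfile_mul_one_sub_cutoff_eq hβ hδ M
  obtain ⟨C, hC, h⟩ := exists_fourier_ballProfile hδ n
  refine ⟨c 0 * C, by positivity, ?_⟩
  -- Each classical symbol with j ≥ 1 gains at least one order of decay over the symbol with j = 0.
  -- Only the latter is kept in the main term, with the coefficient c 0 > 0.
  have hd : HasDecay (δ + n / 2 + 2) (fun y : EuclideanSpace ℝ (Fin (n + 1)) =>
      ∑ j ∈ Finset.Ico 1 (J + 1), (c j : ℂ) *
        𝓕 (radial (EuclideanSpace ℝ (Fin (n + 1))) (ballProfile (δ + j))) y +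
      𝓕 (radial (EuclideanSpace ℝ (Fin (n + 1))) ρ) y) := by
    refine HasDecay.add (HasDecay.sum fun j hj => HasDecay.const_mul ?_ _)
      ((hasDecay_fourier_radial hρ hρ0).mono hM)
    refine (hasDecay_fourier_ballProfile (by positivity) n).mono ?_
    have : (1 : ℝ) ≤ j := by exact_mod_cast (Finset.mem_Ico.1 hj).1
    linarith
  convert! hd using 2 with y
  rw [fourier_radial_linear_combination (fun u _ => hdec u)
    (fun j _ => integrable_ballProfile (by positivity)) (integrable_radial_of_contDiffAt hρ hρ0),
    Finset.range_eq_Ico, Finset.sum_eq_sum_Ico_succ_bot (by omega)]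
  simp only [Nat.cast_zero, add_zero, zero_add, h]
  push_cast
  ring

theorem fourier_rieszProfile_split {E : Type*} [NormedAddCommGroup E] [InnerProductSpace ℝ E]
    [FiniteDimensional ℝ E] [MeasurableSpace E] [BorelSpace E] {β δ : ℝ} (hβ : 0 < β)
    (hδ : 0 < δ) (y : E) :
    𝓕 (radial E (rieszProfile β δ)) y =
      𝓕 (radial E (fun u => rieszProfile β δ u * cutoff u)) y +
      𝓕 (radial E (fun u => rieszProfile β δ u * (1 - cutoff u))) y := by
  have hc := continuous_rieszProfile hβ hδ
  have hc' := (contDiff_cutoff 0).continuous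
  rw [← fourier_add_of_integrable]
  · refine congrFun (congrArg _ (funext fun x => ?_)) y
    simp only [radial]
    push_cast; ring
  · exact integrable_radial (R := 1) (hc.mul hc').continuousOn fun u hu => by
      rw [rieszProfile_eq_zero hβ hδ hu, zero_mul]
  · exact integrable_radial (R := 1) (hc.mul (continuous_const.sub hc')).continuousOn fun u hu => by
      rw [rieszProfile_eq_zero hβ hδ hu, zero_mul]

/-- Decay of the Fourier transform of the generalized Bochner–Riesz symbol. -/
theorem hasDecay_fourier_rieszProfile {β δ : ℝ} (hβ : 0 < β) (hδ : 0 < δ) (n : ℕ) {a : ℝ}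
    (h1 : a ≤ δ + n / 2 + 1) (h2 : (∃ m : ℕ, 0 < m ∧ β = 2 * m) ∨ a ≤ n + 1 + β) :
    HasDecay a (𝓕 (radial (EuclideanSpace ℝ (Fin (n + 1))) (rieszProfile β δ))) := by
  obtain ⟨A, hA, hd⟩ := exists_fourier_rieszProfile_mul_one_sub_cutoff hβ hδ n
  obtain ⟨C, hC, hF⟩ := exists_fourier_ballProfile hδ n
  -- The main term A times Poisson's integral is A/C times the transform of the classical symbol,
  -- whose decay is known.
  have h3 := ((hasDecay_fourier_ballProfile hδ n).const_mul ((A / C : ℝ) : ℂ)).mono h1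
  have h4 := hd.mono (by linarith : a ≤ δ + n / 2 + 2)
  have h5 : HasDecay a (𝓕 (radial (EuclideanSpace ℝ (Fin (n + 1)))
      (fun u => rieszProfile β δ u * cutoff u))) := by
    rcases h2 with ⟨m, hm, rfl⟩ | h2
    · obtain ⟨M, hM⟩ := exists_nat_ge a
      exact (hasDecay_fourier_rieszProfile_mul_cutoff_of_even hm M).mono hM
    · refine (hasDecay_fourier_rieszProfile_mul_cutoff hβ hδ).mono ?_
      simpa using h2
  convert! h5.add (h4.add h3) using 2 with y
  rw [fourier_rieszProfile_split hβ hδ, hF]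
  have : (C : ℂ) ≠ 0 := by exact_mod_cast hC.ne'
  push_cast
  field_simp
  ring

/-! ### Oscillation and failure of integrability. -/

/-- A solution of `w'' + (1 - c / r ^ 2) w = 0` whose energy is bounded below oscillates by a
fixed amount on every unit interval. -/
theorem exists_oscillation {w w₁ : ℝ → ℝ} {c m : ℝ} (hm : 0 < m)
    (hw : ∀ r, 0 < r → HasDerivAt w (w₁ r) r)
    (hw₁ : ∀ r, 0 < r → HasDerivAt w₁ (-w r + c * w r / r ^ 2) r)
    (hE : ∀ r, 1 ≤ r → m ≤ w r ^ 2 + w₁ r ^ 2) :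
    ∃ η : ℝ, 0 < η ∧ ∃ R₀ : ℝ, 1 ≤ R₀ ∧ ∀ R, R₀ ≤ R →
      ∃ s ∈ Set.Icc R (R + 1), ∃ t ∈ Set.Icc R (R + 1), η < |w s - w t| := by
  -- The argument ends with w^2 + w₁^2 ≤ (33η)^2 + (4η)^2 = 1105 η^2 at one point. The choice 2000
  -- η^2 < m contradicts the lower energy bound.
  obtain ⟨η, hη, hηm⟩ : ∃ η : ℝ, 0 < η ∧ 2000 * η ^ 2 < m := by
    refine ⟨√(m / 4000), by positivity, ?_⟩
    rw [sq_sqrt (by positivity)]; linarith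
  refine ⟨η, hη, max 1 (2 * |c|), le_max_left _ _, fun R hR => ?_⟩
  have hR1 : 1 ≤ R := (le_max_left _ _).trans hR
  have hRc : 2 * |c| ≤ R := (le_max_right _ _).trans hR
  -- If w varied by at most η on the interval, the mean value theorem on its first and last quarters
  -- would give two points with |w₁| ≤ 4η, and between them a point with |w''| ≤ 16η. As |c|/r^2 ≤
  -- 1/2 for r ≥ max(1, 2|c|), the equation makes w itself small there, hence w and w₁ are both
  -- small at one point.
  by_contra! hcon
  have hslope : ∀ a ∈ Set.Icc R (R + 3 / 4), ∃ ξ ∈ Set.Ioo a (a + 1 / 4), |w₁ ξ| ≤ 4 * η := by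
    intro a ha
    obtain ⟨ξ, hξ, hξ'⟩ := exists_hasDerivAt_eq_slope w w₁ (show a < a + 1 / 4 by linarith)
      (fun x hx => (hw x (by linarith [hx.1, ha.1])).continuousAt.continuousWithinAt)
      (fun x hx => hw x (by linarith [hx.1, ha.1]))
    refine ⟨ξ, hξ, ?_⟩
    rw [hξ', abs_div, add_sub_cancel_left, abs_of_pos (by norm_num : (0 : ℝ) < 1 / 4)]
    have := hcon (a + 1 / 4) ⟨by linarith [ha.1], by linarith [ha.2]⟩ a ⟨ha.1, by linarith [ha.2]⟩
    linarith
  obtain ⟨ξ₁, h1, h1'⟩ := hslope R ⟨le_rfl, by linarith⟩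
  obtain ⟨ξ₂, h2, h2'⟩ := hslope (R + 3 / 4) ⟨by linarith, le_rfl⟩
  have h12 : 1 / 2 ≤ ξ₂ - ξ₁ := by linarith [h1.2, h2.1]
  obtain ⟨ζ, hζ, hζ'⟩ := exists_hasDerivAt_eq_slope w₁ _ (show ξ₁ < ξ₂ by linarith)
    (fun x hx => (hw₁ x (by linarith [hx.1, h1.1])).continuousAt.continuousWithinAt)
    (fun x hx => hw₁ x (by linarith [hx.1, h1.1]))
  have hζ0 : 1 ≤ ζ := by linarith [hζ.1, h1.1]
  have h3 : |-w ζ + c * w ζ / ζ ^ 2| ≤ 16 * η := by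
    rw [hζ', abs_div, abs_of_pos (by linarith : 0 < ξ₂ - ξ₁), div_le_iff₀ (by linarith)]
    have := abs_sub (w₁ ξ₂) (w₁ ξ₁)
    nlinarith
  have h4 : |w ζ| ≤ 32 * η := by
    have h5 : |c * w ζ / ζ ^ 2| ≤ |w ζ| / 2 := by
      rw [abs_div, abs_mul, abs_of_pos (by positivity : 0 < ζ ^ 2), div_le_iff₀ (by positivity)]
      have : 2 * |c| ≤ ζ ^ 2 := by nlinarith [hζ.1, h1.1]
      nlinarith [abs_nonneg (w ζ)]
    have h6 : |w ζ| ≤ |-w ζ + c * w ζ / ζ ^ 2| + |c * w ζ / ζ ^ 2| := by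
      have := abs_sub (-w ζ + c * w ζ / ζ ^ 2) (c * w ζ / ζ ^ 2)
      rwa [add_sub_cancel_right, abs_neg] at this
    linarith
  have h7 : |w ξ₁| ≤ 33 * η := by
    have h8 := hcon ξ₁ ⟨by linarith [h1.1], by linarith [h1.2]⟩ ζ
      ⟨by linarith [hζ.1, h1.1], by linarith [hζ.2, h2.2]⟩
    have := abs_add_le (w ξ₁ - w ζ) (w ζ)
    rw [sub_add_cancel] at this
    linarith
  have h9 := hE ξ₁ (by linarith [h1.1])
  have h10 : w ξ₁ ^ 2 ≤ (33 * η) ^ 2 := sq_le_sq' (by linarith [(abs_le.1 h7).1]) (abs_le.1 h7).2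
  have h11 : w₁ ξ₁ ^ 2 ≤ (4 * η) ^ 2 := sq_le_sq' (by linarith [(abs_le.1 h1').1]) (abs_le.1 h1').2
  nlinarith

/-- `A w + B` is bounded below on a subinterval of fixed length of every unit interval. -/
theorem exists_lower_bound_on_subintervals {w w₁ : ℝ → ℝ} {c m M : ℝ} (hm : 0 < m)
    (hw : ∀ r, 0 < r → HasDerivAt w (w₁ r) r)
    (hw₁ : ∀ r, 0 < r → HasDerivAt w₁ (-w r + c * w r / r ^ 2) r)
    (hE : ∀ r, 1 ≤ r → m ≤ w r ^ 2 + w₁ r ^ 2 ∧ w r ^ 2 + w₁ r ^ 2 ≤ M)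
    {A : ℝ} {B : ℂ} (hAB : 0 ≤ A) (hAB' : A = 0 → B ≠ 0) :
    ∃ ε : ℝ, 0 < ε ∧ ∃ ℓ : ℝ, 0 < ℓ ∧ ℓ ≤ 1 ∧ ∃ R₀ : ℝ, 1 ≤ R₀ ∧ ∀ R, R₀ ≤ R →
      ∃ t ∈ Set.Icc R (R + 1), ∀ s ∈ Set.Icc t (t + ℓ), ε ≤ ‖((A * w s : ℝ) : ℂ) + B‖ := by
  rcases hAB.eq_or_lt with rfl | hA
  · exact ⟨‖B‖, norm_pos_iff.2 (hAB' rfl), 1, one_pos, le_rfl, 1, le_rfl, fun R hR =>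
      ⟨R, ⟨le_rfl, by linarith⟩, fun s hs => by simp⟩⟩
  obtain ⟨η, hη, R₀, hR₀, hosc⟩ := exists_oscillation hm hw hw₁ fun r hr => (hE r hr).1
  have hw₁b : ∀ r, 1 ≤ r → |w₁ r| ≤ √M + 1 := fun r hr =>
    (abs_le_sqrt (y := M) (by nlinarith [(hE r hr).2, sq_nonneg (w r)])).trans (by linarith)
  have hL : 0 < √M + 1 := by positivity
  set ℓ := min 1 (η / (4 * (√M + 1))) with hℓ
  have hℓ0 : 0 < ℓ := by positivity
  refine ⟨A * η / 4, by positivity, ℓ, hℓ0, min_le_left _ _, R₀, hR₀, fun R hR => ?_⟩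
  obtain ⟨s, hs, t, ht, hst⟩ := hosc R hR
  -- Two values of w differing by more than η cannot both bring A w + B within Aη/2 of zero,
  -- whatever B is. The bound √M + 1 for |w₁| then keeps A w + B at least Aη/4 in modulus on a whole
  -- interval of length ℓ.
  obtain ⟨t, ht, hbig⟩ : ∃ t ∈ Set.Icc R (R + 1), A * η / 2 ≤ ‖((A * w t : ℝ) : ℂ) + B‖ := by
    by_contra! hcon
    have h1 := hcon s hs
    have h2 := hcon t ht
    have h3 := norm_sub_le (((A * w s : ℝ) : ℂ) + B) (((A * w t : ℝ) : ℂ) + B)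
    rw [add_sub_add_right_eq_sub, ← Complex.ofReal_sub, Complex.norm_real, Real.norm_eq_abs,
      ← mul_sub, abs_mul, abs_of_pos hA] at h3
    nlinarith
  refine ⟨t, ht, fun s hs => ?_⟩
  have h4 : |w s - w t| ≤ (√M + 1) * |s - t| := by
    have := Convex.norm_image_sub_le_of_norm_hasDerivWithin_le (f := w) (f' := w₁)
      (C := √M + 1) (s := Set.Ici 1) (x := t) (y := s)
      (fun x hx => (hw x (by linarith [Set.mem_Ici.1 hx])).hasDerivWithinAt)
      (fun x hx => hw₁b x hx) (convex_Ici 1)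
      (by linarith [ht.1, Set.mem_Ici.2 (hR₀.trans (hR.trans ht.1))] : (1 : ℝ) ≤ t)
      (by linarith [ht.1, hs.1] : (1 : ℝ) ≤ s)
    simpa [Real.norm_eq_abs] using this
  have h5 : |s - t| ≤ η / (4 * (√M + 1)) := by
    rw [abs_of_nonneg (by linarith [hs.1])]
    linarith [hs.2, min_le_right 1 (η / (4 * (√M + 1)))]
  have h6 : |w s - w t| ≤ η / 4 := by
    refine h4.trans ((mul_le_mul_of_nonneg_left h5 hL.le).trans_eq ?_)
    field_simp
  have h7 := norm_sub_le (((A * w s : ℝ) : ℂ) + B) (((A * w s : ℝ) : ℂ) - ((A * w t : ℝ) : ℂ))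
  have e : (((A * w s : ℝ) : ℂ) + B) - (((A * w s : ℝ) : ℂ) - ((A * w t : ℝ) : ℂ)) =
    ((A * w t : ℝ) : ℂ) + B := by ring
  have h8 : ‖((A * w s : ℝ) : ℂ) - ((A * w t : ℝ) : ℂ)‖ ≤ A * η / 4 := by
    rw [← Complex.ofReal_sub, Complex.norm_real, Real.norm_eq_abs, ← mul_sub, abs_mul,
      abs_of_pos hA]
    nlinarith
  rw [e] at h7
  linarith

/-- If a nonnegative function is at least `K / r` on subintervals of fixed length of all large
intervals of length two, it is not integrable. -/
theorem not_integrableOn_of_subintervals {k : ℝ → ℝ} {K ℓ : ℝ} (hK : 0 < K) (hℓ : 0 < ℓ)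
    (hℓ1 : ℓ ≤ 1) (hk0 : ∀ r, 0 < r → 0 ≤ k r) {R₀ : ℝ} (hR₀ : 1 ≤ R₀)
    (h : ∀ R, R₀ ≤ R → ∃ t ∈ Set.Icc R (R + 1), ∀ s ∈ Set.Icc t (t + ℓ), K / s ≤ k s) :
    ¬ IntegrableOn k (Set.Ioi 0) := by
  intro hInt
  obtain ⟨j₀, hj₀⟩ := exists_nat_ge R₀
  have hj1 : (1 : ℝ) ≤ j₀ := hR₀.trans hj₀
  -- Blocks of length 2 are used because a subinterval of length at most 1 starting in the first
  -- half of a block stays inside it. The j-th block contributes at least a multiple of 1/(j+1), and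
  -- the harmonic series diverges.
  set I : ℕ → Set ℝ := fun j => Set.Ioc ((j₀ : ℝ) + 2 * j) ((j₀ : ℝ) + 2 * (j + 1)) with hI
  have hdisj : Pairwise (Function.onFun Disjoint I) := by
    have hmono : Monotone fun j : ℕ => (j₀ : ℝ) + 2 * j := fun a b hab => by
      have : (a : ℝ) ≤ b := by exact_mod_cast hab
      simp only []; linarith
    have := hmono.pairwise_disjoint_on_Ioc_succ
    simpa [hI, Function.onFun, Nat.succ_eq_succ] using this
  have hsub : ∀ j, I j ⊆ Set.Ioi 0 := fun j x hx => by
    have : (0 : ℝ) ≤ j := by positivity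
    exact Set.mem_Ioi.2 (by linarith [hx.1])
  have hsum := (hasSum_integral_iUnion (fun j => measurableSet_Ioc) hdisj
    (hInt.mono_set (Set.iUnion_subset hsub))).summable
  have hlow : ∀ j : ℕ, (K * ℓ / (j₀ + 2)) * (1 / ((j : ℝ) + 1)) ≤ ∫ x in I j, k x := by
    intro j
    have hj0 : (0 : ℝ) ≤ j := by positivity
    obtain ⟨t, ht, hs⟩ := h ((j₀ : ℝ) + 2 * j) (by linarith)
    have hsub2 : Set.Ioc t (t + ℓ) ⊆ I j := fun x hx =>
      ⟨by linarith [hx.1, ht.1], by linarith [hx.2, ht.2]⟩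
    have h1 : ∫ x in Set.Ioc t (t + ℓ), K / ((j₀ : ℝ) + 2 * (j + 1)) ≤
        ∫ x in Set.Ioc t (t + ℓ), k x := by
      refine setIntegral_mono_on (by simp) (hInt.mono_set (hsub2.trans (hsub j)))
        measurableSet_Ioc fun x hx => ?_
      refine le_trans ?_ (hs x ⟨hx.1.le, hx.2⟩)
      have hx0 : 0 < x := hsub j (hsub2 hx)
      gcongr
      exact (hsub2 hx).2
    have h2 : ∫ x in Set.Ioc t (t + ℓ), k x ≤ ∫ x in I j, k x :=
      setIntegral_mono_set (hInt.mono_set (hsub j))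
        ((ae_restrict_iff' measurableSet_Ioc).2 (.of_forall fun x hx => hk0 x (hsub j hx)))
        (.of_forall hsub2)
    refine le_trans (le_trans ?_ h1) h2
    rw [setIntegral_const, measureReal_def, Real.volume_Ioc, smul_eq_mul, add_sub_cancel_left,
      ENNReal.toReal_ofReal hℓ.le, div_mul_div_comm, mul_one, mul_div_assoc', mul_comm ℓ]
    gcongr
    nlinarith
  have hns : ¬ Summable fun j : ℕ => (K * ℓ / (j₀ + 2)) * (1 / ((j : ℝ) + 1)) := by
    rw [summable_mul_left_iff (by positivity)]
    have := (summable_nat_add_iff 1 (f := fun n : ℕ => (1 : ℝ) / n)).not.2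
      Real.not_summable_one_div_natCast
    simpa using this
  exact hns (Summable.of_nonneg_of_le (fun j => by positivity) hlow hsum)

/-- A function with an oscillating expansion of order `-e` is not `p`-integrable if `p e` is at
most the dimension. -/
theorem not_integrable_of_oscillating {w w₁ : ℝ → ℝ} {c m M : ℝ} (hm : 0 < m)
    (hw : ∀ r, 0 < r → HasDerivAt w (w₁ r) r)
    (hw₁ : ∀ r, 0 < r → HasDerivAt w₁ (-w r + c * w r / r ^ 2) r)
    (hE : ∀ r, 1 ≤ r → m ≤ w r ^ 2 + w₁ r ^ 2 ∧ w r ^ 2 + w₁ r ^ 2 ≤ M)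
    {A : ℝ} {B : ℂ} (hAB : 0 ≤ A) (hAB' : A = 0 → B ≠ 0) {E : Type*} [NormedAddCommGroup E]
    [InnerProductSpace ℝ E] [FiniteDimensional ℝ E] [MeasurableSpace E] [BorelSpace E]
    [Nontrivial E] {g : E → ℂ} (hg : ∀ x y, ‖x‖ = ‖y‖ → g x = g y) {p e s₁ s₂ C₁ C₂ : ℝ}
    (hp : 0 < p) (hpe : p * e ≤ Module.finrank ℝ E) (h₁ : e < s₁) (h₂ : e < s₂)
    (h : ∀ y, 1 ≤ ‖y‖ → ‖g y - (((A * w (2 * π * ‖y‖) : ℝ) : ℂ) + B) * ((‖y‖ ^ (-e) : ℝ) : ℂ)‖ ≤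
      C₁ * ‖y‖ ^ (-s₁) + C₂ * ‖y‖ ^ (-s₂)) :
    ¬ Integrable (fun y : E => ‖g y‖ ^ p) := by
  obtain ⟨ε, hε, ℓ, hℓ, hℓ1, R₀, hR₀, hlow⟩ :=
    exists_lower_bound_on_subintervals hm hw hw₁ hE hAB hAB'
  obtain ⟨v, hv⟩ := exists_norm_eq E (zero_le_one' ℝ)
  obtain ⟨R₁, hR₁, herr⟩ : ∃ R₁ : ℝ, 1 ≤ R₁ ∧ ∀ r, R₁ ≤ r →
      C₁ * r ^ (-(s₁ - e)) + C₂ * r ^ (-(s₂ - e)) ≤ ε / 2 := by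
    have ht : Tendsto (fun r : ℝ => C₁ * r ^ (-(s₁ - e)) + C₂ * r ^ (-(s₂ - e))) atTop (𝓝 0) := by
      simpa using ((tendsto_rpow_neg_atTop (sub_pos.2 h₁)).const_mul C₁).add
        ((tendsto_rpow_neg_atTop (sub_pos.2 h₂)).const_mul C₂)
    have := (ht.eventually (ge_mem_nhds (show (0 : ℝ) < ε / 2 by positivity))).and
      (eventually_ge_atTop 1)
    obtain ⟨R, hR⟩ := eventually_atTop.1 this
    exact ⟨max 1 R, le_max_left _ _, fun r hr => (hR r ((le_max_right _ _).trans hr)).1⟩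
  set N := Module.finrank ℝ E
  have hN : 0 < N := Module.finrank_pos
  intro hInt
  have e1 : (fun y : E => ‖g y‖ ^ p) = fun y => (fun r : ℝ => ‖g (r • v)‖ ^ p) ‖y‖ := by
    ext y
    simp only []
    rw [hg y (‖y‖ • v) (by simp [norm_smul, hv])]
  rw [e1, integrable_fun_norm_addHaar volume (f := fun r : ℝ => ‖g (r • v)‖ ^ p)] at hInt
  -- This is the integrand in polar coordinates after the substitution s = 2πr, which turns the
  -- argument 2π‖y‖ of w into s.
  set k : ℝ → ℝ := fun s => (s / (2 * π)) ^ (N - 1) * ‖g ((s / (2 * π)) • v)‖ ^ p with hk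
  have hInt2 : IntegrableOn k (Set.Ioi 0) := by
    have h2π : (0 : ℝ) < 2 * π := by positivity
    have := (integrableOn_Ioi_comp_mul_left_iff k 0 h2π)
    rw [mul_zero] at this
    rw [← this]
    convert! hInt using 2 with r
    simp only [hk, smul_eq_mul]
    rw [mul_div_cancel_left₀ _ h2π.ne']
  refine not_integrableOn_of_subintervals (K := 2 * π * (ε / 2) ^ p) (R₀ := max R₀ (2 * π * R₁))
    (by positivity) hℓ hℓ1 (fun r hr => by positivity) (hR₀.trans (le_max_left _ _)) ?_ hInt2
  intro R hR
  obtain ⟨t, ht, hs⟩ := hlow R ((le_max_left _ _).trans hR)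
  refine ⟨t, ht, fun s hst => ?_⟩
  have hRs : 2 * π * R₁ ≤ s := ((le_max_right _ _).trans hR).trans (ht.1.trans hst.1)
  set r := s / (2 * π) with hr
  have hsr : s = 2 * π * r := by rw [hr]; field_simp
  have hrR : R₁ ≤ r := by
    rw [hr, le_div_iff₀ (by positivity)]; linarith
  have hr1 : 1 ≤ r := hR₁.trans hrR
  have hr0 : 0 < r := by linarith
  have hn : ‖r • v‖ = r := by rw [norm_smul, hv, Real.norm_of_nonneg hr0.le, mul_one]
  have h3 := h (r • v) (by rw [hn]; exact hr1)
  rw [hn, ← hsr] at h3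
  have h4 := hs s hst
  have h5 : C₁ * r ^ (-s₁) + C₂ * r ^ (-s₂) ≤ ε / 2 * r ^ (-e) := by
    have := mul_le_mul_of_nonneg_right (herr r hrR) (rpow_nonneg hr0.le (-e))
    refine le_trans (le_of_eq ?_) this
    rw [add_mul, mul_assoc, mul_assoc, ← rpow_add hr0, ← rpow_add hr0]
    ring_nf
  have h6 : ε / 2 * r ^ (-e) ≤ ‖g (r • v)‖ := by
    have h7 : ε * r ^ (-e) ≤ ‖(((A * w s : ℝ) : ℂ) + B) * ((r ^ (-e) : ℝ) : ℂ)‖ := by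
      rw [norm_mul, Complex.norm_real, Real.norm_of_nonneg (by positivity)]
      gcongr
    have h8 := norm_sub_le (g (r • v))
      (g (r • v) - (((A * w s : ℝ) : ℂ) + B) * ((r ^ (-e) : ℝ) : ℂ))
    rw [sub_sub_cancel] at h8
    linarith
  have h9 : (ε / 2) ^ p * r ^ (-(e * p)) ≤ ‖g (r • v)‖ ^ p := by
    have := rpow_le_rpow (by positivity) h6 hp.le
    rwa [mul_rpow (by positivity) (by positivity), ← rpow_mul hr0.le, neg_mul] at this
  -- The hypothesis p e ≤ N means N - 1 - pe ≥ -1, so the radial integrand is at least of size 1/r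
  -- on the good subintervals.
  have h10 : r ^ (-1 : ℝ) ≤ r ^ (N - 1) * r ^ (-(e * p)) := by
    rw [← rpow_natCast, ← rpow_add hr0]
    refine rpow_le_rpow_of_exponent_le hr1 ?_
    rw [Nat.cast_sub hN, Nat.cast_one]
    linarith [mul_comm e p]
  calc 2 * π * (ε / 2) ^ p / s = (ε / 2) ^ p * r ^ (-1 : ℝ) := by
        rw [rpow_neg_one, hsr]; field_simp
    _ ≤ (ε / 2) ^ p * (r ^ (N - 1) * r ^ (-(e * p))) := by gcongr
    _ = r ^ (N - 1) * ((ε / 2) ^ p * r ^ (-(e * p))) := by ring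
    _ ≤ r ^ (N - 1) * ‖g (r • v)‖ ^ p := by gcongr

/-- Failure of `p`-integrability of the Fourier transform of the symbol. -/
theorem not_integrable_fourier_rieszProfile {β δ : ℝ} (hβ : 0 < β) (hδ : 0 < δ) (n : ℕ) {p : ℝ}
    (hp : 0 < p) (h : p * (δ + n / 2 + 1) ≤ n + 1 ∨
      (¬ ∃ m : ℕ, 0 < m ∧ β = 2 * m) ∧ p * (n + 1 + β) ≤ n + 1) :
    ¬ Integrable (fun y : EuclideanSpace ℝ (Fin (n + 1)) =>
      ‖𝓕 (radial (EuclideanSpace ℝ (Fin (n + 1))) (rieszProfile β δ)) y‖ ^ p) := by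
  set a := δ + (n : ℝ) / 2 + 1 with ha
  set b := (n : ℝ) + 1 + β with hb
  have hν : 0 < δ + (n : ℝ) / 2 := by positivity
  obtain ⟨w, w₁, m, M, hm, hF, hw, hw₁, hE⟩ := exists_normalized_solution hν
  obtain ⟨A₀, hA₀, hdS⟩ := exists_fourier_rieszProfile_mul_one_sub_cutoff hβ hδ n
  obtain ⟨D, hD0, hD⟩ := hdS.le_norm_rpow (by positivity)
  set A := A₀ * (2 * π) ^ (-a) with hA
  have hApos : 0 < A := by positivity
  have hdim : ((Module.finrank ℝ (EuclideanSpace ℝ (Fin (n + 1))) : ℕ) : ℝ) = n + 1 := by simp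
  have hrad := fun x y => fourier_radial
    (radial_congr (E := EuclideanSpace ℝ (Fin (n + 1))) (rieszProfile β δ)) (x := x) (y := y)
  have hS : ∀ y : EuclideanSpace ℝ (Fin (n + 1)), 1 ≤ ‖y‖ →
      ‖𝓕 (radial (EuclideanSpace ℝ (Fin (n + 1)))
        (fun u => rieszProfile β δ u * (1 - cutoff u))) y -
        ((A * w (2 * π * ‖y‖) : ℝ) : ℂ) * ((‖y‖ ^ (-a) : ℝ) : ℂ)‖ ≤ D * ‖y‖ ^ (-(a + 1)) := by
    intro y hy
    have h1 := hD y (by linarith)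
    rw [hF _ (by positivity), mul_rpow (by positivity) (by positivity)] at h1
    rw [show a + 1 = δ + n / 2 + 2 by rw [ha]; ring]
    refine le_trans (le_of_eq ?_) h1
    congr 2
    rw [hA]
    push_cast
    ring
  -- For even β the contribution of the origin decays as fast as desired, and the sphere alone
  -- governs.
  by_cases heven : ∃ m : ℕ, 0 < m ∧ β = 2 * m
  · have hpa : p * a ≤ n + 1 := h.resolve_right fun h => h.1 heven
    obtain ⟨k, hk, rfl⟩ := heven
    obtain ⟨L, hL⟩ := exists_nat_ge (a + 1)
    obtain ⟨D₂, hD₂0, hD₂⟩ := ((hasDecay_fourier_rieszProfile_mul_cutoff_of_even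
      (E := EuclideanSpace ℝ (Fin (n + 1))) hk (δ := δ) L).mono hL).le_norm_rpow (by positivity)
    refine not_integrable_of_oscillating hm hw hw₁ hE hApos.le (B := 0)
      (fun h => absurd h hApos.ne') hrad hp (by rw [hdim]; exact hpa)
      (lt_add_one a) (lt_add_one a) (C₁ := D₂) (C₂ := D) fun y hy => ?_
    rw [add_zero, fourier_rieszProfile_split hβ hδ, add_sub_assoc]
    exact (norm_add_le _ _).trans (add_le_add (hD₂ y (by linarith)) (hS y hy))
  obtain ⟨κ, hκ, C, hC0, hC⟩ := exists_fourier_rieszProfile_mul_cutoff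
    (E := EuclideanSpace ℝ (Fin (n + 1))) hβ hδ
  rw [hdim, ← hb] at hC
  have hbβ : (n : ℝ) + 1 + 2 * β = b + β := by rw [hb]; ring
  rw [hbβ] at hC
  -- The slower of the orders a (sphere) and b (origin) dominates. When they are equal, the main
  -- term is (A w + κ) ‖y‖^{-a}, and the oscillation of w prevents the constant κ from cancelling
  -- it. When b < a, the main term is κ ‖y‖^{-b} with κ ≠ 0.
  rcases lt_trichotomy a b with hab | hab | hab
  · have hpa : p * a ≤ n + 1 := by
      rcases h with h | h
      · exact h
      · exact (mul_le_mul_of_nonneg_left hab.le hp.le).trans h.2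
    obtain ⟨D₂, hD₂0, hD₂⟩ := (hasDecay_fourier_rieszProfile_mul_cutoff
      (E := EuclideanSpace ℝ (Fin (n + 1))) hβ hδ).le_norm_rpow (by positivity)
    rw [hdim, ← hb] at hD₂
    refine not_integrable_of_oscillating hm hw hw₁ hE hApos.le (B := 0)
      (fun h => absurd h hApos.ne') hrad hp (by rw [hdim]; exact hpa)
      hab (lt_add_one a) (C₁ := D₂) (C₂ := D) fun y hy => ?_
    rw [add_zero, fourier_rieszProfile_split hβ hδ, add_sub_assoc]
    exact (norm_add_le _ _).trans (add_le_add (hD₂ y (by linarith)) (hS y hy))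
  · have hpa : p * a ≤ n + 1 := by
      rcases h with h | h
      · exact h
      · rw [hab]; exact h.2
    refine not_integrable_of_oscillating hm hw hw₁ hE hApos.le (B := κ)
      (fun h => absurd h hApos.ne') hrad hp (by rw [hdim]; exact hpa)
      (s₁ := a + β) (by linarith) (lt_add_one a) (C₁ := C) (C₂ := D) fun y hy => ?_
    have h1 := hC y hy
    rw [← hab] at h1
    rw [fourier_rieszProfile_split hβ hδ]
    refine le_trans (le_of_eq ?_) ((norm_add_le _ _).trans (add_le_add h1 (hS y hy)))
    congr 1; ring
  · have hpb : p * b ≤ n + 1 := by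
      rcases h with h | h
      · exact (mul_le_mul_of_nonneg_left hab.le hp.le).trans h
      · exact h.2
    refine not_integrable_of_oscillating hm hw hw₁ hE (A := 0) (B := κ) le_rfl
      (fun _ => hκ heven) hrad hp (by rw [hdim]; exact hpb)
      (s₁ := b + β) (by linarith) hab (C₁ := C) (C₂ := D + A * √M) fun y hy => ?_
    have h1 := hC y hy
    have h2 := hS y hy
    have hy0 : 0 < ‖y‖ := by linarith
    have h3 : |w (2 * π * ‖y‖)| ≤ √M := by
      refine abs_le_sqrt ?_
      nlinarith [(hE (2 * π * ‖y‖) (by nlinarith [pi_gt_three])).2,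
        sq_nonneg (w₁ (2 * π * ‖y‖))]
    have h4 : ‖((A * w (2 * π * ‖y‖) : ℝ) : ℂ) * ((‖y‖ ^ (-a) : ℝ) : ℂ)‖ ≤
        A * √M * ‖y‖ ^ (-a) := by
      rw [norm_mul, Complex.norm_real, Complex.norm_real, Real.norm_of_nonneg
        (rpow_nonneg hy0.le _), Real.norm_eq_abs, abs_mul, abs_of_pos hApos]
      gcongr
    have h5 : D * ‖y‖ ^ (-(a + 1)) ≤ D * ‖y‖ ^ (-a) :=
      mul_le_mul_of_nonneg_left (rpow_le_rpow_of_exponent_le hy (by linarith)) hD0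
    rw [fourier_rieszProfile_split hβ hδ]
    have h6 := norm_add₃_le (a := 𝓕 (radial (EuclideanSpace ℝ (Fin (n + 1)))
        (fun u => rieszProfile β δ u * cutoff u)) y - κ * ((‖y‖ ^ (-b) : ℝ) : ℂ))
      (b := 𝓕 (radial (EuclideanSpace ℝ (Fin (n + 1)))
        (fun u => rieszProfile β δ u * (1 - cutoff u))) y -
        ((A * w (2 * π * ‖y‖) : ℝ) : ℂ) * ((‖y‖ ^ (-a) : ℝ) : ℂ))
      (c := ((A * w (2 * π * ‖y‖) : ℝ) : ℂ) * ((‖y‖ ^ (-a) : ℝ) : ℂ))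
    refine le_trans (le_of_eq ?_) (h6.trans (add_le_add (add_le_add h1 h2) h4 |>.trans ?_))
    · congr 1
      push_cast
      ring
    · rw [add_mul]; linarith

end BochnerRiesz

namespace BochnerRiesz

open MeasureTheory Real Filter Topology FourierTransform

/-! ### Lattice sums, periodic functions and the torus. -/

/-- The cube `[0, T)^d`. -/
def cube (d : ℕ) (T : ℝ) : Set (Fin d → ℝ) := Set.univ.pi fun _ => Set.Ico 0 T

theorem measurableSet_cube (d : ℕ) (T : ℝ) : MeasurableSet (cube d T) :=
  MeasurableSet.univ_pi fun _ => measurableSet_Ico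

/-- The lattice vector `T m`. -/
def latVec {d : ℕ} (T : ℝ) (m : Fin d → ℤ) : Fin d → ℝ := fun i => T * m i

theorem mem_cube_iff_floor {d : ℕ} {T : ℝ} (hT : 0 < T) (x : Fin d → ℝ) (m : Fin d → ℤ) :
    (fun i => ⌊x i / T⌋) = m ↔ x - latVec T m ∈ cube d T := by
  simp only [cube, Set.mem_univ_pi, Set.mem_Ico, Pi.sub_apply, latVec, funext_iff,
    Int.floor_eq_iff, le_div_iff₀ hT, div_lt_iff₀ hT]
  refine forall_congr' fun i => ?_
  constructor <;> rintro ⟨h1, h2⟩ <;> constructor <;> linarith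

theorem lintegral_eq_tsum_cube {d : ℕ} {T : ℝ} (hT : 0 < T) (g : (Fin d → ℝ) → ℝ≥0∞) :
    ∫⁻ x, g x = ∑' m : Fin d → ℤ, ∫⁻ x in cube d T, g (x + latVec T m) := by
  set s : (Fin d → ℤ) → Set (Fin d → ℝ) := fun m => {x | (fun i => ⌊x i / T⌋) = m} with hs
  have hpre : ∀ m, s m = (fun x => x - latVec T m) ⁻¹' cube d T := fun m => by
    ext x; exact mem_cube_iff_floor hT x m
  have hmeas : ∀ m, MeasurableSet (s m) := fun m => by
    rw [hpre]; exact (measurable_sub_const _) (measurableSet_cube d T)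
  have hdisj : Pairwise (Function.onFun Disjoint s) := fun m m' h =>
    Set.disjoint_left.2 fun x hx hx' => h (hx.symm.trans hx')
  have hun : ⋃ m, s m = Set.univ := Set.eq_univ_of_forall fun x => Set.mem_iUnion.2 ⟨_, rfl⟩
  rw [← setLIntegral_univ, ← hun, lintegral_iUnion hmeas hdisj]
  refine tsum_congr fun m => ?_
  have := (measurePreserving_sub_right volume (latVec T m)).setLIntegral_comp_preimage_emb
    (MeasurableEquiv.subRight (latVec T m)).measurableEmbedding
    (fun x => g (x + latVec T m)) (cube d T)
  rw [hpre]
  simpa using this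

/-- A lattice point as a vector of Euclidean space. -/
noncomputable def lat {d : ℕ} (m : Fin d → ℤ) : EuclideanSpace ℝ (Fin d) :=
  WithLp.toLp 2 fun i => (m i : ℝ)

theorem latticeNorm_eq {d : ℕ} (k : Fin d → ℤ) : latticeNorm k = ‖lat k‖ := by
  simp [latticeNorm, lat, EuclideanSpace.norm_eq]

theorem lat_add {d : ℕ} (m m' : Fin d → ℤ) : lat (m + m') = lat m + lat m' := by
  ext i; simp [lat]

/-- Peetre's inequality, from 1 + ‖x + y‖ ≤ (1 + ‖x‖)(1 + ‖y‖). It allows the argument to move by a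
bounded amount at the cost of a constant. -/
theorem one_add_norm_rpow_neg_le {E : Type*} [NormedAddCommGroup E] {a : ℝ} (ha : 0 ≤ a)
    (x y : E) : (1 + ‖x‖) ^ (-a) ≤ (1 + ‖y‖) ^ a * (1 + ‖x + y‖) ^ (-a) := by
  have h1 : 0 < 1 + ‖x‖ := by positivity
  have h2 : 0 < 1 + ‖x + y‖ := by positivity
  rw [rpow_neg h1.le, rpow_neg h2.le, ← div_eq_mul_inv, inv_le_iff_one_le_mul₀ (by positivity),
    div_mul_eq_mul_div, one_le_div (by positivity), ← mul_rpow (by positivity) (by positivity)]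
  refine rpow_le_rpow h2.le ?_ ha
  nlinarith [norm_add_le x y, norm_nonneg x, norm_nonneg y]

theorem norm_toLp_le_of_mem_cube {d : ℕ} {x : Fin d → ℝ} (hx : x ∈ cube d 1) :
    ‖(WithLp.toLp 2 x : EuclideanSpace ℝ (Fin d))‖ ≤ √d := by
  rw [EuclideanSpace.norm_eq]
  refine sqrt_le_sqrt ?_
  calc ∑ i, ‖x i‖ ^ 2 ≤ ∑ _i : Fin d, (1 : ℝ) := by
        refine Finset.sum_le_sum fun i _ => ?_
        have := hx i trivial
        rw [Real.norm_of_nonneg this.1]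
        nlinarith [this.1, this.2]
    _ = d := by simp

theorem volume_cube_one (d : ℕ) : volume (cube d 1) = 1 := by
  simp [cube, Real.volume_pi_Ico]

/-- Integral test: by Peetre's inequality each term is at most a constant times the integral of (1 +
‖x‖)^(-a) over the unit cube with corner m, and a > d makes the integral over the whole space
finite. -/
theorem summable_lattice {d : ℕ} {a : ℝ} (ha : (d : ℝ) < a) :
    Summable fun m : Fin d → ℤ => (1 + ‖lat m‖) ^ (-a) := by
  have ha0 : 0 ≤ a := (Nat.cast_nonneg d).trans ha.le
  set g : (Fin d → ℝ) → ℝ≥0∞ := fun x =>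
    ENNReal.ofReal ((1 + ‖(WithLp.toLp 2 x : EuclideanSpace ℝ (Fin d))‖) ^ (-a)) with hg
  have hfin : ∫⁻ x, g x ≠ ∞ := by
    have h1 : Integrable fun x : EuclideanSpace ℝ (Fin d) => (1 + ‖x‖) ^ (-a) :=
      integrable_one_add_norm (by simpa using ha)
    have h2 := h1.lintegral_lt_top
    rw [← (EuclideanSpace.volume_preserving_symm_measurableEquiv_toLp (Fin d)).symm.lintegral_comp_emb
      (MeasurableEquiv.measurableEmbedding _)] at h2
    exact h2.ne
  rw [lintegral_eq_tsum_cube one_pos] at hfin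
  set c : ℝ := (1 + √d) ^ (-a) with hc
  have hc0 : 0 < c := by positivity
  have hle : ∀ m : Fin d → ℤ, ENNReal.ofReal (c * (1 + ‖lat m‖) ^ (-a)) ≤
      ∫⁻ x in cube d 1, g (x + latVec 1 m) := by
    intro m
    calc _ = ∫⁻ x in cube d 1, ENNReal.ofReal (c * (1 + ‖lat m‖) ^ (-a)) := by
          rw [setLIntegral_const, volume_cube_one, mul_one]
      _ ≤ _ := by
          refine setLIntegral_mono' (measurableSet_cube d 1) fun x hx => ENNReal.ofReal_le_ofReal ?_
          have h1 : (WithLp.toLp 2 (x + latVec 1 m) : EuclideanSpace ℝ (Fin d)) =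
              lat m + WithLp.toLp 2 x := by
            ext i; simp [lat, latVec, add_comm]
          have h2 := one_add_norm_rpow_neg_le ha0 (lat m) (WithLp.toLp 2 x)
          have h3 : (1 + ‖(WithLp.toLp 2 x : EuclideanSpace ℝ (Fin d))‖) ^ a ≤ (1 + √d) ^ a :=
            rpow_le_rpow (by positivity) (by linarith [norm_toLp_le_of_mem_cube hx]) ha0
          have h4 : c * (1 + √d) ^ a = 1 := by
            rw [hc, ← rpow_add (by positivity)]; simp
          rw [h1]
          set Q := (1 + ‖lat m + WithLp.toLp 2 x‖) ^ (-a)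
          have hQ : 0 ≤ Q := by positivity
          calc c * (1 + ‖lat m‖) ^ (-a) ≤ c * ((1 + √d) ^ a * Q) := by
                gcongr
                exact h2.trans (by gcongr)
            _ = Q := by rw [← mul_assoc, h4, one_mul]
  have hs : Summable fun m : Fin d → ℤ => c * (1 + ‖lat m‖) ^ (-a) := by
    have := ENNReal.summable_toReal (ne_top_of_le_ne_top hfin (ENNReal.tsum_le_tsum hle))
    refine this.congr fun m => ?_
    rw [ENNReal.toReal_ofReal (by positivity)]
  exact (summable_mul_left_iff hc0.ne').1 hs

/-- The lattice sums `∑ (1 + ‖m - y‖)^(-a)` are bounded uniformly in `y`. -/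
theorem exists_tsum_lattice_le {d : ℕ} {a : ℝ} (ha : (d : ℝ) < a) :
    ∃ C : ℝ≥0∞, C ≠ ∞ ∧ ∀ y : EuclideanSpace ℝ (Fin d),
      ∑' m : Fin d → ℤ, ENNReal.ofReal ((1 + ‖lat m - y‖) ^ (-a)) ≤ C := by
  have ha0 : 0 ≤ a := (Nat.cast_nonneg d).trans ha.le
  refine ⟨∑' m : Fin d → ℤ, ENNReal.ofReal ((1 + √d) ^ a * (1 + ‖lat m‖) ^ (-a)), ?_, fun y => ?_⟩
  · exact ((summable_lattice ha).mul_left _).tsum_ofReal_ne_top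
  · set q : Fin d → ℤ := fun i => ⌊y i⌋ with hq
    rw [← (Equiv.addRight q).tsum_eq]
    refine ENNReal.tsum_le_tsum fun m => ENNReal.ofReal_le_ofReal ?_
    have h1 : lat ((Equiv.addRight q) m) - y = lat m - (y - lat q) := by
      rw [Equiv.coe_addRight, lat_add]; abel
    have h2 : y - lat q = WithLp.toLp 2 fun i => Int.fract (y i) := by
      ext i; simp [lat, hq, Int.self_sub_floor]
    have h3 : ‖y - lat q‖ ≤ √d := by
      rw [h2]
      exact norm_toLp_le_of_mem_cube fun i _ => ⟨Int.fract_nonneg _, Int.fract_lt_one _⟩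
    rw [h1]
    refine (one_add_norm_rpow_neg_le ha0 _ (y - lat q)).trans ?_
    rw [sub_add_cancel]
    gcongr

/-- Invariance under the lattice `2π ℤ^d`. -/
def Per {d : ℕ} {Y : Type*} (f : (Fin d → ℝ) → Y) : Prop :=
  ∀ (x : Fin d → ℝ) (m : Fin d → ℤ), f (x + latVec (2 * π) m) = f x

/-- The periods of f form an additive subgroup, and the generators of 2πℤ^d belong to it. -/
theorem IsPeriodic.per {d : ℕ} {f : (Fin d → ℝ) → ℝ} (hf : IsPeriodic f) : Per f := by
  let H : AddSubgroup (Fin d → ℝ) :=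
    { carrier := {v | ∀ x, f (x + v) = f x}
      zero_mem' := fun x => by simp
      add_mem' := fun {v w} hv hw x => by rw [← add_assoc, hw, hv]
      neg_mem' := fun {v} hv x => by
        have := hv (x + -v)
        simpa using this.symm }
  intro x m
  have hm : latVec (2 * π) m ∈ H := by
    have : latVec (2 * π) m = ∑ i, m i • (Pi.single i (2 * π) : Fin d → ℝ) := by
      ext j
      simp [latVec, Finset.sum_apply, Pi.single_apply, mul_comm]
    rw [this]
    exact H.sum_mem fun i _ => H.zsmul_mem (fun x => hf x i) _
  exact hm x

theorem Per.isPeriodic {d : ℕ} {f : (Fin d → ℝ) → ℝ} (hf : Per f) : IsPeriodic f := by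
  intro x i
  have := hf x (Pi.single i 1)
  convert this using 3
  ext j
  by_cases h : j = i
  · subst h; simp [latVec]
  · simp [latVec, h]

theorem Per.add_right {d : ℕ} {Y : Type*} {f : (Fin d → ℝ) → Y} (hf : Per f) (y : Fin d → ℝ) :
    Per fun x => f (x + y) := fun x m => by
  beta_reduce
  rw [add_right_comm]; exact hf _ m

theorem Per.sub_right {d : ℕ} {Y : Type*} {f : (Fin d → ℝ) → Y} (hf : Per f) (y : Fin d → ℝ) :
    Per fun x => f (x - y) := by simpa [sub_eq_add_neg] using hf.add_right (-y)

theorem latVec_neg {d : ℕ} (T : ℝ) (m : Fin d → ℤ) : latVec T (-m) = -latVec T m := by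
  ext i; simp [latVec]

theorem Per.sub_left {d : ℕ} {Y : Type*} {f : (Fin d → ℝ) → Y} (hf : Per f) (y : Fin d → ℝ) :
    Per fun x => f (y - x) := fun x m => by
  have := hf (y - x) (-m)
  rw [latVec_neg] at this
  beta_reduce
  rw [← this]; congr 1; abel

theorem Per.comp {d : ℕ} {Y Z : Type*} {f : (Fin d → ℝ) → Y} (hf : Per f) (g : Y → Z) :
    Per fun x => g (f x) := fun x m => congrArg g (hf x m)

/-- Periodic functions have the same integral over every translate of the cell. -/
theorem Per.setLIntegral_add {d : ℕ} {g : (Fin d → ℝ) → ℝ≥0∞} (hg : Per g) (y : Fin d → ℝ) :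
    ∫⁻ x in cell d, g (x + y) = ∫⁻ x in cell d, g x := by
  have hT : 0 < 2 * π := by positivity
  have hc : MeasurableSet (cell d) := measurableSet_cube d _
  -- These sets tile space by translates of the cell. Tiling the integral by copies of the cell
  -- moves each piece of the translated cell back into the cell, where the pieces reassemble.
  set B : (Fin d → ℤ) → Set (Fin d → ℝ) := fun m => {x | x - y + latVec (2 * π) m ∈ cell d} with hB
  have hBm : ∀ m, MeasurableSet (B m) := fun m =>
    ((measurable_sub_const y).add_const (latVec (2 * π) m)) hc
  have hBeq : ∀ m x, x ∈ B m ↔ (fun i => ⌊(x - y) i / (2 * π)⌋) = -m := fun m x => by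
    rw [mem_cube_iff_floor hT, latVec_neg, sub_neg_eq_add]; rfl
  have hBd : Pairwise (Function.onFun Disjoint B) := fun m m' h =>
    Set.disjoint_left.2 fun x hx hx' => h (neg_injective
      (((hBeq _ _).1 hx).symm.trans ((hBeq _ _).1 hx')))
  have hBu : ⋃ m, B m = Set.univ := Set.eq_univ_of_forall fun x =>
    Set.mem_iUnion.2 ⟨-(fun i => ⌊(x - y) i / (2 * π)⌋), (hBeq _ _).2 (neg_neg _).symm⟩
  calc ∫⁻ x in cell d, g (x + y)
      = ∫⁻ x, (cell d).indicator (fun x => g (x + y)) x := (lintegral_indicator hc _).symm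
    _ = ∫⁻ x, (cell d).indicator (fun x => g (x + y)) (x - y) := (lintegral_sub_right_eq_self _ y).symm
    _ = ∑' m, ∫⁻ x in cell d, (B m).indicator g x := by
        rw [lintegral_eq_tsum_cube hT]
        refine tsum_congr fun m => lintegral_congr fun x => ?_
        have h1 : x + latVec (2 * π) m - y = x - y + latVec (2 * π) m := by abel
        rw [h1]
        by_cases h : x ∈ B m
        · rw [Set.indicator_of_mem h, Set.indicator_of_mem (show _ ∈ cell d from h)]
          rw [← hg x m]; congr 1; abel
        · rw [Set.indicator_of_notMem h, Set.indicator_of_notMem (show _ ∉ cell d from h)]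
    _ = ∑' m, ∫⁻ x in B m, g x ∂(volume.restrict (cell d)) :=
        tsum_congr fun m => lintegral_indicator (hBm m) _
    _ = ∫⁻ x in cell d, g x := by
        rw [← lintegral_iUnion hBm hBd, hBu, Measure.restrict_univ]

theorem Per.setLIntegral_sub {d : ℕ} {g : (Fin d → ℝ) → ℝ≥0∞} (hg : Per g) (y : Fin d → ℝ) :
    ∫⁻ x in cell d, g (x - y) = ∫⁻ x in cell d, g x := by
  simpa [sub_eq_add_neg] using hg.setLIntegral_add (-y)

theorem Per.aemeasurable {d : ℕ} {Y : Type*} [MeasurableSpace Y] {f : (Fin d → ℝ) → Y}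
    (hf : Per f) (hm : AEMeasurable f (volume.restrict (cell d))) : AEMeasurable f := by
  have hT : 0 < 2 * π := by positivity
  set s : (Fin d → ℤ) → Set (Fin d → ℝ) := fun m => (fun x => x - latVec (2 * π) m) ⁻¹' cell d
  have hun : ⋃ m, s m = Set.univ := Set.eq_univ_of_forall fun x =>
    Set.mem_iUnion.2 ⟨_, (mem_cube_iff_floor hT x _).1 rfl⟩
  rw [← Measure.restrict_univ (μ := (volume : Measure (Fin d → ℝ))), ← hun, aemeasurable_iUnion_iff]
  intro m
  have hp : MeasurePreserving (fun x => x - latVec (2 * π) m) (volume.restrict (s m))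
      (volume.restrict (cell d)) :=
    (measurePreserving_sub_right volume (latVec (2 * π) m)).restrict_preimage
      (measurableSet_cube d _)
  refine (hm.comp_quasiMeasurePreserving hp.quasiMeasurePreserving).congr (Eventually.of_forall fun x => ?_)
  have := hf (x - latVec (2 * π) m) m
  simpa using this.symm

/-- The projection of `ℝ^d` to the torus `ℝ^d / 2πℤ^d`, normalized to period one. -/
noncomputable def toTorus {d : ℕ} (x : Fin d → ℝ) : UnitAddTorus (Fin d) :=
  fun i => ((x i / (2 * π) : ℝ) : UnitAddCircle)

/-- A section of `toTorus`. -/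
noncomputable def ofTorus {d : ℕ} (t : UnitAddTorus (Fin d)) : Fin d → ℝ :=
  fun i => 2 * π * (AddCircle.equivIoc 1 0 (t i) : ℝ)

theorem toTorus_ofTorus {d : ℕ} (t : UnitAddTorus (Fin d)) : toTorus (ofTorus t) = t := by
  ext i
  have : 2 * π ≠ 0 := by positivity
  simp only [toTorus, ofTorus]
  rw [mul_div_cancel_left₀ _ this]
  exact AddCircle.coe_equivIoc ..

theorem Per.apply_ofTorus {d : ℕ} {Y : Type*} {f : (Fin d → ℝ) → Y} (hf : Per f)
    (x : Fin d → ℝ) : f (ofTorus (toTorus x)) = f x := by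
  have h := toTorus_ofTorus (toTorus x)
  have hπ : 2 * π ≠ 0 := by positivity
  have h1 : ∀ i, ∃ m : ℤ, x i = ofTorus (toTorus x) i + 2 * π * m := fun i => by
    have := congrFun h i
    simp only [toTorus] at this
    rw [← sub_eq_zero, ← AddCircle.coe_sub, AddCircle.coe_eq_zero_iff] at this
    obtain ⟨m, hm⟩ := this
    refine ⟨-m, ?_⟩
    rw [zsmul_one, eq_comm, ← sub_div, div_eq_iff hπ] at hm
    push_cast
    linear_combination -hm
  choose m hm using h1
  have : x = ofTorus (toTorus x) + latVec (2 * π) m := by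
    ext i; simpa [latVec] using hm i
  conv_rhs => rw [this]
  exact (hf _ m).symm

theorem continuous_toTorus {d : ℕ} : Continuous (toTorus (d := d)) :=
  continuous_pi fun i => (AddCircle.continuous_mk' _).comp (by fun_prop)

/-- The section `ofTorus` is itself discontinuous. The closed cube maps continuously onto the torus
by a closed map, hence a quotient map, so continuity may be tested on the cube. -/
theorem Per.continuous_comp_ofTorus {d : ℕ} {Y : Type*} [TopologicalSpace Y]
    {f : (Fin d → ℝ) → Y} (hf : Per f) (hc : Continuous f) :
    Continuous fun t => f (ofTorus t) := by
  let g : Set.Icc (0 : Fin d → ℝ) (fun _ => 2 * π) → UnitAddTorus (Fin d) := fun x => toTorus x.1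
  have hg : Continuous g := continuous_toTorus.comp continuous_subtype_val
  have hs : Function.Surjective g := fun t => by
    refine ⟨⟨ofTorus t, ?_, ?_⟩, toTorus_ofTorus t⟩ <;> intro i <;>
      have h := (AddCircle.equivIoc (1 : ℝ) 0 (t i)).2 <;> simp only [ofTorus, Pi.zero_apply]
    · exact mul_nonneg (by positivity) h.1.le
    · exact mul_le_of_le_one_right (by positivity) (h.2.trans_eq (zero_add 1))
  rw [(hg.isClosedMap.isQuotientMap hg hs).continuous_iff]
  refine (hc.comp continuous_subtype_val).congr fun x => ?_
  exact (hf.apply_ofTorus x.1).symm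

/-- The normalized Haar measure of the torus. -/
noncomputable def torusMeasure (d : ℕ) : Measure (UnitAddTorus (Fin d)) :=
  Measure.pi fun _ => AddCircle.haarAddCircle

theorem measurable_ofTorus {d : ℕ} : Measurable (ofTorus (d := d)) :=
  measurable_pi_lambda _ fun i => ((measurable_subtype_coe.comp
    (AddCircle.measurableEquivIoc (1 : ℝ) 0).measurable).comp (measurable_pi_apply i)).const_mul _

theorem lintegral_comp_smul_of_pos {d : ℕ} {c : ℝ} (hc : 0 < c) (h : (Fin d → ℝ) → ℝ≥0∞) :
    ∫⁻ x, h (c • x) = ENNReal.ofReal (c ^ d)⁻¹ * ∫⁻ x, h x := by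
  have h1 := lintegral_map_equiv (μ := (volume : Measure (Fin d → ℝ))) h
    (Homeomorph.smulOfNeZero c hc.ne').toMeasurableEquiv
  have h2 : Measure.map (Homeomorph.smulOfNeZero c hc.ne').toMeasurableEquiv
      (volume : Measure (Fin d → ℝ)) = ENNReal.ofReal (c ^ d)⁻¹ • volume := by
    have := Measure.map_addHaar_smul (volume : Measure (Fin d → ℝ)) hc.ne'
    rw [Module.finrank_fin_fun, abs_of_pos (by positivity)] at this
    exact this
  rw [h2, lintegral_smul_measure] at h1
  exact h1.symm

theorem lintegral_torusMeasure {d : ℕ} {g : (Fin d → ℝ) → ℝ≥0∞} (hg : Per g) :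
    ∫⁻ t, g (ofTorus t) ∂(torusMeasure d) =
      ENNReal.ofReal ((2 * π) ^ d)⁻¹ * ∫⁻ x in cell d, g x := by
  have hT : 0 < 2 * π := by positivity
  have h1 := UnitAddTorus.lintegral_preimage (fun t => g (ofTorus t)) (0 : Fin d → ℝ)
  have h2 : ∀ x : Fin d → ℝ, g (ofTorus fun i => (x i : UnitAddCircle)) = g ((2 * π) • x) := by
    intro x
    rw [← hg.apply_ofTorus ((2 * π) • x)]
    congr 2
    ext i
    simp [toTorus, mul_div_cancel_left₀ _ hT.ne']
  simp only [h2] at h1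
  refine Eq.trans (Eq.trans ?_ h1) ?_
  · rfl
  set s := {x : Fin d → ℝ | ∀ i, x i ∈ Set.Ioc ((0 : Fin d → ℝ) i) ((0 : Fin d → ℝ) i + 1)} with hs
  have hsm : MeasurableSet s := MeasurableSet.univ_pi' fun i => measurableSet_Ioc
  have h3 : (cell d : Set (Fin d → ℝ)) =ᵐ[volume] (fun x => (2 * π)⁻¹ • x) ⁻¹' s := by
    have : (fun x => (2 * π)⁻¹ • x) ⁻¹' s = Set.univ.pi fun _ : Fin d => Set.Ioc 0 (2 * π) := by
      ext x
      simp only [hs, Set.mem_preimage, Set.mem_ofPred_eq, Set.mem_univ_pi, Pi.smul_apply,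
        Pi.zero_apply, smul_eq_mul, zero_add, Set.mem_Ioc]
      refine forall_congr' fun i => ?_
      rw [inv_mul_le_iff₀ hT, mul_one, mul_pos_iff_of_pos_left (by positivity)]
    rw [this]
    exact (Measure.univ_pi_Ico_ae_eq_Icc (μ := fun _ : Fin d => (volume : Measure ℝ))).trans
      (Measure.univ_pi_Ioc_ae_eq_Icc (μ := fun _ : Fin d => (volume : Measure ℝ))).symm
  rw [setLIntegral_congr h3, ← lintegral_indicator hsm, ← lintegral_indicator
    ((measurable_const_smul _) hsm)]
  have h4 : ∀ x, (((fun x => (2 * π)⁻¹ • x) ⁻¹' s).indicator g x) =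
      (fun y => s.indicator (fun y => g ((2 * π) • y)) y) ((2 * π)⁻¹ • x) := by
    intro x
    by_cases h : (2 * π)⁻¹ • x ∈ s
    · rw [Set.indicator_of_mem (show x ∈ _ ⁻¹' s from h)]
      simp only [Set.indicator_of_mem h, smul_inv_smul₀ hT.ne']
    · rw [Set.indicator_of_notMem (show x ∉ _ ⁻¹' s from h)]
      simp only [Set.indicator_of_notMem h]
  simp only [h4]
  rw [lintegral_comp_smul_of_pos (inv_pos.2 hT), ← mul_assoc, ← ENNReal.ofReal_mul (by positivity)]
  rw [← inv_pow, mul_inv_cancel₀ (by positivity), ENNReal.ofReal_one, one_mul]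

/-- The exponential `x ↦ e^{i(k,x)}`. -/
noncomputable def expo {d : ℕ} (k : Fin d → ℤ) (x : Fin d → ℝ) : ℂ :=
  Complex.exp (Complex.I * ((∑ i, (k i : ℝ) * x i : ℝ) : ℂ))

theorem expo_add_right {d : ℕ} (k : Fin d → ℤ) (x y : Fin d → ℝ) :
    expo k (x + y) = expo k x * expo k y := by
  rw [expo, expo, expo, ← Complex.exp_add, ← mul_add, ← Complex.ofReal_add, ← Finset.sum_add_distrib]
  simp [mul_add]

theorem expo_neg_right {d : ℕ} (k : Fin d → ℤ) (x : Fin d → ℝ) :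
    expo k (-x) = expo (-k) x := by
  simp [expo]

theorem expo_sub_right {d : ℕ} (k : Fin d → ℤ) (x y : Fin d → ℝ) :
    expo k (x - y) = expo k x * expo k (-y) := by
  rw [sub_eq_add_neg, expo_add_right]

theorem expo_add_left {d : ℕ} (k k' : Fin d → ℤ) (x : Fin d → ℝ) :
    expo (k + k') x = expo k x * expo k' x := by
  rw [expo, expo, expo, ← Complex.exp_add, ← mul_add, ← Complex.ofReal_add, ← Finset.sum_add_distrib]
  simp [add_mul]

@[simp]
theorem norm_expo {d : ℕ} (k : Fin d → ℤ) (x : Fin d → ℝ) : ‖expo k x‖ = 1 := by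
  rw [expo, mul_comm, Complex.norm_exp_ofReal_mul_I]

@[simp]
theorem expo_zero_right {d : ℕ} (k : Fin d → ℤ) : expo k 0 = 1 := by simp [expo]

@[simp]
theorem expo_zero_left {d : ℕ} (x : Fin d → ℝ) : expo 0 x = 1 := by simp [expo]

theorem continuous_expo {d : ℕ} (k : Fin d → ℤ) : Continuous (expo k) := by
  unfold expo; fun_prop

theorem expo_eq_mFourier {d : ℕ} (k : Fin d → ℤ) (x : Fin d → ℝ) :
    expo k x = UnitAddTorus.mFourier k (toTorus x) := by
  have hπ : (π : ℂ) ≠ 0 := by exact_mod_cast pi_ne_zero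
  simp only [UnitAddTorus.mFourier, ContinuousMap.coe_mk, toTorus, fourier_coe_apply]
  rw [← Complex.exp_sum, expo]
  push_cast
  rw [Finset.mul_sum]
  congr 1
  refine Finset.sum_congr rfl fun i _ => ?_
  field_simp

theorem per_expo {d : ℕ} (k : Fin d → ℤ) : Per (expo k) := by
  intro x m
  rw [expo_eq_mFourier, expo_eq_mFourier]
  congr 1
  have hπ : 2 * π ≠ 0 := by positivity
  ext i
  simp only [toTorus, Pi.add_apply, latVec, add_div, mul_div_cancel_left₀ _ hπ, AddCircle.coe_add]
  rw [add_eq_left, AddCircle.coe_eq_zero_iff]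
  exact ⟨m i, by simp⟩

/-- Trigonometric polynomials with frequencies in the cube `[-n, n]^d`. -/
noncomputable def trigPoly (d n : ℕ) : Submodule ℂ ((Fin d → ℝ) → ℂ) :=
  Submodule.span ℂ (expo '' {k | ∀ i, |k i| ≤ n})

theorem trigPoly_mono (d : ℕ) {n m : ℕ} (h : n ≤ m) : trigPoly d n ≤ trigPoly d m :=
  Submodule.span_mono (Set.image_mono fun k hk i => (hk i).trans (by exact_mod_cast h))

theorem expo_mem_trigPoly {d n : ℕ} {k : Fin d → ℤ} (hk : ∀ i, |k i| ≤ n) :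
    expo k ∈ trigPoly d n := Submodule.subset_span ⟨k, hk, rfl⟩

theorem exists_expo_mem_trigPoly {d : ℕ} (k : Fin d → ℤ) : ∃ n, expo k ∈ trigPoly d n := by
  refine ⟨(∑ i, |k i|).toNat, expo_mem_trigPoly fun i => ?_⟩
  rw [Int.toNat_of_nonneg (Finset.sum_nonneg fun i _ => abs_nonneg _)]
  exact Finset.single_le_sum (f := fun i => |k i|) (fun i _ => abs_nonneg _) (Finset.mem_univ i)

theorem per_of_mem_trigPoly {d n : ℕ} {T : (Fin d → ℝ) → ℂ} (hT : T ∈ trigPoly d n) : Per T := by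
  induction hT using Submodule.span_induction with
  | mem x h => obtain ⟨k, -, rfl⟩ := h; exact per_expo k
  | zero => exact fun _ _ => rfl
  | add x y _ _ hx hy => exact fun z m => by simp only [Pi.add_apply, hx z m, hy z m]
  | smul a x _ hx => exact fun z m => by simp only [Pi.smul_apply, hx z m]

theorem continuous_of_mem_trigPoly {d n : ℕ} {T : (Fin d → ℝ) → ℂ} (hT : T ∈ trigPoly d n) :
    Continuous T := by
  induction hT using Submodule.span_induction with
  | mem x h => obtain ⟨k, -, rfl⟩ := h; exact continuous_expo k
  | zero => exact continuous_const
  | add x y _ _ hx hy => exact hx.add hy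
  | smul a x _ hx => exact hx.const_smul a

theorem exists_mem_trigPoly_of_mem_span {d : ℕ} {P : C(UnitAddTorus (Fin d), ℂ)}
    (hP : P ∈ Submodule.span ℂ (Set.range (UnitAddTorus.mFourier (d := Fin d)))) :
    ∃ n, (fun x => P (toTorus x)) ∈ trigPoly d n := by
  induction hP using Submodule.span_induction with
  | mem x h =>
    obtain ⟨k, rfl⟩ := h
    simpa only [← expo_eq_mFourier] using exists_expo_mem_trigPoly k
  | zero => exact ⟨0, (trigPoly d 0).zero_mem⟩
  | add x y _ _ hx hy =>
    obtain ⟨n, hn⟩ := hx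
    obtain ⟨m, hm⟩ := hy
    exact ⟨max n m, (trigPoly d _).add_mem (trigPoly_mono d (le_max_left _ _) hn)
      (trigPoly_mono d (le_max_right _ _) hm)⟩
  | smul a x _ hx =>
    obtain ⟨n, hn⟩ := hx
    exact ⟨n, (trigPoly d n).smul_mem a hn⟩

/-- Continuous functions on the torus are uniform limits of trigonometric polynomials. -/
theorem exists_trigPoly_uniform {d : ℕ} (g : C(UnitAddTorus (Fin d), ℂ)) {ε : ℝ} (hε : 0 < ε) :
    ∃ n, ∃ T ∈ trigPoly d n, ∀ x, ‖g (toTorus x) - T x‖ ≤ ε := by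
  have h : g ∈ (Submodule.span ℂ
      (Set.range (UnitAddTorus.mFourier (d := Fin d)))).topologicalClosure := by
    rw [UnitAddTorus.span_mFourier_closure_eq_top]; trivial
  obtain ⟨P, hP, hd⟩ := Metric.mem_closure_iff.1 h ε hε
  obtain ⟨n, hn⟩ := exists_mem_trigPoly_of_mem_span hP
  refine ⟨n, _, hn, fun x => ?_⟩
  rw [← dist_eq_norm]
  exact (ContinuousMap.dist_apply_le_dist _).trans hd.le

theorem latVec_zero {d : ℕ} (T : ℝ) : latVec T (0 : Fin d → ℤ) = 0 := by
  ext i; simp [latVec]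

/-- The union of all lattice translates of a null set is null and periodic, and
`lintegral_torusMeasure` applies to its indicator. The lemma transports a.e. measurability to the
torus. -/
theorem quasiMeasurePreserving_ofTorus (d : ℕ) :
    Measure.QuasiMeasurePreserving (ofTorus (d := d)) (torusMeasure d) volume := by
  refine ⟨measurable_ofTorus, Measure.AbsolutelyContinuous.mk fun A hA h0 => ?_⟩
  rw [Measure.map_apply measurable_ofTorus hA]
  set A' : Set (Fin d → ℝ) := ⋃ m : Fin d → ℤ, (fun x => x + latVec (2 * π) m) ⁻¹' A with hA'
  have hA'0 : volume A' = 0 := measure_iUnion_null fun m => by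
    rw [measure_preimage_add_right]; exact h0
  have hA'm : MeasurableSet A' := MeasurableSet.iUnion fun m => (measurable_add_const _) hA
  have hper : Per (A'.indicator (fun _ => (1 : ℝ≥0∞))) := by
    intro x m
    have : x + latVec (2 * π) m ∈ A' ↔ x ∈ A' := by
      simp only [hA', Set.mem_iUnion, Set.mem_preimage]
      have hl : ∀ a b : Fin d → ℤ, latVec (2 * π) a + latVec (2 * π) b = latVec (2 * π) (a + b) :=
        fun a b => by ext i; simp [latVec, mul_add]
      constructor
      · rintro ⟨m', h⟩; exact ⟨m + m', by rwa [← hl, ← add_assoc]⟩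
      · rintro ⟨m', h⟩; exact ⟨m' - m, by rw [add_assoc, hl]; simpa using h⟩
    by_cases h : x ∈ A'
    · rw [Set.indicator_of_mem h, Set.indicator_of_mem (this.2 h)]
    · rw [Set.indicator_of_notMem h, Set.indicator_of_notMem (mt this.1 h)]
  have h1 := lintegral_torusMeasure hper
  have h2 : ∫⁻ x in cell d, A'.indicator (fun _ => (1 : ℝ≥0∞)) x = 0 := by
    rw [lintegral_indicator hA'm]
    simp only [lintegral_const, one_mul, Measure.restrict_apply_univ]
    exact Measure.absolutelyContinuous_of_le Measure.restrict_le_self hA'0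
  rw [h2, mul_zero] at h1
  refine measure_mono_null (t := ofTorus ⁻¹' A') (Set.preimage_mono fun x hx => ?_) ?_
  · exact Set.mem_iUnion.2 ⟨0, by simpa [latVec_zero] using hx⟩
  · rw [← lintegral_indicator_one (measurable_ofTorus hA'm)]
    exact h1

theorem Per.lintegral_rpow_ofTorus {d : ℕ} {h : (Fin d → ℝ) → ℂ} (hh : Per h) (p : ℝ) :
    ∫⁻ t, ‖h (ofTorus t)‖ₑ ^ p ∂(torusMeasure d) =
      ENNReal.ofReal ((2 * π) ^ d)⁻¹ * ∫⁻ x in cell d, ‖h x‖ₑ ^ p :=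
  lintegral_torusMeasure (g := fun x => ‖h x‖ₑ ^ p) (hh.comp fun z => ‖z‖ₑ ^ p)

/-- Complex valued periodic functions in `L_p` of the torus (continuous if `p = ∞`). -/
def MemT {d : ℕ} (p : ℝ≥0∞) (h : (Fin d → ℝ) → ℂ) : Prop :=
  Per h ∧ if p = ⊤ then Continuous h else MemLp h p (volume.restrict (cell d))

theorem MemTorusLp.memT {d : ℕ} {p : ℝ≥0∞} {f : (Fin d → ℝ) → ℝ} (hf : MemTorusLp p f) :
    MemT p fun x => (f x : ℂ) := by
  refine ⟨hf.1.per.comp _, ?_⟩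
  have := hf.2
  split_ifs at this ⊢
  · exact Complex.continuous_ofReal.comp this
  · exact this.ofReal

theorem MemT.aemeasurable {d : ℕ} {p : ℝ≥0∞} {h : (Fin d → ℝ) → ℂ} (hh : MemT p h) :
    AEMeasurable h := by
  obtain ⟨h1, h2⟩ := hh
  split_ifs at h2
  · exact h2.measurable.aemeasurable
  · exact h1.aemeasurable h2.1.aemeasurable

theorem volume_cell_lt_top (d : ℕ) : volume (cell d) < ⊤ := by
  have : cell d ⊆ Set.Icc 0 (fun _ => 2 * π) := fun x hx =>
    ⟨fun i => (hx i trivial).1, fun i => (hx i trivial).2.le⟩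
  exact (measure_mono this).trans_lt isCompact_Icc.measure_lt_top

instance (d : ℕ) : IsFiniteMeasure (volume.restrict (cell d)) :=
  ⟨by simpa using volume_cell_lt_top d⟩

theorem eLpNorm_le_of_bound_cell {d : ℕ} {p : ℝ≥0∞} {h : (Fin d → ℝ) → ℂ} {C : ℝ}
    (hC : ∀ x, ‖h x‖ ≤ C) :
    eLpNorm h p (volume.restrict (cell d)) ≤
      volume (cell d) ^ p.toReal⁻¹ * ENNReal.ofReal C := by
  have := eLpNorm_le_of_ae_bound (p := p) (μ := volume.restrict (cell d)) (f := h)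
    (Eventually.of_forall hC)
  simpa using this

/-- On the torus, a finite measure space, bounded continuous functions are dense in L_p for every
finite p > 0, including p < 1. `key` relates the quasi-norms on the torus and on the cell by a
constant factor. -/
theorem exists_continuousMap_near {d : ℕ} {p : ℝ≥0∞} (hp0 : p ≠ 0) (hp : p ≠ ⊤)
    {h : (Fin d → ℝ) → ℂ} (hper : Per h) (hh : MemLp h p (volume.restrict (cell d)))
    {ε : ℝ≥0∞} (hε : ε ≠ 0) :
    ∃ g : C(UnitAddTorus (Fin d), ℂ),
      eLpNorm (fun x => h x - g (toTorus x)) p (volume.restrict (cell d)) ≤ ε := by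
  have hpr : 0 < p.toReal := ENNReal.toReal_pos hp0 hp
  set c : ℝ≥0∞ := ENNReal.ofReal ((2 * π) ^ d)⁻¹ with hc
  have hc0 : c ≠ 0 := by rw [hc]; exact (ENNReal.ofReal_pos.2 (by positivity)).ne'
  have hct : c ≠ ⊤ := ENNReal.ofReal_ne_top
  have key : ∀ u : (Fin d → ℝ) → ℂ, Per u →
      eLpNorm (fun t => u (ofTorus t)) p (torusMeasure d) =
        c ^ p.toReal⁻¹ * eLpNorm u p (volume.restrict (cell d)) := by
    intro u hu
    rw [eLpNorm_eq_lintegral_rpow_enorm_toReal hp0 hp, eLpNorm_eq_lintegral_rpow_enorm_toReal hp0 hp,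
      hu.lintegral_rpow_ofTorus, ENNReal.mul_rpow_of_nonneg _ _ (by positivity), one_div]
  have hmem : MemLp (fun t => h (ofTorus t)) p (torusMeasure d) := by
    refine ⟨?_, ?_⟩
    · exact ((hper.aemeasurable hh.1.aemeasurable).comp_quasiMeasurePreserving
        (quasiMeasurePreserving_ofTorus d)).aestronglyMeasurable
    · rw [key h hper]
      exact ENNReal.mul_lt_top (ENNReal.rpow_lt_top_of_nonneg (by positivity) hct) hh.2
  have : IsFiniteMeasure (torusMeasure d) := by
    unfold torusMeasure; infer_instance
  have hcp0 : c ^ p.toReal⁻¹ ≠ 0 := by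
    simp [hc0, hct]
  have hcpt : c ^ p.toReal⁻¹ ≠ ⊤ := (ENNReal.rpow_lt_top_of_nonneg (by positivity) hct).ne
  obtain ⟨g, hg, -⟩ := hmem.exists_boundedContinuous_eLpNorm_sub_le hp
    (ε := c ^ p.toReal⁻¹ * ε) (mul_ne_zero hcp0 hε)
  refine ⟨g.toContinuousMap, ?_⟩
  have hgper : Per fun x => h x - g.toContinuousMap (toTorus x) := by
    intro x m
    have : toTorus (x + latVec (2 * π) m) = toTorus x := by
      have hπ : 2 * π ≠ 0 := by positivity
      ext i
      simp only [toTorus, Pi.add_apply, latVec, add_div, mul_div_cancel_left₀ _ hπ,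
        AddCircle.coe_add]
      rw [add_eq_left, AddCircle.coe_eq_zero_iff]
      exact ⟨m i, by simp⟩
    simp only [this, hper x m]
  have h1 := key _ hgper
  simp only [toTorus_ofTorus] at h1
  have h2 : c ^ p.toReal⁻¹ * eLpNorm (fun x => h x - g.toContinuousMap (toTorus x)) p
      (volume.restrict (cell d)) ≤ c ^ p.toReal⁻¹ * ε := by
    rw [← h1]; exact hg
  exact (ENNReal.mul_le_mul_iff_right hcp0 hcpt).1 h2

/-- Trigonometric polynomials are dense in `L_p` of the torus. -/
theorem MemT.exists_trigPoly {d : ℕ} {p : ℝ≥0∞} (hp0 : p ≠ 0) {h : (Fin d → ℝ) → ℂ}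
    (hh : MemT p h) {ε : ℝ≥0∞} (hε : ε ≠ 0) :
    ∃ n, ∃ T ∈ trigPoly d n, torusNorm p (fun x => h x - T x) ≤ ε := by
  obtain ⟨hper, hh⟩ := hh
  by_cases hp : p = ⊤
  · rw [if_pos hp] at hh
    obtain ⟨e, he0, he⟩ : ∃ e : ℝ, 0 < e ∧ ENNReal.ofReal e ≤ ε := by
      rcases eq_or_ne ε ⊤ with rfl | h
      · exact ⟨1, one_pos, le_top⟩
      · exact ⟨ε.toReal, ENNReal.toReal_pos hε h, ENNReal.ofReal_toReal_le⟩
    obtain ⟨n, T, hT, hb⟩ := exists_trigPoly_uniform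
      ⟨fun t => h (ofTorus t), hper.continuous_comp_ofTorus hh⟩ he0
    refine ⟨n, T, hT, ?_⟩
    rw [torusNorm, if_pos hp]
    refine iSup₂_le fun x _ => ?_
    refine le_trans ?_ he
    rw [← ofReal_norm]
    have := hb x
    rw [ContinuousMap.coe_mk, hper.apply_ofTorus] at this
    exact ENNReal.ofReal_le_ofReal this
  · rw [if_neg hp] at hh
    have hpr : 0 < p.toReal := ENNReal.toReal_pos hp0 hp
    obtain ⟨e, he0, he⟩ := exists_Lp_half ℂ (volume.restrict (cell d)) p hε
    obtain ⟨g, hg⟩ := exists_continuousMap_near hp0 hp hper hh he0.ne'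
    set c := volume (cell d) ^ p.toReal⁻¹ with hc
    have hct : c ≠ ⊤ := (ENNReal.rpow_lt_top_of_nonneg (by positivity) (volume_cell_lt_top d).ne).ne
    obtain ⟨η, hη0, hη⟩ : ∃ η : ℝ, 0 < η ∧ c * ENNReal.ofReal η ≤ e := by
      have hlim : Tendsto (fun η : ℝ => c * ENNReal.ofReal η) (𝓝[>] 0) (𝓝 0) := by
        have : Tendsto (fun η : ℝ => c * ENNReal.ofReal η) (𝓝 0) (𝓝 (c * ENNReal.ofReal 0)) :=
          ENNReal.Tendsto.const_mul (ENNReal.tendsto_ofReal tendsto_id) (Or.inr hct)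
        rw [ENNReal.ofReal_zero, mul_zero] at this
        exact this.mono_left nhdsWithin_le_nhds
      obtain ⟨η, h1, h2⟩ := ((hlim.eventually_le_const he0).and self_mem_nhdsWithin).exists
      exact ⟨η, h2, h1⟩
    obtain ⟨n, T, hT, hb⟩ := exists_trigPoly_uniform g hη0
    refine ⟨n, T, hT, ?_⟩
    rw [torusNorm, if_neg hp]
    have hgc : Continuous fun x => g (toTorus x) := g.continuous.comp continuous_toTorus
    have := he (fun x => h x - g (toTorus x)) (fun x => g (toTorus x) - T x)
      (hh.1.sub hgc.aestronglyMeasurable)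
      (hgc.sub (continuous_of_mem_trigPoly hT)).aestronglyMeasurable hg
      ((eLpNorm_le_of_bound_cell hb).trans hη)
    refine (le_of_eq ?_).trans this.le
    congr 1
    ext x
    simp

/-! ### Periodization and Poisson summation. -/

theorem integral_eq_integral_cube_tsum {d : ℕ} {G : (Fin d → ℝ) → ℂ} (hG : Integrable G) :
    ∫ x, G x = ∫ x in cube d 1, ∑' m : Fin d → ℤ, G (x + latVec 1 m) := by
  set s : (Fin d → ℤ) → Set (Fin d → ℝ) := fun m => (fun x => x - latVec 1 m) ⁻¹' cube d 1 with hs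
  have hmem : ∀ x m, x ∈ s m ↔ (fun i => ⌊x i / 1⌋) = m := fun x m =>
    (mem_cube_iff_floor one_pos x m).symm
  have hmeas : ∀ m, MeasurableSet (s m) := fun m =>
    (measurable_sub_const _) (measurableSet_cube d 1)
  have hdisj : Pairwise (Function.onFun Disjoint s) := fun m m' h =>
    Set.disjoint_left.2 fun x hx hx' => h (((hmem x m).1 hx).symm.trans ((hmem x m').1 hx'))
  have hun : ⋃ m, s m = Set.univ := Set.eq_univ_of_forall fun x =>
    Set.mem_iUnion.2 ⟨_, (hmem x _).2 rfl⟩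
  have hsum := lintegral_eq_tsum_cube one_pos (fun x => ‖G x‖ₑ)
  rw [integral_tsum]
  · rw [← setIntegral_univ, ← hun, integral_iUnion hmeas hdisj hG.integrableOn]
    refine tsum_congr fun m => ?_
    have := (measurePreserving_sub_right volume (latVec 1 m)).setIntegral_preimage_emb
      (MeasurableEquiv.subRight (latVec 1 m)).measurableEmbedding
      (fun x => G (x + latVec 1 m)) (cube d 1)
    simpa using this
  · intro m
    exact ((measurePreserving_add_right volume (latVec 1 m)).integrable_comp_of_integrable
      hG).aestronglyMeasurable.restrict
  · rw [← hsum]; exact hG.hasFiniteIntegral.ne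

theorem finite_lat_norm_lt {d : ℕ} (R : ℝ) : {k : Fin d → ℤ | ‖lat k‖ < R}.Finite := by
  refine (Set.finite_Icc (fun _ : Fin d => -⌈R⌉) (fun _ => ⌈R⌉)).subset fun k hk => ?_
  have h : ∀ i, |(k i : ℝ)| ≤ ⌈R⌉ := fun i => by
    have := PiLp.norm_apply_le (lat k) i
    simp only [lat, Real.norm_eq_abs] at this
    exact this.trans (hk.le.trans (Int.le_ceil R))
  exact ⟨fun i => by exact_mod_cast (abs_le.1 (h i)).1, fun i => by exact_mod_cast (abs_le.1 (h i)).2⟩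

/-- The periodization of a function, in the normalization of the Poisson summation formula. -/
noncomputable def periodize {d : ℕ} (F : EuclideanSpace ℝ (Fin d) → ℂ) (x : Fin d → ℝ) : ℂ :=
  ∑' m : Fin d → ℤ, F (-(WithLp.toLp 2 ((2 * π)⁻¹ • x) + lat m))

theorem per_periodize {d : ℕ} (F : EuclideanSpace ℝ (Fin d) → ℂ) : Per (periodize F) := by
  intro x k
  rw [periodize, periodize]
  refine Eq.trans (tsum_congr fun m => ?_) ((Equiv.addLeft k).tsum_eq _)
  have hπ : π ≠ 0 := pi_ne_zero
  congr 2
  ext i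
  simp [lat, latVec]
  field_simp
  ring

/-- Locally uniform convergence: near a given point Peetre's inequality dominates the terms by a
multiple of the summable sequence (1 + ‖m‖)^(-a). -/
theorem continuous_periodize {d : ℕ} {F : EuclideanSpace ℝ (Fin d) → ℂ} (hF : Continuous F)
    {a : ℝ} (ha : (d : ℝ) < a) (hd : HasDecay a F) : Continuous (periodize F) := by
  obtain ⟨C, hC, hb⟩ := hd
  have ha0 : 0 ≤ a := (Nat.cast_nonneg d).trans ha.le
  have hcoe : Continuous fun x : Fin d → ℝ =>
      (WithLp.toLp 2 ((2 * π)⁻¹ • x) : EuclideanSpace ℝ (Fin d)) := by fun_prop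
  rw [continuous_iff_continuousAt]
  intro x₀
  set R : ℝ := ‖(WithLp.toLp 2 ((2 * π)⁻¹ • x₀) : EuclideanSpace ℝ (Fin d))‖ + 1 with hR
  set U : Set (Fin d → ℝ) :=
    {x | ‖(WithLp.toLp 2 ((2 * π)⁻¹ • x) : EuclideanSpace ℝ (Fin d))‖ < R} with hU
  have hUo : IsOpen U := isOpen_lt hcoe.norm continuous_const
  have hx₀ : x₀ ∈ U := by simp [hU, hR]
  refine ContinuousOn.continuousAt ?_ (hUo.mem_nhds hx₀)
  refine continuousOn_tsum (u := fun m => C * ((1 + R) ^ a * (1 + ‖lat m‖) ^ (-a)))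
    (fun m => (hF.comp (hcoe.add continuous_const).neg).continuousOn)
    (((summable_lattice ha).mul_left _).mul_left _) fun m x hx => ?_
  refine (hb _).trans (mul_le_mul_of_nonneg_left ?_ hC)
  set y := (WithLp.toLp 2 ((2 * π)⁻¹ • x) : EuclideanSpace ℝ (Fin d))
  have h1 := one_add_norm_rpow_neg_le ha0 (y + lat m) (-y)
  rw [norm_neg, add_comm y, add_neg_cancel_right] at h1
  rw [norm_neg, add_comm y]
  refine h1.trans ?_
  have : ‖y‖ ≤ R := le_of_lt hx
  gcongr

/-- **Poisson summation** for a compactly supported function with decaying Fourier transform. -/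
theorem poisson_summation {d : ℕ} {ψ : EuclideanSpace ℝ (Fin d) → ℂ} (hψ : Continuous ψ)
    {R : ℝ} (hR : ∀ v, R ≤ ‖v‖ → ψ v = 0) {a : ℝ} (ha : (d : ℝ) < a) (hd : HasDecay a (𝓕 ψ))
    (x : Fin d → ℝ) :
    HasSum (fun k : Fin d → ℤ => ψ (lat k) * expo k x) (periodize (𝓕 ψ) x) := by
  have hπ : 2 * π ≠ 0 := by positivity
  have hsupp : HasCompactSupport ψ := by
    refine HasCompactSupport.of_support_subset_isCompact
      (isCompact_closedBall (0 : EuclideanSpace ℝ (Fin d)) R) fun v hv => ?_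
    rw [mem_closedBall_zero_iff]
    by_contra h
    exact hv (hR v (not_le.1 h).le)
  have hInt : Integrable ψ := hψ.integrable_of_hasCompactSupport hsupp
  have hFc : Continuous (𝓕 ψ) := VectorFourier.fourierIntegral_continuous
    Real.continuous_fourierChar (by exact continuous_inner) hInt
  have hFint : Integrable (𝓕 ψ) := by
    obtain ⟨C, hC, hb⟩ := hd
    refine ((integrable_one_add_norm (E := EuclideanSpace ℝ (Fin d))
      (by simpa using ha)).const_mul C).mono' hFc.aestronglyMeasurable (Eventually.of_forall hb)
  set P := periodize (𝓕 ψ) with hP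
  have hPper : Per P := per_periodize _
  have hPc : Continuous P := continuous_periodize hFc ha hd
  let PT : C(UnitAddTorus (Fin d), ℂ) :=
    ⟨fun t => P (ofTorus t), hPper.continuous_comp_ofTorus hPc⟩
  -- Unfolding the sum over the lattice turns the k-th Fourier coefficient of the periodization into
  -- the inverse Fourier transform of 𝓕 ψ at k, which is ψ(k). Only finitely many coefficients are
  -- nonzero, so the Fourier series converges to the continuous periodization.
  have hcoeff : ∀ k, UnitAddTorus.mFourierCoeff PT k = ψ (lat k) := by
    intro k
    set G : (Fin d → ℝ) → ℂ := fun y =>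
      expo (-k) ((2 * π) • y) * 𝓕 ψ (-(WithLp.toLp 2 y)) with hG
    have hmp := EuclideanSpace.volume_preserving_symm_measurableEquiv_toLp (Fin d)
    set H : EuclideanSpace ℝ (Fin d) → ℂ := fun w =>
      Complex.exp (((2 * π * inner ℝ w (lat k) : ℝ) : ℂ) * Complex.I) • 𝓕 ψ w with hH
    have hGE : ∀ v : EuclideanSpace ℝ (Fin d), G v = H (-v) := by
      intro v
      simp only [hG, hH, expo, smul_eq_mul]
      congr 2
      rw [inner_neg_left, mul_comm]
      congr 2
      rw [PiLp.inner_apply, ← Finset.sum_neg_distrib, Finset.mul_sum]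
      refine Finset.sum_congr rfl fun i _ => ?_
      simp [lat]
      ring
    have hHint : Integrable H := by
      refine hFint.mono ?_ (Eventually.of_forall fun w => ?_)
      · refine Continuous.aestronglyMeasurable ?_
        have : Continuous fun w : EuclideanSpace ℝ (Fin d) => inner ℝ w (lat k) := by fun_prop
        fun_prop
      · rw [hH, norm_smul, Complex.norm_exp_ofReal_mul_I, one_mul]
    have hGint : Integrable G := by
      rw [← hmp.integrable_comp_emb (MeasurableEquiv.measurableEmbedding _)]
      exact hHint.comp_neg.congr (Eventually.of_forall fun v => (hGE v).symm)
    rw [UnitAddTorus.mFourierCoeff_eq_integral _ _ 0]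
    calc _ = ∫ y in cube d 1, ∑' m, G (y + latVec 1 m) := by
          have hset : {x : Fin d → ℝ | ∀ i, x i ∈ Set.Ioc ((0 : Fin d → ℝ) i)
              ((0 : Fin d → ℝ) i + 1)} = Set.univ.pi fun _ : Fin d => Set.Ioc 0 1 := by
            ext; simp
          have hae : (Set.univ.pi fun _ : Fin d => Set.Ioc (0 : ℝ) 1) =ᵐ[volume] cube d 1 :=
            (Measure.univ_pi_Ioc_ae_eq_Icc (μ := fun _ : Fin d => (volume : Measure ℝ))).trans
            (Measure.univ_pi_Ico_ae_eq_Icc (μ := fun _ : Fin d => (volume : Measure ℝ))).symm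
          rw [hset, setIntegral_congr_set hae]
          refine integral_congr_ae (Eventually.of_forall fun y => ?_)
          have hy : (fun i => (y i : UnitAddCircle)) = toTorus ((2 * π) • y) := by
            ext i; simp [toTorus, mul_div_cancel_left₀ _ hπ]
          simp only [PT, ContinuousMap.coe_mk]
          rw [hy, ← expo_eq_mFourier, hPper.apply_ofTorus, hP, periodize, smul_eq_mul,
            ← tsum_mul_left]
          refine tsum_congr fun m => ?_
          have h1 : (2 * π) • (y + latVec 1 m) = (2 * π) • y + latVec (2 * π) m := by
            ext i; simp [latVec, mul_add]
          simp only [hG]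
          have h2 : (WithLp.toLp 2 (y + latVec 1 m) : EuclideanSpace ℝ (Fin d)) =
              WithLp.toLp 2 ((2 * π)⁻¹ • (2 * π) • y) + lat m := by
            rw [inv_smul_smul₀ hπ]
            ext i
            simp [lat, latVec]
          rw [h1, per_expo, h2]
      _ = ∫ y, G y := (integral_eq_integral_cube_tsum hGint).symm
      _ = 𝓕⁻ (𝓕 ψ) (lat k) := by
          rw [Real.fourierInv_eq', ← integral_neg_eq_self (fun v => Complex.exp _ • 𝓕 ψ v),
            ← hmp.integral_comp (MeasurableEquiv.measurableEmbedding _)]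
          exact integral_congr_ae (Eventually.of_forall fun v => hGE v)
      _ = ψ (lat k) := by rw [hψ.fourierInv_fourier_eq hInt hFint]
  have hsumm : Summable (UnitAddTorus.mFourierCoeff PT) := by
    refine summable_of_hasFiniteSupport ((finite_lat_norm_lt R).subset fun k hk => ?_)
    rw [Function.mem_support, hcoeff] at hk
    by_contra h
    exact hk (hR _ (not_lt.1 h))
  have := UnitAddTorus.hasSum_mFourier_series_apply_of_summable hsumm (toTorus x)
  simp only [hcoeff, smul_eq_mul, ← expo_eq_mFourier] at this
  convert this using 1
  exact (hPper.apply_ofTorus x).symm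

/-! ### Kernels and sampling on equidistant grids. -/

theorem ennreal_rpow_sum_le {ι : Type*} (s : Finset ι) (f : ι → ℝ≥0∞) {r : ℝ} (hr : 0 < r)
    (hr1 : r ≤ 1) : (∑ i ∈ s, f i) ^ r ≤ ∑ i ∈ s, f i ^ r := by
  classical
  induction s using Finset.induction_on with
  | empty => simp [hr]
  | insert i s hi ih =>
    rw [Finset.sum_insert hi, Finset.sum_insert hi]
    exact (ENNReal.rpow_add_le_add_rpow _ _ hr.le hr1).trans (by gcongr)

theorem ennreal_rpow_tsum_le {ι : Type*} (f : ι → ℝ≥0∞) {r : ℝ} (hr : 0 < r) (hr1 : r ≤ 1) :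
    (∑' i, f i) ^ r ≤ ∑' i, f i ^ r := by
  have h : Tendsto (fun s : Finset ι => (∑ i ∈ s, f i) ^ r) atTop (𝓝 ((∑' i, f i) ^ r)) :=
    (ENNReal.continuous_rpow_const.tendsto _).comp ENNReal.summable.hasSum
  exact le_of_tendsto' h fun s => (ennreal_rpow_sum_le s f hr hr1).trans (ENNReal.sum_le_tsum s)

/-- The natural inclusion `{0, …, N-1}^d → ℤ^d`. -/
def fz {d N : ℕ} (k : Fin d → Fin N) : Fin d → ℤ := fun i => ((k i : ℕ) : ℤ)

/-- The points `2πm / N`. -/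
noncomputable def inode {d : ℕ} (N : ℕ) (m : Fin d → ℤ) : Fin d → ℝ := fun i => 2 * π * m i / N

theorem inode_add {d : ℕ} (N : ℕ) (m m' : Fin d → ℤ) :
    inode N (m + m') = inode N m + inode N m' := by
  ext i; simp [inode, mul_add, add_div]

theorem inode_smul {d N : ℕ} (hN : 0 < N) (m : Fin d → ℤ) :
    inode N (N • m) = latVec (2 * π) m := by
  have : (N : ℝ) ≠ 0 := by positivity
  ext i; simp only [inode, latVec, Pi.smul_apply, nsmul_eq_mul]; push_cast; field_simp

/-- Coordinatewise residue modulo `N`. -/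
def modN {d : ℕ} (N : ℕ) [NeZero N] (m : Fin d → ℤ) : Fin d → Fin N :=
  fun i => (Int.divModEquiv N (m i)).2

theorem exists_eq_fz_modN {d : ℕ} (N : ℕ) [NeZero N] (m : Fin d → ℤ) :
    m = fz (modN N m) + N • fun i => (Int.divModEquiv N (m i)).1 := by
  ext i
  have := (Int.divModEquiv N).symm_apply_apply (m i)
  rw [Int.divModEquiv_symm_apply] at this
  rw [Pi.add_apply, Pi.smul_apply, nsmul_eq_mul]
  simp only [fz, modN]
  linarith

theorem modN_fz_add {d : ℕ} (N : ℕ) [NeZero N] (k : Fin d → Fin N) (q : Fin d → ℤ) :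
    modN N (fz k + N • q) = k := by
  ext1 i
  have := (Int.divModEquiv N).apply_symm_apply (q i, k i)
  rw [Int.divModEquiv_symm_apply] at this
  have h2 := congrArg Prod.snd this
  simp only at h2
  rw [modN, ← h2]
  congr 2
  simp [fz]; ring

theorem modN_fz {d : ℕ} (N : ℕ) [NeZero N] (k : Fin d → Fin N) : modN N (fz k) = k := by
  simpa using modN_fz_add N k 0

theorem modN_add_smul {d : ℕ} (N : ℕ) [NeZero N] (m q : Fin d → ℤ) :
    modN N (m + N • q) = modN N m := by
  conv_lhs => rw [exists_eq_fz_modN N m, add_assoc, ← smul_add]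
  exact modN_fz_add N _ _

/-- Sums of `N`-periodic functions over a full period are shift invariant. -/
theorem sum_fz_add {d N : ℕ} [NeZero N] {M : Type*} [AddCommMonoid M] {F : (Fin d → ℤ) → M}
    (hF : ∀ m q, F (m + N • q) = F m) (m : Fin d → ℤ) :
    ∑ k : Fin d → Fin N, F (fz k + m) = ∑ k : Fin d → Fin N, F (fz k) := by
  have hinj : Function.Injective fun k : Fin d → Fin N => modN N (fz k + m) := by
    intro k k' h
    have h1 := exists_eq_fz_modN N (fz k + m)
    have h2 := exists_eq_fz_modN N (fz k' + m)
    simp only at h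
    rw [h] at h1
    set q := (fun i => (Int.divModEquiv N ((fz k + m) i)).1)
    set q' := (fun i => (Int.divModEquiv N ((fz k' + m) i)).1)
    have h3 : fz k = fz k' + N • (q - q') := by
      rw [smul_sub]
      generalize fz (modN N (fz k' + m)) = w at h1 h2
      have h1' := eq_sub_of_add_eq h1
      have h2' := eq_sub_of_add_eq h2
      rw [h1', h2']; abel
    rw [← modN_fz N k, h3, modN_fz_add]
  refine Fintype.sum_bijective _ (Finite.injective_iff_bijective.1 hinj) _ _ fun k => ?_
  conv_lhs => rw [exists_eq_fz_modN N (fz k + m)]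
  exact hF _ _

theorem sum_tsum_fz {d N : ℕ} [NeZero N] (F : (Fin d → ℤ) → ℝ≥0∞) :
    ∑ k : Fin d → Fin N, ∑' m : Fin d → ℤ, F (fz k + N • m) = ∑' j, F j := by
  let e : (Fin d → Fin N) × (Fin d → ℤ) ≃ (Fin d → ℤ) :=
    { toFun := fun p => fz p.1 + N • p.2
      invFun := fun m => (modN N m, fun i => (Int.divModEquiv N (m i)).1)
      left_inv := fun p => by
        have h1 := modN_fz_add N p.1 p.2
        refine Prod.ext h1 ?_
        have h2 := exists_eq_fz_modN N (fz p.1 + N • p.2)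
        rw [h1, add_right_inj] at h2
        exact (smul_right_injective _ (NeZero.ne N) h2).symm
      right_inv := fun m => (exists_eq_fz_modN N m).symm }
  rw [← e.tsum_eq, ENNReal.tsum_prod', tsum_fintype]
  rfl

/-- The kernel `∑_k ψ(k/n) e^{i(k,x)}` of a Fourier multiplier with symbol `ψ`. -/
noncomputable def symKernel {d : ℕ} (ψ : EuclideanSpace ℝ (Fin d) → ℂ) (n : ℕ)
    (x : Fin d → ℝ) : ℂ :=
  ∑' k : Fin d → ℤ, ψ ((n : ℝ)⁻¹ • lat k) * expo k x

/-- A continuous compactly supported symbol whose Fourier transform decays with order `a`. -/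
structure IsSymbol {d : ℕ} (a R : ℝ) (ψ : EuclideanSpace ℝ (Fin d) → ℂ) : Prop where
  continuous : Continuous ψ
  support : ∀ v, R ≤ ‖v‖ → ψ v = 0
  decay : HasDecay a (𝓕 ψ)

/-- Poisson summation applied to ψ(·/n), whose transform is n^d 𝓕 ψ(n ·); the decay of 𝓕 ψ is then
inserted term by term. -/
theorem exists_symKernel_le {d : ℕ} {ψ : EuclideanSpace ℝ (Fin d) → ℂ} {a R : ℝ}
    (hψ : IsSymbol a R ψ) (ha : (d : ℝ) < a) :
    ∃ C : ℝ, 0 ≤ C ∧ ∀ n : ℕ, 0 < n → ∀ x : Fin d → ℝ,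
      ‖symKernel ψ n x‖ₑ ≤ ENNReal.ofReal (C * n ^ d) * ∑' m : Fin d → ℤ,
        ENNReal.ofReal ((1 + n * ‖WithLp.toLp 2 ((2 * π)⁻¹ • x) + lat m‖) ^ (-a)) := by
  obtain ⟨C, hC, hb⟩ := hψ.decay
  refine ⟨C, hC, fun n hn x => ?_⟩
  have ha0 : 0 ≤ a := (Nat.cast_nonneg d).trans ha.le
  have hn' : (0 : ℝ) < n := by exact_mod_cast hn
  have hn1 : (1 : ℝ) ≤ n := by exact_mod_cast hn
  have hF : ∀ y, ‖𝓕 (fun v => ψ ((n : ℝ)⁻¹ • v)) y‖ ≤ C * n ^ d * (1 + n * ‖y‖) ^ (-a) := by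
    intro y
    rw [fourier_comp_smul ψ hn' y, norm_mul]
    have h1 := hb ((n : ℝ) • y)
    rw [norm_smul, Real.norm_of_nonneg hn'.le] at h1
    have h2 : ‖(((n : ℝ) ^ Module.finrank ℝ (EuclideanSpace ℝ (Fin d)) : ℝ) : ℂ)‖ = (n : ℝ) ^ d := by
      rw [Complex.norm_real, finrank_euclideanSpace_fin, Real.norm_of_nonneg (by positivity)]
    rw [h2]
    calc (n : ℝ) ^ d * ‖𝓕 ψ ((n : ℝ) • y)‖ ≤ (n : ℝ) ^ d * (C * (1 + n * ‖y‖) ^ (-a)) := by gcongr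
      _ = _ := by ring
  have hdec : HasDecay a (𝓕 (fun v => ψ ((n : ℝ)⁻¹ • v))) := by
    refine ⟨C * n ^ d, by positivity, fun y => (hF y).trans ?_⟩
    have : (1 + n * ‖y‖) ^ (-a) ≤ (1 + ‖y‖) ^ (-a) :=
      rpow_le_rpow_of_nonpos (by positivity) (by nlinarith [norm_nonneg y]) (by linarith)
    gcongr
  have hP := poisson_summation (ψ := fun v => ψ ((n : ℝ)⁻¹ • v)) (R := n * R)
    (hψ.continuous.comp (continuous_const_smul _)) (fun v hv => hψ.support _ ?_) ha hdec x
  · rw [symKernel, hP.tsum_eq, periodize]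
    refine (enorm_tsum_le_tsum_enorm).trans ?_
    rw [← ENNReal.tsum_mul_left]
    refine ENNReal.tsum_le_tsum fun m => ?_
    rw [← ENNReal.ofReal_mul (by positivity), ← ofReal_norm]
    refine ENNReal.ofReal_le_ofReal ((hF _).trans ?_)
    rw [norm_neg]
  · rw [norm_smul, norm_inv, Real.norm_of_nonneg hn'.le, ← div_eq_inv_mul, le_div_iff₀ hn']
    linarith

/-- Uniform bounds for the sums of `|K_n|^r` over shifted equidistant nodes. -/
theorem exists_sum_symKernel_rpow_le {d : ℕ} {ψ : EuclideanSpace ℝ (Fin d) → ℂ} {a R r : ℝ}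
    (hψ : IsSymbol a R ψ) (ha : (d : ℝ) < a) (hr : 0 < r) (hr1 : r ≤ 1) (hra : (d : ℝ) < a * r) :
    ∃ C : ℝ≥0∞, C ≠ ⊤ ∧ ∀ n N : ℕ, 0 < N → N ≤ 5 * n → ∀ x : Fin d → ℝ,
      ∑ k : Fin d → Fin N, ‖symKernel ψ n (x - inode N (fz k))‖ₑ ^ r ≤
        C * ENNReal.ofReal ((n : ℝ) ^ (d * r)) := by
  obtain ⟨C, hC, hb⟩ := exists_symKernel_le hψ ha
  obtain ⟨C', hC', hb'⟩ := exists_tsum_lattice_le hra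
  have har0 : 0 ≤ a * r := (Nat.cast_nonneg d).trans hra.le
  refine ⟨ENNReal.ofReal (C ^ r) * (ENNReal.ofReal (5 ^ (a * r)) * C'), by finiteness,
    fun n N hN hNn x => ?_⟩
  have hn : 0 < n := by omega
  have : NeZero N := ⟨hN.ne'⟩
  have hN' : (0 : ℝ) < N := by exact_mod_cast hN
  have hNn' : (N : ℝ) ≤ 5 * n := by exact_mod_cast hNn
  set y : EuclideanSpace ℝ (Fin d) := WithLp.toLp 2 ((2 * π)⁻¹ • x) with hy
  set g : (Fin d → ℤ) → ℝ≥0∞ := fun j =>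
    ENNReal.ofReal ((1 + n * ‖y - (N : ℝ)⁻¹ • lat j‖) ^ (-(a * r))) with hg
  -- For r ≤ 1 the power passes inside the lattice sum. The grid points and the lattice periods then
  -- combine into a single sum over the lattice ℤ^d/N.
  have h1 : ∀ k : Fin d → Fin N, ‖symKernel ψ n (x - inode N (fz k))‖ₑ ^ r ≤
      ENNReal.ofReal ((C * n ^ d) ^ r) * ∑' m : Fin d → ℤ, g (fz k + N • m) := by
    intro k
    refine (ENNReal.rpow_le_rpow (hb n hn _) hr.le).trans ?_
    rw [ENNReal.mul_rpow_of_nonneg _ _ hr.le, ENNReal.ofReal_rpow_of_nonneg (by positivity) hr.le]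
    gcongr
    refine (ennreal_rpow_tsum_le _ hr hr1).trans ?_
    rw [← (Equiv.neg (Fin d → ℤ)).tsum_eq]
    refine ENNReal.tsum_le_tsum fun m => le_of_eq ?_
    rw [hg, ENNReal.ofReal_rpow_of_nonneg (by positivity) hr.le, ← rpow_mul (by positivity),
      neg_mul]
    congr 5
    ext i
    simp [hy, lat, inode, fz]
    field_simp
    ring
  -- From N ≤ 5n one gets 1 + N t ≤ 5 (1 + n t), which replaces the scale n by the scale N of the
  -- lattice at the cost of 5^{ar}. The grids used below have 2n + 1 or 4n + 1 points per axis, at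
  -- most 5n for n ≥ 1.
  have h2 : ∀ j, g j ≤ ENNReal.ofReal (5 ^ (a * r)) *
      ENNReal.ofReal ((1 + ‖lat j - (N : ℝ) • y‖) ^ (-(a * r))) := by
    intro j
    rw [hg, ← ENNReal.ofReal_mul (by positivity)]
    refine ENNReal.ofReal_le_ofReal ?_
    have e1 : ‖lat j - (N : ℝ) • y‖ = N * ‖y - (N : ℝ)⁻¹ • lat j‖ := by
      rw [← Real.norm_of_nonneg hN'.le, ← norm_smul, Real.norm_of_nonneg hN'.le, smul_sub,
        smul_inv_smul₀ hN'.ne', norm_sub_rev]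
    rw [e1]
    set t := ‖y - (N : ℝ)⁻¹ • lat j‖
    have ht : 0 ≤ t := norm_nonneg _
    rw [rpow_neg (by positivity), rpow_neg (by positivity), ← div_eq_mul_inv,
      ← div_rpow (by positivity) (by positivity), ← inv_rpow (by positivity)]
    refine rpow_le_rpow (by positivity) ?_ har0
    rw [inv_le_comm₀ (by positivity) (by positivity), inv_div, div_le_iff₀ (by norm_num)]
    nlinarith
  calc _ ≤ ∑ k : Fin d → Fin N, ENNReal.ofReal ((C * n ^ d) ^ r) * ∑' m, g (fz k + N • m) :=
        Finset.sum_le_sum fun k _ => h1 k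
    _ = ENNReal.ofReal ((C * n ^ d) ^ r) * ∑' j, g j := by
        rw [← Finset.mul_sum, sum_tsum_fz]
    _ ≤ ENNReal.ofReal ((C * n ^ d) ^ r) * (ENNReal.ofReal (5 ^ (a * r)) * C') := by
        gcongr
        refine (ENNReal.tsum_le_tsum h2).trans ?_
        rw [ENNReal.tsum_mul_left]
        gcongr
        exact hb' _
    _ = _ := by
        rw [mul_rpow hC (by positivity), ← rpow_natCast, ← rpow_mul (by positivity),
          ENNReal.ofReal_mul (by positivity)]
        ring

section

variable {d : ℕ} {ψ : EuclideanSpace ℝ (Fin d) → ℂ} {a R : ℝ} {n : ℕ}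

theorem IsSymbol.eq_zero (hψ : IsSymbol a R ψ) (hn : 0 < n) {k : Fin d → ℤ}
    (hk : n * R ≤ ‖lat k‖) : ψ ((n : ℝ)⁻¹ • lat k) = 0 := by
  have hn' : (0 : ℝ) < n := by exact_mod_cast hn
  refine hψ.support _ ?_
  rw [norm_smul, norm_inv, Real.norm_of_nonneg hn'.le, ← div_eq_inv_mul, le_div_iff₀ hn']
  linarith

/-- The frequencies on which the kernel of a symbol supported in the ball of radius `R` lives. -/
noncomputable def freqs (d : ℕ) (R : ℝ) (n : ℕ) : Finset (Fin d → ℤ) :=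
  (finite_lat_norm_lt (n * R)).toFinset

theorem mem_freqs {k : Fin d → ℤ} : k ∈ freqs d R n ↔ ‖lat k‖ < n * R := by
  simp [freqs]

theorem abs_le_norm_lat (k : Fin d → ℤ) (i : Fin d) : |(k i : ℝ)| ≤ ‖lat k‖ := by
  have := PiLp.norm_apply_le (lat k) i
  simpa only [lat, Real.norm_eq_abs] using this

theorem abs_le_of_mem_freqs {m : ℕ} {k : Fin d → ℤ} (hk : k ∈ freqs d m n) (i : Fin d) :
    |k i| ≤ (m * n : ℕ) := by
  have h := (abs_le_norm_lat k i).trans (mem_freqs.1 hk).le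
  rw [mul_comm] at h
  exact_mod_cast h

theorem IsSymbol.symKernel_eq_sum (hψ : IsSymbol a R ψ) (hn : 0 < n) (x : Fin d → ℝ) :
    symKernel ψ n x = ∑ k ∈ freqs d R n, ψ ((n : ℝ)⁻¹ • lat k) * expo k x := by
  refine tsum_eq_sum fun k hk => ?_
  rw [hψ.eq_zero hn (not_lt.1 (mt mem_freqs.2 hk)), zero_mul]

theorem IsSymbol.continuous_symKernel (hψ : IsSymbol a R ψ) (hn : 0 < n) :
    Continuous (symKernel ψ n) := by
  have : symKernel ψ n = fun x => ∑ k ∈ freqs d R n, ψ ((n : ℝ)⁻¹ • lat k) * expo k x :=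
    funext fun x => hψ.symKernel_eq_sum hn x
  rw [this]
  exact continuous_finsetSum _ fun k _ => continuous_const.mul (continuous_expo k)

theorem per_symKernel (ψ : EuclideanSpace ℝ (Fin d) → ℂ) (n : ℕ) : Per (symKernel ψ n) :=
  fun x m => tsum_congr fun k => by rw [per_expo]

end

theorem expo_inode_smul {d N : ℕ} (hN : 0 < N) (q m : Fin d → ℤ) :
    expo q (inode N (N • m)) = 1 := by
  rw [inode_smul hN, ← zero_add (latVec _ _), per_expo, expo_zero_right]

/-- Orthogonality of exponentials on the equidistant grid. -/
theorem sum_expo_inode {d N : ℕ} [NeZero N] {q : Fin d → ℤ} (hq : ∀ i, |q i| < N) :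
    ∑ k : Fin d → Fin N, expo q (inode N (fz k)) = if q = 0 then (N : ℂ) ^ d else 0 := by
  have hN : 0 < N := Nat.pos_of_ne_zero (NeZero.ne N)
  split_ifs with h
  · subst h; simp
  · obtain ⟨i, hi⟩ := Function.ne_iff.1 h
    -- Shifting the grid by one step in a direction i with q i ≠ 0 leaves the sum unchanged but
    -- multiplies it by a root of unity, which differs from 1 because |q i| < N.
    have h1 := sum_fz_add (N := N) (F := fun m => expo q (inode N m)) (fun m r => by
      rw [inode_add, expo_add_right, expo_inode_smul hN, mul_one]) (Pi.single i 1)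
    simp only [inode_add, expo_add_right, ← Finset.sum_mul] at h1
    have h2 : expo q (inode N (Pi.single i 1)) ≠ 1 := by
      have h3 : expo q (inode N (Pi.single i 1)) =
          Complex.exp (Complex.I * ((q i : ℝ) * (2 * π / N) : ℝ)) := by
        rw [expo]
        congr 3
        rw [Finset.sum_eq_single i]
        · simp [inode]
        · intro j _ hj; simp [inode, hj]
        · simp
      rw [h3, Ne, Complex.exp_eq_one_iff]
      rintro ⟨m, hm⟩
      have hNc : (N : ℂ) ≠ 0 := by exact_mod_cast hN.ne'
      have hπ : (π : ℂ) ≠ 0 := by exact_mod_cast pi_ne_zero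
      have h4 : (q i : ℂ) = m * N := by
        push_cast at hm
        field_simp at hm
        rw [hm, mul_comm]
      have h5 : q i = m * N := by exact_mod_cast h4
      have h6 := hq i
      rw [h5, abs_mul, Nat.abs_cast] at h6
      have h7 : m = 0 := by
        by_contra hm0
        have : 1 ≤ |m| := Int.one_le_abs hm0
        nlinarith
      rw [h7, zero_mul] at h5
      exact hi h5
    have h8 : (∑ k : Fin d → Fin N, expo q (inode N (fz k))) *
        (expo q (inode N (Pi.single i 1)) - 1) = 0 := by rw [mul_sub, h1]; ring
    exact (mul_eq_zero.1 h8).resolve_right (sub_ne_zero.2 h2)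

/-- The sampling operator with kernel `K` on the `N`-point grid shifted by `l`. -/
noncomputable def sampleOp {d : ℕ} (N : ℕ) (K : (Fin d → ℝ) → ℂ) (l : Fin d → ℝ)
    (f : (Fin d → ℝ) → ℂ) (x : Fin d → ℝ) : ℂ :=
  ((N : ℂ) ^ d)⁻¹ * ∑ k : Fin d → Fin N,
    f (inode N (fz k) + l) * K (x - inode N (fz k) - l)

section

variable {d N : ℕ} {K : (Fin d → ℝ) → ℂ}

theorem sampleOp_add (l : Fin d → ℝ) (f g : (Fin d → ℝ) → ℂ) (x : Fin d → ℝ) :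
    sampleOp N K l (f + g) x = sampleOp N K l f x + sampleOp N K l g x := by
  simp only [sampleOp, Pi.add_apply, add_mul, Finset.sum_add_distrib, mul_add]

theorem sampleOp_smul (l : Fin d → ℝ) (c : ℂ) (f : (Fin d → ℝ) → ℂ) (x : Fin d → ℝ) :
    sampleOp N K l (c • f) x = c * sampleOp N K l f x := by
  simp only [sampleOp, Pi.smul_apply, smul_eq_mul, Finset.mul_sum]
  exact Finset.sum_congr rfl fun k _ => by ring

theorem sampleOp_sub (l : Fin d → ℝ) (f g : (Fin d → ℝ) → ℂ) (x : Fin d → ℝ) :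
    sampleOp N K l (f - g) x = sampleOp N K l f x - sampleOp N K l g x := by
  simp only [sampleOp, Pi.sub_apply, sub_mul, Finset.sum_sub_distrib, mul_sub]

theorem continuous_sampleOp (hK : Continuous K) (l : Fin d → ℝ) (f : (Fin d → ℝ) → ℂ) :
    Continuous (sampleOp N K l f) := by
  unfold sampleOp; fun_prop

theorem per_sampleOp (hK : Per K) (l : Fin d → ℝ) (f : (Fin d → ℝ) → ℂ) :
    Per (sampleOp N K l f) := by
  intro x m
  simp only [sampleOp]
  congr 1
  refine Finset.sum_congr rfl fun k _ => ?_
  rw [← hK (x - _ - _) m]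
  congr 2
  abel

end

/-- The sampling operator acts on low frequency exponentials as the multiplier `ψ(·/n)`. -/
theorem sampleOp_expo {d N n m M : ℕ} {ψ : EuclideanSpace ℝ (Fin d) → ℂ} {a : ℝ}
    (hψ : IsSymbol a m ψ) (hn : 0 < n) (hN : m * n + M < N) {j : Fin d → ℤ} (hj : ∀ i, |j i| ≤ M)
    (l x : Fin d → ℝ) :
    sampleOp N (symKernel ψ n) l (expo j) x = ψ ((n : ℝ)⁻¹ • lat j) * expo j x := by
  have : NeZero N := ⟨by omega⟩
  have hNc : (N : ℂ) ^ d ≠ 0 := pow_ne_zero _ (by exact_mod_cast NeZero.ne N)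
  have h1 : ∀ k : Fin d → Fin N, expo j (inode N (fz k) + l) *
      symKernel ψ n (x - inode N (fz k) - l) = ∑ q ∈ freqs d m n,
        ψ ((n : ℝ)⁻¹ • lat q) * expo q (x - l) * expo j l * expo (j - q) (inode N (fz k)) := by
    intro k
    rw [hψ.symKernel_eq_sum hn, Finset.mul_sum]
    refine Finset.sum_congr rfl fun q _ => ?_
    rw [sub_right_comm, expo_sub_right q (x - l), expo_add_right, expo_neg_right, sub_eq_add_neg j q,
      expo_add_left]
    ring
  rw [sampleOp]
  simp only [h1]
  rw [Finset.sum_comm]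
  simp only [← Finset.mul_sum]
  -- No aliasing: |j - q| ≤ M + m n < N in every coordinate, so only the frequency q = j survives
  -- the summation over the grid.
  have h2 : ∀ q ∈ freqs d m n, ∑ k : Fin d → Fin N, expo (j - q) (inode N (fz k)) =
      if q = j then (N : ℂ) ^ d else 0 := by
    intro q hq
    rw [sum_expo_inode fun i => ?_]
    · simp only [sub_eq_zero, eq_comm]
    · have h3 := abs_le_of_mem_freqs hq i
      have h4 := hj i
      have := abs_sub (j i) (q i)
      rw [Pi.sub_apply]
      omega
  rw [Finset.sum_congr rfl fun q hq => by rw [h2 q hq]]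
  simp only [mul_ite, mul_zero, Finset.sum_ite_eq']
  split_ifs with hjm
  · rw [expo_sub_right, expo_neg_right]
    have : expo (-j) l * expo j l = 1 := by rw [← expo_add_left]; simp
    generalize ψ ((n : ℝ)⁻¹ • lat j) = z
    field_simp
    linear_combination (z * expo j x) * this
  · rw [hψ.eq_zero hn (not_lt.1 (mt mem_freqs.2 hjm))]; simp

/-- On trigonometric polynomials the sampling operators converge uniformly. -/
theorem eventually_norm_sampleOp_sub_le {d M : ℕ} {ψ : EuclideanSpace ℝ (Fin d) → ℂ} {a : ℝ}
    {m : ℕ} {N : ℕ → ℕ} (hN : ∀ n, m * n + n < N n)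
    (hψ : IsSymbol a m ψ) {T : (Fin d → ℝ) → ℂ} (hT : T ∈ trigPoly d M) :
    ∀ ε > 0, ∀ᶠ n : ℕ in atTop, ∀ l x,
      ‖sampleOp (N n) (symKernel ψ n) l T x - ψ 0 * T x‖ ≤ ε := by
  induction hT using Submodule.span_induction with
  | mem T h =>
    intro ε hε
    obtain ⟨j, hj, rfl⟩ := h
    have hlim : Tendsto (fun n : ℕ => ψ ((n : ℝ)⁻¹ • lat j) - ψ 0) atTop (𝓝 0) := by
      have h1 : Tendsto (fun n : ℕ => (n : ℝ)⁻¹ • lat j) atTop (𝓝 0) := by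
        have := (tendsto_inv_atTop_nhds_zero_nat (𝕜 := ℝ)).smul_const (lat j)
        rwa [zero_smul] at this
      have h2 := (hψ.continuous.tendsto 0).comp h1
      have h3 := h2.sub_const (ψ 0)
      rw [sub_self] at h3
      exact h3
    filter_upwards [hlim.norm.eventually_le_const (by simpa using hε), eventually_gt_atTop 0,
      eventually_ge_atTop M] with n h1 h2 h3 l x
    rw [sampleOp_expo hψ h2 (hN n) (fun i => (hj i).trans (by exact_mod_cast h3)), ← sub_mul,
      norm_mul, norm_expo, mul_one]
    exact h1
  | zero =>
    intro ε hε
    refine Eventually.of_forall fun n l x => ?_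
    simpa [sampleOp] using hε.le
  | add T T' _ _ hT hT' =>
    intro ε hε
    filter_upwards [hT (ε / 2) (by positivity), hT' (ε / 2) (by positivity)] with n h1 h2 l x
    rw [sampleOp_add, Pi.add_apply]
    calc _ = ‖(sampleOp (N n) (symKernel ψ n) l T x - ψ 0 * T x) +
          (sampleOp (N n) (symKernel ψ n) l T' x - ψ 0 * T' x)‖ := by congr 1; ring
      _ ≤ ε / 2 + ε / 2 := (norm_add_le _ _).trans (add_le_add (h1 l x) (h2 l x))
      _ = ε := by ring
  | smul c T _ hT =>
    intro ε hε
    filter_upwards [hT (ε / (‖c‖ + 1)) (by positivity)] with n h1 l x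
    rw [sampleOp_smul, Pi.smul_apply, smul_eq_mul]
    calc _ = ‖c‖ * ‖sampleOp (N n) (symKernel ψ n) l T x - ψ 0 * T x‖ := by
          rw [← norm_mul]; congr 1; ring
      _ ≤ (‖c‖ + 1) * (ε / (‖c‖ + 1)) := by
          gcongr
          · linarith
          · exact h1 l x
      _ = ε := by field_simp

/-! ### Powers of quasi-norms and uniform boundedness. -/

/-- The exponent to which the `L_p` quasi-norm is raised: `p`, or `1` if `p = ∞`. -/
noncomputable def ex (p : ℝ≥0∞) : ℝ := if p = ⊤ then 1 else p.toReal

theorem ex_pos {p : ℝ≥0∞} (hp : p ≠ 0) : 0 < ex p := by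
  unfold ex; split_ifs with h
  · exact one_pos
  · exact ENNReal.toReal_pos hp h

/-- The `p`-th power of the `L_p` quasi-norm over the cell (the supremum if `p = ∞`). -/
noncomputable def pnorm {d : ℕ} (p : ℝ≥0∞) (g : (Fin d → ℝ) → ℝ≥0∞) : ℝ≥0∞ :=
  if p = ⊤ then ⨆ x ∈ cell d, g x else ∫⁻ x in cell d, g x ^ p.toReal

/-- The `p`-th power of the iterated quasi-norm. -/
noncomputable def qnorm {d : ℕ} (p : ℝ≥0∞) (H : (Fin d → ℝ) → (Fin d → ℝ) → ℝ≥0∞) : ℝ≥0∞ :=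
  if p = ⊤ then ⨆ l ∈ cell d, pnorm p (H l) else ∫⁻ l in cell d, pnorm p (H l)

/-- The constant in the quasi-triangle inequality. -/
noncomputable def quasiConst (p : ℝ≥0∞) : ℝ≥0∞ := 2 ^ max (ex p - 1) 0

theorem quasiConst_ne_top (p : ℝ≥0∞) : quasiConst p ≠ ⊤ :=
  (ENNReal.rpow_lt_top_of_nonneg (le_max_right _ _) (by simp)).ne

theorem one_le_quasiConst (p : ℝ≥0∞) : 1 ≤ quasiConst p :=
  (ENNReal.one_rpow _).symm.le.trans (ENNReal.rpow_le_rpow (by norm_num) (le_max_right _ _))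

theorem rpow_add_le_quasiConst {p : ℝ≥0∞} (hp0 : p ≠ 0) (a b : ℝ≥0∞) :
    (a + b) ^ ex p ≤ quasiConst p * (a ^ ex p + b ^ ex p) := by
  rcases le_total (ex p) 1 with h | h
  · refine (ENNReal.rpow_add_le_add_rpow _ _ (ex_pos hp0).le h).trans ?_
    exact le_mul_of_one_le_left zero_le (one_le_quasiConst p)
  · rw [quasiConst, max_eq_left (by linarith)]
    exact ENNReal.rpow_add_le_mul_rpow_add_rpow _ _ h

section

variable {d : ℕ} {p : ℝ≥0∞}

theorem ex_of_ne_top (hp : p ≠ ⊤) : ex p = p.toReal := if_neg hp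

theorem pnorm_top (g : (Fin d → ℝ) → ℝ≥0∞) : pnorm ⊤ g = ⨆ x ∈ cell d, g x := if_pos rfl

theorem pnorm_of_ne_top (hp : p ≠ ⊤) (g : (Fin d → ℝ) → ℝ≥0∞) :
    pnorm p g = ∫⁻ x in cell d, g x ^ p.toReal := if_neg hp

theorem qnorm_top (H : (Fin d → ℝ) → (Fin d → ℝ) → ℝ≥0∞) :
    qnorm ⊤ H = ⨆ l ∈ cell d, pnorm ⊤ (H l) := if_pos rfl

theorem qnorm_of_ne_top (hp : p ≠ ⊤) (H : (Fin d → ℝ) → (Fin d → ℝ) → ℝ≥0∞) :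
    qnorm p H = ∫⁻ l in cell d, pnorm p (H l) := if_neg hp

theorem torusNorm_eq_pnorm {E : Type*} [ENorm E] (hp0 : p ≠ 0) (f : (Fin d → ℝ) → E) :
    torusNorm p f = pnorm p (fun x => ‖f x‖ₑ) ^ (1 / ex p) := by
  unfold torusNorm pnorm ex
  split_ifs with h
  · simp
  · rw [eLpNorm_eq_lintegral_rpow_enorm_toReal hp0 h]

theorem torusNormBar_eq_qnorm {E : Type*} [ENorm E] (hp0 : p ≠ 0)
    (F : (Fin d → ℝ) → (Fin d → ℝ) → E) :
    torusNormBar p F = qnorm p (fun l x => ‖F l x‖ₑ) ^ (1 / ex p) := by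
  rw [torusNormBar, torusNorm_eq_pnorm hp0]
  congr 1
  simp only [enorm_eq_self, torusNorm_eq_pnorm hp0]
  by_cases h : p = ⊤
  · subst h; simp [ex, qnorm_top, pnorm_top]
  · rw [qnorm_of_ne_top h, pnorm_of_ne_top h, ex_of_ne_top h]
    have := (ENNReal.toReal_pos hp0 h).ne'
    simp only [← ENNReal.rpow_mul, one_div, inv_mul_cancel₀ this, ENNReal.rpow_one]

theorem pnorm_mono {g h : (Fin d → ℝ) → ℝ≥0∞} (hgh : ∀ x, g x ≤ h x) : pnorm p g ≤ pnorm p h := by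
  unfold pnorm; split_ifs
  · exact iSup₂_mono fun x _ => hgh x
  · exact lintegral_mono fun x => ENNReal.rpow_le_rpow (hgh x) ENNReal.toReal_nonneg

theorem qnorm_mono' {G H : (Fin d → ℝ) → (Fin d → ℝ) → ℝ≥0∞}
    (h : ∀ l, pnorm p (G l) ≤ pnorm p (H l)) : qnorm p G ≤ qnorm p H := by
  unfold qnorm; split_ifs
  · exact iSup₂_mono fun x _ => h x
  · exact lintegral_mono fun x => h x

theorem qnorm_mono {G H : (Fin d → ℝ) → (Fin d → ℝ) → ℝ≥0∞} (h : ∀ l x, G l x ≤ H l x) :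
    qnorm p G ≤ qnorm p H := qnorm_mono' fun l => pnorm_mono (h l)

theorem pnorm_add_le (hp0 : p ≠ 0) {A : (Fin d → ℝ) → ℝ≥0∞} (B : (Fin d → ℝ) → ℝ≥0∞)
    (hA : AEMeasurable A (volume.restrict (cell d))) :
    pnorm p (fun x => A x + B x) ≤ quasiConst p * (pnorm p A + pnorm p B) := by
  by_cases h : p = ⊤
  · subst h
    simp only [pnorm_top]
    refine le_trans ?_ (le_mul_of_one_le_left zero_le (one_le_quasiConst _))
    exact iSup₂_le fun x hx => add_le_add (le_iSup₂ (f := fun x _ => A x) x hx)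
      (le_iSup₂ (f := fun x _ => B x) x hx)
  · have h1 := rpow_add_le_quasiConst hp0
    simp only [ex_of_ne_top h] at h1
    simp only [pnorm_of_ne_top h]
    refine (lintegral_mono fun x => h1 (A x) (B x)).trans ?_
    rw [lintegral_const_mul' _ _ (quasiConst_ne_top p), lintegral_add_left' (hA.pow_const _)]

theorem qnorm_add_le (hp0 : p ≠ 0) {A : (Fin d → ℝ) → (Fin d → ℝ) → ℝ≥0∞}
    (B : (Fin d → ℝ) → (Fin d → ℝ) → ℝ≥0∞)
    (hA : ∀ l, AEMeasurable (A l) (volume.restrict (cell d)))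
    (hA' : p ≠ ⊤ → AEMeasurable (fun l => pnorm p (A l)) (volume.restrict (cell d))) :
    qnorm p (fun l x => A l x + B l x) ≤ quasiConst p * (qnorm p A + qnorm p B) := by
  by_cases h : p = ⊤
  · subst h
    simp only [qnorm_top]
    refine iSup₂_le fun l hl => (pnorm_add_le hp0 (B l) (hA l)).trans ?_
    gcongr
    · exact le_iSup₂ (f := fun l _ => pnorm ⊤ (A l)) l hl
    · exact le_iSup₂ (f := fun l _ => pnorm ⊤ (B l)) l hl
  · simp only [qnorm_of_ne_top h]
    refine (lintegral_mono fun l => pnorm_add_le hp0 (B l) (hA l)).trans ?_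
    rw [lintegral_const_mul' _ _ (quasiConst_ne_top p), lintegral_add_left' (hA' h)]

/-- The measure factor of functions that do not depend on the shift. -/
noncomputable def cellConst (d : ℕ) (p : ℝ≥0∞) : ℝ≥0∞ := if p = ⊤ then 1 else volume (cell d)

theorem cellConst_ne_top (d : ℕ) (p : ℝ≥0∞) : cellConst d p ≠ ⊤ := by
  unfold cellConst; split_ifs
  · simp
  · exact (volume_cell_lt_top d).ne

theorem qnorm_const_le (p : ℝ≥0∞) (A : (Fin d → ℝ) → ℝ≥0∞) :
    qnorm p (fun _ => A) ≤ cellConst d p * pnorm p A := by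
  unfold qnorm cellConst; split_ifs
  · rw [one_mul]; exact iSup₂_le fun _ _ => le_rfl
  · rw [setLIntegral_const, mul_comm]

theorem qnorm_add_const_le (hp0 : p ≠ 0) {A : (Fin d → ℝ) → ℝ≥0∞}
    (B : (Fin d → ℝ) → (Fin d → ℝ) → ℝ≥0∞)
    (hA : AEMeasurable A (volume.restrict (cell d))) :
    qnorm p (fun l x => A x + B l x) ≤
      quasiConst p * (cellConst d p * pnorm p A + qnorm p B) := by
  refine (qnorm_add_le hp0 (A := fun _ => A) B (fun _ => hA) fun _ => aemeasurable_const).trans ?_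
  gcongr
  exact qnorm_const_le p A

theorem pnorm_const_le (p : ℝ≥0∞) (c : ℝ≥0∞) :
    pnorm p (fun _ : Fin d → ℝ => c) ≤ cellConst d p * c ^ ex p := by
  unfold pnorm cellConst ex; split_ifs with h
  · rw [one_mul, ENNReal.rpow_one]; exact iSup₂_le fun _ _ => le_rfl
  · rw [setLIntegral_const, mul_comm]

theorem pnorm_const_mul (c : ℝ≥0∞) (hc : c ≠ ⊤) (A : (Fin d → ℝ) → ℝ≥0∞) :
    pnorm p (fun x => c * A x) = c ^ ex p * pnorm p A := by
  unfold pnorm ex; split_ifs with h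
  · simp only [ENNReal.mul_iSup, ENNReal.rpow_one]
  · simp only [ENNReal.mul_rpow_of_nonneg _ _ (ENNReal.toReal_nonneg)]
    rw [lintegral_const_mul' _ _ (ENNReal.rpow_lt_top_of_nonneg ENNReal.toReal_nonneg hc).ne]

theorem qnorm_const_mul (c : ℝ≥0∞) (hc : c ≠ ⊤) (H : (Fin d → ℝ) → (Fin d → ℝ) → ℝ≥0∞)
    (hp0 : p ≠ 0) : qnorm p (fun l x => c * H l x) = c ^ ex p * qnorm p H := by
  unfold qnorm
  simp only [pnorm_const_mul c hc _]
  split_ifs with h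
  · simp only [ENNReal.mul_iSup]
  · rw [lintegral_const_mul' _ _ (ENNReal.rpow_lt_top_of_nonneg (ex_pos hp0).le hc).ne]

theorem exists_mem_cell_per {Y : Type*} {f : (Fin d → ℝ) → Y} (hf : Per f) (x : Fin d → ℝ) :
    ∃ y ∈ cell d, f y = f x := by
  have hT : 0 < 2 * π := by positivity
  refine ⟨x - latVec (2 * π) fun i => ⌊x i / (2 * π)⌋, (mem_cube_iff_floor hT x _).1 rfl, ?_⟩
  rw [← hf _ fun i => ⌊x i / (2 * π)⌋, sub_add_cancel]

theorem Per.le_pnorm_top {g : (Fin d → ℝ) → ℝ≥0∞} (hg : Per g) (x : Fin d → ℝ) :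
    g x ≤ pnorm ⊤ g := by
  obtain ⟨y, hy, h⟩ := exists_mem_cell_per hg x
  rw [pnorm_top, ← h]
  exact le_iSup₂ (f := fun x _ => g x) y hy

end

section

variable {d N : ℕ} {K : (Fin d → ℝ) → ℂ}

/-- All N^d shifted kernels have the same integral over the cell, so a pointwise bound for their sum
bounds N^d times a single integral. -/
theorem Per.lintegral_kernel_le (hK : Per K) (hKc : Continuous K) {s : ℝ} {B : ℝ≥0∞}
    (hB : ∀ x, ∑ k : Fin d → Fin N, ‖K (x - inode N (fz k))‖ₑ ^ s ≤ B) :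
    (N : ℝ≥0∞) ^ d * ∫⁻ x in cell d, ‖K x‖ₑ ^ s ≤ volume (cell d) * B := by
  have h1 : ∀ k : Fin d → Fin N, ∫⁻ x in cell d, ‖K (x - inode N (fz k))‖ₑ ^ s =
      ∫⁻ x in cell d, ‖K x‖ₑ ^ s := fun k =>
    Per.setLIntegral_sub (g := fun x => ‖K x‖ₑ ^ s) (hK.comp fun z => ‖z‖ₑ ^ s) _
  calc (N : ℝ≥0∞) ^ d * ∫⁻ x in cell d, ‖K x‖ₑ ^ s
      = ∑ k : Fin d → Fin N, ∫⁻ x in cell d, ‖K (x - inode N (fz k))‖ₑ ^ s := by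
        simp [h1]
    _ = ∫⁻ x in cell d, ∑ k : Fin d → Fin N, ‖K (x - inode N (fz k))‖ₑ ^ s := by
        rw [lintegral_finsetSum]
        exact fun k _ => ((hKc.comp (continuous_sub_right _)).measurable.enorm.pow_const _)
    _ ≤ ∫⁻ x in cell d, B := lintegral_mono hB
    _ = volume (cell d) * B := by rw [setLIntegral_const, mul_comm]

/-- Integrating over x first produces the integral of the kernel, and integrating over the shift l
then produces the integral of h. Without the average over l, point values of h would remain. -/
theorem lintegral_sum_kernel_mul_le (hK : Per K) (hKc : Continuous K) {s : ℝ}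
    {B : ℝ≥0∞} (hB : ∀ x, ∑ k : Fin d → Fin N, ‖K (x - inode N (fz k))‖ₑ ^ s ≤ B)
    {h : (Fin d → ℝ) → ℝ≥0∞} (hh : Per h) (hm : AEMeasurable h) :
    ∫⁻ l in cell d, ∫⁻ x in cell d, ∑ k : Fin d → Fin N,
      h (inode N (fz k) + l) * ‖K (x - inode N (fz k) - l)‖ₑ ^ s ≤
      volume (cell d) * B * ∫⁻ x in cell d, h x := by
  set I := ∫⁻ x in cell d, ‖K x‖ₑ ^ s with hI
  have hKm : ∀ y, Measurable fun x => ‖K (x - y)‖ₑ ^ s := fun y =>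
    (hKc.comp (continuous_sub_right _)).measurable.enorm.pow_const _
  have h1 : ∀ l, ∫⁻ x in cell d, ∑ k : Fin d → Fin N,
      h (inode N (fz k) + l) * ‖K (x - inode N (fz k) - l)‖ₑ ^ s =
      ∑ k : Fin d → Fin N, h (inode N (fz k) + l) * I := by
    intro l
    simp only [sub_sub]
    rw [lintegral_finsetSum _ fun k _ => (hKm _).const_mul _]
    refine Finset.sum_congr rfl fun k _ => ?_
    rw [lintegral_const_mul _ (hKm _)]
    congr 1
    exact Per.setLIntegral_sub (g := fun x => ‖K x‖ₑ ^ s) (hK.comp fun z => ‖z‖ₑ ^ s) _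
  simp only [h1]
  have hhm : ∀ y, AEMeasurable (fun l => h (y + l)) (volume.restrict (cell d)) := fun y =>
    (hm.comp_quasiMeasurePreserving (quasiMeasurePreserving_add_left volume y)).restrict
  rw [lintegral_finsetSum' _ fun k _ => (hhm _).mul_const _]
  have h2 : ∀ k : Fin d → Fin N, ∫⁻ l in cell d, h (inode N (fz k) + l) * I =
      (∫⁻ x in cell d, h x) * I := by
    intro k
    rw [lintegral_mul_const'' _ (hhm _)]
    congr 1
    simp only [add_comm (inode N (fz k))]
    exact hh.setLIntegral_add _
  simp only [h2]
  calc _ = ((N : ℝ≥0∞) ^ d * I) * ∫⁻ x in cell d, h x := by simp; ring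
    _ ≤ _ := by exact mul_le_mul_left (hK.lintegral_kernel_le hKc hB) _

theorem enorm_sampleOp_le (hN : 0 < N) (l : Fin d → ℝ) (g : (Fin d → ℝ) → ℂ) (x : Fin d → ℝ) :
    ‖sampleOp N K l g x‖ₑ ≤ ((N : ℝ≥0∞) ^ d)⁻¹ * ∑ k : Fin d → Fin N,
      ‖g (inode N (fz k) + l)‖ₑ * ‖K (x - inode N (fz k) - l)‖ₑ := by
  rw [sampleOp, enorm_mul]
  have h1 : ‖((N : ℂ) ^ d)⁻¹‖ₑ = ((N : ℝ≥0∞) ^ d)⁻¹ := by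
    rw [enorm_inv (pow_ne_zero _ (by exact_mod_cast hN.ne')), enorm_pow]
    congr 2
    rw [← ofReal_norm, Complex.norm_natCast, ENNReal.ofReal_natCast]
  rw [h1]
  gcongr
  refine (enorm_sum_le _ _).trans (le_of_eq ?_)
  simp only [enorm_mul]

end

theorem inv_pow_rpow_mul_le_one {d n N : ℕ} (hn : 0 < n) (hnN : n ≤ N) {s : ℝ} (hs : 0 ≤ s) :
    (((N : ℝ≥0∞) ^ d)⁻¹) ^ s * ENNReal.ofReal ((n : ℝ) ^ (d * s)) ≤ 1 := by
  have h1 : ENNReal.ofReal ((n : ℝ) ^ (d * s)) = ((n : ℝ≥0∞) ^ d) ^ s := by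
    rw [rpow_mul (by positivity), rpow_natCast, ← ENNReal.ofReal_rpow_of_nonneg (by positivity) hs,
      ENNReal.ofReal_pow (by positivity), ENNReal.ofReal_natCast]
  rw [h1, ← ENNReal.mul_rpow_of_nonneg _ _ hs]
  refine ENNReal.rpow_le_one ?_ hs
  rw [← ENNReal.div_eq_inv_mul]
  refine ENNReal.div_le_of_le_mul ?_
  rw [one_mul]
  gcongr

/-- The sampling weights of a symbol have uniformly bounded sums. -/
theorem IsSymbol.exists_sum_weights_le {d : ℕ} {ψ : EuclideanSpace ℝ (Fin d) → ℂ} {a R : ℝ}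
    (hψ : IsSymbol a R ψ) (ha : (d : ℝ) < a) :
    ∃ C : ℝ≥0∞, C ≠ ⊤ ∧
      (∀ n N : ℕ, 0 < N → N ≤ 5 * n → ∀ x : Fin d → ℝ,
        ∑ k : Fin d → Fin N, ‖symKernel ψ n (x - inode N (fz k))‖ₑ ^ (1 : ℝ) ≤
          C * ENNReal.ofReal ((n : ℝ) ^ (d * (1 : ℝ)))) ∧
      ∀ n N : ℕ, 0 < n → n ≤ N → N ≤ 5 * n → ∀ l x : Fin d → ℝ, ∑ k : Fin d → Fin N,
        ((N : ℝ≥0∞) ^ d)⁻¹ * ‖symKernel ψ n (x - inode N (fz k) - l)‖ₑ ≤ C := by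
  obtain ⟨C₁, hC₁, hb₁⟩ := exists_sum_symKernel_rpow_le hψ ha one_pos le_rfl (by simpa using ha)
  refine ⟨C₁, hC₁, hb₁, fun n N hn hnN hN l x => ?_⟩
  have h1 := hb₁ n N (hn.trans_le hnN) hN (x - l)
  simp only [ENNReal.rpow_one] at h1
  simp only [sub_right_comm x _ l]
  rw [← Finset.mul_sum]
  refine (mul_le_mul_right h1 _).trans ?_
  have h2 := inv_pow_rpow_mul_le_one (d := d) hn hnN zero_le_one
  rw [ENNReal.rpow_one] at h2
  calc _ = C₁ * (((N : ℝ≥0∞) ^ d)⁻¹ * ENNReal.ofReal ((n : ℝ) ^ (d * (1 : ℝ)))) := by ring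
    _ ≤ C₁ * 1 := by gcongr
    _ = C₁ := mul_one _

/-- Uniform boundedness of the sampling operators of a symbol with decaying Fourier transform. -/
theorem IsSymbol.exists_qnorm_sampleOp_le {d : ℕ} {ψ : EuclideanSpace ℝ (Fin d) → ℂ} {a R : ℝ}
    (hψ : IsSymbol a R ψ) (ha : (d : ℝ) < a) {p : ℝ≥0∞} (hp0 : p ≠ 0)
    (hpa : p ≠ ⊤ → (d : ℝ) < a * p.toReal) :
    ∃ C : ℝ≥0∞, C ≠ ⊤ ∧ ∀ n N : ℕ, 0 < n → n ≤ N → N ≤ 5 * n → ∀ g : (Fin d → ℝ) → ℂ,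
      Per g → AEMeasurable g →
      qnorm p (fun l x => ‖sampleOp N (symKernel ψ n) l g x‖ₑ) ≤ C * pnorm p fun x => ‖g x‖ₑ := by
  obtain ⟨C₁, hC₁, hb₁, hW⟩ := hψ.exists_sum_weights_le ha
  by_cases hp : p = ⊤
  · subst hp
    refine ⟨C₁, hC₁, fun n N hn hnN hN g hg _ => ?_⟩
    rw [qnorm_top]
    refine iSup₂_le fun l _ => ?_
    conv_lhs => rw [pnorm_top]
    refine iSup₂_le fun x _ => ?_
    refine (enorm_sampleOp_le (hn.trans_le hnN) l g x).trans ?_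
    rw [Finset.mul_sum]
    calc _ ≤ ∑ k : Fin d → Fin N, ((N : ℝ≥0∞) ^ d)⁻¹ *
          ‖symKernel ψ n (x - inode N (fz k) - l)‖ₑ * pnorm ⊤ fun x => ‖g x‖ₑ := by
          refine Finset.sum_le_sum fun k _ => ?_
          have := Per.le_pnorm_top (g := fun x => ‖g x‖ₑ) (hg.comp fun z => ‖z‖ₑ)
            (inode N (fz k) + l)
          rw [mul_comm ‖g _‖ₑ, ← mul_assoc]
          gcongr
      _ ≤ _ := by
          rw [← Finset.sum_mul]
          gcongr
          exact hW n N hn hnN hN l x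
  have hpr : 0 < p.toReal := ENNReal.toReal_pos hp0 hp
  -- For p ≤ 1 the p-th power is subadditive, and the condition d < a p bounds the grid sums of
  -- |K|^p. For p ≥ 1 the sums of |K| suffice, by a weighted Hölder inequality.
  rcases le_total p.toReal 1 with hp1 | hp1
  · obtain ⟨C, hC, hb⟩ := exists_sum_symKernel_rpow_le hψ ha hpr hp1 (hpa hp)
    refine ⟨volume (cell d) * C, ENNReal.mul_ne_top (volume_cell_lt_top d).ne hC,
      fun n N hn hnN hN g hg hgm => ?_⟩
    have hN0 := hn.trans_le hnN
    simp only [qnorm_of_ne_top hp, pnorm_of_ne_top hp]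
    set ν : ℝ≥0∞ := ((N : ℝ≥0∞) ^ d)⁻¹ with hν
    have hνt : ν ≠ ⊤ := by rw [hν]; simp [hN0.ne']
    calc _ ≤ ∫⁻ l in cell d, ∫⁻ x in cell d, ν ^ p.toReal * ∑ k : Fin d → Fin N,
          ‖g (inode N (fz k) + l)‖ₑ ^ p.toReal *
            ‖symKernel ψ n (x - inode N (fz k) - l)‖ₑ ^ p.toReal := by
          refine lintegral_mono fun l => lintegral_mono fun x => ?_
          refine (ENNReal.rpow_le_rpow (enorm_sampleOp_le hN0 l g x) hpr.le).trans ?_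
          rw [ENNReal.mul_rpow_of_nonneg _ _ hpr.le]
          gcongr
          refine (ennreal_rpow_sum_le _ _ hpr hp1).trans (le_of_eq ?_)
          simp only [ENNReal.mul_rpow_of_nonneg _ _ hpr.le]
      _ = ν ^ p.toReal * ∫⁻ l in cell d, ∫⁻ x in cell d, ∑ k : Fin d → Fin N,
          ‖g (inode N (fz k) + l)‖ₑ ^ p.toReal *
            ‖symKernel ψ n (x - inode N (fz k) - l)‖ₑ ^ p.toReal := by
          have ht : ν ^ p.toReal ≠ ⊤ := (ENNReal.rpow_lt_top_of_nonneg hpr.le hνt).ne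
          simp only [lintegral_const_mul' _ _ ht]
      _ ≤ ν ^ p.toReal * (volume (cell d) * (C * ENNReal.ofReal ((n : ℝ) ^ (d * p.toReal))) *
          ∫⁻ x in cell d, ‖g x‖ₑ ^ p.toReal) := by
          gcongr
          exact lintegral_sum_kernel_mul_le (per_symKernel ψ n) (hψ.continuous_symKernel hn)
            (hb n N hN0 hN) (hg.comp fun z => ‖z‖ₑ ^ p.toReal) (hgm.enorm.pow_const _)
      _ = (ν ^ p.toReal * ENNReal.ofReal ((n : ℝ) ^ (d * p.toReal))) * (volume (cell d) * C *
          ∫⁻ x in cell d, ‖g x‖ₑ ^ p.toReal) := by ring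
      _ ≤ 1 * _ := by gcongr; exact inv_pow_rpow_mul_le_one hn hnN hpr.le
      _ = _ := one_mul _
  · refine ⟨C₁ ^ (p.toReal - 1) * (volume (cell d) * C₁), ENNReal.mul_ne_top
      (ENNReal.rpow_lt_top_of_nonneg (by linarith) hC₁).ne
      (ENNReal.mul_ne_top (volume_cell_lt_top d).ne hC₁), fun n N hn hnN hN g hg hgm => ?_⟩
    have hN0 := hn.trans_le hnN
    simp only [qnorm_of_ne_top hp, pnorm_of_ne_top hp]
    set ν : ℝ≥0∞ := ((N : ℝ≥0∞) ^ d)⁻¹ with hν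
    have hνt : ν ≠ ⊤ := by rw [hν]; simp [hN0.ne']
    have hCt : C₁ ^ (p.toReal - 1) ≠ ⊤ := (ENNReal.rpow_lt_top_of_nonneg (by linarith) hC₁).ne
    calc _ ≤ ∫⁻ l in cell d, ∫⁻ x in cell d, C₁ ^ (p.toReal - 1) * (ν * ∑ k : Fin d → Fin N,
          ‖g (inode N (fz k) + l)‖ₑ ^ p.toReal *
            ‖symKernel ψ n (x - inode N (fz k) - l)‖ₑ ^ (1 : ℝ)) := by
          refine lintegral_mono fun l => lintegral_mono fun x => ?_
          set w : (Fin d → Fin N) → ℝ≥0∞ := fun k =>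
            ν * ‖symKernel ψ n (x - inode N (fz k) - l)‖ₑ with hw
          have h1 : ‖sampleOp N (symKernel ψ n) l g x‖ₑ ≤
              ∑ k, w k * ‖g (inode N (fz k) + l)‖ₑ := by
            refine (enorm_sampleOp_le hN0 l g x).trans (le_of_eq ?_)
            rw [Finset.mul_sum]
            exact Finset.sum_congr rfl fun k _ => by simp only [hw]; ring
          -- The weights w have sum at most C₁, uniformly in l and x. Hölder's inequality moves the
          -- p-th power onto |g| and leaves one factor w.
          have h2 := ENNReal.inner_le_weight_mul_Lp_of_nonneg Finset.univ hp1 w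
            fun k => ‖g (inode N (fz k) + l)‖ₑ
          refine (ENNReal.rpow_le_rpow (h1.trans h2) hpr.le).trans ?_
          rw [ENNReal.mul_rpow_of_nonneg _ _ hpr.le, ← ENNReal.rpow_mul, ← ENNReal.rpow_mul,
            inv_mul_cancel₀ hpr.ne', ENNReal.rpow_one, sub_mul, one_mul, inv_mul_cancel₀ hpr.ne']
          refine mul_le_mul' (ENNReal.rpow_le_rpow (hW n N hn hnN hN l x) (by linarith))
            (le_of_eq ?_)
          rw [Finset.mul_sum]
          exact Finset.sum_congr rfl fun k _ => by simp only [hw, ENNReal.rpow_one]; ring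
      _ = C₁ ^ (p.toReal - 1) * (ν * ∫⁻ l in cell d, ∫⁻ x in cell d, ∑ k : Fin d → Fin N,
          ‖g (inode N (fz k) + l)‖ₑ ^ p.toReal *
            ‖symKernel ψ n (x - inode N (fz k) - l)‖ₑ ^ (1 : ℝ)) := by
          simp only [lintegral_const_mul' _ _ hCt, lintegral_const_mul' _ _ hνt]
      _ ≤ C₁ ^ (p.toReal - 1) * (ν * (volume (cell d) *
          (C₁ * ENNReal.ofReal ((n : ℝ) ^ (d * (1 : ℝ)))) *
          ∫⁻ x in cell d, ‖g x‖ₑ ^ p.toReal)) := by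
          gcongr
          exact lintegral_sum_kernel_mul_le (per_symKernel ψ n) (hψ.continuous_symKernel hn)
            (hb₁ n N hN0 hN) (hg.comp fun z => ‖z‖ₑ ^ p.toReal) (hgm.enorm.pow_const _)
      _ = (ν ^ (1 : ℝ) * ENNReal.ofReal ((n : ℝ) ^ (d * (1 : ℝ)))) *
          (C₁ ^ (p.toReal - 1) * (volume (cell d) * C₁) *
          ∫⁻ x in cell d, ‖g x‖ₑ ^ p.toReal) := by rw [ENNReal.rpow_one]; ring
      _ ≤ 1 * _ := by gcongr; exact inv_pow_rpow_mul_le_one hn hnN zero_le_one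
      _ = _ := one_mul _

/-! ### Convergence when the transform of the symbol decays. -/

section

variable {d : ℕ} {p : ℝ≥0∞}

theorem exists_ofReal_rpow_le {e : ℝ} (he : 0 < e) {ε : ℝ≥0∞} (hε : ε ≠ 0) :
    ∃ η : ℝ, 0 < η ∧ ENNReal.ofReal η ^ e ≤ ε := by
  have h1 : Tendsto (fun η : ℝ => ENNReal.ofReal η ^ e) (𝓝[>] 0) (𝓝 0) := by
    have h2 := ((ENNReal.continuous_rpow_const (y := e)).comp ENNReal.continuous_ofReal).tendsto
      (0 : ℝ)
    simp only [Function.comp, ENNReal.ofReal_zero, ENNReal.zero_rpow_of_pos he] at h2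
    exact h2.mono_left nhdsWithin_le_nhds
  obtain ⟨η, h3, h4⟩ := ((h1.eventually_le_const (pos_iff_ne_zero.2 hε)).and
    self_mem_nhdsWithin).exists
  exact ⟨η, h4, h3⟩

theorem tendsto_torusNormBar_iff (hp0 : p ≠ 0) {E : Type*} [ENorm E]
    (F : ℕ → (Fin d → ℝ) → (Fin d → ℝ) → E) :
    Tendsto (fun n => torusNormBar p (F n)) atTop (𝓝 0) ↔
      Tendsto (fun n => qnorm p fun l x => ‖F n l x‖ₑ) atTop (𝓝 0) := by
  have he := ex_pos hp0
  simp only [torusNormBar_eq_qnorm hp0]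
  constructor
  · intro h
    have h1 := ((ENNReal.continuous_rpow_const (y := ex p)).tendsto 0).comp h
    rw [ENNReal.zero_rpow_of_pos he] at h1
    refine h1.congr fun n => ?_
    simp only [Function.comp, ← ENNReal.rpow_mul, one_div, inv_mul_cancel₀ he.ne', ENNReal.rpow_one]
  · intro h
    have h1 := ((ENNReal.continuous_rpow_const (y := 1 / ex p)).tendsto 0).comp h
    rw [ENNReal.zero_rpow_of_pos (by positivity)] at h1
    exact h1

theorem tendsto_zero_of_eventually_le {u : ℕ → ℝ≥0∞} {C : ℝ≥0∞} (hC : C ≠ ⊤)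
    (h : ∀ ε : ℝ≥0∞, ε ≠ 0 → ∀ᶠ n in atTop, u n ≤ C * ε) : Tendsto u atTop (𝓝 0) := by
  rw [ENNReal.tendsto_nhds_zero]
  intro ε hε
  have hC1 : C + 1 ≠ ⊤ := by simp [hC]
  filter_upwards [h (ε / (C + 1)) (ENNReal.div_ne_zero.2 ⟨hε.ne', hC1⟩)] with n hn
  refine hn.trans ?_
  calc C * (ε / (C + 1)) ≤ (C + 1) * (ε / (C + 1)) := by gcongr; exact le_self_add
    _ = ε := ENNReal.mul_div_cancel (by simp) hC1

theorem pnorm_le_of_torusNorm_le (hp0 : p ≠ 0) {f : (Fin d → ℝ) → ℂ} {ε : ℝ≥0∞}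
    (h : torusNorm p f ≤ ε ^ (1 / ex p)) : pnorm p (fun x => ‖f x‖ₑ) ≤ ε := by
  rw [torusNorm_eq_pnorm hp0] at h
  exact (ENNReal.rpow_le_rpow_iff (by have := ex_pos hp0; positivity)).1 h

theorem MemT.exists_trigPoly_pnorm (hp0 : p ≠ 0) {h : (Fin d → ℝ) → ℂ}
    (hh : MemT p h) {ε : ℝ≥0∞} (hε : ε ≠ 0) :
    ∃ n, ∃ T ∈ trigPoly d n, pnorm p (fun x => ‖h x - T x‖ₑ) ≤ ε := by
  have he := ex_pos hp0
  obtain ⟨n, T, hT, hb⟩ := hh.exists_trigPoly hp0 (ε := ε ^ (1 / ex p))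
    (by simp [hε, not_lt.2 he.le])
  exact ⟨n, T, hT, pnorm_le_of_torusNorm_le hp0 hb⟩

/-- Convergence of the sampling operators of a symbol with decaying Fourier transform. -/
theorem IsSymbol.tendsto_qnorm {m : ℕ} {ψ : EuclideanSpace ℝ (Fin d) → ℂ} {a : ℝ}
    (hψ : IsSymbol a m ψ) (ha : (d : ℝ) < a) (hp0 : p ≠ 0) (hpa : p ≠ ⊤ → (d : ℝ) < a * p.toReal)
    (h0 : ψ 0 = 1) {N : ℕ → ℕ} (hN : ∀ n, m * n + n < N n) (hN5 : ∀ n, 0 < n → N n ≤ 5 * n)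
    {f : (Fin d → ℝ) → ℂ} (hf : MemT p f) :
    Tendsto (fun n => qnorm p fun l x => ‖f x - sampleOp (N n) (symKernel ψ n) l f x‖ₑ)
      atTop (𝓝 0) := by
  obtain ⟨C, hC, hb⟩ := hψ.exists_qnorm_sampleOp_le ha hp0 hpa
  have he := ex_pos hp0
  have hq := quasiConst_ne_top p
  have hc := cellConst_ne_top d p
  refine tendsto_zero_of_eventually_le (C := quasiConst p * (cellConst d p + quasiConst p *
    (cellConst d p * cellConst d p + C))) (by finiteness) fun ε hε => ?_
  obtain ⟨M, T, hT, hfT⟩ := hf.exists_trigPoly_pnorm hp0 hε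
  have hTc := continuous_of_mem_trigPoly hT
  obtain ⟨η, hη0, hη⟩ := exists_ofReal_rpow_le he hε
  filter_upwards [eventually_norm_sampleOp_sub_le hN hψ hT η hη0, eventually_gt_atTop 0]
    with n hn hn0
  have hnN : n ≤ N n := (Nat.le_add_left _ _).trans (hN n).le
  have hg : Per fun x => T x - f x := fun x m => by
    simp only [per_of_mem_trigPoly hT x m, hf.1 x m]
  have hgm : AEMeasurable fun x => T x - f x :=
    hTc.measurable.aemeasurable.sub hf.aemeasurable
  have hS := hb n (N n) hn0 hnN (hN5 n hn0) _ hg hgm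
  calc _ ≤ qnorm p fun l x => ‖f x - T x‖ₑ + (ENNReal.ofReal η +
        ‖sampleOp (N n) (symKernel ψ n) l (fun x => T x - f x) x‖ₑ) := by
        refine qnorm_mono fun l x => ?_
        -- Splitting f - Sf = (f - T) - (ST - T) + S(T - f): density controls the first term,
        -- convergence on polynomials the second, uniform boundedness the third.
        have h1 : f x - sampleOp (N n) (symKernel ψ n) l f x = (f x - T x) +
            (-(sampleOp (N n) (symKernel ψ n) l T x - ψ 0 * T x) +
              sampleOp (N n) (symKernel ψ n) l (T - f) x) := by
          rw [sampleOp_sub, h0]; ring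
        rw [h1]
        refine (enorm_add_le _ _).trans (add_le_add le_rfl ((enorm_add_le _ _).trans
          (add_le_add ?_ le_rfl)))
        rw [enorm_neg, ← ofReal_norm]
        exact ENNReal.ofReal_le_ofReal (hn l x)
    _ ≤ quasiConst p * (cellConst d p * ε + quasiConst p * (cellConst d p *
          (cellConst d p * ε) + C * ε)) := by
        refine (qnorm_add_const_le hp0 _
          (hf.aemeasurable.sub hTc.measurable.aemeasurable).enorm.restrict).trans ?_
        gcongr
        · exact hfT
        refine (qnorm_add_const_le hp0 (A := fun _ => ENNReal.ofReal η) _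
          aemeasurable_const).trans ?_
        gcongr
        · exact (pnorm_const_le p _).trans (by gcongr)
        · refine hS.trans ?_
          gcongr
          refine le_trans (pnorm_mono fun x => ?_) hfT
          rw [enorm_sub_rev]
    _ = _ := by ring

end

/-! ### The Bochner–Riesz means as sampling operators. -/

/-- The symbol `(1 - |ξ|^β)_+^δ`. -/
noncomputable def rieszSymbol (d : ℕ) (β δ : ℝ) : EuclideanSpace ℝ (Fin d) → ℂ :=
  radial (EuclideanSpace ℝ (Fin d)) (rieszProfile β δ)

theorem kernel_eq_symKernel {d n : ℕ} (hn : 0 < n) (β δ : ℝ) (x : Fin d → ℝ) :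
    kernel β δ n x = symKernel (rieszSymbol d β δ) n x := by
  have hn' : (0 : ℝ) < n := by exact_mod_cast hn
  refine tsum_congr fun k => ?_
  rw [expo]
  congr 2
  have h0 : 0 ≤ latticeNorm k / n := div_nonneg (sqrt_nonneg _) hn'.le
  have h1 : ‖(n : ℝ)⁻¹ • lat k‖ = latticeNorm k / n := by
    rw [norm_smul, norm_inv, Real.norm_of_nonneg hn'.le, latticeNorm_eq, div_eq_inv_mul]
  have h2 : ((latticeNorm k / n) ^ 2) ^ (β / 2) = latticeNorm k ^ β / (n : ℝ) ^ β := by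
    rw [← rpow_natCast, ← rpow_mul h0, ← div_rpow (show 0 ≤ latticeNorm k from sqrt_nonneg _) hn'.le]
    congr 1; push_cast; ring
  rw [rieszProfile, h1, max_eq_left (sq_nonneg (latticeNorm k / (n : ℝ))), h2]

theorem node_eq_inode {d n : ℕ} (k : Fin d → Fin (2 * n + 1)) :
    node n k = inode (2 * n + 1) (fz k) := by
  ext i; simp [node, inode, fz]

theorem polyOp_eq_sampleOp {d n : ℕ} (hn : 0 < n) (β δ : ℝ) (l : Fin d → ℝ) (f : (Fin d → ℝ) → ℝ)
    (x : Fin d → ℝ) :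
    polyOp β δ n l f x =
      sampleOp (2 * n + 1) (symKernel (rieszSymbol d β δ) n) l (fun x => (f x : ℂ)) x := by
  simp only [polyOp, sampleOp, node_eq_inode, kernel_eq_symKernel hn]
  push_cast
  rfl

/-- The original operators are identified with the sampling operators for n > 0 only, which does not
matter for a limit. -/
theorem familyConverges_iff {d : ℕ} {p : ℝ≥0∞} (hp0 : p ≠ 0) (β δ : ℝ) :
    FamilyConverges d p β δ ↔ ∀ f : (Fin d → ℝ) → ℝ, MemTorusLp p f →
      Tendsto (fun n : ℕ => qnorm p fun (l x : Fin d → ℝ) => ‖(f x : ℂ) -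
        sampleOp (2 * n + 1) (symKernel (rieszSymbol d β δ) n) l (fun x => (f x : ℂ)) x‖ₑ)
        atTop (𝓝 0) := by
  refine forall₂_congr fun f _ => ?_
  rw [tendsto_torusNormBar_iff hp0]
  refine tendsto_congr' ?_
  filter_upwards [eventually_gt_atTop 0] with n hn
  simp only [polyOp_eq_sampleOp hn]

theorem rieszSymbol_zero {d : ℕ} {β : ℝ} (hβ : 0 < β) (δ : ℝ) : rieszSymbol d β δ 0 = 1 := by
  simp [rieszSymbol, radial, rieszProfile, zero_rpow (by positivity : β / 2 ≠ 0)]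

theorem rieszSymbol_eq_zero {d : ℕ} {β δ : ℝ} (hβ : 0 < β) (hδ : 0 < δ)
    {v : EuclideanSpace ℝ (Fin d)} (hv : 1 ≤ ‖v‖) : rieszSymbol d β δ v = 0 := by
  rw [rieszSymbol, radial, rieszProfile_eq_zero hβ hδ (by nlinarith), Complex.ofReal_zero]

theorem isSymbol_riesz {β δ : ℝ} (hβ : 0 < β) (hδ : 0 < δ) (n : ℕ) {a : ℝ}
    (h1 : a ≤ δ + n / 2 + 1) (h2 : (∃ m : ℕ, 0 < m ∧ β = 2 * m) ∨ a ≤ n + 1 + β) :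
    IsSymbol a (1 : ℕ) (rieszSymbol (n + 1) β δ) where
  continuous := continuous_radial (continuous_rieszProfile hβ hδ).continuousOn
  support v hv := rieszSymbol_eq_zero hβ hδ (by simpa using hv)
  decay := hasDecay_fourier_rieszProfile hβ hδ n h1 h2

/-- The sufficiency half of the theorem. The exponent a is any admissible order of decay of the
transform, and 2n + 1 nodes per axis exceed n + n, which excludes aliasing with frequencies up to n.
-/
theorem familyConverges_of_decay {β δ : ℝ} (hβ : 0 < β) (hδ : 0 < δ) (n : ℕ) {a : ℝ}
    (h1 : a ≤ δ + n / 2 + 1) (h2 : (∃ m : ℕ, 0 < m ∧ β = 2 * m) ∨ a ≤ n + 1 + β)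
    (ha : ((n + 1 : ℕ) : ℝ) < a) {p : ℝ≥0∞} (hp0 : p ≠ 0)
    (hpa : p ≠ ⊤ → ((n + 1 : ℕ) : ℝ) < a * p.toReal) : FamilyConverges (n + 1) p β δ := by
  rw [familyConverges_iff hp0]
  intro f hf
  exact (isSymbol_riesz hβ hδ n h1 h2).tendsto_qnorm ha hp0 hpa (rieszSymbol_zero hβ δ)
    (N := fun n => 2 * n + 1) (fun n => by omega) (fun n hn => by omega) hf.memT

/-! ### Comparison of two exponents β for p ≥ 1. -/

/-- The low frequency part of the symbol. -/
theorem isSymbol_riesz_cutoff {β δ : ℝ} (hβ : 0 < β) (hδ : 0 < δ) (n : ℕ) :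
    IsSymbol (((n + 1 : ℕ) : ℝ) + β) (1 : ℕ) (radial (EuclideanSpace ℝ (Fin (n + 1)))
      fun u => rieszProfile β δ u * cutoff u) where
  continuous := continuous_radial ((continuous_rieszProfile hβ hδ).mul
    (contDiff_cutoff 0).continuous).continuousOn
  support v hv := by
    rw [radial, rieszProfile_eq_zero hβ hδ (by rw [Nat.cast_one] at hv; nlinarith), zero_mul,
      Complex.ofReal_zero]
  decay := by
    have := hasDecay_fourier_rieszProfile_mul_cutoff (E := EuclideanSpace ℝ (Fin (n + 1))) hβ hδ
    rwa [finrank_euclideanSpace_fin] at this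

/-- The profile of the multiplier transforming the high frequency parts of two symbols. -/
noncomputable def ratioProfile (β β' δ u : ℝ) : ℝ :=
  (powSlope (β / 2) u / powSlope (β' / 2) u) ^ δ * (1 - cutoff u) * smoothTransition (3 - u)

theorem contDiffAt_ratioProfile {β β' : ℝ} (hβ : 0 < β) (hβ' : 0 < β') (δ : ℝ) (M : ℕ) (u : ℝ) :
    ContDiffAt ℝ M (ratioProfile β β' δ) u := by
  rcases lt_or_ge u (1 / 4) with h | h
  · have : ratioProfile β β' δ =ᶠ[𝓝 u] fun _ => 0 := by
      filter_upwards [Iio_mem_nhds h] with v hv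
      rw [ratioProfile, cutoff_eq_one (le_of_lt hv)]; ring
    exact contDiffAt_const.congr_of_eventuallyEq this
  · have hu : 0 < u := by linarith
    have p1 := powSlope_pos (by positivity : 0 < β / 2) hu
    have p2 := powSlope_pos (by positivity : 0 < β' / 2) hu
    refine ContDiffAt.mul (ContDiffAt.mul ?_ ?_) ?_
    · exact ((analyticAt_powSlope _ hu).contDiffAt.div (analyticAt_powSlope _ hu).contDiffAt
        p2.ne').rpow_const_of_ne (div_pos p1 p2).ne'
    · exact contDiffAt_const.sub (contDiff_cutoff M).contDiffAt
    · exact ((smoothTransition.contDiff (n := M)).comp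
        (contDiff_const.sub contDiff_id)).contDiffAt

theorem isSymbol_ratioProfile {β β' : ℝ} (hβ : 0 < β) (hβ' : 0 < β') (δ : ℝ) (d M : ℕ) :
    IsSymbol (M : ℝ) (2 : ℕ) (radial (EuclideanSpace ℝ (Fin d)) (ratioProfile β β' δ)) where
  continuous := continuous_radial (continuous_iff_continuousAt.2 fun u =>
    (contDiffAt_ratioProfile hβ hβ' δ 0 u).continuousAt).continuousOn
  support v hv := by
    rw [radial, ratioProfile, smoothTransition.zero_of_nonpos
      (by push_cast at hv; nlinarith), mul_zero, Complex.ofReal_zero]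
  decay := hasDecay_fourier_radial (R := 3) (fun u _ => contDiffAt_ratioProfile hβ hβ' δ M u)
    fun u hu => by rw [ratioProfile, smoothTransition.zero_of_nonpos (by linarith), mul_zero]

theorem ratioProfile_zero (β β' δ : ℝ) : ratioProfile β β' δ 0 = 0 := by
  rw [ratioProfile, cutoff_eq_one (by norm_num)]; ring

/-- Inside the ball the two symbols differ by the factor (`powSlope (β / 2)` / `powSlope (β' /
2)`)^δ, which is smooth and positive away from the origin. The factor 1 - `cutoff` removes the
origin, the missing part being the last summand, and the factor in 3 - u equals 1 on the ball. -/
theorem rieszProfile_eq_ratio {β β' δ : ℝ} (hβ : 0 < β) (hβ' : 0 < β') (hδ : 0 < δ) {u : ℝ}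
    (hu : 0 ≤ u) : rieszProfile β δ u =
      rieszProfile β' δ u * ratioProfile β β' δ u + rieszProfile β δ u * cutoff u := by
  rcases hu.eq_or_lt with rfl | hu
  · rw [ratioProfile_zero, cutoff_eq_one (by norm_num)]; ring
  rcases le_or_gt 1 u with h1 | h1
  · rw [rieszProfile_eq_zero hβ hδ h1, rieszProfile_eq_zero hβ' hδ h1]; ring
  · have p1 := powSlope_pos (by positivity : 0 < β / 2) hu
    have p2 := powSlope_pos (by positivity : 0 < β' / 2) hu
    rw [rieszProfile_eq_mul hβ hu, rieszProfile_eq_mul hβ' hu, ratioProfile,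
      smoothTransition.one_of_one_le (by linarith), div_rpow p1.le p2.le]
    have : 0 < powSlope (β' / 2) u ^ δ := by positivity
    field_simp
    ring

section

variable {d : ℕ} {p : ℝ≥0∞} {ψ : EuclideanSpace ℝ (Fin d) → ℂ} {a R : ℝ}

theorem one_le_ex (hp1 : 1 ≤ p) : 1 ≤ ex p := by
  unfold ex; split_ifs with h
  · exact le_rfl
  · rw [← ENNReal.toReal_one]; exact ENNReal.toReal_mono h hp1

/-- The multiplier operator with symbol `ψ(·/n)`, realized as a discrete convolution, is bounded in
`L_p` for `p ≥ 1`. -/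
theorem IsSymbol.exists_pnorm_multiplier_le (hψ : IsSymbol a R ψ) (ha : (d : ℝ) < a) (hp1 : 1 ≤ p) :
    ∃ C : ℝ≥0∞, C ≠ ⊤ ∧ ∀ n N : ℕ, 0 < n → n ≤ N → N ≤ 5 * n → ∀ g : (Fin d → ℝ) → ℂ,
      Per g → AEMeasurable g →
      pnorm p (fun x => ‖sampleOp N (symKernel ψ n) x g x‖ₑ) ≤ C * pnorm p fun x => ‖g x‖ₑ := by
  obtain ⟨C₁, hC₁, -, hW⟩ := hψ.exists_sum_weights_le ha
  -- With the shift equal to the point of evaluation, the kernel is sampled at points independent of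
  -- x. The operator is a finite combination of translations with weights of bounded sum, so no
  -- average over shifts is needed.
  have key : ∀ n N : ℕ, 0 < n → n ≤ N → ∀ (g : (Fin d → ℝ) → ℂ) (x : Fin d → ℝ),
      ‖sampleOp N (symKernel ψ n) x g x‖ₑ ≤ ∑ k : Fin d → Fin N, (((N : ℝ≥0∞) ^ d)⁻¹ *
        ‖symKernel ψ n (0 - inode N (fz k) - 0)‖ₑ) * ‖g (inode N (fz k) + x)‖ₑ := by
    intro n N hn hnN g x
    refine (enorm_sampleOp_le (hn.trans_le hnN) x g x).trans (le_of_eq ?_)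
    rw [Finset.mul_sum]
    refine Finset.sum_congr rfl fun k _ => ?_
    have : x - inode N (fz k) - x = 0 - inode N (fz k) - 0 := by abel
    rw [this]; ring
  by_cases hp : p = ⊤
  · subst hp
    refine ⟨C₁, hC₁, fun n N hn hnN hN g hg _ => ?_⟩
    conv_lhs => rw [pnorm_top]
    refine iSup₂_le fun x _ => (key n N hn hnN g x).trans ?_
    refine le_trans ?_ (mul_le_mul_left (hW n N hn hnN hN 0 0) _)
    rw [Finset.sum_mul]
    gcongr
    exact Per.le_pnorm_top (g := fun x => ‖g x‖ₑ) (hg.comp fun z => ‖z‖ₑ) _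
  · have hp1' : 1 ≤ p.toReal := by simpa [ex_of_ne_top hp] using one_le_ex hp1
    have hpr : 0 < p.toReal := by linarith
    refine ⟨C₁ ^ (p.toReal - 1) * C₁, ENNReal.mul_ne_top
      (ENNReal.rpow_lt_top_of_nonneg (by linarith) hC₁).ne hC₁, fun n N hn hnN hN g hg hgm => ?_⟩
    simp only [pnorm_of_ne_top hp]
    set w : (Fin d → Fin N) → ℝ≥0∞ := fun k =>
      ((N : ℝ≥0∞) ^ d)⁻¹ * ‖symKernel ψ n (0 - inode N (fz k) - 0)‖ₑ with hw
    have hwC : ∑ k, w k ≤ C₁ := hW n N hn hnN hN 0 0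
    have hCt : C₁ ^ (p.toReal - 1) ≠ ⊤ := (ENNReal.rpow_lt_top_of_nonneg (by linarith) hC₁).ne
    have hm : ∀ y, AEMeasurable (fun x => ‖g (y + x)‖ₑ ^ p.toReal) (volume.restrict (cell d)) :=
      fun y => ((hgm.comp_quasiMeasurePreserving
        (quasiMeasurePreserving_add_left volume y)).enorm.pow_const _).restrict
    calc _ ≤ ∫⁻ x in cell d, C₁ ^ (p.toReal - 1) *
          ∑ k : Fin d → Fin N, w k * ‖g (inode N (fz k) + x)‖ₑ ^ p.toReal := by
          refine lintegral_mono fun x => ?_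
          have h2 := ENNReal.inner_le_weight_mul_Lp_of_nonneg Finset.univ hp1' w
            fun k => ‖g (inode N (fz k) + x)‖ₑ
          refine (ENNReal.rpow_le_rpow ((key n N hn hnN g x).trans h2) hpr.le).trans ?_
          rw [ENNReal.mul_rpow_of_nonneg _ _ hpr.le, ← ENNReal.rpow_mul, ← ENNReal.rpow_mul,
            inv_mul_cancel₀ hpr.ne', ENNReal.rpow_one, sub_mul, one_mul, inv_mul_cancel₀ hpr.ne']
          exact mul_le_mul' (ENNReal.rpow_le_rpow hwC (by linarith)) le_rfl
      _ = C₁ ^ (p.toReal - 1) * ((∑ k, w k) * ∫⁻ x in cell d, ‖g x‖ₑ ^ p.toReal) := by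
          rw [lintegral_const_mul' _ _ hCt,
            lintegral_finsetSum' _ fun k _ => (hm _).const_mul _, Finset.sum_mul]
          congr 1
          refine Finset.sum_congr rfl fun k _ => ?_
          rw [lintegral_const_mul'' _ (hm _)]
          congr 1
          simp only [add_comm (inode N (fz k))]
          exact Per.setLIntegral_add (g := fun x => ‖g x‖ₑ ^ p.toReal)
            (hg.comp fun z => ‖z‖ₑ ^ p.toReal) _
      _ ≤ C₁ ^ (p.toReal - 1) * (C₁ * ∫⁻ x in cell d, ‖g x‖ₑ ^ p.toReal) := by gcongr
      _ = _ := by ring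

theorem qnorm_le_of_pnorm_le {C : ℝ≥0∞} (hC : C ≠ ⊤)
    {G H : (Fin d → ℝ) → (Fin d → ℝ) → ℝ≥0∞} (h : ∀ l, pnorm p (G l) ≤ C * pnorm p (H l)) :
    qnorm p G ≤ C * qnorm p H := by
  unfold qnorm; split_ifs
  · simp only [ENNReal.mul_iSup]
    exact iSup₂_mono fun l _ => h l
  · rw [← lintegral_const_mul' _ _ hC]
    exact lintegral_mono fun l => h l

theorem aemeasurable_sampleOp_prod {N : ℕ} {K : (Fin d → ℝ) → ℂ} (hK : Continuous K)
    {f : (Fin d → ℝ) → ℂ} (hf : AEMeasurable f) :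
    AEMeasurable (fun z : (Fin d → ℝ) × (Fin d → ℝ) => sampleOp N K z.1 f z.2)
      ((volume.restrict (cell d)).prod (volume.restrict (cell d))) := by
  unfold sampleOp
  refine AEMeasurable.const_mul (Finset.aemeasurable_fun_sum _ fun k _ => AEMeasurable.mul ?_ ?_) _
  · exact AEMeasurable.comp_fst (f := fun l => f (inode N (fz k) + l))
      (hf.comp_quasiMeasurePreserving (quasiMeasurePreserving_add_left volume _)).restrict
  · have : Continuous fun z : (Fin d → ℝ) × (Fin d → ℝ) => K (z.2 - inode N (fz k) - z.1) := by
      fun_prop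
    exact this.measurable.aemeasurable

theorem aemeasurable_pnorm_sampleOp {N : ℕ} {K : (Fin d → ℝ) → ℂ} (hK : Continuous K)
    {f : (Fin d → ℝ) → ℂ} (hf : AEMeasurable f) (hp : p ≠ ⊤) :
    AEMeasurable (fun l => pnorm p fun x => ‖sampleOp N K l f x‖ₑ) (volume.restrict (cell d)) := by
  simp only [pnorm_of_ne_top hp]
  exact ((aemeasurable_sampleOp_prod hK hf).enorm.pow_const p.toReal).lintegral_prod_right'

theorem aemeasurable_pnorm_sub_sampleOp {N : ℕ} {K : (Fin d → ℝ) → ℂ} (hK : Continuous K)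
    {f : (Fin d → ℝ) → ℂ} (hf : AEMeasurable f) (hp : p ≠ ⊤) :
    AEMeasurable (fun l => pnorm p fun x => ‖f x - sampleOp N K l f x‖ₑ)
      (volume.restrict (cell d)) := by
  simp only [pnorm_of_ne_top hp]
  exact ((hf.restrict.comp_snd.sub (aemeasurable_sampleOp_prod hK hf)).enorm.pow_const
    p.toReal).lintegral_prod_right'

/-- The multiplier operator as a linear map. -/
noncomputable def multiplierMap (N : ℕ) (K : (Fin d → ℝ) → ℂ) :
    ((Fin d → ℝ) → ℂ) →ₗ[ℂ] ((Fin d → ℝ) → ℂ) where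
  toFun f x := sampleOp N K x f x
  map_add' f g := by ext x; exact sampleOp_add x f g x
  map_smul' c f := by ext x; exact sampleOp_smul x c f x

/-- The frequencies of the kernel are below m' n and those of the multiplier below m n. The
condition m n + m' n < N excludes aliasing, so the discrete convolution multiplies the symbols
exactly. -/
theorem multiplierMap_symKernel {m m' n N : ℕ} {ψ' : EuclideanSpace ℝ (Fin d) → ℂ} {a' : ℝ}
    (hψ : IsSymbol a m ψ) (hψ' : IsSymbol a' m' ψ') (hn : 0 < n) (hN : m * n + m' * n < N)
    (y : Fin d → ℝ) :
    multiplierMap N (symKernel ψ n) (fun x => symKernel ψ' n (x - y)) =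
      fun x => symKernel (fun v => ψ' v * ψ v) n (x - y) := by
  have h1 : (fun x => symKernel ψ' n (x - y)) =
      ∑ k ∈ freqs d m' n, (ψ' ((n : ℝ)⁻¹ • lat k) * expo k (-y)) • expo k := by
    ext x
    rw [hψ'.symKernel_eq_sum hn, Finset.sum_apply]
    refine Finset.sum_congr rfl fun k _ => ?_
    rw [Pi.smul_apply, smul_eq_mul, expo_sub_right]; ring
  rw [h1, map_sum]
  ext x
  have h2 : symKernel (fun v => ψ' v * ψ v) n (x - y) =
      ∑ k ∈ freqs d m' n, ψ' ((n : ℝ)⁻¹ • lat k) * ψ ((n : ℝ)⁻¹ • lat k) * expo k (x - y) := by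
    refine tsum_eq_sum fun k hk => ?_
    simp only [hψ'.eq_zero hn (not_lt.1 (mt mem_freqs.2 hk)), zero_mul]
  rw [h2, Finset.sum_apply]
  refine Finset.sum_congr rfl fun k hk => ?_
  rw [map_smul, Pi.smul_apply, smul_eq_mul]
  have h3 : multiplierMap N (symKernel ψ n) (expo k) x = ψ ((n : ℝ)⁻¹ • lat k) * expo k x :=
    sampleOp_expo hψ hn hN (abs_le_of_mem_freqs hk) x x
  rw [h3, expo_sub_right]
  ring

/-- A sampled function is a linear combination of translates of the kernel, and on each translate
the multiplier acts by multiplying the symbols. -/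
theorem multiplierMap_sampleOp {m m' n N N' : ℕ} {ψ' : EuclideanSpace ℝ (Fin d) → ℂ} {a' : ℝ}
    (hψ : IsSymbol a m ψ) (hψ' : IsSymbol a' m' ψ') (hn : 0 < n) (hN : m * n + m' * n < N)
    (l : Fin d → ℝ) (f : (Fin d → ℝ) → ℂ) :
    multiplierMap N (symKernel ψ n) (sampleOp N' (symKernel ψ' n) l f) =
      sampleOp N' (symKernel (fun v => ψ' v * ψ v) n) l f := by
  have h : ∀ K : (Fin d → ℝ) → ℂ, sampleOp N' K l f = ((N' : ℂ) ^ d)⁻¹ •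
      ∑ k : Fin d → Fin N', f (inode N' (fz k) + l) • fun x => K (x - (inode N' (fz k) + l)) := by
    intro K
    ext x
    simp only [sampleOp, Pi.smul_apply, Finset.sum_apply, smul_eq_mul, sub_sub]
  rw [h, h, map_smul, map_sum]
  simp only [map_smul, multiplierMap_symKernel hψ hψ' hn hN]

end

theorem summable_symKernel {d n : ℕ} {ψ : EuclideanSpace ℝ (Fin d) → ℂ} {R : ℝ} (hn : 0 < n)
    (h : ∀ v, R ≤ ‖v‖ → ψ v = 0) (x : Fin d → ℝ) :
    Summable fun k : Fin d → ℤ => ψ ((n : ℝ)⁻¹ • lat k) * expo k x := by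
  have hn' : (0 : ℝ) < n := by exact_mod_cast hn
  refine summable_of_ne_finset_zero (s := freqs d R n) fun k hk => ?_
  rw [h _ ?_, zero_mul]
  have := not_lt.1 (mt mem_freqs.2 hk)
  rw [norm_smul, norm_inv, Real.norm_of_nonneg hn'.le, ← div_eq_inv_mul, le_div_iff₀ hn']
  linarith

theorem rieszSymbol_eq_ratio {d : ℕ} {β β' δ : ℝ} (hβ : 0 < β) (hβ' : 0 < β') (hδ : 0 < δ)
    (v : EuclideanSpace ℝ (Fin d)) : rieszSymbol d β δ v =
      rieszSymbol d β' δ v * radial (EuclideanSpace ℝ (Fin d)) (ratioProfile β β' δ) v +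
        radial (EuclideanSpace ℝ (Fin d)) (fun u => rieszProfile β δ u * cutoff u) v := by
  simp only [rieszSymbol, radial]
  conv_lhs => rw [rieszProfile_eq_ratio hβ hβ' hδ (sq_nonneg ‖v‖)]
  push_cast
  rfl

theorem sampleOp_add_symbol {d n N : ℕ} {ψ ψ₁ ψ₂ : EuclideanSpace ℝ (Fin d) → ℂ} {R : ℝ}
    (h₁ : ∀ v, R ≤ ‖v‖ → ψ₁ v = 0) (h₂ : ∀ v, R ≤ ‖v‖ → ψ₂ v = 0) (hψ : ∀ v, ψ v = ψ₁ v + ψ₂ v)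
    (hn : 0 < n) (l : Fin d → ℝ) (f : (Fin d → ℝ) → ℂ) (x : Fin d → ℝ) :
    sampleOp N (symKernel ψ n) l f x =
      sampleOp N (symKernel ψ₁ n) l f x + sampleOp N (symKernel ψ₂ n) l f x := by
  have h : ∀ y, symKernel ψ n y = symKernel ψ₁ n y + symKernel ψ₂ n y := by
    intro y
    refine Eq.trans (tsum_congr fun k => ?_)
      (Summable.tsum_add (summable_symKernel hn h₁ y) (summable_symKernel hn h₂ y))
    rw [hψ, add_mul]
  simp only [sampleOp, h, mul_add, Finset.sum_add_distrib]

/-- If `ψ = ψ' ψm + ψc` with `ψm`, `ψc` having integrable Fourier transforms, then the convergence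
for the symbol `ψ'` implies the convergence for `ψ`. -/
theorem tendsto_qnorm_of_factor {d : ℕ} {p : ℝ≥0∞} (hp1 : 1 ≤ p)
    {ψ ψ' ψm ψc : EuclideanSpace ℝ (Fin d) → ℂ} {a' am ac : ℝ} (hr : IsSymbol a' (1 : ℕ) ψ')
    (hm : IsSymbol am (2 : ℕ) ψm) (ham : (d : ℝ) < am) (hm0 : ψm 0 = 0)
    (hc : IsSymbol ac (1 : ℕ) ψc) (hac : (d : ℝ) < ac) (hc0 : ψc 0 = 1)
    (hψ : ∀ v, ψ v = ψ' v * ψm v + ψc v) {F : (Fin d → ℝ) → ℂ} (hF : MemT p F)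
    (hrconv : Tendsto (fun n : ℕ => qnorm p fun (l x : Fin d → ℝ) =>
      ‖F x - sampleOp (2 * n + 1) (symKernel ψ' n) l F x‖ₑ) atTop (𝓝 0)) :
    Tendsto (fun n : ℕ => qnorm p fun (l x : Fin d → ℝ) =>
      ‖F x - sampleOp (2 * n + 1) (symKernel ψ n) l F x‖ₑ) atTop (𝓝 0) := by
  have hp0 : p ≠ 0 := (zero_lt_one.trans_le hp1).ne'
  have hcconv := hc.tendsto_qnorm hac hp0 (fun hp => by
      have h1 : 1 ≤ p.toReal := by simpa [ex_of_ne_top hp] using one_le_ex hp1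
      have h2 : (0 : ℝ) ≤ d := Nat.cast_nonneg d
      nlinarith) hc0 (N := fun n => 2 * n + 1) (fun n => by omega) (fun n hn => by omega) hF
  obtain ⟨C, hC, hb⟩ := hm.exists_pnorm_multiplier_le ham hp1
  have he := ex_pos hp0
  have hq := quasiConst_ne_top p
  have hcc := cellConst_ne_top d p
  refine tendsto_zero_of_eventually_le (C := quasiConst p * (cellConst d p * cellConst d p +
    quasiConst p * (1 + C * (quasiConst p * (cellConst d p + 1))))) (by finiteness) fun ε hε => ?_
  obtain ⟨M, T, hT, hFT⟩ := hF.exists_trigPoly_pnorm hp0 hε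
  have hTc := continuous_of_mem_trigPoly hT
  obtain ⟨η, hη0, hη⟩ := exists_ofReal_rpow_le he hε
  filter_upwards [eventually_norm_sampleOp_sub_le (N := fun n => 4 * n + 1) (fun n => by omega) hm hT
    η hη0, eventually_gt_atTop 0, hcconv.eventually_le_const (pos_iff_ne_zero.2 hε),
    hrconv.eventually_le_const (pos_iff_ne_zero.2 hε)] with k hkT hk hkc hkr
  have hKc := hc.continuous_symKernel hk
  have hKr := hr.continuous_symKernel hk
  -- With S', S_c and m denoting the sampling operators of ψ' and ψc and the multiplier, F - SF =
  -- -mT + (F - S_c F) - m(S'F - T). The first term tends to 0 because ψm vanishes at 0, and the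
  -- last is bounded by the size of S'F - T.
  have hid : ∀ l x, F x - sampleOp (2 * k + 1) (symKernel ψ k) l F x =
      -(sampleOp (4 * k + 1) (symKernel ψm k) x T x - ψm 0 * T x) +
      ((F x - sampleOp (2 * k + 1) (symKernel ψc k) l F x) +
      -(sampleOp (4 * k + 1) (symKernel ψm k) x
        (sampleOp (2 * k + 1) (symKernel ψ' k) l F - T) x)) := by
    intro l x
    have h1 := congrFun (multiplierMap_sampleOp (N := 4 * k + 1) (N' := 2 * k + 1) hm hr hk
      (by omega) l F) x
    rw [sampleOp_add_symbol (fun v hv => by simp [hr.support v (by simpa using hv)]) hc.support hψ hk, sampleOp_sub, hm0, ← h1]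
    simp only [multiplierMap, LinearMap.coe_mk, AddHom.coe_mk]
    ring
  have hGper : ∀ l, Per (sampleOp (2 * k + 1) (symKernel ψ' k) l F - T) := by
    intro l x m
    simp only [Pi.sub_apply, per_sampleOp (per_symKernel _ _) l F x m, per_of_mem_trigPoly hT x m]
  have hG : qnorm p (fun l x => ‖(sampleOp (2 * k + 1) (symKernel ψ' k) l F - T)
      x‖ₑ) ≤ quasiConst p * (cellConst d p * ε + ε) := by
    refine (qnorm_mono (H := fun l x => ‖F x - T x‖ₑ + ‖F x - sampleOp (2 * k + 1)
      (symKernel ψ' k) l F x‖ₑ) fun l x => ?_).trans ?_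
    · have : (sampleOp (2 * k + 1) (symKernel ψ' k) l F - T) x =
        (F x - T x) - (F x - sampleOp (2 * k + 1) (symKernel ψ' k) l F x) := by
        rw [Pi.sub_apply]; ring
      rw [this]
      exact enorm_sub_le
    · refine (qnorm_add_const_le hp0 _
        (hF.aemeasurable.sub hTc.measurable.aemeasurable).enorm.restrict).trans ?_
      gcongr
      exact hFT
  calc _ ≤ qnorm p fun l x => ENNReal.ofReal η +
        (‖F x - sampleOp (2 * k + 1) (symKernel ψc k) l F x‖ₑ + ‖sampleOp (4 * k + 1)
          (symKernel ψm k) x (sampleOp (2 * k + 1) (symKernel ψ' k) l F - T) x‖ₑ) := by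
        refine qnorm_mono fun l x => ?_
        rw [hid l x]
        refine (enorm_add_le _ _).trans (add_le_add ?_ ((enorm_add_le _ _).trans
          (add_le_add le_rfl (enorm_neg _).le)))
        rw [enorm_neg, ← ofReal_norm]
        exact ENNReal.ofReal_le_ofReal (hkT x x)
    _ ≤ quasiConst p * (cellConst d p * (cellConst d p * ε) + quasiConst p * (ε +
          C * (quasiConst p * (cellConst d p * ε + ε)))) := by
        refine (qnorm_add_const_le hp0 (A := fun _ => ENNReal.ofReal η) _
          aemeasurable_const).trans ?_
        gcongr
        · exact (pnorm_const_le p _).trans (by gcongr)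
        refine (qnorm_add_le hp0 _ (fun l => ?_) fun hp => ?_).trans ?_
        · exact (hF.aemeasurable.sub
            (continuous_sampleOp hKc l F).measurable.aemeasurable).enorm.restrict
        · exact aemeasurable_pnorm_sub_sampleOp hKc hF.aemeasurable hp
        gcongr
        refine (qnorm_le_of_pnorm_le hC fun l => hb k (4 * k + 1) hk (by omega) (by omega) _
          (hGper l) ?_).trans ?_
        · exact ((continuous_sampleOp hKr l F).sub hTc).measurable.aemeasurable
        · gcongr
    _ = _ := by ring

/-- For `p ≥ 1` the convergence of the families does not depend on `β`. -/
theorem FamilyConverges.of_exponent {n : ℕ} {p : ℝ≥0∞} (hp1 : 1 ≤ p) {β β' δ : ℝ} (hβ : 0 < β)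
    (hβ' : 0 < β') (hδ : 0 < δ) (h : FamilyConverges (n + 1) p β' δ) :
    FamilyConverges (n + 1) p β δ := by
  have hp0 : p ≠ 0 := (zero_lt_one.trans_le hp1).ne'
  rw [familyConverges_iff hp0] at h ⊢
  intro f hf
  refine tendsto_qnorm_of_factor hp1
    -- For ψ' only continuity and support are used, so the trivial order of decay 0 is enough.
    (isSymbol_riesz hβ' hδ n (a := 0) (by positivity) (Or.inr (by positivity)))
    (isSymbol_ratioProfile hβ hβ' δ (n + 1) (n + 2)) (by push_cast; linarith) ?_
    (isSymbol_riesz_cutoff hβ hδ n) (by linarith) ?_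
    (rieszSymbol_eq_ratio hβ hβ' hδ) hf.memT (h f hf)
  · simp [radial, ratioProfile_zero]
  · have := rieszSymbol_zero (d := n + 1) hβ δ
    rw [rieszSymbol, radial] at this
    rw [radial, Complex.ofReal_mul, this, norm_zero, cutoff_eq_one (by norm_num)]
    simp

/-! ### Completeness of L_p and the Banach–Steinhaus theorem. -/

section

variable {d : ℕ} {p : ℝ≥0∞} {f g : (Fin d → ℝ) → ℝ}

theorem MemTorusLp.aemeasurable (hf : MemTorusLp p f) : AEMeasurable f := by
  obtain ⟨h1, h2⟩ := hf
  split_ifs at h2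
  · exact h2.measurable.aemeasurable
  · exact h1.per.aemeasurable h2.1.aemeasurable

theorem MemTorusLp.add (hf : MemTorusLp p f) (hg : MemTorusLp p g) : MemTorusLp p (f + g) := by
  refine ⟨fun x i => by simp only [Pi.add_apply, hf.1 x i, hg.1 x i], ?_⟩
  have h1 := hf.2; have h2 := hg.2
  split_ifs at h1 h2 ⊢
  · exact Continuous.add h1 h2
  · exact MemLp.add h1 h2

theorem MemTorusLp.const_smul (hf : MemTorusLp p f) (c : ℝ) : MemTorusLp p (c • f) := by
  refine ⟨fun x i => by simp only [Pi.smul_apply, hf.1 x i], ?_⟩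
  have h1 := hf.2
  split_ifs at h1 ⊢
  · exact Continuous.const_smul h1 c
  · exact MemLp.const_smul h1 c

theorem MemTorusLp.sub (hf : MemTorusLp p f) (hg : MemTorusLp p g) : MemTorusLp p (f - g) := by
  have := hf.add (hg.const_smul (-1))
  simpa [sub_eq_add_neg] using this

/-- The power of the quasi-norm that satisfies the triangle inequality. -/
noncomputable def modulus (p : ℝ≥0∞) (f : (Fin d → ℝ) → ℝ) : ℝ≥0∞ :=
  pnorm p (fun x => ‖f x‖ₑ) ^ (1 / max 1 (ex p))

theorem modulus_eq_torusNorm (hp0 : p ≠ 0) (h : 1 ≤ ex p) : modulus p f = torusNorm p f := by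
  rw [modulus, max_eq_right h, torusNorm_eq_pnorm hp0]

theorem modulus_add_le (hp0 : p ≠ 0) (hf : MemTorusLp p f) (hg : MemTorusLp p g) :
    modulus p (f + g) ≤ modulus p f + modulus p g := by
  rcases le_or_gt (ex p) 1 with h | h
  · have hq : quasiConst p = 1 := by rw [quasiConst, max_eq_right (by linarith), ENNReal.rpow_zero]
    simp only [modulus, max_eq_left h, div_one, ENNReal.rpow_one]
    have := pnorm_add_le hp0 (fun x => ‖g x‖ₑ) hf.aemeasurable.enorm.restrict
    rw [hq, one_mul] at this
    exact (pnorm_mono fun x => enorm_add_le (f x) (g x)).trans this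
  · have hp : p ≠ ⊤ := fun hp => by simp [hp, ex] at h
    rw [modulus_eq_torusNorm hp0 h.le, modulus_eq_torusNorm hp0 h.le, modulus_eq_torusNorm hp0 h.le]
    simp only [torusNorm, if_neg hp]
    refine eLpNorm_add_le hf.aemeasurable.aestronglyMeasurable.restrict
      hg.aemeasurable.aestronglyMeasurable.restrict ?_
    rw [ex_of_ne_top hp] at h
    rw [← ENNReal.ofReal_toReal hp]
    exact ENNReal.one_le_ofReal.2 h.le

theorem modulus_sub_comm (f g : (Fin d → ℝ) → ℝ) : modulus p (f - g) = modulus p (g - f) := by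
  simp only [modulus, Pi.sub_apply, enorm_sub_rev (f _)]

theorem pnorm_zero (hp0 : p ≠ 0) : pnorm p (fun _ : Fin d → ℝ => 0) = 0 := by
  unfold pnorm; split_ifs with h
  · simp
  · simp [ENNReal.zero_rpow_of_pos (ENNReal.toReal_pos hp0 h)]

theorem modulus_zero (hp0 : p ≠ 0) : modulus p (0 : (Fin d → ℝ) → ℝ) = 0 := by
  simp only [modulus, Pi.zero_apply, enorm_zero, pnorm_zero hp0]
  exact ENNReal.zero_rpow_of_pos (by positivity)

/-- The choice is s = p when p ≤ 1, and s = 1 with Hölder's inequality on the cell otherwise. The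
bound yields absolute convergence almost everywhere of fast Cauchy sequences. -/
theorem exists_lintegral_rpow_le_modulus (d : ℕ) (hp0 : p ≠ 0) (hp : p ≠ ⊤) :
    ∃ s : ℝ, 0 < s ∧ s ≤ 1 ∧ ∃ K : ℝ≥0∞, K ≠ ⊤ ∧ ∀ f : (Fin d → ℝ) → ℝ, MemTorusLp p f →
      ∫⁻ x in cell d, ‖f x‖ₑ ^ s ≤ K * modulus p f := by
  rcases le_or_gt (ex p) 1 with h | h
  · refine ⟨p.toReal, ENNReal.toReal_pos hp0 hp, by rwa [ex_of_ne_top hp] at h, 1, by simp,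
      fun f _ => ?_⟩
    rw [modulus, max_eq_left h, one_mul, div_one, ENNReal.rpow_one, pnorm_of_ne_top hp]
  · refine ⟨1, one_pos, le_rfl, volume (cell d) ^ (1 - 1 / p.toReal), ?_, fun f hf => ?_⟩
    · rw [ex_of_ne_top hp] at h
      exact (ENNReal.rpow_lt_top_of_nonneg (by
        rw [sub_nonneg, div_le_one (by linarith)]; exact h.le) (volume_cell_lt_top d).ne).ne
    · rw [modulus_eq_torusNorm hp0 h.le, torusNorm, if_neg hp]
      have h1 : 1 ≤ p := by
        rw [ex_of_ne_top hp] at h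
        rw [← ENNReal.ofReal_toReal hp]
        exact ENNReal.one_le_ofReal.2 h.le
      have := eLpNorm_le_eLpNorm_mul_rpow_measure_univ (μ := volume.restrict (cell d)) h1
        hf.aemeasurable.aestronglyMeasurable.restrict
      rw [eLpNorm_one_eq_lintegral_enorm, Measure.restrict_apply_univ, ENNReal.toReal_one,
        div_one] at this
      simpa only [ENNReal.rpow_one, mul_comm] using this

end

/-- The space `L_p(𝕋^d)` of functions, with the distance given by `modulus`. -/
structure TorusLp (d : ℕ) (p : ℝ≥0∞) where
  toFun : (Fin d → ℝ) → ℝ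
  mem : MemTorusLp p toFun

/-- Functions are not identified modulo null sets, since the sampling operators use point values. A
pseudo-metric is sufficient for the category argument. -/
noncomputable instance {d : ℕ} {p : ℝ≥0∞} [hp : Fact (p ≠ 0)] : PseudoEMetricSpace (TorusLp d p) where
  edist f g := modulus p (f.toFun - g.toFun)
  edist_self f := by
    rw [sub_self, modulus_zero hp.out]
  edist_comm f g := modulus_sub_comm _ _
  edist_triangle f g h := by
    have := modulus_add_le hp.out (f.mem.sub g.mem) (g.mem.sub h.mem)
    rwa [sub_add_sub_cancel] at this

section

variable {d : ℕ} {p : ℝ≥0∞} [hp : Fact (p ≠ 0)]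

theorem TorusLp.edist_def (f g : TorusLp d p) : edist f g = modulus p (f.toFun - g.toFun) := rfl

theorem TorusLp.exists_limit_top [Fact ((⊤ : ℝ≥0∞) ≠ 0)] {u : ℕ → TorusLp d ⊤}
    (hu : ∀ N n m, N ≤ n → N ≤ m → edist (u n) (u m) < (1 / 2) ^ N) :
    ∃ x, Tendsto u atTop (𝓝 x) := by
  have hb : ∀ N n m, N ≤ n → N ≤ m → ∀ x, edist ((u n).toFun x) ((u m).toFun x) ≤ (1 / 2) ^ N := by
    intro N n m hn hm x
    have h1 := (hu N n m hn hm).le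
    rw [TorusLp.edist_def, modulus] at h1
    simp only [ex, if_true, max_self, div_one, ENNReal.rpow_one] at h1
    refine le_trans ?_ h1
    have h2 : Per fun x => ‖((u n).toFun - (u m).toFun) x‖ₑ :=
      ((u n).mem.sub (u m).mem).1.per.comp fun z => ‖z‖ₑ
    rw [edist_eq_enorm_sub]
    exact h2.le_pnorm_top x
  have hlim0 : Tendsto (fun N : ℕ => ((1 : ℝ≥0∞) / 2) ^ N) atTop (𝓝 0) :=
    ENNReal.tendsto_pow_atTop_nhds_zero_of_lt_one (by rw [one_div]; exact ENNReal.one_half_lt_one)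
  have hcau : ∀ x, ∃ y, Tendsto (fun n => (u n).toFun x) atTop (𝓝 y) := fun x =>
    cauchySeq_tendsto_of_complete (EMetric.cauchySeq_iff_le_tendsto_0.2
      ⟨fun N => (1 / 2) ^ N, fun n m N hn hm => hb N n m hn hm x, hlim0⟩)
  choose F hF using hcau
  have hFb : ∀ n x, edist ((u n).toFun x) (F x) ≤ (1 / 2) ^ n := fun n x =>
    le_of_tendsto (tendsto_const_nhds.edist (hF x))
      (eventually_atTop.2 ⟨n, fun m hm => hb n n m le_rfl hm x⟩)
  have hFper : IsPeriodic F := fun x i => by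
    refine tendsto_nhds_unique (hF _) ?_
    simpa only [(u _).mem.1 x i] using hF x
  have hFc : Continuous F := by
    have : TendstoUniformly (fun n => (u n).toFun) F atTop := by
      rw [EMetric.tendstoUniformly_iff]
      intro ε hε
      filter_upwards [hlim0.eventually_lt_const hε] with n hn x
      rw [edist_comm]
      exact (hFb n x).trans_lt hn
    refine this.continuous (Frequently.of_forall fun n => ?_)
    have := (u n).mem.2
    rwa [if_pos rfl] at this
  refine ⟨⟨F, hFper, by rwa [if_pos rfl]⟩, ?_⟩
  rw [EMetric.tendsto_atTop]
  intro ε hε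
  obtain ⟨N, hN⟩ := eventually_atTop.1 (hlim0.eventually_lt_const hε)
  refine ⟨N, fun n hn => lt_of_le_of_lt ?_ (hN n hn)⟩
  rw [TorusLp.edist_def, modulus]
  simp only [ex, if_true, max_self, div_one, ENNReal.rpow_one, pnorm_top]
  refine iSup₂_le fun x _ => ?_
  rw [Pi.sub_apply, ← edist_eq_enorm_sub]
  exact hFb n x

/-- Riesz–Fischer for all finite p > 0: the s-th powers of the successive differences have a
summable integral, which gives a limit almost everywhere, and Fatou's lemma gives convergence in the
modulus. -/
theorem TorusLp.exists_limit (hpt : p ≠ ⊤) {u : ℕ → TorusLp d p}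
    (hu : ∀ N n m, N ≤ n → N ≤ m → edist (u n) (u m) < (1 / 2) ^ N) :
    ∃ x, Tendsto u atTop (𝓝 x) := by
  have hp0 : p ≠ 0 := hp.out
  have he := ex_pos hp0
  have hlim0 : Tendsto (fun N : ℕ => ((1 : ℝ≥0∞) / 2) ^ N) atTop (𝓝 0) :=
    ENNReal.tendsto_pow_atTop_nhds_zero_of_lt_one (by rw [one_div]; exact ENNReal.one_half_lt_one)
  obtain ⟨s, hs, hs1, K, hK, hb⟩ := exists_lintegral_rpow_le_modulus d hp0 hpt
  set v : ℕ → (Fin d → ℝ) → ℝ := fun n => (u n).toFun with hv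
  have hvm : ∀ n, AEMeasurable (v n) := fun n => (u n).mem.aemeasurable
  have hsum : ∫⁻ x in cell d, ∑' n, ‖v n x - v (n + 1) x‖ₑ ^ s ≠ ⊤ := by
    rw [lintegral_tsum (f := fun n x => ‖v n x - v (n + 1) x‖ₑ ^ s)
      fun n => (((hvm n).sub (hvm (n + 1))).enorm.pow_const s).restrict]
    have h1 : ∀ n, ∫⁻ x in cell d, ‖v n x - v (n + 1) x‖ₑ ^ s ≤ K * (1 / 2) ^ n := fun n =>
      (hb _ ((u n).mem.sub (u (n + 1)).mem)).trans
        (by gcongr; exact (hu n n (n + 1) le_rfl n.le_succ).le)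
    refine ne_top_of_le_ne_top ?_ (ENNReal.tsum_le_tsum h1)
    rw [ENNReal.tsum_mul_left, one_div, ENNReal.tsum_geometric]
    exact ENNReal.mul_ne_top hK (by simp)
  have hae : ∀ᵐ x ∂(volume.restrict (cell d)), ∃ y, Tendsto (fun n => v n x) atTop (𝓝 y) := by
    filter_upwards [ae_lt_top' (AEMeasurable.tsum fun n =>
      (((hvm n).sub (hvm (n + 1))).enorm.pow_const s).restrict) hsum] with x hx
    refine cauchySeq_tendsto_of_complete (cauchySeq_of_edist_le_of_tsum_ne_top
      (fun n => ‖v n x - v (n + 1) x‖ₑ) (fun n => (edist_eq_enorm_sub _ _).le) ?_)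
    have h2 := (ennreal_rpow_tsum_le (fun n => ‖v n x - v (n + 1) x‖ₑ) hs hs1).trans_lt hx
    intro htop
    rw [htop, ENNReal.top_rpow_of_pos hs] at h2
    exact lt_irrefl _ h2
  -- The limit is chosen pointwise as a function of the sequence of values, so F is periodic at
  -- every point and not only almost everywhere.
  set F : (Fin d → ℝ) → ℝ := fun x => limUnder atTop fun n => v n x with hFdef
  have hF : ∀ᵐ x ∂(volume.restrict (cell d)), Tendsto (fun n => v n x) atTop (𝓝 (F x)) := by
    filter_upwards [hae] with x hx
    exact tendsto_nhds_limUnder hx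
  have hFper : IsPeriodic F := fun x i => by
    simp only [hFdef]
    congr 1
    ext n
    exact (u n).mem.1 x i
  have hFm : AEMeasurable F (volume.restrict (cell d)) :=
    aemeasurable_of_tendsto_metrizable_ae atTop (fun n => (hvm n).restrict) hF
  have hmod : ∀ n, modulus p (v n - F) ≤ (1 / 2) ^ n := by
    intro n
    have hfat : eLpNorm (v n - F) p (volume.restrict (cell d)) ≤
        atTop.liminf fun m => eLpNorm (v n - v m) p (volume.restrict (cell d)) := by
      refine Lp.eLpNorm_lim_le_liminf_eLpNorm
        (fun m => ((hvm n).sub (hvm m)).aestronglyMeasurable.restrict) _ ?_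
      filter_upwards [hF] with x hx
      exact tendsto_const_nhds.sub hx
    have hconv : ∀ h : (Fin d → ℝ) → ℝ, modulus p h =
        eLpNorm h p (volume.restrict (cell d)) ^ (ex p / max 1 (ex p)) := by
      intro h
      have := torusNorm_eq_pnorm hp0 h
      rw [torusNorm, if_neg hpt] at this
      rw [this, modulus, ← ENNReal.rpow_mul]
      congr 1
      field_simp
    have hexp : 0 < ex p / max 1 (ex p) := by positivity
    have hle : ∀ m ≥ n, eLpNorm (v n - v m) p (volume.restrict (cell d)) ≤
        ((1 / 2) ^ n) ^ (ex p / max 1 (ex p))⁻¹ := by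
      intro m hm
      rw [← ENNReal.rpow_le_rpow_iff hexp, ← hconv, ← ENNReal.rpow_mul, inv_mul_cancel₀ hexp.ne',
        ENNReal.rpow_one]
      exact (hu n n m le_rfl hm).le
    have hle2 : eLpNorm (v n - F) p (volume.restrict (cell d)) ≤
        ((1 / 2) ^ n) ^ (ex p / max 1 (ex p))⁻¹ := by
      refine hfat.trans (liminf_le_of_frequently_le' (Eventually.frequently ?_))
      filter_upwards [eventually_ge_atTop n] with m hm using hle m hm
    rw [hconv]
    refine (ENNReal.rpow_le_rpow hle2 hexp.le).trans (le_of_eq ?_)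
    rw [← ENNReal.rpow_mul, inv_mul_cancel₀ hexp.ne', ENNReal.rpow_one]
  have hFmem : MemTorusLp p F := by
    refine ⟨hFper, ?_⟩
    rw [if_neg hpt]
    have h0 := (u 0).mem.2
    rw [if_neg hpt] at h0
    have h1 : MemLp (v 0 - F) p (volume.restrict (cell d)) := by
      refine ⟨((hvm 0).restrict.sub hFm).aestronglyMeasurable, ?_⟩
      have h2 := hmod 0
      rw [modulus, pow_zero] at h2
      have h3 : pnorm p (fun x => ‖(v 0 - F) x‖ₑ) ≠ ⊤ := by
        intro htop
        rw [htop, ENNReal.top_rpow_of_pos (by positivity)] at h2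
        exact absurd h2 (by simp)
      have := torusNorm_eq_pnorm hp0 (v 0 - F)
      rw [torusNorm, if_neg hpt] at this
      rw [this]
      exact ENNReal.rpow_lt_top_of_nonneg (by positivity) h3
    have h4 := h0.sub h1
    convert h4 using 1
    ext x
    simp [hv]
  refine ⟨⟨F, hFmem⟩, ?_⟩
  rw [EMetric.tendsto_atTop]
  intro ε hε
  obtain ⟨N, hN⟩ := eventually_atTop.1 (hlim0.eventually_lt_const hε)
  exact ⟨N, fun n hn => (hmod n).trans_lt (hN n hn)⟩

instance : CompleteSpace (TorusLp d p) := by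
  refine EMetric.complete_of_convergent_controlled_sequences (fun N => (1 / 2) ^ N)
    (fun N => pos_iff_ne_zero.2 (pow_ne_zero N (by simp))) fun u hu => ?_
  by_cases h : p = ⊤
  · subst h; exact TorusLp.exists_limit_top hu
  · exact TorusLp.exists_limit h hu

end

section

variable {d N : ℕ} {p : ℝ≥0∞} {K : (Fin d → ℝ) → ℂ}

theorem Per.exists_bound (hK : Per K) (hKc : Continuous K) : ∃ κ : ℝ≥0∞, κ ≠ ⊤ ∧ ∀ x, ‖K x‖ₑ ≤ κ := by
  obtain ⟨C, hC⟩ := (isCompact_Icc (a := (0 : Fin d → ℝ)) (b := fun _ => 2 * π)).exists_bound_of_continuousOn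
    hKc.continuousOn
  refine ⟨ENNReal.ofReal C, ENNReal.ofReal_ne_top, fun x => ?_⟩
  obtain ⟨y, hy, h⟩ := exists_mem_cell_per hK x
  rw [← h, ← ofReal_norm]
  exact ENNReal.ofReal_le_ofReal (hC y ⟨fun i => (hy i trivial).1, fun i => (hy i trivial).2.le⟩)

theorem Per.pnorm_add_right {g : (Fin d → ℝ) → ℝ≥0∞} (hg : Per g) (y : Fin d → ℝ) :
    pnorm p (fun x => g (y + x)) ≤ pnorm p g := by
  by_cases h : p = ⊤
  · subst h
    conv_lhs => rw [pnorm_top]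
    exact iSup₂_le fun x _ => hg.le_pnorm_top _
  · simp only [pnorm_of_ne_top h, add_comm y]
    exact (Per.setLIntegral_add (g := fun x => g x ^ p.toReal)
      (hg.comp fun z => z ^ p.toReal) y).le

theorem pnorm_sum_le {ι : Type*} (hp0 : p ≠ 0) (s : Finset ι) {h : ι → (Fin d → ℝ) → ℝ≥0∞}
    (hm : ∀ i, AEMeasurable (h i) (volume.restrict (cell d))) :
    pnorm p (fun x => ∑ i ∈ s, h i x) ≤ quasiConst p ^ s.card * ∑ i ∈ s, pnorm p (h i) := by
  classical
  induction s using Finset.induction_on with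
  | empty => simp [pnorm_zero hp0]
  | insert i s hi ih =>
    simp only [Finset.sum_insert hi, Finset.card_insert_of_notMem hi]
    refine (pnorm_add_le hp0 _ (hm i)).trans ?_
    have h1 : (1 : ℝ≥0∞) ≤ quasiConst p ^ s.card := one_le_pow₀ (one_le_quasiConst p)
    calc _ ≤ quasiConst p * (quasiConst p ^ s.card * pnorm p (h i) +
          quasiConst p ^ s.card * ∑ i ∈ s, pnorm p (h i)) := by
          gcongr
          exact le_mul_of_one_le_left zero_le h1
      _ = _ := by ring

/-- Each sampling operator is bounded. -/
theorem exists_qnorm_sampleOp_le_of_continuous (hp0 : p ≠ 0) (hN : 0 < N) (hK : Per K)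
    (hKc : Continuous K) :
    ∃ B : ℝ≥0∞, B ≠ ⊤ ∧ ∀ g : (Fin d → ℝ) → ℂ, Per g → AEMeasurable g →
      qnorm p (fun l x => ‖sampleOp N K l g x‖ₑ) ≤ B * pnorm p fun x => ‖g x‖ₑ := by
  obtain ⟨κ, hκ, hb⟩ := hK.exists_bound hKc
  set ν : ℝ≥0∞ := ((N : ℝ≥0∞) ^ d)⁻¹ with hν
  have hνt : ν ≠ ⊤ := by rw [hν]; simp [hN.ne']
  have hc : ν * κ ≠ ⊤ := ENNReal.mul_ne_top hνt hκ
  have hq := quasiConst_ne_top p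
  have hcc := cellConst_ne_top d p
  have hct : (ν * κ) ^ ex p ≠ ⊤ := (ENNReal.rpow_lt_top_of_nonneg (ex_pos hp0).le hc).ne
  set m : ℕ := (Finset.univ : Finset (Fin d → Fin N)).card with hm
  refine ⟨cellConst d p * ((ν * κ) ^ ex p * (quasiConst p ^ m * m)), ?_, fun g hg hgm => ?_⟩
  · exact ENNReal.mul_ne_top hcc (ENNReal.mul_ne_top hct
      (ENNReal.mul_ne_top (ENNReal.pow_ne_top hq) (ENNReal.natCast_ne_top m)))
  · have hgm' : ∀ y, AEMeasurable (fun l => ‖g (y + l)‖ₑ) (volume.restrict (cell d)) := fun y =>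
      (hgm.comp_quasiMeasurePreserving
        (quasiMeasurePreserving_add_left volume y)).enorm.restrict
    set H : (Fin d → ℝ) → ℝ≥0∞ := fun l =>
      ν * κ * ∑ k : Fin d → Fin N, ‖g (inode N (fz k) + l)‖ₑ with hH
    have h1 : ∀ l x, ‖sampleOp N K l g x‖ₑ ≤ H l := by
      intro l x
      refine (enorm_sampleOp_le hN l g x).trans ?_
      simp only [hH]
      rw [mul_assoc, mul_comm κ, Finset.sum_mul]
      gcongr with k
      exact hb _
    have h2 : qnorm p (fun l _ => H l) ≤ cellConst d p * pnorm p H := by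
      by_cases h : p = ⊤
      · subst h
        rw [qnorm_top, pnorm_top, cellConst, if_pos rfl, one_mul]
        refine iSup₂_mono fun l _ => ?_
        rw [pnorm_top]
        exact iSup₂_le fun _ _ => le_rfl
      · rw [qnorm_of_ne_top h, pnorm_of_ne_top h, ← lintegral_const_mul' _ _ hcc]
        refine lintegral_mono fun l => (pnorm_const_le p (H l)).trans ?_
        rw [ex_of_ne_top h]
    have h3 : pnorm p H ≤ (ν * κ) ^ ex p * (quasiConst p ^ m * m) * pnorm p fun x => ‖g x‖ₑ := by
      rw [hH, pnorm_const_mul _ hc, mul_assoc]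
      gcongr
      refine (pnorm_sum_le hp0 Finset.univ fun k => hgm' _).trans ?_
      rw [mul_assoc]
      gcongr
      refine (Finset.sum_le_sum fun k _ => Per.pnorm_add_right (g := fun x => ‖g x‖ₑ)
        (hg.comp fun z => ‖z‖ₑ) (inode N (fz k))).trans ?_
      rw [Finset.sum_const, nsmul_eq_mul]
    calc _ ≤ qnorm p (fun l _ => H l) := qnorm_mono h1
      _ ≤ _ := h2
      _ ≤ _ := by rw [mul_assoc]; gcongr

end

theorem exists_pos_forall_mul_rpow_le_one {B : ℝ≥0∞} (hB : B ≠ ⊤) {r : ℝ} (hr : 0 < r) :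
    ∃ η : ℝ≥0∞, 0 < η ∧ ∀ t < η, B * t ^ r ≤ 1 := by
  refine ⟨(B + 1)⁻¹ ^ (1 / r), ENNReal.rpow_pos (by simp [hB]) (by simp), fun t ht => ?_⟩
  have h1 : t ^ r ≤ (B + 1)⁻¹ := by
    refine (ENNReal.rpow_le_rpow ht.le hr.le).trans (le_of_eq ?_)
    rw [← ENNReal.rpow_mul, one_div, inv_mul_cancel₀ hr.ne', ENNReal.rpow_one]
  calc B * t ^ r ≤ (B + 1) * (B + 1)⁻¹ := mul_le_mul' le_self_add h1
    _ ≤ 1 := ENNReal.mul_inv_le_one _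

section

variable {d : ℕ} {p : ℝ≥0∞}

theorem MemTorusLp.per_ofReal {f : (Fin d → ℝ) → ℝ} (hf : MemTorusLp p f) :
    Per fun x => (f x : ℂ) := hf.1.per.comp fun z : ℝ => (z : ℂ)

theorem MemTorusLp.aemeasurable_ofReal {f : (Fin d → ℝ) → ℝ} (hf : MemTorusLp p f) :
    AEMeasurable fun x => (f x : ℂ) := Complex.measurable_ofReal.comp_aemeasurable hf.aemeasurable

theorem MemTorusLp.pnorm_ne_top {f : (Fin d → ℝ) → ℝ} (hf : MemTorusLp p f) (hp0 : p ≠ 0) :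
    pnorm p (fun x => ‖f x‖ₑ) ≠ ⊤ := by
  have he := ex_pos hp0
  have h := torusNorm_eq_pnorm hp0 f
  have h2 : torusNorm p f ≠ ⊤ := by
    have := hf.2
    rw [torusNorm]
    split_ifs at this ⊢ with hp
    · obtain ⟨κ, hκ, hb⟩ := hf.per_ofReal.exists_bound (Complex.continuous_ofReal.comp this)
      refine ne_top_of_le_ne_top hκ (iSup₂_le fun x _ => ?_)
      simpa [← ofReal_norm] using hb x
    · exact this.2.ne
  intro htop
  rw [h, htop, ENNReal.top_rpow_of_pos (by positivity)] at h2
  exact h2 rfl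

theorem qnorm_sampleOp_add_le (hp0 : p ≠ 0) {N : ℕ} {K : (Fin d → ℝ) → ℂ}
    (hKc : Continuous K) {f g : (Fin d → ℝ) → ℂ} (hf : AEMeasurable f) :
    qnorm p (fun l x => ‖sampleOp N K l (f + g) x‖ₑ) ≤
      quasiConst p * (qnorm p (fun l x => ‖sampleOp N K l f x‖ₑ) +
        qnorm p (fun l x => ‖sampleOp N K l g x‖ₑ)) := by
  refine le_trans (qnorm_mono fun l x => ?_) (qnorm_add_le hp0 _
    (fun l => ((continuous_sampleOp hKc l f).measurable.enorm.aemeasurable))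
    fun h => aemeasurable_pnorm_sampleOp hKc hf h)
  rw [sampleOp_add]
  exact enorm_add_le _ _

theorem qnorm_sampleOp_smul (hp0 : p ≠ 0) {N : ℕ} {K : (Fin d → ℝ) → ℂ} (c : ℂ)
    (f : (Fin d → ℝ) → ℂ) :
    qnorm p (fun l x => ‖sampleOp N K l (c • f) x‖ₑ) =
      ‖c‖ₑ ^ ex p * qnorm p (fun l x => ‖sampleOp N K l f x‖ₑ) := by
  simp only [sampleOp_smul, enorm_mul]
  exact qnorm_const_mul _ (by simp) _ hp0

/-- The Banach–Steinhaus theorem for sampling operators: convergence implies uniform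
boundedness. -/
theorem exists_qnorm_sampleOp_le_of_tendsto (hp0 : p ≠ 0) {N : ℕ → ℕ}
    {K : ℕ → (Fin d → ℝ) → ℂ} (hN : ∀ k, 0 < N k) (hK : ∀ k, Per (K k))
    (hKc : ∀ k, Continuous (K k))
    (h : ∀ f : (Fin d → ℝ) → ℝ, MemTorusLp p f → Tendsto (fun k => qnorm p fun l x =>
      ‖(f x : ℂ) - sampleOp (N k) (K k) l (fun y => (f y : ℂ)) x‖ₑ) atTop (𝓝 0)) :
    ∃ C : ℝ≥0∞, C ≠ ⊤ ∧ ∃ k₀, ∀ k ≥ k₀, ∀ f : (Fin d → ℝ) → ℝ, MemTorusLp p f →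
      qnorm p (fun l x => ‖sampleOp (N k) (K k) l (fun y => (f y : ℂ)) x‖ₑ) ≤
        C * pnorm p fun x => ‖f x‖ₑ := by
  have : Fact (p ≠ 0) := ⟨hp0⟩
  have he := ex_pos hp0
  have hc := quasiConst_ne_top p
  have hcc := cellConst_ne_top d p
  have hmax : 0 < max 1 (ex p) := by positivity
  set q : ℕ → ((Fin d → ℝ) → ℝ) → ℝ≥0∞ := fun k f =>
    qnorm p (fun l x => ‖sampleOp (N k) (K k) l (fun y => (f y : ℂ)) x‖ₑ) with hq
  have hqadd : ∀ k f g, MemTorusLp p f → q k (f + g) ≤ quasiConst p * (q k f + q k g) := by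
    intro k f g hf
    have := qnorm_sampleOp_add_le hp0 (N := N k) (hKc k) (g := fun y => (g y : ℂ))
      hf.aemeasurable_ofReal
    convert this using 6
    ext y; simp
  have hqsmul : ∀ k (c : ℝ) f, q k (c • f) = ‖c‖ₑ ^ ex p * q k f := by
    intro k c f
    have := qnorm_sampleOp_smul hp0 (N := N k) (K := K k) (c : ℂ) (fun y => (f y : ℂ))
    have hc : ‖(c : ℂ)‖ₑ = ‖c‖ₑ := by simp [← ofReal_norm]
    rw [hc] at this
    rw [← this]
    simp only [hq]
    congr! 5
    ext y; simp
  have hq0 : ∀ f : (Fin d → ℝ) → ℝ, pnorm p (fun x => ‖(f x : ℂ)‖ₑ) = pnorm p fun x => ‖f x‖ₑ := by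
    intro f
    congr! 2 with x
    simp [← ofReal_norm]
  have hcrude : ∀ k, ∃ B : ℝ≥0∞, B ≠ ⊤ ∧ ∀ f, MemTorusLp p f →
      q k f ≤ B * pnorm p fun x => ‖f x‖ₑ := by
    intro k
    obtain ⟨B, hB, hb⟩ := exists_qnorm_sampleOp_le_of_continuous hp0 (hN k) (hK k) (hKc k)
    exact ⟨B, hB, fun f hf => hq0 f ▸ hb _ hf.per_ofReal hf.aemeasurable_ofReal⟩
  choose B hB hqB using hcrude
  have hmod : ∀ f : (Fin d → ℝ) → ℝ, pnorm p (fun x => ‖f x‖ₑ) = modulus p f ^ max 1 (ex p) := by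
    intro f
    rw [modulus, ← ENNReal.rpow_mul, one_div, inv_mul_cancel₀ hmax.ne', ENNReal.rpow_one]
  -- Convergence at f bounds the values q k f for all large k, so these sets cover the space. By
  -- Baire the closure of one of them contains a ball.
  set A : ℕ → Set (TorusLp d p) := fun M => {f | ∀ k ≥ M, q k f.toFun ≤ M} with hA
  have hcover : ⋃ M, closure (A M) = Set.univ := by
    refine Set.eq_univ_of_forall fun f => ?_
    have hD : quasiConst p * (cellConst d p * pnorm p (fun x => ‖f.toFun x‖ₑ) + 1) ≠ ⊤ :=
      ENNReal.mul_ne_top hc (ENNReal.add_ne_top.2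
        ⟨ENNReal.mul_ne_top hcc (f.mem.pnorm_ne_top hp0), ENNReal.one_ne_top⟩)
    obtain ⟨M₁, hM₁⟩ := ENNReal.exists_nat_gt hD
    obtain ⟨M₂, hM₂⟩ := eventually_atTop.1
      ((h f.toFun f.mem).eventually_le_const (u := 1) one_pos)
    refine Set.mem_iUnion.2 ⟨max M₁ M₂, subset_closure fun k hk => ?_⟩
    have h1 : q k f.toFun ≤ quasiConst p *
        (cellConst d p * pnorm p (fun x => ‖f.toFun x‖ₑ) + 1) := by
      refine (qnorm_mono fun l x => ?_).trans ((qnorm_add_const_le hp0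
        (A := fun x => ‖(f.toFun x : ℂ)‖ₑ) (fun l x => ‖(f.toFun x : ℂ) -
          sampleOp (N k) (K k) l (fun y => (f.toFun y : ℂ)) x‖ₑ)
        f.mem.aemeasurable_ofReal.enorm.restrict).trans ?_)
      · have := enorm_sub_le (E := ℂ) (a := (f.toFun x : ℂ)) (b := (f.toFun x : ℂ) -
          sampleOp (N k) (K k) l (fun y => (f.toFun y : ℂ)) x)
        rwa [sub_sub_cancel] at this
      · rw [hq0]
        gcongr
        exact hM₂ k ((le_max_right _ _).trans hk)
    refine h1.trans (hM₁.le.trans ?_)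
    exact_mod_cast le_max_left _ _
  have : Nonempty (TorusLp d p) := ⟨⟨0, fun _ _ => rfl, by
    split_ifs
    · exact continuous_const
    · exact MemLp.zero⟩⟩
  obtain ⟨M, f₀, hf₀⟩ := nonempty_interior_of_iUnion_of_closed (fun M => isClosed_closure) hcover
  obtain ⟨ε, hε, hball⟩ := EMetric.mem_nhds_iff.1 (mem_interior_iff_mem_nhds.1 hf₀)
  -- Each single operator is continuous, so the bound extends to the closure with the loss of a
  -- quasi-triangle constant. How near g must be to f depends on k, but the resulting bound does
  -- not.
  have hcl : ∀ f ∈ closure (A M), ∀ k ≥ M, q k f.toFun ≤ quasiConst p * (1 + M) := by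
    intro f hf k hk
    obtain ⟨η, hη, hη'⟩ := exists_pos_forall_mul_rpow_le_one (hB k) hmax
    obtain ⟨g, hg, hfg⟩ := EMetric.mem_closure_iff.1 hf η hη
    have h1 := hqadd k (f.toFun - g.toFun) g.toFun (f.mem.sub g.mem)
    rw [sub_add_cancel] at h1
    refine h1.trans ?_
    gcongr
    · refine (hqB k _ (f.mem.sub g.mem)).trans ?_
      rw [hmod]
      exact hη' _ hfg
    · exact hg k hk
  set D : ℝ≥0∞ := quasiConst p * (quasiConst p * (1 + M) + quasiConst p * (1 + M)) with hD
  have hDt : D ≠ ⊤ := by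
    have : quasiConst p * (1 + M) ≠ ⊤ := ENNReal.mul_ne_top hc (by simp)
    exact ENNReal.mul_ne_top hc (ENNReal.add_ne_top.2 ⟨this, this⟩)
  -- Writing f = (f₀ + f) - f₀, with both members in the ball around f₀, transfers the bound to a
  -- ball around 0.
  have hsmall : ∀ f : (Fin d → ℝ) → ℝ, MemTorusLp p f → modulus p f < ε → ∀ k ≥ M, q k f ≤ D := by
    intro f hf hfε k hk
    have h1 := hcl ⟨f₀.toFun + f, f₀.mem.add hf⟩ (hball (by
      rw [Metric.mem_eball, TorusLp.edist_def]
      simpa using hfε)) k hk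
    have h2 := hcl f₀ (hball (Metric.mem_eball_self hε)) k hk
    have h3 := hqadd k (f₀.toFun + f) ((-1 : ℝ) • f₀.toFun) (f₀.mem.add hf)
    rw [hqsmul] at h3
    have h4 : f₀.toFun + f + (-1 : ℝ) • f₀.toFun = f := by ext; simp
    rw [h4] at h3
    rw [enorm_neg, enorm_one, ENNReal.one_rpow, one_mul] at h3
    exact h3.trans (mul_le_mul' le_rfl (add_le_add h1 h2))
  obtain ⟨e, he0, heε⟩ : ∃ e : ℝ≥0∞, 0 < e ∧ e < ε := exists_between hε
  set e₁ := min e 1 with he₁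
  have he₁0 : e₁ ≠ 0 := (lt_min he0 one_pos).ne'
  have he₁t : e₁ ≠ ⊤ := ne_top_of_le_ne_top ENNReal.one_ne_top (min_le_right _ _)
  set e₂ := e₁ ^ max 1 (ex p) with he₂
  have he₂0 : e₂ ≠ 0 := (ENNReal.rpow_pos (pos_iff_ne_zero.2 he₁0) he₁t).ne'
  have he₂t : e₂ ≠ ⊤ := (ENNReal.rpow_lt_top_of_nonneg hmax.le he₁t).ne
  refine ⟨D / e₂, ENNReal.div_ne_top hDt he₂0, M, fun k hk f hf => ?_⟩
  set P := pnorm p fun x => ‖f x‖ₑ with hP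
  by_cases hP0 : P = 0
  · have := hqB k f hf
    rw [← hP, hP0, mul_zero] at this
    exact this.trans zero_le
  have hPt : P ≠ ⊤ := hf.pnorm_ne_top hp0
  -- This factor rescales f to have modulus e₁ < ε, and homogeneity then turns the bound on a ball
  -- into an operator bound.
  set t : ℝ≥0∞ := (e₂ / P) ^ (1 / ex p) with ht
  have htt : t ≠ ⊤ := (ENNReal.rpow_lt_top_of_nonneg (by positivity) (ENNReal.div_ne_top he₂t hP0)).ne
  have hte : ‖t.toReal‖ₑ ^ ex p = e₂ / P := by
    rw [← ofReal_norm, Real.norm_of_nonneg ENNReal.toReal_nonneg, ENNReal.ofReal_toReal htt, ht,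
      ← ENNReal.rpow_mul, one_div, inv_mul_cancel₀ he.ne', ENNReal.rpow_one]
  have h1 := hsmall (t.toReal • f) (hf.const_smul _) (by
    rw [modulus]
    simp only [Pi.smul_apply, smul_eq_mul, enorm_mul]
    rw [pnorm_const_mul _ (by simp), hte, ← hP, ENNReal.div_mul_cancel hP0 hPt, he₂,
      ← ENNReal.rpow_mul, one_div, mul_inv_cancel₀ hmax.ne', ENNReal.rpow_one]
    exact (min_le_left _ _).trans_lt heε) k hk
  rw [hqsmul, hte] at h1
  have hne : e₂ / P ≠ 0 := ENNReal.div_ne_zero.2 ⟨he₂0, hPt⟩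
  have hnt : e₂ / P ≠ ⊤ := ENNReal.div_ne_top he₂t hP0
  have h2 : q k f ≤ D / (e₂ / P) := by
    rw [ENNReal.le_div_iff_mul_le (Or.inl hne) (Or.inl hnt), mul_comm]
    exact h1
  refine h2.trans (le_of_eq ?_)
  rw [div_eq_mul_inv, ENNReal.inv_div (Or.inl hPt) (Or.inl hP0), div_eq_mul_inv, div_eq_mul_inv]
  ring

end

/-! ### Testing operators on step functions. -/

theorem volume_cell_ne_zero (d : ℕ) : volume (cell d) ≠ 0 := by
  rw [cell, Real.volume_pi_Ico, Finset.prod_ne_zero_iff]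
  intro i _
  simp [pi_pos]

section

variable {d N : ℕ} [NeZero N]

/-- The index of the mesh cube of side `2π / N` containing a point. -/
noncomputable def meshIndex (N : ℕ) (x : Fin d → ℝ) : Fin d → ℤ := fun i => ⌊N * x i / (2 * π)⌋

/-- The periodic step function with the values `a` on the mesh cubes. -/
noncomputable def stepFun (a : (Fin d → Fin N) → ℝ) (x : Fin d → ℝ) : ℝ :=
  a (modN N (meshIndex N x))

theorem meshIndex_add_inode (x : Fin d → ℝ) (m : Fin d → ℤ) :
    meshIndex N (x + inode N m) = meshIndex N x + m := by
  ext i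
  have hN : (N : ℝ) ≠ 0 := by exact_mod_cast NeZero.ne N
  have hπ := pi_pos.ne'
  have : (N : ℝ) * (x i + 2 * π * m i / N) / (2 * π) = N * x i / (2 * π) + m i := by
    field_simp
  simp only [meshIndex, Pi.add_apply, inode, this, Int.floor_add_intCast]

theorem per_stepFun (a : (Fin d → Fin N) → ℝ) : Per (stepFun a) := by
  intro x m
  rw [stepFun, stepFun, ← inode_smul (NeZero.pos N), meshIndex_add_inode, modN_add_smul]

theorem measurable_stepFun (a : (Fin d → Fin N) → ℝ) : Measurable (stepFun a) := by
  have h1 : Measurable fun m : Fin d → ℤ => a (modN N m) := measurable_of_countable _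
  refine h1.comp (measurable_pi_lambda _ fun i => Int.measurable_floor.comp ?_)
  exact ((measurable_pi_apply i).const_mul _).div_const _

theorem memTorusLp_stepFun {p : ℝ≥0∞} (hp : p ≠ ⊤) (a : (Fin d → Fin N) → ℝ) :
    MemTorusLp p (stepFun a) := by
  refine ⟨(per_stepFun a).isPeriodic, ?_⟩
  rw [if_neg hp]
  refine MemLp.of_bound (measurable_stepFun a).aestronglyMeasurable (∑ k, ‖a k‖)
    (Eventually.of_forall fun x => ?_)
  exact Finset.single_le_sum (f := fun k => ‖a k‖) (fun k _ => norm_nonneg _) (Finset.mem_univ _)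

/-- Translations by the grid permute the mesh cubes, so the sum over all grid translates takes the
constant value given by the sum over all cubes. -/
theorem pow_mul_lintegral_stepFun (a : (Fin d → Fin N) → ℝ) (s : ℝ) :
    (N : ℝ≥0∞) ^ d * ∫⁻ x in cell d, ‖stepFun a x‖ₑ ^ s = volume (cell d) * ∑ k, ‖a k‖ₑ ^ s := by
  have h1 : ∀ k : Fin d → Fin N, ∫⁻ x in cell d, ‖stepFun a (x + inode N (fz k))‖ₑ ^ s =
      ∫⁻ x in cell d, ‖stepFun a x‖ₑ ^ s := fun k =>
    Per.setLIntegral_add (g := fun x => ‖stepFun a x‖ₑ ^ s)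
      ((per_stepFun a).comp fun z => ‖z‖ₑ ^ s) _
  have hm : ∀ y, Measurable fun x => ‖stepFun a (x + y)‖ₑ ^ s := fun y =>
    ((measurable_stepFun a).comp (measurable_add_const y)).enorm.pow_const s
  calc _ = ∑ k : Fin d → Fin N, ∫⁻ x in cell d, ‖stepFun a (x + inode N (fz k))‖ₑ ^ s := by
        simp [h1]
    _ = ∫⁻ x in cell d, ∑ k : Fin d → Fin N, ‖stepFun a (x + inode N (fz k))‖ₑ ^ s := by
        rw [lintegral_finsetSum _ fun k _ => hm _]
    _ = ∫⁻ x in cell d, ∑ k, ‖a k‖ₑ ^ s := by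
        refine lintegral_congr fun x => ?_
        have h2 := sum_fz_add (N := N) (F := fun m => ‖a (modN N m)‖ₑ ^ s)
          (fun m q => by rw [modN_add_smul]) (meshIndex N x)
        simp only [modN_fz] at h2
        rw [← h2]
        refine Finset.sum_congr rfl fun k _ => ?_
        rw [stepFun, meshIndex_add_inode, add_comm]
    _ = _ := by rw [setLIntegral_const, mul_comm]

/-- The sampled values depend only on the mesh cube containing l. After reindexing, l enters only
through its offset within that cube, as a translation in x, so the quasi-norm in x does not depend
on l. -/
theorem sampleOp_stepFun {K : (Fin d → ℝ) → ℂ} (hK : Per K) (a : (Fin d → Fin N) → ℝ)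
    (l x : Fin d → ℝ) :
    sampleOp N K l (fun y => (stepFun a y : ℂ)) x = ((N : ℂ) ^ d)⁻¹ *
      ∑ k, (a k : ℂ) * K (x - (l - inode N (meshIndex N l)) - inode N (fz k)) := by
  rw [sampleOp]
  congr 1
  have h := sum_fz_add (N := N) (F := fun m => (a (modN N m) : ℂ) *
    K (x - (l - inode N (meshIndex N l)) - inode N m)) (fun m q => by
      rw [modN_add_smul, inode_add, inode_smul (NeZero.pos N), ← hK _ q]
      congr 2; abel) (meshIndex N l)
  simp only [modN_fz] at h
  rw [← h]
  refine Finset.sum_congr rfl fun k _ => ?_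
  rw [stepFun, add_comm (inode N (fz k)), meshIndex_add_inode, add_comm (meshIndex N l), inode_add]
  congr 2
  abel

/-- Testing a bounded sampling operator on step functions. -/
theorem lintegral_sum_kernel_rpow_le {p : ℝ≥0∞} (hp : p ≠ ⊤) {K : (Fin d → ℝ) → ℂ}
    (hK : Per K) {C : ℝ≥0∞} (h : ∀ f : (Fin d → ℝ) → ℝ, MemTorusLp p f →
      qnorm p (fun l x => ‖sampleOp N K l (fun y => (f y : ℂ)) x‖ₑ) ≤ C * pnorm p fun x => ‖f x‖ₑ)
    (a : (Fin d → Fin N) → ℝ) :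
    (N : ℝ≥0∞) ^ d * ∫⁻ x in cell d,
      ‖((N : ℂ) ^ d)⁻¹ * ∑ k, (a k : ℂ) * K (x - inode N (fz k))‖ₑ ^ p.toReal ≤
      C * ∑ k, ‖a k‖ₑ ^ p.toReal := by
  set G : (Fin d → ℝ) → ℂ := fun x => ((N : ℂ) ^ d)⁻¹ * ∑ k, (a k : ℂ) * K (x - inode N (fz k))
  have hG : Per G := fun x m => by
    simp only [G]
    congr 1
    exact Finset.sum_congr rfl fun k _ => congrArg _ (hK.sub_right _ x m)
  have h1 := h (stepFun a) (memTorusLp_stepFun hp a)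
  rw [qnorm_of_ne_top hp] at h1
  simp only [pnorm_of_ne_top hp, sampleOp_stepFun hK] at h1
  have h2 : ∀ l, ∫⁻ x in cell d, ‖((N : ℂ) ^ d)⁻¹ * ∑ k, (a k : ℂ) *
      K (x - (l - inode N (meshIndex N l)) - inode N (fz k))‖ₑ ^ p.toReal =
      ∫⁻ x in cell d, ‖G x‖ₑ ^ p.toReal := fun l =>
    Per.setLIntegral_sub (g := fun x => ‖G x‖ₑ ^ p.toReal) (hG.comp fun z => ‖z‖ₑ ^ p.toReal) _
  simp only [h2] at h1
  rw [setLIntegral_const] at h1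
  have h3 : volume (cell d) * ((N : ℝ≥0∞) ^ d * ∫⁻ x in cell d, ‖G x‖ₑ ^ p.toReal) ≤
      volume (cell d) * (C * ∑ k, ‖a k‖ₑ ^ p.toReal) := by
    calc _ = (N : ℝ≥0∞) ^ d * ((∫⁻ x in cell d, ‖G x‖ₑ ^ p.toReal) * volume (cell d)) := by ring
      _ ≤ (N : ℝ≥0∞) ^ d * (C * ∫⁻ x in cell d, ‖stepFun a x‖ₑ ^ p.toReal) := by gcongr
      _ = C * ((N : ℝ≥0∞) ^ d * ∫⁻ x in cell d, ‖stepFun a x‖ₑ ^ p.toReal) := by ring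
      _ = _ := by rw [pow_mul_lintegral_stepFun]; ring
  exact (ENNReal.mul_le_mul_iff_right (volume_cell_ne_zero d) (volume_cell_lt_top d).ne).1 h3

/-- Testing a bounded sampling operator on the indicator function of a mesh cube. -/
theorem lintegral_kernel_rpow_le {p : ℝ≥0∞} (hp0 : p ≠ 0) (hp : p ≠ ⊤) {K : (Fin d → ℝ) → ℂ}
    (hK : Per K) {C : ℝ≥0∞} (h : ∀ f : (Fin d → ℝ) → ℝ, MemTorusLp p f →
      qnorm p (fun l x => ‖sampleOp N K l (fun y => (f y : ℂ)) x‖ₑ) ≤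
        C * pnorm p fun x => ‖f x‖ₑ) :
    (N : ℝ≥0∞) ^ d * ∫⁻ x in cell d, ‖((N : ℂ) ^ d)⁻¹ * K x‖ₑ ^ p.toReal ≤ C := by
  classical
  have h1 := lintegral_sum_kernel_rpow_le hp hK h (Pi.single 0 1)
  have h0 : inode N (fz (0 : Fin d → Fin N)) = 0 := by
    ext i; simp [inode, fz]
  have hpr := ENNReal.toReal_pos hp0 hp
  have e1 : ∀ x, ∑ k, (((Pi.single 0 1 : (Fin d → Fin N) → ℝ) k : ℝ) : ℂ) *
      K (x - inode N (fz k)) = K x := by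
    intro x
    rw [Finset.sum_eq_single 0 (fun k _ hk => by simp [hk]) (by simp)]
    simp [h0]
  have e2 : ∑ k, ‖(Pi.single 0 1 : (Fin d → Fin N) → ℝ) k‖ₑ ^ p.toReal = 1 := by
    rw [Finset.sum_eq_single 0 (fun k _ hk => by simp [hk, hpr]) (by simp)]
    simp
  simpa only [e1, e2, mul_one] using h1

end

/-! ### Rescaled kernels and the Fourier transform of the symbol. -/

section

open scoped Pointwise

variable {d : ℕ}

/-- Riemann sums of compactly supported continuous functions. -/
theorem tendsto_riemann_sum_real {F : (Fin d → ℝ) → ℝ} (hF : Continuous F) {R : ℝ}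
    (h0 : ∀ v, R < ‖v‖ → F v = 0) :
    Tendsto (fun n : ℕ => (∑' k : Fin d → ℤ, F (fun i => (n : ℝ)⁻¹ * k i)) / n ^ d) atTop
      (𝓝 (∫ v, F v)) := by
  set s : Set (Fin d → ℝ) := Metric.closedBall 0 R with hs
  have h1 := tendsto_tsum_div_pow_atTop_integral s F hF Metric.isBounded_closedBall
    measurableSet_closedBall ((convex_closedBall 0 R).addHaar_frontier volume)
  rw [setIntegral_eq_integral_of_forall_compl_eq_zero
    (fun x hx => h0 x (by simpa [hs] using hx)), Fintype.card_fin] at h1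
  refine h1.congr' ?_
  filter_upwards [eventually_gt_atTop 0] with n hn
  have hn' : (n : ℝ) ≠ 0 := by positivity
  have : NeZero n := ⟨hn.ne'⟩
  congr 1
  set S : Set (Fin d → ℝ) := s ∩ (n : ℝ)⁻¹ •
    (Submodule.span ℤ (Set.range (Pi.basisFun ℝ (Fin d))) : Set (Fin d → ℝ)) with hS
  set e : (Fin d → ℤ) → (Fin d → ℝ) := fun k i => (n : ℝ)⁻¹ * k i with he
  have hinj : Function.Injective e := by
    intro k k' h
    ext i
    have := congrFun h i
    simp only [he] at this
    exact_mod_cast mul_left_cancel₀ (inv_ne_zero hn') this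
  have hmem : ∀ v, v ∈ (n : ℝ)⁻¹ •
      (Submodule.span ℤ (Set.range (Pi.basisFun ℝ (Fin d))) : Set (Fin d → ℝ)) ↔
      v ∈ Set.range e := by
    intro v
    have := BoxIntegral.unitPartition.mem_smul_span_iff (n := n) (v := v)
    refine this.trans ⟨fun h => ?_, ?_⟩
    · choose k hk using h
      refine ⟨k, ?_⟩
      ext i
      have := hk i
      simp only [he]
      simp only [algebraMap_int_eq, eq_intCast] at this
      rw [this]; field_simp
    · rintro ⟨k, rfl⟩ i
      refine ⟨k i, ?_⟩
      simp only [he]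
      simp only [algebraMap_int_eq, eq_intCast]
      field_simp
  have h2 : ∑' x : ↑S, F x = ∑' x, S.indicator F x := tsum_subtype S F
  have h3 := hinj.tsum_eq (f := S.indicator F) (fun x hx => (hmem x).1
    (Set.mem_of_indicator_ne_zero hx).2)
  refine h2.trans (h3.symm.trans (tsum_congr fun k => ?_))
  by_cases hk : e k ∈ s
  · exact Set.indicator_of_mem (show e k ∈ S from ⟨hk, (hmem _).2 ⟨k, rfl⟩⟩) F
  · rw [Set.indicator_of_notMem (fun h => hk h.1)]
    exact (h0 _ (by simpa [hs] using hk)).symm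

theorem tendsto_riemann_sum {F : (Fin d → ℝ) → ℂ} (hF : Continuous F) {R : ℝ}
    (h0 : ∀ v, R < ‖v‖ → F v = 0) :
    Tendsto (fun n : ℕ => (∑' k : Fin d → ℤ, F (fun i => (n : ℝ)⁻¹ * k i)) / n ^ d) atTop
      (𝓝 (∫ v, F v)) := by
  have hInt : Integrable F := hF.integrable_of_hasCompactSupport
    (HasCompactSupport.intro (isCompact_closedBall (0 : Fin d → ℝ) R)
      fun x hx => h0 x (by simpa using hx))
  have h1 := tendsto_riemann_sum_real (Complex.continuous_re.comp hF) (R := R)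
    fun v hv => by simp [h0 v hv]
  have h2 := tendsto_riemann_sum_real (Complex.continuous_im.comp hF) (R := R)
    fun v hv => by simp [h0 v hv]
  have h3 := ((Complex.continuous_ofReal.tendsto _).comp h1).add
    (((Complex.continuous_ofReal.tendsto _).comp h2).mul_const Complex.I)
  have e1 : ((∫ v, (Complex.re ∘ F) v : ℝ) : ℂ) + ((∫ v, (Complex.im ∘ F) v : ℝ) : ℂ) * Complex.I =
      ∫ v, F v := by
    have := integral_re_add_im (𝕜 := ℂ) hInt
    simpa using this
  rw [e1] at h3
  refine h3.congr' ?_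
  filter_upwards [eventually_gt_atTop 0] with n hn
  have hn' : (0 : ℝ) < n := by positivity
  have hsum : Summable fun k : Fin d → ℤ => F (fun i => (n : ℝ)⁻¹ * k i) := by
    refine summable_of_hasFiniteSupport ((Set.finite_Icc (fun _ : Fin d => -⌈n * R⌉)
      (fun _ => ⌈n * R⌉)).subset fun k hk => ?_)
    have h4 : ‖fun i => (n : ℝ)⁻¹ * k i‖ ≤ R := by
      by_contra h
      exact hk (h0 _ (not_le.1 h))
    have h5 : ∀ i, |(k i : ℝ)| ≤ ⌈n * R⌉ := fun i => by
      have := (norm_le_pi_norm (fun i => (n : ℝ)⁻¹ * (k i : ℝ)) i).trans h4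
      rw [Real.norm_eq_abs, abs_mul, abs_of_pos (inv_pos.2 hn'), ← div_eq_inv_mul,
        div_le_iff₀ hn', mul_comm] at this
      exact this.trans (Int.le_ceil _)
    exact ⟨fun i => by exact_mod_cast (abs_le.1 (h5 i)).1,
      fun i => by exact_mod_cast (abs_le.1 (h5 i)).2⟩
  simp only [Function.comp_apply, Complex.ofReal_div, Complex.ofReal_pow, Complex.ofReal_natCast]
  rw [← Complex.re_tsum hsum, ← Complex.im_tsum hsum, div_mul_eq_mul_div, ← add_div,
    Complex.re_add_im]

variable {ψ : EuclideanSpace ℝ (Fin d) → ℂ} {R : ℝ}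

/-- The rescaled kernels of a symbol converge to its Fourier transform. -/
theorem tendsto_symKernel_div (hψ : Continuous ψ) (h0 : ∀ v, R ≤ ‖v‖ → ψ v = 0)
    (y : Fin d → ℝ) :
    Tendsto (fun n : ℕ => symKernel ψ n ((n : ℝ)⁻¹ • y) / n ^ d) atTop
      (𝓝 (𝓕 ψ (WithLp.toLp 2 (-((2 * π)⁻¹ • y))))) := by
  set F : (Fin d → ℝ) → ℂ := fun v => ψ (WithLp.toLp 2 v) *
    Complex.exp (Complex.I * ((∑ i, v i * y i : ℝ) : ℂ)) with hF
  have hFc : Continuous F := by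
    have : Continuous fun v : Fin d → ℝ => (WithLp.toLp 2 v : EuclideanSpace ℝ (Fin d)) := by
      fun_prop
    have h2 := hψ.comp this
    simp only [Function.comp_def] at h2
    fun_prop
  have h1 := tendsto_riemann_sum hFc (R := R) (fun v hv => by
    have : R ≤ ‖(WithLp.toLp 2 v : EuclideanSpace ℝ (Fin d))‖ := by
      by_contra hlt
      have hle : ‖v‖ ≤ ‖(WithLp.toLp 2 v : EuclideanSpace ℝ (Fin d))‖ :=
        (pi_norm_le_iff_of_nonneg (norm_nonneg _)).2 fun i =>
          PiLp.norm_apply_le (WithLp.toLp 2 v : EuclideanSpace ℝ (Fin d)) i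
      linarith [not_le.1 hlt]
    simp only [hF, h0 _ this, zero_mul])
  have e1 : ∫ v, F v = 𝓕 ψ (WithLp.toLp 2 (-((2 * π)⁻¹ • y))) := by
    rw [Real.fourier_eq', ← (EuclideanSpace.volume_preserving_symm_measurableEquiv_toLp
      (Fin d)).integral_comp (MeasurableEquiv.measurableEmbedding _)]
    refine integral_congr_ae (Eventually.of_forall fun v => ?_)
    simp only [hF, smul_eq_mul]
    rw [mul_comm]
    congr 2
    rw [mul_comm]
    congr 2
    rw [PiLp.inner_apply, Finset.mul_sum]
    refine Finset.sum_congr rfl fun i _ => ?_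
    have hπ : π ≠ 0 := pi_ne_zero
    simp
    field_simp
  rw [e1] at h1
  refine h1.congr fun n => ?_
  congr 1
  refine tsum_congr fun k => ?_
  simp only [hF, expo]
  congr 4
  refine Finset.sum_congr rfl fun i _ => ?_
  simp
  ring

/-- The shift by π puts the origin at the centre of the cell, so that the rescaled cells exhaust the
whole space as n grows. -/
theorem lintegral_indicator_cell_smul {g : (Fin d → ℝ) → ℝ≥0∞} (hg : Per g) {n : ℕ} (hn : 0 < n) :
    ∫⁻ y : Fin d → ℝ, (cell d).indicator (fun x => g (x - fun _ => π))
      ((n : ℝ)⁻¹ • y + fun _ => π) = (n : ℝ≥0∞) ^ d * ∫⁻ x in cell d, g x := by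
  have hn' : (0 : ℝ) < n := by positivity
  rw [lintegral_comp_smul_of_pos (inv_pos.2 hn') fun x =>
    (cell d).indicator (fun x => g (x - fun _ => π)) (x + fun _ => π),
    lintegral_add_right_eq_self fun x => (cell d).indicator (fun x => g (x - fun _ => π)) x,
    lintegral_indicator (show MeasurableSet (cell d) from measurableSet_cube d _), hg.setLIntegral_sub]
  congr 1
  rw [inv_pow, inv_inv, ENNReal.ofReal_pow hn'.le, ENNReal.ofReal_natCast]

theorem eventually_mem_cell (y : Fin d → ℝ) :
    ∀ᶠ n : ℕ in atTop, (n : ℝ)⁻¹ • y + (fun _ => π) ∈ cell d := by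
  have h1 : Tendsto (fun n : ℕ => (n : ℝ)⁻¹ • y + fun _ => π) atTop
      (𝓝 ((0 : ℝ) • y + fun _ => π)) :=
    (tendsto_inv_atTop_nhds_zero_nat.smul_const y).add_const _
  rw [zero_smul, zero_add] at h1
  have h2 : (Set.univ.pi fun _ : Fin d => Set.Ioo 0 (2 * π)) ∈ 𝓝 (fun _ : Fin d => π) :=
    (isOpen_set_pi Set.finite_univ fun _ _ => isOpen_Ioo).mem_nhds fun i _ =>
      ⟨pi_pos, by linarith [pi_pos]⟩
  filter_upwards [h1 h2] with n hn i _
  exact Set.Ioo_subset_Ico_self (hn i trivial)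

/-- A uniform bound for the `L_s` quasi-norms of the rescaled kernels passes to the Fourier
transform of the symbol. -/
theorem lintegral_fourier_rpow_ne_top (hψ : Continuous ψ) (h0 : ∀ v, R ≤ ‖v‖ → ψ v = 0)
    (hKc : ∀ n : ℕ, 0 < n → Continuous (symKernel ψ n)) {s : ℝ} (hs : 0 < s) {C : ℝ≥0∞}
    (hC : C ≠ ⊤)
    (h : ∀ᶠ n : ℕ in atTop, ((2 * n + 1 : ℕ) : ℝ≥0∞) ^ d * ∫⁻ x in cell d,
      ‖(((2 * n + 1 : ℕ) : ℂ) ^ d)⁻¹ * symKernel ψ n x‖ₑ ^ s ≤ C) :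
    ∫⁻ y, ‖𝓕 ψ y‖ₑ ^ s ≠ ⊤ := by
  set g : ℕ → (Fin d → ℝ) → ℝ≥0∞ := fun n x =>
    ‖(((2 * n + 1 : ℕ) : ℂ) ^ d)⁻¹ * symKernel ψ n x‖ₑ ^ s with hg
  have hgper : ∀ n, Per (g n) := fun n =>
    (per_symKernel ψ n).comp fun z => ‖(((2 * n + 1 : ℕ) : ℂ) ^ d)⁻¹ * z‖ₑ ^ s
  set H : ℕ → (Fin d → ℝ) → ℝ≥0∞ := fun n y =>
    (cell d).indicator (fun x => g n (x - fun _ => π)) ((n : ℝ)⁻¹ • y + fun _ => π) with hH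
  have hHm : ∀ n : ℕ, 0 < n → Measurable (H n) := by
    intro n hn
    have h1 : Measurable (g n) := ((hKc n hn).measurable.const_mul _).enorm.pow_const s
    exact ((h1.comp (measurable_sub_const _)).indicator (measurableSet_cube d _)).comp
      ((measurable_const_smul _).add_const _)
  set L : (Fin d → ℝ) → ℝ≥0∞ := fun y =>
    ‖((2 : ℂ) ^ d)⁻¹ * 𝓕 ψ (WithLp.toLp 2 (-((2 * π)⁻¹ • y)))‖ₑ ^ s with hL
  -- Any fixed y eventually lies in the rescaled cell. The normalization by (2n+1)^d instead of n^d
  -- produces the factor 2^{-d} in the limit.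
  have hlim : ∀ y, Tendsto (fun n => H n y) atTop (𝓝 (L y)) := by
    intro y
    have h1 : Tendsto (fun n : ℕ => ((n : ℂ) / (2 * n + 1 : ℕ)) ^ d *
        (symKernel ψ n ((n : ℝ)⁻¹ • y) / n ^ d)) atTop
        (𝓝 ((1 / 2) ^ d * 𝓕 ψ (WithLp.toLp 2 (-((2 * π)⁻¹ • y))))) := by
      refine Tendsto.mul (Tendsto.pow ?_ d) (tendsto_symKernel_div hψ h0 y)
      have h2 : Tendsto (fun n : ℕ => ((n : ℝ) / (2 * n + 1 : ℕ))) atTop (𝓝 (1 / 2)) := by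
        have h3 : Tendsto (fun n : ℕ => (1 : ℝ) / (2 + (n : ℝ)⁻¹)) atTop (𝓝 (1 / (2 + 0))) :=
          tendsto_const_nhds.div (tendsto_const_nhds.add tendsto_inv_atTop_nhds_zero_nat)
            (by norm_num)
        rw [add_zero] at h3
        refine h3.congr' ?_
        filter_upwards [eventually_gt_atTop 0] with n hn
        have : (n : ℝ) ≠ 0 := by positivity
        push_cast
        field_simp
      have := (Complex.continuous_ofReal.tendsto _).comp h2
      simpa [Function.comp_def] using this
    rw [one_div, inv_pow] at h1
    have h4 := ((ENNReal.continuous_rpow_const (y := s)).tendsto _).comp h1.enorm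
    refine h4.congr' ?_
    filter_upwards [eventually_gt_atTop 0, eventually_mem_cell y] with n hn hy
    have hn' : (n : ℂ) ^ d ≠ 0 := pow_ne_zero _ (by exact_mod_cast hn.ne')
    simp only [hH, Function.comp_apply, Set.indicator_of_mem hy, hg, add_sub_cancel_right]
    congr 2
    rw [div_pow]
    field_simp
  have hfat : ∫⁻ y, L y ≤ C := by
    -- Fatou's lemma is applied along n + 1, because measurability of the kernels is available for
    -- positive indices only.
    have e : ∀ y, L y = liminf (fun n => H (n + 1) y) atTop := fun y =>
      (((tendsto_add_atTop_iff_nat 1).2 (hlim y)).liminf_eq).symm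
    simp only [e]
    refine (lintegral_liminf_le fun n => hHm (n + 1) n.succ_pos).trans ?_
    refine liminf_le_of_frequently_le' (Eventually.frequently ?_)
    filter_upwards [(tendsto_add_atTop_nat 1).eventually h] with n hn
    refine le_trans ?_ hn
    simp only [hH]
    rw [lintegral_indicator_cell_smul (hgper _) n.succ_pos]
    gcongr
    omega
  set Φ : (Fin d → ℝ) → ℝ≥0∞ := fun x => ‖𝓕 ψ (WithLp.toLp 2 x)‖ₑ ^ s with hΦ
  have e1 : ∫⁻ y, ‖𝓕 ψ y‖ₑ ^ s = ∫⁻ x, Φ x :=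
    ((PiLp.volume_preserving_toLp (Fin d)).lintegral_comp_emb
      (MeasurableEquiv.toLp 2 (Fin d → ℝ)).measurableEmbedding fun y => ‖𝓕 ψ y‖ₑ ^ s).symm
  have e2 : ∀ y, L y = ‖((2 : ℂ) ^ d)⁻¹‖ₑ ^ s * Φ (-((2 * π)⁻¹ • y)) := fun y => by
    simp only [hL, hΦ]
    rw [enorm_mul, ENNReal.mul_rpow_of_nonneg _ _ hs.le]
  have hc0 : ‖((2 : ℂ) ^ d)⁻¹‖ₑ ^ s ≠ 0 :=
    (ENNReal.rpow_pos (by simp) (by simp)).ne'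
  have hct : ‖((2 : ℂ) ^ d)⁻¹‖ₑ ^ s ≠ ⊤ := (ENNReal.rpow_lt_top_of_nonneg hs.le (by simp)).ne
  simp only [e2] at hfat
  rw [lintegral_const_mul' _ _ hct, lintegral_comp_smul_of_pos (by positivity) fun x => Φ (-x),
    lintegral_neg_eq_self Φ] at hfat
  rw [e1]
  intro htop
  rw [htop, ENNReal.mul_top (by simp; positivity), ENNReal.mul_top hc0] at hfat
  exact hC (top_le_iff.1 hfat)

end

/-! ### A Nikolskii inequality and the conjugate exponent. -/

section

variable {d : ℕ}

/-- A smooth symbol equal to `1` on the unit ball and supported in the ball of radius `2`. -/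
noncomputable def plateau (d : ℕ) : EuclideanSpace ℝ (Fin d) → ℂ :=
  radial _ fun u => smoothTransition (3 - u)

theorem plateau_eq_one {v : EuclideanSpace ℝ (Fin d)} (hv : ‖v‖ ≤ 1) : plateau d v = 1 := by
  rw [plateau, radial, smoothTransition.one_of_one_le (by nlinarith [norm_nonneg v]),
    Complex.ofReal_one]

theorem isSymbol_plateau (d M : ℕ) : IsSymbol (M : ℝ) (2 : ℕ) (plateau d) where
  continuous := continuous_radial
    (smoothTransition.continuous.comp (continuous_const.sub continuous_id)).continuousOn
  support v hv := by
    rw [plateau, radial, smoothTransition.zero_of_nonpos (by push_cast at hv; nlinarith),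
      Complex.ofReal_zero]
  decay := hasDecay_fourier_radial (R := 3) (fun u _ => ((smoothTransition.contDiff (n := M)).comp
      (contDiff_const.sub contDiff_id)).contDiffAt)
    fun u hu => smoothTransition.zero_of_nonpos (by linarith)

/-- Trigonometric polynomials with frequencies in the open ball of radius `n`. -/
noncomputable def ballPoly (d n : ℕ) : Submodule ℂ ((Fin d → ℝ) → ℂ) :=
  Submodule.span ℂ (expo '' (freqs d (1 : ℕ) n : Set (Fin d → ℤ)))

theorem ballPoly_le_trigPoly (d n : ℕ) : ballPoly d n ≤ trigPoly d n :=
  Submodule.span_mono (Set.image_mono fun k hk i => by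
    simpa using abs_le_of_mem_freqs (m := 1) hk i)

theorem IsSymbol.symKernel_sub_mem_ballPoly {ψ : EuclideanSpace ℝ (Fin d) → ℂ} {a : ℝ} {n : ℕ}
    (hψ : IsSymbol a (1 : ℕ) ψ) (hn : 0 < n) (y : Fin d → ℝ) :
    (fun x => symKernel ψ n (x - y)) ∈ ballPoly d n := by
  have : (fun x => symKernel ψ n (x - y)) = ∑ k ∈ freqs d (1 : ℕ) n,
      (ψ ((n : ℝ)⁻¹ • lat k) * expo k (-y)) • expo k := by
    ext x
    rw [hψ.symKernel_eq_sum hn, Finset.sum_apply]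
    refine Finset.sum_congr rfl fun k _ => ?_
    rw [Pi.smul_apply, smul_eq_mul, expo_sub_right]
    ring
  rw [this]
  exact Submodule.sum_mem _ fun k hk => Submodule.smul_mem _ _ (Submodule.subset_span ⟨k, hk, rfl⟩)

/-- The symbol is 1 at all frequencies of G after scaling, and N > 3n excludes aliasing, so sampling
reproduces G. -/
theorem sampleOp_plateau {n N : ℕ} (hn : 0 < n) (hN : 2 * n + n < N) {G : (Fin d → ℝ) → ℂ}
    (hG : G ∈ ballPoly d n) (l x : Fin d → ℝ) :
    sampleOp N (symKernel (plateau d) n) l G x = G x := by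
  induction hG using Submodule.span_induction with
  | mem g h =>
    obtain ⟨k, hk, rfl⟩ := h
    rw [sampleOp_expo (isSymbol_plateau d 0) hn hN (M := n)
      (by simpa using abs_le_of_mem_freqs (m := 1) hk), plateau_eq_one, one_mul]
    have hn' : (0 : ℝ) < n := by positivity
    have := (mem_freqs.1 hk).le
    rw [norm_smul, norm_inv, Real.norm_of_nonneg hn'.le, ← div_eq_inv_mul, div_le_one hn']
    simpa using this
  | zero => simp [sampleOp]
  | add g h _ _ h1 h2 => rw [sampleOp_add, h1, h2, Pi.add_apply]
  | smul c g _ h1 => rw [sampleOp_smul, h1, Pi.smul_apply, smul_eq_mul]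

/-- A Nikolskii type inequality for trigonometric polynomials. -/
theorem exists_enorm_rpow_le_lintegral (d : ℕ) {s : ℝ} (hs : 1 ≤ s) :
    ∃ C : ℝ≥0∞, C ≠ ⊤ ∧ ∀ n : ℕ, 0 < n → ∀ G ∈ ballPoly d n, ∀ y,
      ‖G y‖ₑ ^ s ≤ C * (((2 * n + 1 : ℕ) : ℝ≥0∞) ^ d * ∫⁻ x in cell d, ‖G x‖ₑ ^ s) := by
  obtain ⟨C, hC, -, hW⟩ := (isSymbol_plateau d (d + 1)).exists_sum_weights_le
    (by push_cast; linarith)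
  have hs0 : 0 < s := by linarith
  have hCs : C ^ s ≠ ⊤ := (ENNReal.rpow_lt_top_of_nonneg hs0.le hC).ne
  have hv0 := volume_cell_ne_zero d
  have hvt := (volume_cell_lt_top d).ne
  refine ⟨(volume (cell d))⁻¹ * (C ^ s * 2 ^ d), ENNReal.mul_ne_top (ENNReal.inv_ne_top.2 hv0)
    (ENNReal.mul_ne_top hCs (by simp)), fun n hn G hG y => ?_⟩
  have hGt := ballPoly_le_trigPoly d n hG
  have hGp := per_of_mem_trigPoly hGt
  have hGm := (continuous_of_mem_trigPoly hGt).measurable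
  set N := 4 * n + 1 with hN
  -- The reproducing formula holds for every shift of the grid. Averaging this bound over the shifts
  -- turns the discrete sum into an integral over the cell.
  have h1 : ∀ l : Fin d → ℝ, ‖G y‖ₑ ^ s ≤
      C ^ s * ∑ k : Fin d → Fin N, ‖G (inode N (fz k) + l)‖ₑ ^ s := by
    intro l
    set w : (Fin d → Fin N) → ℝ≥0∞ := fun k =>
      ((N : ℝ≥0∞) ^ d)⁻¹ * ‖symKernel (plateau d) n (y - inode N (fz k) - l)‖ₑ with hw
    have hwC : ∑ k, w k ≤ C := hW n N hn (by omega) (by omega) l y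
    have h2 : ‖G y‖ₑ ≤ ∑ k, w k * ‖G (inode N (fz k) + l)‖ₑ := by
      conv_lhs => rw [← sampleOp_plateau hn (N := N) (by omega) hG l y]
      refine (enorm_sampleOp_le (by omega) l G y).trans (le_of_eq ?_)
      rw [Finset.mul_sum]
      exact Finset.sum_congr rfl fun k _ => by simp only [hw]; ring
    have h3 := ENNReal.inner_le_weight_mul_Lp_of_nonneg Finset.univ hs w
      fun k => ‖G (inode N (fz k) + l)‖ₑ
    refine (ENNReal.rpow_le_rpow (h2.trans h3) hs0.le).trans ?_
    rw [ENNReal.mul_rpow_of_nonneg _ _ hs0.le, ← ENNReal.rpow_mul, ← ENNReal.rpow_mul,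
      inv_mul_cancel₀ hs0.ne', ENNReal.rpow_one, sub_mul, one_mul, inv_mul_cancel₀ hs0.ne']
    have h4 : C ^ s = C ^ (s - 1) * C := by
      conv_rhs => rw [← ENNReal.rpow_one C, ← ENNReal.rpow_mul, one_mul,
        ← ENNReal.rpow_add_of_nonneg _ _ (by linarith) zero_le_one, sub_add_cancel]
    rw [h4, mul_assoc, Finset.mul_sum (a := C)]
    refine mul_le_mul' (ENNReal.rpow_le_rpow hwC (by linarith)) (Finset.sum_le_sum fun k _ => ?_)
    gcongr
    exact (Finset.single_le_sum (f := w) (fun _ _ => zero_le) (Finset.mem_univ k)).trans hwC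
  have hm : ∀ z, Measurable fun l => ‖G (z + l)‖ₑ ^ s := fun z =>
    (hGm.comp (measurable_const_add z)).enorm.pow_const s
  have h5 : volume (cell d) * ‖G y‖ₑ ^ s ≤
      C ^ s * ((N : ℝ≥0∞) ^ d * ∫⁻ x in cell d, ‖G x‖ₑ ^ s) := by
    calc volume (cell d) * ‖G y‖ₑ ^ s = ∫⁻ l in cell d, ‖G y‖ₑ ^ s := by
          rw [setLIntegral_const, mul_comm]
      _ ≤ ∫⁻ l in cell d, C ^ s * ∑ k : Fin d → Fin N, ‖G (inode N (fz k) + l)‖ₑ ^ s :=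
          lintegral_mono h1
      _ = C ^ s * ∑ k : Fin d → Fin N, ∫⁻ l in cell d, ‖G (inode N (fz k) + l)‖ₑ ^ s := by
          rw [lintegral_const_mul' _ _ hCs, lintegral_finsetSum _ fun k _ => hm _]
      _ = _ := by
          have : ∀ k : Fin d → Fin N, ∫⁻ l in cell d, ‖G (inode N (fz k) + l)‖ₑ ^ s =
              ∫⁻ x in cell d, ‖G x‖ₑ ^ s := fun k => by
            simp only [add_comm (inode N (fz k))]
            exact Per.setLIntegral_add (g := fun x => ‖G x‖ₑ ^ s) (hGp.comp fun z => ‖z‖ₑ ^ s) _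
          simp [this]
  have h6 : (N : ℝ≥0∞) ^ d ≤ 2 ^ d * ((2 * n + 1 : ℕ) : ℝ≥0∞) ^ d := by
    rw [← mul_pow]
    gcongr
    rw [hN]
    exact_mod_cast (by omega : 4 * n + 1 ≤ 2 * (2 * n + 1))
  calc ‖G y‖ₑ ^ s = (volume (cell d))⁻¹ * (volume (cell d) * ‖G y‖ₑ ^ s) := by
        rw [← mul_assoc, ENNReal.inv_mul_cancel hv0 hvt, one_mul]
    _ ≤ (volume (cell d))⁻¹ * (C ^ s * ((N : ℝ≥0∞) ^ d * ∫⁻ x in cell d, ‖G x‖ₑ ^ s)) := by gcongr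
    _ ≤ (volume (cell d))⁻¹ * (C ^ s * (2 ^ d * ((2 * n + 1 : ℕ) : ℝ≥0∞) ^ d *
        ∫⁻ x in cell d, ‖G x‖ₑ ^ s)) := by gcongr
    _ = _ := by ring

/-- The kernel of a real radial symbol is real. -/
theorem symKernel_radial_eq_re (ρ : ℝ → ℝ) (n : ℕ) (x : Fin d → ℝ) :
    symKernel (radial _ ρ) n x = ((symKernel (radial _ ρ) n x).re : ℂ) := by
  refine (Complex.conj_eq_iff_re.1 ?_).symm
  rw [symKernel, Complex.conj_tsum, ← (Equiv.neg (Fin d → ℤ)).tsum_eq]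
  refine tsum_congr fun k => ?_
  have h1 : (starRingEnd ℂ) (expo (-k) x) = expo k x := by
    simp [expo, ← Complex.exp_conj]
  have h2 : lat (-k) = -lat k := by ext i; simp [lat]
  rw [Equiv.neg_apply, map_mul, h1, h2]
  congr 1
  simp [radial]

end

section

variable {d N : ℕ} [NeZero N] {K : (Fin d → ℝ) → ℂ} {C : ℝ≥0∞}

/-- Testing a bounded sampling operator on a function resembling the sign of the kernel. -/
theorem sum_enorm_kernel_le_of_top (hK : Per K) (hKc : Continuous K)
    (hKr : ∀ x, K x = ((K x).re : ℂ)) (h : ∀ f : (Fin d → ℝ) → ℝ, MemTorusLp ⊤ f →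
      qnorm ⊤ (fun l x => ‖sampleOp N K l (fun y => (f y : ℂ)) x‖ₑ) ≤
        C * pnorm ⊤ fun x => ‖f x‖ₑ) (y : Fin d → ℝ) :
    ∑ k : Fin d → Fin N, ‖((N : ℂ) ^ d)⁻¹ * K (y - inode N (fz k))‖ₑ ^ (1 : ℝ) ≤ C + 1 := by
  -- A continuous substitute for the sign of the kernel, as p = ∞ demands continuous functions.
  -- Since |t| ≤ t^2/(|t| + 1) + 1, it loses at most 1 after averaging over the grid.
  set f : (Fin d → ℝ) → ℝ := fun t => (K (y - t)).re / (|(K (y - t)).re| + 1) with hf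
  have hden : ∀ t : ℝ, 0 < |t| + 1 := fun t => by positivity
  have hfmem : MemTorusLp ⊤ f := by
    refine ⟨Per.isPeriodic ((hK.sub_left y).comp fun z : ℂ => z.re / (|z.re| + 1)), ?_⟩
    rw [if_pos rfl]
    have h1 : Continuous fun t => (K (y - t)).re :=
      Complex.continuous_re.comp (hKc.comp (continuous_sub_left y))
    exact h1.div (by fun_prop) fun t => (hden _).ne'
  have hf1 : pnorm ⊤ (fun x => ‖f x‖ₑ) ≤ 1 := by
    rw [pnorm_top]
    refine iSup₂_le fun t _ => ?_
    rw [← ofReal_norm, Real.norm_eq_abs, hf, abs_div, abs_of_pos (hden _)]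
    refine ENNReal.ofReal_le_one.2 ((div_le_one (hden _)).2 ?_)
    linarith
  have h1 : ‖sampleOp N K 0 (fun t => (f t : ℂ)) y‖ₑ ≤ C := by
    calc _ ≤ pnorm ⊤ (fun x => ‖sampleOp N K 0 (fun t => (f t : ℂ)) x‖ₑ) :=
          Per.le_pnorm_top ((per_sampleOp hK 0 _).comp fun z => ‖z‖ₑ) y
      _ ≤ qnorm ⊤ (fun l x => ‖sampleOp N K l (fun t => (f t : ℂ)) x‖ₑ) := by
          rw [qnorm_top]
          exact le_iSup₂ (f := fun l _ => pnorm ⊤ fun x =>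
            ‖sampleOp N K l (fun t => (f t : ℂ)) x‖ₑ) 0 fun i _ => ⟨le_rfl, by simp [pi_pos]⟩
      _ ≤ C * pnorm ⊤ fun x => ‖f x‖ₑ := h f hfmem
      _ ≤ C * 1 := by gcongr
      _ = C := mul_one C
  set r : (Fin d → Fin N) → ℝ := fun k => (K (y - inode N (fz k))).re with hr
  have hNpos : (0 : ℝ) < (N : ℝ) ^ d := pow_pos (by exact_mod_cast NeZero.pos N) d
  have e1 : sampleOp N K 0 (fun t => (f t : ℂ)) y =
      ((((N : ℝ) ^ d)⁻¹ * ∑ k, r k / (|r k| + 1) * r k : ℝ) : ℂ) := by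
    rw [sampleOp]
    push_cast
    congr 1
    refine Finset.sum_congr rfl fun k _ => ?_
    rw [add_zero, sub_zero, hKr (y - inode N (fz k))]
    simp only [hf, hr]
    push_cast
    rfl
  have e2 : ∀ k, ‖((N : ℂ) ^ d)⁻¹ * K (y - inode N (fz k))‖ₑ ^ (1 : ℝ) =
      ENNReal.ofReal (((N : ℝ) ^ d)⁻¹ * |r k|) := by
    intro k
    rw [ENNReal.rpow_one, ← ofReal_norm, norm_mul, hKr (y - inode N (fz k)), Complex.norm_real,
      norm_inv, norm_pow, Complex.norm_natCast, Real.norm_eq_abs]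
  simp only [e2]
  rw [← ENNReal.ofReal_sum_of_nonneg fun k _ => by positivity]
  have h2 : ∀ t : ℝ, |t| ≤ t / (|t| + 1) * t + 1 := by
    intro t
    have : t / (|t| + 1) * t = |t| ^ 2 / (|t| + 1) := by rw [sq_abs]; ring
    rw [this, ← sub_le_iff_le_add, le_div_iff₀ (hden t)]
    nlinarith
  have h3 : ∑ k, ((N : ℝ) ^ d)⁻¹ * |r k| ≤
      ((N : ℝ) ^ d)⁻¹ * ∑ k, r k / (|r k| + 1) * r k + 1 := by
    calc ∑ k, ((N : ℝ) ^ d)⁻¹ * |r k| ≤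
          ((N : ℝ) ^ d)⁻¹ * ∑ k : Fin d → Fin N, (r k / (|r k| + 1) * r k + 1) := by
          rw [← Finset.mul_sum]
          gcongr with k
          exact h2 _
      _ = _ := by
          rw [Finset.sum_add_distrib, mul_add]
          congr 1
          simp [hNpos.ne']
  refine (ENNReal.ofReal_le_ofReal h3).trans (ENNReal.ofReal_add_le.trans ?_)
  rw [ENNReal.ofReal_one]
  gcongr
  refine le_trans ?_ h1
  rw [e1, ← ofReal_norm, Complex.norm_real]
  exact ENNReal.ofReal_le_ofReal (le_abs_self _)

/-- Testing a bounded sampling operator on the extremal step function for the dual exponent. -/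
theorem sum_enorm_kernel_rpow_le_of_conj {p : ℝ≥0∞} (hp : p ≠ ⊤) {q : ℝ}
    (hpq : p.toReal.HolderConjugate q) (hK : Per K) (hKr : ∀ x, K x = ((K x).re : ℂ))
    (h : ∀ f : (Fin d → ℝ) → ℝ, MemTorusLp p f →
      qnorm p (fun l x => ‖sampleOp N K l (fun y => (f y : ℂ)) x‖ₑ) ≤ C * pnorm p fun x => ‖f x‖ₑ)
    {D : ℝ≥0∞} (y : Fin d → ℝ)
    (hD : ∀ a : (Fin d → Fin N) → ℝ, ∀ G : (Fin d → ℝ) → ℂ,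
      (G = fun x => ((N : ℂ) ^ d)⁻¹ * ∑ k, (a k : ℂ) * K (x - inode N (fz k))) →
      ‖G y‖ₑ ^ p.toReal ≤ D * ((N : ℝ≥0∞) ^ d * ∫⁻ x in cell d, ‖G x‖ₑ ^ p.toReal)) :
    ∑ k : Fin d → Fin N, ‖((N : ℂ) ^ d)⁻¹ * K (y - inode N (fz k))‖ₑ ^ q ≤
      (D * C) ^ (1 / (p.toReal - 1)) := by
  have hp1 : 1 < p.toReal := hpq.lt
  have hq0 : 0 < q := hpq.symm.pos
  have hq1 : 1 < q := hpq.symm.lt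
  set r : (Fin d → Fin N) → ℝ := fun k => ((N : ℝ) ^ d)⁻¹ * (K (y - inode N (fz k))).re with hr
  have er : ∀ k, ((N : ℂ) ^ d)⁻¹ * K (y - inode N (fz k)) = (r k : ℂ) := by
    intro k
    rw [hKr (y - inode N (fz k))]
    simp only [hr]
    push_cast
    rfl
  have e1 : ∀ k, ‖((N : ℂ) ^ d)⁻¹ * K (y - inode N (fz k))‖ₑ ^ q = ENNReal.ofReal (|r k| ^ q) := by
    intro k
    rw [er, ← ofReal_norm, Complex.norm_real, Real.norm_eq_abs,
      ENNReal.ofReal_rpow_of_nonneg (abs_nonneg _) hq0.le]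
  simp only [e1]
  rw [← ENNReal.ofReal_sum_of_nonneg fun k _ => by positivity]
  set X : ℝ := ∑ k, |r k| ^ q with hX
  have hX0 : 0 ≤ X := Finset.sum_nonneg fun k _ => by positivity
  -- The extremal case of Hölder's inequality: a k · r k = |r k|^q = |a k|^p. Thus G takes the value
  -- X at y while its coefficients have p-th power sum X.
  set a : (Fin d → Fin N) → ℝ := fun k => |r k| ^ (q - 2) * r k with ha
  have ha1 : ∀ k, a k * r k = |r k| ^ q := by
    intro k
    by_cases h0 : r k = 0
    · simp [h0, zero_rpow hq0.ne']
    · have : 0 < |r k| := abs_pos.2 h0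
      simp only [ha]
      rw [mul_assoc, ← sq, ← sq_abs, ← rpow_natCast |r k| 2, ← rpow_add this]
      norm_num
  have ha2 : ∀ k, ‖a k‖ₑ ^ p.toReal = ENNReal.ofReal (|r k| ^ q) := by
    intro k
    rw [← ofReal_norm, ENNReal.ofReal_rpow_of_nonneg (norm_nonneg _) hpq.pos.le]
    congr 1
    simp only [ha]
    rw [norm_mul, Real.norm_eq_abs, Real.norm_eq_abs]
    by_cases h0 : r k = 0
    · simp [h0, zero_rpow hq0.ne', zero_rpow hpq.pos.ne']
    · have : 0 < |r k| := abs_pos.2 h0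
      rw [abs_of_pos (rpow_pos_of_pos this _)]
      nth_rewrite 2 [← rpow_one |r k|]
      rw [← rpow_add this, ← rpow_mul this.le]
      congr 1
      have := hpq.symm.sub_one_mul_conj
      linarith
  set G : (Fin d → ℝ) → ℂ := fun x =>
    ((N : ℂ) ^ d)⁻¹ * ∑ k, (a k : ℂ) * K (x - inode N (fz k)) with hG
  have hGy : G y = (X : ℂ) := by
    simp only [hG, hX]
    push_cast
    rw [Finset.mul_sum]
    refine Finset.sum_congr rfl fun k _ => ?_
    rw [mul_left_comm, er, ← Complex.ofReal_mul, ha1]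
  -- The point value G(y) is bounded by the Nikolskii inequality and the L_p size of G by the
  -- operator bound. The result X^p ≤ D C X bounds X, as p > 1.
  have h1 : ENNReal.ofReal X ^ p.toReal ≤ D * C * ENNReal.ofReal X := by
    have h2 := hD a G hG
    have h3 := lintegral_sum_kernel_rpow_le hp hK h a
    rw [hGy, ← ofReal_norm, Complex.norm_real, Real.norm_of_nonneg hX0] at h2
    refine h2.trans ?_
    rw [mul_assoc]
    refine mul_le_mul' le_rfl (h3.trans ?_)
    simp only [ha2]
    rw [← ENNReal.ofReal_sum_of_nonneg fun k _ => by positivity]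
  by_cases hXz : ENNReal.ofReal X = 0
  · rw [hXz]; exact zero_le
  have h4 : ENNReal.ofReal X ^ (p.toReal - 1) ≤ D * C := by
    have h5 : ENNReal.ofReal X ^ p.toReal =
        ENNReal.ofReal X ^ (p.toReal - 1) * ENNReal.ofReal X := by
      conv_rhs => rw [← ENNReal.rpow_one (ENNReal.ofReal X), ← ENNReal.rpow_mul, one_mul,
        ← ENNReal.rpow_add_of_nonneg _ _ (by linarith) zero_le_one, sub_add_cancel]
    rw [h5] at h1
    exact (ENNReal.mul_le_mul_iff_left hXz ENNReal.ofReal_ne_top).1 h1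
  have h6 := ENNReal.rpow_le_rpow h4 (by
    have : 0 < p.toReal - 1 := by linarith
    positivity : 0 ≤ 1 / (p.toReal - 1))
  rwa [← ENNReal.rpow_mul, mul_one_div_cancel (by linarith), ENNReal.rpow_one] at h6

end

/-! ### Necessary conditions and the equivalences. -/

section

variable {β δ : ℝ} {n : ℕ} {p : ℝ≥0∞}

/-- Convergence implies uniform boundedness of the operators. -/
theorem FamilyConverges.exists_bound (hβ : 0 < β) (hδ : 0 < δ) (hp0 : p ≠ 0)
    (h : FamilyConverges (n + 1) p β δ) :
    ∃ C : ℝ≥0∞, C ≠ ⊤ ∧ ∀ᶠ m : ℕ in atTop, ∀ f : (Fin (n + 1) → ℝ) → ℝ, MemTorusLp p f →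
      qnorm p (fun l x => ‖sampleOp (2 * m + 1) (symKernel (rieszSymbol (n + 1) β δ) m) l
        (fun y => (f y : ℂ)) x‖ₑ) ≤ C * pnorm p fun x => ‖f x‖ₑ := by
  have hψ : IsSymbol 0 (1 : ℕ) (rieszSymbol (n + 1) β δ) :=
    isSymbol_riesz hβ hδ n (by positivity) (Or.inr (by positivity))
  rw [familyConverges_iff hp0] at h
  -- The index is shifted by one, because continuity of the kernel is available only for positive
  -- indices.
  obtain ⟨C, hC, k₀, hk₀⟩ := exists_qnorm_sampleOp_le_of_tendsto hp0
    (N := fun k => 2 * (k + 1) + 1) (K := fun k => symKernel (rieszSymbol (n + 1) β δ) (k + 1))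
    (fun k => by omega) (fun k => per_symKernel _ _)
    (fun k => hψ.continuous_symKernel k.succ_pos)
    (fun f hf => (tendsto_add_atTop_iff_nat 1).2 (h f hf))
  refine ⟨C, hC, eventually_atTop.2 ⟨k₀ + 1, fun m hm => ?_⟩⟩
  obtain ⟨k, rfl⟩ : ∃ k, m = k + 1 := ⟨m - 1, by omega⟩
  exact hk₀ k (by omega)

theorem lintegral_kernel_le_of_sum_le {d N : ℕ} [NeZero N] {K : (Fin d → ℝ) → ℂ} (hK : Per K)
    (hKc : Continuous K) {s : ℝ} {B : ℝ≥0∞}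
    (h : ∀ y, ∑ k : Fin d → Fin N, ‖((N : ℂ) ^ d)⁻¹ * K (y - inode N (fz k))‖ₑ ^ s ≤ B) :
    (N : ℝ≥0∞) ^ d * ∫⁻ x in cell d, ‖((N : ℂ) ^ d)⁻¹ * K x‖ₑ ^ s ≤ volume (cell d) * B :=
  Per.lintegral_kernel_le (K := fun x => ((N : ℂ) ^ d)⁻¹ * K x)
    (hK.comp fun z => ((N : ℂ) ^ d)⁻¹ * z) (by fun_prop) h

/-- Convergence implies integrability of a power of the Fourier transform of the symbol. -/
theorem FamilyConverges.integrable_fourier (hβ : 0 < β) (hδ : 0 < δ) (hp0 : p ≠ 0)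
    (h : FamilyConverges (n + 1) p β δ) {s : ℝ}
    (hs : (p ≠ ⊤ ∧ s = p.toReal) ∨ (p = ⊤ ∧ s = 1) ∨ (p ≠ ⊤ ∧ p.toReal.HolderConjugate s)) :
    Integrable (fun y : EuclideanSpace ℝ (Fin (n + 1)) =>
      ‖𝓕 (radial (EuclideanSpace ℝ (Fin (n + 1))) (rieszProfile β δ)) y‖ ^ s) := by
  have hψ : IsSymbol 0 (1 : ℕ) (rieszSymbol (n + 1) β δ) :=
    isSymbol_riesz hβ hδ n (by positivity) (Or.inr (by positivity))
  have hs0 : 0 < s := by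
    rcases hs with ⟨hp, rfl⟩ | ⟨-, rfl⟩ | ⟨-, hs⟩
    · exact ENNReal.toReal_pos hp0 hp
    · exact one_pos
    · exact hs.symm.pos
  obtain ⟨C, hC, hb⟩ := h.exists_bound hβ hδ hp0
  have hKr : ∀ m x, symKernel (rieszSymbol (n + 1) β δ) m x =
      ((symKernel (rieszSymbol (n + 1) β δ) m x).re : ℂ) := fun m x =>
    symKernel_radial_eq_re _ m x
  -- Three test functions for the three exponents: the indicator of a mesh cube for s = p, an
  -- approximate sign for p = ∞ with s = 1, and the extremal step function for the conjugate
  -- exponent.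
  have key : ∃ B : ℝ≥0∞, B ≠ ⊤ ∧ ∀ᶠ m : ℕ in atTop,
      ((2 * m + 1 : ℕ) : ℝ≥0∞) ^ (n + 1) * ∫⁻ x in cell (n + 1),
        ‖(((2 * m + 1 : ℕ) : ℂ) ^ (n + 1))⁻¹ *
          symKernel (rieszSymbol (n + 1) β δ) m x‖ₑ ^ s ≤ B := by
    rcases hs with ⟨hp, rfl⟩ | ⟨rfl, rfl⟩ | ⟨hp, hs⟩
    · exact ⟨C, hC, hb.mono fun m hm => lintegral_kernel_rpow_le hp0 hp (per_symKernel _ _) hm⟩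
    · refine ⟨volume (cell (n + 1)) * (C + 1), ENNReal.mul_ne_top (volume_cell_lt_top _).ne
        (by simp [hC]), ?_⟩
      filter_upwards [hb, eventually_gt_atTop 0] with m hm hm0
      exact lintegral_kernel_le_of_sum_le (per_symKernel _ _) (hψ.continuous_symKernel hm0)
        (sum_enorm_kernel_le_of_top (per_symKernel _ _) (hψ.continuous_symKernel hm0) (hKr m) hm)
    · obtain ⟨D, hD, hnik⟩ := exists_enorm_rpow_le_lintegral (n + 1) hs.lt.le
      have h1 : 0 ≤ 1 / (p.toReal - 1) := by
        have := hs.lt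
        exact one_div_nonneg.2 (by linarith)
      refine ⟨volume (cell (n + 1)) * (D * C) ^ (1 / (p.toReal - 1)),
        ENNReal.mul_ne_top (volume_cell_lt_top _).ne
          (ENNReal.rpow_lt_top_of_nonneg h1 (ENNReal.mul_ne_top hD hC)).ne, ?_⟩
      filter_upwards [hb, eventually_gt_atTop 0] with m hm hm0
      refine lintegral_kernel_le_of_sum_le (per_symKernel _ _) (hψ.continuous_symKernel hm0)
        fun y => sum_enorm_kernel_rpow_le_of_conj hp hs (per_symKernel _ _) (hKr m) hm y
          fun a G hG => hnik m hm0 G ?_ y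
      have : G = ((((2 * m + 1 : ℕ) : ℂ) ^ (n + 1))⁻¹) • ∑ k, (a k : ℂ) •
          fun x => symKernel (rieszSymbol (n + 1) β δ) m (x - inode (2 * m + 1) (fz k)) := by
        rw [hG]
        ext x
        simp [Finset.sum_apply]
      rw [this]
      exact Submodule.smul_mem _ _ (Submodule.sum_mem _ fun k _ => Submodule.smul_mem _ _
        (hψ.symKernel_sub_mem_ballPoly hm0 _))
  obtain ⟨B, hB, hkey⟩ := key
  have hfin := lintegral_fourier_rpow_ne_top hψ.continuous hψ.support
    (fun m hm => hψ.continuous_symKernel hm) hs0 hB hkey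
  have hInt : Integrable (rieszSymbol (n + 1) β δ) := integrable_radial (R := 1)
    (continuous_rieszProfile hβ hδ).continuousOn fun u hu => rieszProfile_eq_zero hβ hδ hu
  have hFc : Continuous (𝓕 (rieszSymbol (n + 1) β δ)) := VectorFourier.fourierIntegral_continuous
    Real.continuous_fourierChar (by exact continuous_inner) hInt
  refine ⟨(hFc.norm.rpow_const fun _ => Or.inr hs0.le).aestronglyMeasurable, ?_⟩
  rw [hasFiniteIntegral_iff_enorm, lt_top_iff_ne_top]
  convert hfin using 3 with y
  rw [← ofReal_norm, Real.norm_of_nonneg (by positivity),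
    ← ENNReal.ofReal_rpow_of_nonneg (norm_nonneg _) hs0.le, ofReal_norm]
  rfl

/-- Convergence fails if the Fourier transform of the symbol is not `s`-integrable. -/
theorem not_familyConverges (hβ : 0 < β) (hδ : 0 < δ) (hp0 : p ≠ 0) {s : ℝ} (hs0 : 0 < s)
    (hs : (p ≠ ⊤ ∧ s = p.toReal) ∨ (p = ⊤ ∧ s = 1) ∨ (p ≠ ⊤ ∧ p.toReal.HolderConjugate s))
    (h : s * (δ + n / 2 + 1) ≤ n + 1 ∨
      (¬ ∃ m : ℕ, 0 < m ∧ β = 2 * m) ∧ s * (n + 1 + β) ≤ n + 1) :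
    ¬ FamilyConverges (n + 1) p β δ := fun hc =>
  not_integrable_fourier_rieszProfile hβ hδ n hs0 h (hc.integrable_fourier hβ hδ hp0 hs)

/-- The condition δ > (d-1)/2 says δ + (d+1)/2 > d, and d + β > d always holds. So the transform
decays with an order a > d, and a p > d follows from p ≥ 1. -/
theorem familyConverges_of_mem_sigmaSet (hβ : 0 < β) (hδ : 0 < δ) (hp1 : 1 ≤ p)
    (h : ((p⁻¹).toReal, δ) ∈ SigmaSet (n + 1)) : FamilyConverges (n + 1) p β δ := by
  obtain ⟨-, -, h⟩ := h
  have h1 := (le_max_left _ _).trans_lt h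
  push_cast at h1
  have hd : (0 : ℝ) ≤ n := Nat.cast_nonneg n
  set a : ℝ := min (δ + n / 2 + 1) (n + 1 + β) with ha
  have ha1 : ((n + 1 : ℕ) : ℝ) < a := by
    push_cast
    exact lt_min (by linarith) (by linarith)
  refine familyConverges_of_decay hβ hδ n (min_le_left _ _) (Or.inr (min_le_right _ _)) ha1
    (zero_lt_one.trans_le hp1).ne' fun hp => ?_
  have h2 : 1 ≤ p.toReal := by simpa [ex_of_ne_top hp] using one_le_ex hp1
  push_cast at ha1 ⊢
  nlinarith

/-- For 1/p ≥ 1/2 the inequality defining Γ is p (δ + (d+1)/2) ≤ d, the failure of p-integrability.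
For 1/p < 1/2 it is the same inequality for the conjugate exponent, which is 1 when p = ∞. -/
theorem not_familyConverges_of_mem_gammaSet (hβ : 0 < β) (hδ : 0 < δ) (hp1 : 1 ≤ p)
    (h : ((p⁻¹).toReal, δ) ∈ GammaSet (n + 1)) : ¬ FamilyConverges (n + 1) p β δ := by
  have hp0 : p ≠ 0 := (zero_lt_one.trans_le hp1).ne'
  obtain ⟨-, -, h⟩ := h
  have hd : (0 : ℝ) ≤ n := Nat.cast_nonneg n
  push_cast at h
  by_cases hp : p = ⊤
  · subst hp
    refine not_familyConverges hβ hδ hp0 one_pos (Or.inr (Or.inl ⟨rfl, rfl⟩)) (Or.inl ?_)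
    simp only [ENNReal.inv_top, ENNReal.toReal_zero, zero_sub, abs_neg] at h
    rw [abs_of_pos (by norm_num)] at h
    linarith
  have hp1' : 1 ≤ p.toReal := by simpa [ex_of_ne_top hp] using one_le_ex hp1
  have hpr : 0 < p.toReal := by linarith
  rw [ENNReal.toReal_inv] at h
  rcases le_or_gt (1 / 2) p.toReal⁻¹ with h2 | h2
  · refine not_familyConverges hβ hδ hp0 hpr (Or.inl ⟨hp, rfl⟩) (Or.inl ?_)
    rw [abs_of_nonneg (by linarith)] at h
    have h3 : δ + n / 2 + 1 ≤ (n + 1) * p.toReal⁻¹ := by linarith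
    calc p.toReal * (δ + n / 2 + 1) ≤ p.toReal * ((n + 1) * p.toReal⁻¹) := by gcongr
      _ = n + 1 := by field_simp
  · have h1p : 1 < p.toReal := by
      by_contra hle
      rw [le_antisymm (not_lt.1 hle) hp1'] at h2
      norm_num at h2
    have hpq := Real.HolderConjugate.conjExponent h1p
    have hq0 := hpq.symm.pos
    refine not_familyConverges hβ hδ hp0 hq0 (Or.inr (Or.inr ⟨hp, hpq⟩)) (Or.inl ?_)
    rw [abs_of_neg (by linarith)] at h
    have h4 := hpq.inv_add_inv_eq_one
    set q := p.toReal.conjExponent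
    have h3 : δ + n / 2 + 1 ≤ (n + 1) * q⁻¹ := by
      have : q⁻¹ = 1 - p.toReal⁻¹ := by linarith
      rw [this]
      linarith
    calc q * (δ + n / 2 + 1) ≤ q * ((n + 1) * q⁻¹) := by gcongr
      _ = n + 1 := by field_simp

/-- For p < 1 both directions use the exponent p itself. The sphere contributes the condition p (δ +
(d+1)/2) > d, which is Σ; the origin contributes p (d + β) > d, that is β > d (1/p - 1), unless β is
even. -/
theorem familyConverges_iff_of_lt_one (hβ : 0 < β) (hδ : 0 < δ) (hp0 : 0 < p) (hp1 : p < 1) :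
    FamilyConverges (n + 1) p β δ ↔
      ((p⁻¹).toReal, δ) ∈ SigmaSet (n + 1) ∧ ((p⁻¹).toReal, β) ∈ BSet (n + 1) := by
  have hp : p ≠ ⊤ := (hp1.trans ENNReal.one_lt_top).ne
  have hpr : 0 < p.toReal := ENNReal.toReal_pos hp0.ne' hp
  have hpr1 : p.toReal < 1 := by
    rw [← ENNReal.toReal_one]
    exact (ENNReal.toReal_lt_toReal hp ENNReal.one_ne_top).2 hp1
  have hd : (0 : ℝ) ≤ n := Nat.cast_nonneg n
  have hinv : 1 < p.toReal⁻¹ := (one_lt_inv₀ hpr).2 hpr1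
  have hlt : ∀ a : ℝ, (n + 1) * p.toReal⁻¹ < a ↔ ((n : ℝ) + 1) < a * p.toReal := fun a => by
    rw [← div_eq_mul_inv, div_lt_iff₀ hpr]
  simp only [SigmaSet, BSet, Set.mem_ofPred_eq, ENNReal.toReal_inv]
  constructor
  · intro hc
    refine ⟨⟨by positivity, hδ.le, ?_⟩, by positivity, hβ.le, ?_⟩
    · by_contra hle
      refine not_familyConverges hβ hδ hp0.ne' hpr (Or.inl ⟨hp, rfl⟩) (Or.inl ?_) hc
      by_contra hlt'
      refine hle ?_
      have h1 := (hlt (δ + n / 2 + 1)).2 (by linarith)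
      push_cast
      refine max_lt ?_ ?_
      · nlinarith
      · linarith
    · by_contra hle
      push Not at hle
      refine not_familyConverges hβ hδ hp0.ne' hpr (Or.inl ⟨hp, rfl⟩) (Or.inr ⟨?_, ?_⟩) hc
      · rintro ⟨m, hm, h⟩
        exact hle.1 m hm h
      · have h1 := hle.2
        rw [max_eq_left (by linarith)] at h1
        by_contra hlt'
        have h2 := (hlt (n + 1 + β)).2 (by linarith)
        push_cast at h1
        linarith
  · rintro ⟨⟨-, -, h1⟩, -, -, h2⟩
    have h1 := (le_max_right _ _).trans_lt h1
    push_cast at h1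
    have h1' : (n + 1) * p.toReal⁻¹ < δ + n / 2 + 1 := by linarith
    have hsuff : ∀ a : ℝ, (n + 1) * p.toReal⁻¹ < a → ((n + 1 : ℕ) : ℝ) < a ∧
        (p ≠ ⊤ → ((n + 1 : ℕ) : ℝ) < a * p.toReal) := by
      intro a ha
      push_cast
      exact ⟨by nlinarith, fun _ => (hlt a).1 ha⟩
    rcases h2 with h2 | h2
    · obtain ⟨h3, h4⟩ := hsuff _ h1'
      exact familyConverges_of_decay hβ hδ n le_rfl (Or.inl h2) h3 hp0.ne' h4
    · rw [max_eq_left (by linarith)] at h2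
      push_cast at h2
      obtain ⟨h3, h4⟩ := hsuff (min (δ + n / 2 + 1) (n + 1 + β)) (lt_min h1' (by linarith))
      exact familyConverges_of_decay hβ hδ n (min_le_left _ _) (Or.inr (min_le_right _ _)) h3
        hp0.ne' h4

end

end BochnerRiesz

theorem theorem2p2 (d : ℕ) (hd : 1 ≤ d) (p : ℝ≥0∞) (β δ : ℝ) (hβ : 0 < β) (hδ : 0 < δ) :
    (1 ≤ p →
      (BochnerRiesz.FamilyConverges d p β δ ↔ BochnerRiesz.FamilyConverges d p 2 δ) ∧
      (((p⁻¹).toReal, δ) ∈ BochnerRiesz.SigmaSet d → BochnerRiesz.FamilyConverges d p β δ) ∧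
      (((p⁻¹).toReal, δ) ∈ BochnerRiesz.GammaSet d → ¬ BochnerRiesz.FamilyConverges d p β δ)) ∧
    (0 < p → p < 1 →
      (BochnerRiesz.FamilyConverges d p β δ ↔
        ((p⁻¹).toReal, δ) ∈ BochnerRiesz.SigmaSet d ∧
        ((p⁻¹).toReal, β) ∈ BochnerRiesz.BSet d)) := by
  obtain ⟨n, rfl⟩ : ∃ n, d = n + 1 := ⟨d - 1, by omega⟩
  refine ⟨fun hp1 => ⟨⟨fun h => ?_, fun h => ?_⟩, fun h => ?_, fun h => ?_⟩, fun hp0 hp1 => ?_⟩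
  · exact h.of_exponent hp1 two_pos hβ hδ
  · exact h.of_exponent hp1 hβ two_pos hδ
  · exact BochnerRiesz.familyConverges_of_mem_sigmaSet hβ hδ hp1 h
  · exact BochnerRiesz.not_familyConverges_of_mem_gammaSet hβ hδ hp1 h
  · exact BochnerRiesz.familyConverges_iff_of_lt_one hβ hδ hp0 hp1
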